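/- **Setting.** Let $a,b,\mu>0$ and let $\sigma\in C^1(\mathbb R)$ satisfy $\sigma(v)=bv$ on $(-a,a)$, $\sigma\in C^3([a,\infty))$ with $\sigma''>0$ on $[a,\infty)$, and $\sigma''<0$ on $(-\infty,-a]$ (one-sided second derivatives at $\pm a$). Put $\lambda_2(v)=\sqrt{\sigma'(v)}$. Let the far-field states satisfy $-a<v_-<a\le v_+$ and, with $u_a:=u_++\int_a^{v_+}\lambda_2(s)\,ds$, the contact condition $-\sqrt b\,(a-v_-)-(u_a-u_-)=0$. Put $\delta=|v_+-v_-|$. **Composite wave.** Let $W(x,t)$ be the classical solution of $W_t+WW_x=0$ with $W(x,0)=\frac{\lambda_2(v_+)+\lambda_2(a)}2+\frac{\lambda_2(v_+)-\lambda_2(a)}2\tanh x$, and $$v^r=(\lambda_2|_{[a,\infty)})^{-1}(W),\quad u^r=u_a-\int_a^{v^r}\lambda_2(s)\,ds,\quad \Xi_2(x,t)=v_-+\frac{a-v_-}{\sqrt\pi}\int_{-\infty}^{\frac{x-\sqrt b t}{\sqrt{2\mu(1+t)}}}e^{-\xi^2}d\xi,$$ $$v^c=\Xi_2+\frac{\mu}{4\sqrt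 b}\,\Xi_{2x},\qquad u^c=\sqrt b\Big(\frac{\mu}{4\sqrt b}\,\Xi_{2x}-\Xi_2\Big)+(u_-+\sqrt b\,v_-),$$ $$\hat v=v^c+v^r-a,\qquad \hat u=u^c+u^r-u_a,\qquad \hat u_1=u^r-\sqrt b\,\Xi_2 .$$ **Solution.** Let $T\ge0$ and let $(v,u)$ be a strong solution on $\mathbb R\times[0,T]$ of $v_t-u_x=0$, $u_t-\sigma(v)_x=\mu u_{xx}$ such that $(\phi,\psi)=(v-\hat v,u-\hat u)$ satisfies $(\phi,\psi)\in C([0,T];H^1(\mathbb R))$, $\phi_x\in L^2(0,T;L^2)$, $\psi_x\in L^2(0,T;H^1)$. Let $\|\cdot\|$ be the $L^2(\mathbb R)$ norm and put $$N(T)=\sup_{\tau\in[0,T]}\|(\phi,\psi)(\cdot,\tau)\|_{H^1(\mathbb R)},\qquad w(x,t)=\frac1{\sqrt{2\mu(1+t)}}\,e^{-\frac{(x-\sqrt b t)^2}{2\mu(1+t)}},$$ $$\begin{aligned}G(t)=&-\int_0^t\!\int_{\{v>a,\ \hat v>a\}}\hat u_{1x}\,\phi^2\,dx\,d\tau-\int_0^t\!\int_{\{v>a,\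 -a<\hat v\le a\}}\hat u_{1x}\,(v-a)^2\,dx\,d\tau\\&-\int_0^t\!\int_{\{-a<v\le a,\ \hat v>a\}}\hat u_{1x}\,(a-\hat v)^2\,dx\,d\tau .\end{aligned}$$ **Lemma 4.2 (heat kernel estimate).** There are constants $\epsilon_0>0$ and $C>0$, depending only on $\sigma,a,b,\mu$, such that for all $v_\pm,u_\pm$, $T$ and $(v,u)$ as above, if $$\delta+\|(\phi,\psi)(\cdot,0)\|_{H^1(\mathbb R)}\le\epsilon_0\quad\text{and}\quad N(T)\le\epsilon_0,$$ then for every $t\in[0,T]$ $$\begin{aligned}\int_0^t\!\int_{\mathbb R}w^2(\phi^2+\psi^2)\,dx\,d\tau\le{}&C\int_0^t\|(\phi_x,\psi_x)\|^2d\tau+C\big(\|(\phi,\psi)(t)\|^2+1\big)+C\,G(t)\\&+C(\delta+N(T))\int_0^t\!\int_{\mathbb R}w\,\big(\sigma(v)-\sigma(\hat v)-\sigma'(\hat v)\phi\big)\,dx\,d\tau .\end{aligned}$$ -/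

import Mathlib

open Set Filter Topology MeasureTheory

noncomputable section

namespace Viscoelastic

/-- Partial derivative in the space variable of a function of `(x, t)`. -/
def dx (f : ℝ → ℝ → ℝ) (x t : ℝ) : ℝ := deriv (fun y => f y t) x

/-! ### The stress function -/

/-- The stress function `σ` is `C¹` on the line, linear with slope `b` on `(-a, a)`, strictly convex
on `[a, ∞)` (where it is `C³`) and strictly concave on `(-∞, -a]`; second derivatives at the
end points `a`, `-a` are one-sided. -/
structure IsStress (a b : ℝ) (σ : ℝ → ℝ) : Prop where
  a_pos : 0 < a
  b_pos : 0 < b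
  contDiff : ContDiff ℝ 1 σ
  smooth_right : ContDiffOn ℝ 3 σ (Ici a)
  convex_right : ∀ v ∈ Ici a, 0 < derivWithin (deriv σ) (Ici a) v
  linear : ∀ v ∈ Ioo (-a) a, σ v = b * v
  concave_left : ∀ v ∈ Iic (-a), derivWithin (deriv σ) (Iic (-a)) v < 0

/-- The second characteristic speed `√(σ'(v))`. -/
def lam (σ : ℝ → ℝ) (v : ℝ) : ℝ := √(deriv σ v)

/-! ### The smooth solution of the Burgers equation -/

/-- Smooth monotone data joining `wl` to `wr`. -/
def burgersData (wl wr y : ℝ) : ℝ := (wr + wl) / 2 + (wr - wl) / 2 * Real.tanh y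

/-- The foot at time `0` of the characteristic through `(x, t)`: the unique `y` such that
`y + t * burgersData wl wr y = x` (see `burgersFoot_spec`). -/
def burgersFoot (wl wr x t : ℝ) : ℝ := sSup {y | y + t * burgersData wl wr y ≤ x}

/-- The classical solution of `w_t + w w_x = 0`, `w(·,0) = burgersData wl wr`. -/
def burgers (wl wr x t : ℝ) : ℝ := burgersData wl wr (burgersFoot wl wr x t)

/-! ### The composite wave -/

/-- The smooth rarefaction wave, strain component: `λ₂⁻¹(w)`, inverse taken on `[a, ∞)`. -/
def vr (σ : ℝ → ℝ) (a vp x t : ℝ) : ℝ :=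
  Function.invFunOn (lam σ) (Ici a) (burgers (lam σ a) (lam σ vp) x t)

/-- The intermediate velocity between contact wave and rarefaction wave. -/
def ua (σ : ℝ → ℝ) (a vp up : ℝ) : ℝ := up + ∫ s in a..vp, lam σ s

/-- The smooth rarefaction wave, velocity component. -/
def ur (σ : ℝ → ℝ) (a vp up x t : ℝ) : ℝ := ua σ a vp up - ∫ s in a..(vr σ a vp x t), lam σ s

/-- The linear diffusion wave `Ξ₂` joining `vm` to `a`. -/
def Xi (a b μ vm x t : ℝ) : ℝ :=
  vm + (a - vm) / √Real.pi *
    ∫ ξ in Iic ((x - √b * t) / √(2 * μ * (1 + t))), Real.exp (-ξ ^ 2)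

/-- The viscous contact wave, strain component. -/
def vc (a b μ vm x t : ℝ) : ℝ := Xi a b μ vm x t + μ / (4 * √b) * dx (Xi a b μ vm) x t

/-- The viscous contact wave, velocity component; the constant `um + √b * vm` vanishes under the
Galilean normalization `um = -√b * vm`. -/
def uc (a b μ vm um x t : ℝ) : ℝ :=
  √b * (μ / (4 * √b) * dx (Xi a b μ vm) x t - Xi a b μ vm x t) + (um + √b * vm)

/-- The composite wave, strain component. -/
def vhat (σ : ℝ → ℝ) (a b μ vm vp x t : ℝ) : ℝ := vc a b μ vm x t + vr σ a vp x t - a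

/-- The composite wave, velocity component. -/
def uhat (σ : ℝ → ℝ) (a b μ vm vp um up x t : ℝ) : ℝ :=
  uc a b μ vm um x t + ur σ a vp up x t - ua σ a vp up

/-- `û₁ = u^r - √b Ξ₂`. -/
def uhat1 (σ : ℝ → ℝ) (a b μ vm vp up x t : ℝ) : ℝ :=
  ur σ a vp up x t - √b * Xi a b μ vm x t

/-- Far field states joined by a 2-contact wave from `(vm, um)` to `(a, ua)` followed by a
2-rarefaction wave from `(a, ua)` to `(vp, up)`. -/
structure IsContactRarefaction (σ : ℝ → ℝ) (a b vm vp um up : ℝ) : Prop where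
  vm_mem : vm ∈ Ioo (-a) a
  vp_mem : vp ∈ Ici a
  rankine_hugoniot : -√b * (a - vm) - (ua σ a vp up - um) = 0

/-! ### Norms and function spaces -/

/-- Membership in `H¹(ℝ)` (continuous representative): square integrable, locally absolutely
continuous, with square integrable derivative. -/
structure InH1 (f : ℝ → ℝ) : Prop where
  memLp : MemLp f 2 volume
  absCont : ∀ x y, AbsolutelyContinuousOnInterval f x y
  memLp_deriv : MemLp (deriv f) 2 volume

/-- `‖(f, g)‖²` in `L²(ℝ)`. -/
def l2Sq (f g : ℝ → ℝ) : ℝ := (∫ x, f x ^ 2) + ∫ x, g x ^ 2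

/-- `‖(f, g)‖` in `H¹(ℝ)`. -/
def h1Norm (f g : ℝ → ℝ) : ℝ := √(l2Sq f g + l2Sq (deriv f) (deriv g))

/-- The solution space: `(φ, ψ) ∈ C([0,T]; H¹)`, `φ_x ∈ L²(0,T; L²)`, `ψ_x ∈ L²(0,T; H¹)`. -/
structure InX (T : ℝ) (φ ψ : ℝ → ℝ → ℝ) : Prop where
  phi_H1 : ∀ t ∈ Icc 0 T, InH1 (fun x => φ x t)
  psi_H1 : ∀ t ∈ Icc 0 T, InH1 (fun x => ψ x t)
  cont : ∀ t ∈ Icc 0 T,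
    Tendsto (fun s => h1Norm (fun x => φ x s - φ x t) (fun x => ψ x s - ψ x t))
      (𝓝[Icc 0 T] t) (𝓝 0)
  phi_x_L2 : IntegrableOn (fun t => ∫ x, dx φ x t ^ 2) (Icc 0 T)
  psi_x_H1 : ∀ᵐ t ∂(volume.restrict (Icc 0 T)), InH1 (fun x => dx ψ x t)
  psi_x_L2 : IntegrableOn (fun t => ∫ x, dx ψ x t ^ 2) (Icc 0 T)
  psi_xx_L2 : IntegrableOn (fun t => ∫ x, dx (dx ψ) x t ^ 2) (Icc 0 T)

/-- `N(T) = sup_{τ ∈ [0,T]} ‖(φ,ψ)(·,τ)‖_{H¹}`. -/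
def NT (T : ℝ) (φ ψ : ℝ → ℝ → ℝ) : ℝ :=
  sSup ((fun τ => h1Norm (fun x => φ x τ) (fun x => ψ x τ)) '' Icc 0 T)

/-! ### The viscoelastic system -/

/-- `(v, u)` is a strong solution on `ℝ × [0, T]` of `v_t - u_x = 0`, `u_t - σ(v)_x = μ u_xx`:
both equations hold almost everywhere, written in integrated form in time. -/
structure IsSolution (σ : ℝ → ℝ) (μ T : ℝ) (v u : ℝ → ℝ → ℝ) : Prop where
  strain : ∀ t ∈ Icc 0 T, ∀ᵐ x, v x t - v x 0 = ∫ τ in (0 : ℝ)..t, dx u x τ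
  momentum : ∀ t ∈ Icc 0 T, ∀ᵐ x, u x t - u x 0 =
    ∫ τ in (0 : ℝ)..t, (dx (fun y s => σ (v y s)) x τ + μ * dx (dx u) x τ)

/-! ### The terms of the estimate -/

/-- The functional `G(t)`, for perturbed strain `v`, background strain `vb` and `û₁ = u1`. -/
def G (a : ℝ) (v vb u1 : ℝ → ℝ → ℝ) (t : ℝ) : ℝ :=
  -(∫ τ in (0 : ℝ)..t, ∫ x in {x | v x τ > a ∧ vb x τ > a},
      dx u1 x τ * (v x τ - vb x τ) ^ 2)
  - (∫ τ in (0 : ℝ)..t, ∫ x in {x | v x τ > a ∧ -a < vb x τ ∧ vb x τ ≤ a},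
      dx u1 x τ * (v x τ - a) ^ 2)
  - (∫ τ in (0 : ℝ)..t, ∫ x in {x | -a < v x τ ∧ v x τ ≤ a ∧ vb x τ > a},
      dx u1 x τ * (a - vb x τ) ^ 2)

/-- The heat kernel weight. -/
def heatWeight (b μ x t : ℝ) : ℝ :=
  1 / √(2 * μ * (1 + t)) * Real.exp (-(x - √b * t) ^ 2 / (2 * μ * (1 + t)))

/-! ### The definition of `burgers` is correct -/

lemma hasDerivAt_tanh (y : ℝ) : HasDerivAt Real.tanh (1 / Real.cosh y ^ 2) y := by
  have h := (Real.hasDerivAt_sinh y).div (Real.hasDerivAt_cosh y) (Real.cosh_pos y).ne'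
  have e : (fun y => Real.sinh y / Real.cosh y) = Real.tanh := by
    funext z; rw [Real.tanh_eq_sinh_div_cosh]
  have h2 := Real.cosh_sq y
  rw [show Real.cosh y * Real.cosh y - Real.sinh y * Real.sinh y = 1 by nlinarith] at h
  rw [← e]; exact h

lemma hasDerivAt_burgersData (wl wr y : ℝ) :
    HasDerivAt (burgersData wl wr) ((wr - wl) / 2 * (1 / Real.cosh y ^ 2)) y :=
  ((hasDerivAt_tanh y).const_mul _).const_add _

lemma burgersData_mono {wl wr : ℝ} (h : wl ≤ wr) : Monotone (burgersData wl wr) := by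
  apply monotone_of_deriv_nonneg (fun y => (hasDerivAt_burgersData wl wr y).differentiableAt)
  intro y
  rw [(hasDerivAt_burgersData wl wr y).deriv]
  have : 0 ≤ wr - wl := by linarith
  positivity

lemma burgersData_mem {wl wr : ℝ} (h : wl ≤ wr) (y : ℝ) : burgersData wl wr y ∈ Icc wl wr := by
  have hc := Real.cosh_pos y
  have h1 : Real.tanh y ≤ 1 := by
    rw [Real.tanh_eq_sinh_div_cosh, div_le_one hc]; exact (Real.sinh_lt_cosh y).le
  have h2 : -1 ≤ Real.tanh y := by
    rw [Real.tanh_eq_sinh_div_cosh, le_div_iff₀ hc]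
    have := Real.sinh_lt_cosh (-y)
    rw [Real.sinh_neg, Real.cosh_neg] at this; linarith
  constructor <;> unfold burgersData <;> nlinarith

lemma burgersFoot_unique {wl wr x t y : ℝ} (h : wl ≤ wr) (ht : 0 ≤ t)
    (hy : y + t * burgersData wl wr y = x) : burgersFoot wl wr x t = y := by
  have e : {z | z + t * burgersData wl wr z ≤ x} = Iic y := by
    ext z
    change z + t * burgersData wl wr z ≤ x ↔ z ≤ y
    constructor
    · intro hz
      by_contra! hlt
      have := mul_le_mul_of_nonneg_left (burgersData_mono h hlt.le) ht
      linarith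
    · intro hz
      have := mul_le_mul_of_nonneg_left (burgersData_mono h hz) ht
      linarith
  rw [burgersFoot, e, csSup_Iic]

lemma burgersFoot_spec {wl wr : ℝ} (h : wl ≤ wr) (x : ℝ) {t : ℝ} (ht : 0 ≤ t) :
    burgersFoot wl wr x t + t * burgers wl wr x t = x := by
  have hc : Continuous fun y => y + t * burgersData wl wr y :=
    continuous_id.add (continuous_const.mul
      (continuous_iff_continuousAt.2 fun y => (hasDerivAt_burgersData wl wr y).continuousAt))
  obtain ⟨y, -, hy⟩ := intermediate_value_Icc (a := x - t * wr) (b := x - t * wl)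
    (by nlinarith) hc.continuousOn (show x ∈ Icc _ _ from
      ⟨by have := (burgersData_mem h (x - t * wr)).2; change _ ≤ _; nlinarith,
        by have := (burgersData_mem h (x - t * wl)).1; change _ ≤ _; nlinarith⟩)
  have := burgersFoot_unique h ht hy
  rw [burgers, this]; exact hy

lemma burgers_zero {wl wr : ℝ} (h : wl ≤ wr) (x : ℝ) :
    burgers wl wr x 0 = burgersData wl wr x := by
  rw [burgers, burgersFoot_unique h le_rfl (y := x) (by simp)]

/-- For `0 < wl ≤ wr` and `t > 0`, `burgers` solves the Burgers equation. -/
lemma burgers_solves {wl wr : ℝ} (h0 : 0 < wl) (h : wl ≤ wr) (x : ℝ) {t : ℝ} (ht : 0 < t) :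
    ∃ wt wx : ℝ, HasDerivAt (fun s => burgers wl wr x s) wt t ∧
      HasDerivAt (fun y => burgers wl wr y t) wx x ∧ wt + burgers wl wr x t * wx = 0 := by
  set g := burgersData wl wr with hg
  set Y := burgersFoot wl wr x t with hY
  set d := (wr - wl) / 2 * (1 / Real.cosh Y ^ 2) with hd
  have hgd : HasDerivAt g d Y := hasDerivAt_burgersData wl wr Y
  have hd0 : 0 ≤ d := by
    have : 0 ≤ wr - wl := by linarith
    positivity
  have hgpos : ∀ y, 0 < g y := fun y => h0.trans_le (burgersData_mem h y).1
  have hden : 0 < 1 + t * d := by positivity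
  have hYeq : Y + t * g Y = x := burgersFoot_spec h x ht.le
  -- derivative in space
  have cx : ContinuousAt (fun y => burgersFoot wl wr y t) x := by
    apply LipschitzWith.continuous (K := 1) _ |>.continuousAt
    apply LipschitzWith.of_le_add
    intro y z
    rw [Real.dist_eq]
    have e1 := burgersFoot_spec h y ht.le
    have e2 := burgersFoot_spec h z ht.le
    rcases le_total (burgersFoot wl wr y t) (burgersFoot wl wr z t) with hl | hl
    · linarith [abs_nonneg (y - z)]
    · have := mul_le_mul_of_nonneg_left (burgersData_mono h hl) ht.le
      unfold burgers at e1 e2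
      linarith [le_abs_self (y - z)]
  have fx : HasDerivAt (fun y => burgersFoot wl wr y t) (1 + t * d)⁻¹ x :=
    HasDerivAt.of_local_left_inverse (f := fun y => y + t * g y) cx
      ((hasDerivAt_id Y).add (hgd.const_mul t)) hden.ne'
      (Eventually.of_forall fun y => burgersFoot_spec h y ht.le)
  -- derivative in time
  have ct : ContinuousAt (fun s => burgersFoot wl wr x s) t := by
    have key : ∀ s, 0 ≤ s → |burgersFoot wl wr x s - Y| ≤ |s - t| * wr := by
      intro s hs
      have e1 := burgersFoot_spec h x hs
      unfold burgers at e1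
      set Z := burgersFoot wl wr x s
      have b2 := burgersData_mem h Z
      have hZ := hgpos Z
      have hm : ∀ p q : ℝ, p ≤ q → t * g p ≤ t * g q := fun p q hpq =>
        mul_le_mul_of_nonneg_left (burgersData_mono h hpq) ht.le
      have hb : |(s - t) * g Z| ≤ |s - t| * wr := by
        rw [abs_mul, abs_of_pos hZ]
        exact mul_le_mul_of_nonneg_left b2.2 (abs_nonneg _)
      have e3 : Z - Y + t * (g Z - g Y) = -((s - t) * g Z) := by linarith
      have hb' := abs_le.1 hb
      rw [abs_le]
      rcases le_total Z Y with hl | hl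
      · have := hm _ _ hl
        constructor <;> nlinarith [abs_nonneg (s - t), hb'.1, hb'.2]
      · have := hm _ _ hl
        constructor <;> nlinarith [abs_nonneg (s - t), hb'.1, hb'.2]
    rw [ContinuousAt, tendsto_iff_norm_sub_tendsto_zero]
    have hz : Tendsto (fun s => |s - t| * wr) (𝓝 t) (𝓝 0) := by
      have : Continuous fun s : ℝ => |s - t| * wr := by fun_prop
      simpa using this.tendsto t
    refine squeeze_zero' (Eventually.of_forall fun _ => norm_nonneg _) ?_ hz
    filter_upwards [lt_mem_nhds ht] with s hs
    exact key s hs.le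
  have gY := (hgpos Y).ne'
  have ft : HasDerivAt (fun s => burgersFoot wl wr x s) (-(1 + t * d) / g Y)⁻¹ t := by
    have hf : HasDerivAt (fun y => (x - y) / g y) (-(1 + t * d) / g Y) Y := by
      have := ((hasDerivAt_const Y x).sub (hasDerivAt_id Y)).div hgd gY
      have e : ((0 - 1) * g Y - (x - Y) * d) / g Y ^ 2 = -(1 + t * d) / g Y := by
        rw [show x - Y = t * g Y by linarith]
        field_simp
        ring
      rw [← e]
      exact this
    refine HasDerivAt.of_local_left_inverse ct hf ?_ ?_
    · exact div_ne_zero (neg_ne_zero.2 hden.ne') gY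
    · filter_upwards [lt_mem_nhds ht] with s hs
      have e1 := burgersFoot_spec h x hs.le
      unfold burgers at e1
      rw [div_eq_iff (hgpos _).ne']
      linarith
  refine ⟨_, _, hgd.comp t ft, hgd.comp x fx, ?_⟩
  change d * (-(1 + t * d) / g Y)⁻¹ + g Y * (d * (1 + t * d)⁻¹) = 0
  field_simp
  ring

end Viscoelastic

end

/-!
Let `s = (x - √b t) / √(2μ(1+t))` and `w = e^{-s²} / √(2μ(1+t))`. In the characteristic variables
`k = ψ + √b φ` and `h = ψ - √b φ` the perturbation splits into a part `k` carried to the left with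
speed `√b`, transversally to the contact wave, and a part `h` carried along with it. Everything
beyond this linear picture comes from `F(v) = σ(v) - b v`, which vanishes on `[-a, a]`.

The estimate is an energy estimate with two weights.
* For `k`, the negative increasing weight `η = (arctan s - π/2) / √(1+t)`. As `k` crosses the
  support of the weight, the rate of change of `∫ η k²/2` contains `-√b ∫ η_x k²`, and `η_x`
  dominates `(1 + s²) w²`. The weight is small to the right of the contact wave, where the strain
  lies in the nonlinear region.
* For `h`, the weight `θ = 1 - e^{-2s²}`. In the frame of the contact wave it changes only by
  spreading, `θ_t + √b θ_x = -4μ s² w²`, so that the rate of change of `∫ θ h²/2` contains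
  `-2μ ∫ s² w² h²`. Since `(1 - 4s²) w²` is the derivative of `s e^{-s²} w`, an integration by parts
  trades `s² w²` for `w²` at the cost of `∫ h_x²`. The energy of `h` is completed by the relative
  potential of `F`, which turns the flux of `F(v) - F(v̂)` into terms with a sign and into
  `w (σ(v) - σ(v̂) - σ'(v̂) φ)`.

The estimate for `h` produces terms in `η_x k²`; adding a large multiple `Λ` of the estimate for `k`
absorbs them. This is `reducedRate_le`. The composite wave enters through its decay
(`NearStates.exists_waveBounds`): the interaction of contact wave and rarefaction wave and the
contact error have squared norms of order `(1+t)^{-5/4}`, integrable in time, and the viscous error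
of the rarefaction wave, only of order `(1+t)^{-1}` in `L¹`, is paired with `‖(φ, ψ)‖_∞`, which is
bounded by `‖(φ_x, ψ_x)‖^{1/2}`. This gives `exists_energy_inequality`.

For solutions that satisfy the equations only in integrated form, the energy is differentiated on
almost every line `x = const`, where the perturbation is absolutely continuous in time
(`ae_timePair`), and Fubini's theorem yields `energy_identity`. Together these imply
`exists_heat_kernel_estimate`, in which `G` does not occur: since `û₁` decreases in space,
`G ≥ 0` (`G_nonneg`).
-/

noncomputable section

namespace Viscoelastic

/-! ### Locally absolutely continuous functions and `H¹` -/

/-- Local absolute continuity on the line. -/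
def LocAC (f : ℝ → ℝ) : Prop := ∀ x y, AbsolutelyContinuousOnInterval f x y

lemma absolutelyContinuousOnInterval_comp {f g : ℝ → ℝ} {x y : ℝ} {s : Set ℝ} {K : NNReal}
    (hf : AbsolutelyContinuousOnInterval f x y) (hg : LipschitzOnWith K g s)
    (hs : MapsTo f (uIcc x y) s) : AbsolutelyContinuousOnInterval (fun z => g (f z)) x y := by
  rw [absolutelyContinuousOnInterval_iff] at hf ⊢
  intro ε hε
  obtain ⟨δ, hδ, H⟩ := hf (ε / (K + 1)) (by positivity)
  refine ⟨δ, hδ, fun E hE hlt => ?_⟩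
  have h1 := H E hE hlt
  have hle : ∑ i ∈ Finset.range E.1, dist (g (f (E.2 i).1)) (g (f (E.2 i).2))
      ≤ ∑ i ∈ Finset.range E.1, K * dist (f (E.2 i).1) (f (E.2 i).2) :=
    Finset.sum_le_sum fun i hi =>
      hg.dist_le_mul _ (hs (hE.1 i hi).1) _ (hs (hE.1 i hi).2)
  rw [← Finset.mul_sum] at hle
  have hS : 0 ≤ ∑ i ∈ Finset.range E.1, dist (f (E.2 i).1) (f (E.2 i).2) :=
    Finset.sum_nonneg fun _ _ => dist_nonneg
  calc _ ≤ _ := hle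
    _ ≤ (K + 1) * ∑ i ∈ Finset.range E.1, dist (f (E.2 i).1) (f (E.2 i).2) := by gcongr; linarith
    _ < (K + 1) * (ε / (K + 1)) := by gcongr
    _ = ε := by field

lemma sub_eq_integral_of_ae_hasDerivAt {f f' : ℝ → ℝ} {x y : ℝ}
    (hf : AbsolutelyContinuousOnInterval f x y)
    (h : ∀ᵐ z, z ∈ uIcc x y → HasDerivAt f (f' z) z) : f y - f x = ∫ z in x..y, f' z := by
  rw [← hf.integral_deriv_eq_sub]
  refine intervalIntegral.integral_congr_ae ?_
  filter_upwards [h] with z hz hz'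
  exact (hz (uIoc_subset_uIcc hz')).deriv

namespace LocAC

variable {f g : ℝ → ℝ}

lemma continuous (hf : LocAC f) : Continuous f := by
  rw [continuous_iff_continuousAt]
  intro x
  have h := (hf (x - 1) (x + 1)).continuousOn
  rw [uIcc_of_le (by linarith)] at h
  exact h.continuousAt (Icc_mem_nhds (by linarith) (by linarith))

lemma ae_hasDerivAt (hf : LocAC f) : ∀ᵐ x, HasDerivAt f (deriv f x) x := by
  have h : ∀ n : ℕ, ∀ᵐ x, x ∈ uIcc (-n : ℝ) n → DifferentiableAt ℝ f x :=
    fun n => (hf _ _).ae_differentiableAt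
  filter_upwards [ae_all_iff.2 h] with x hx
  obtain ⟨n, hn⟩ := exists_nat_ge |x|
  refine (hx n ?_).hasDerivAt
  rw [uIcc_of_le (by linarith [abs_nonneg x])]
  exact abs_le.1 hn

lemma add (hf : LocAC f) (hg : LocAC g) : LocAC (fun x => f x + g x) :=
  fun x y => (hf x y).add (hg x y)

lemma sub (hf : LocAC f) (hg : LocAC g) : LocAC (fun x => f x - g x) :=
  fun x y => (hf x y).sub (hg x y)

lemma mul (hf : LocAC f) (hg : LocAC g) : LocAC (fun x => f x * g x) :=
  fun x y => (hf x y).mul (hg x y)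

lemma const_mul (c : ℝ) (hf : LocAC f) : LocAC (fun x => c * f x) :=
  fun x y => (hf x y).const_mul c

lemma of_hasDerivAt {f' : ℝ → ℝ} (h : ∀ x, HasDerivAt f (f' x) x) (hc : Continuous f') :
    LocAC f := by
  have : ContDiff ℝ 1 f := by
    rw [contDiff_one_iff_deriv]
    refine ⟨fun x => (h x).differentiableAt, ?_⟩
    rwa [show deriv f = f' from funext fun x => (h x).deriv]
  exact fun x y => this.contDiffOn.absolutelyContinuousOnInterval

lemma comp_lipschitzOn {s : Set ℝ} {K : NNReal} (hf : LocAC f) (hg : LipschitzOnWith K g s)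
    (hs : ∀ x, f x ∈ s) : LocAC (fun x => g (f x)) :=
  fun x y => absolutelyContinuousOnInterval_comp (hf x y) hg fun z _ => hs z

lemma sub_eq_integral (hf : LocAC f) (x y : ℝ) : f y - f x = ∫ z in x..y, deriv f z :=
  ((hf x y).integral_deriv_eq_sub).symm

lemma integral_deriv_eq_zero (hf : LocAC f) (hi : Integrable f) (hd : Integrable (deriv f)) :
    ∫ x, deriv f x = 0 := by
  have h1 : Tendsto (fun x : ℝ => ∫ z in (-x)..x, deriv f z) atTop (𝓝 (∫ z, deriv f z)) :=
    intervalIntegral_tendsto_integral hd tendsto_neg_atTop_atBot tendsto_id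
  have h2 : Integrable (fun x => f x - f (-x)) := hi.sub hi.comp_neg
  refine IntegrableAtFilter.eq_zero_of_tendsto (l := atTop) (h2.integrableAtFilter _) ?_ ?_
    (μ := volume)
  · intro s hs
    obtain ⟨c, hc⟩ := mem_atTop_sets.1 hs
    exact measure_mono_top (s₁ := Ici c) hc (by simp)
  · refine h1.congr fun x => ?_
    rw [hf.sub_eq_integral]

/-- A function vanishing at infinity is bounded by the `L¹` norm of its derivative. -/
lemma abs_le_integral_abs_deriv (hf : LocAC f) (hi : Integrable f) (hd : Integrable (deriv f))
    (x : ℝ) : |f x| ≤ ∫ z, |deriv f z| := by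
  have h1 : Tendsto (fun y : ℝ => f y - f x) atTop (𝓝 (∫ z in Ioi x, deriv f z)) := by
    refine (intervalIntegral_tendsto_integral_Ioi x hd.integrableOn tendsto_id).congr fun y => ?_
    rw [hf.sub_eq_integral]; rfl
  have h2 : Tendsto f atTop (𝓝 ((∫ z in Ioi x, deriv f z) + f x)) := by
    simpa using h1.add_const (f x)
  have h3 := IntegrableAtFilter.eq_zero_of_tendsto (μ := volume) (hi.integrableAtFilter atTop)
    (fun s hs => by
      obtain ⟨c, hc⟩ := mem_atTop_sets.1 hs
      exact measure_mono_top (s₁ := Ici c) hc (by simp)) h2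
  have : f x = -∫ z in Ioi x, deriv f z := by linarith
  rw [this, abs_neg]
  calc _ ≤ ∫ z in Ioi x, |deriv f z| := abs_integral_le_integral_abs
    _ ≤ ∫ z, |deriv f z| := setIntegral_le_integral hd.abs (ae_of_all _ fun _ => abs_nonneg _)

end LocAC

namespace InH1

variable {f g : ℝ → ℝ}

lemma locAC (hf : InH1 f) : LocAC f := hf.absCont

lemma continuous (hf : InH1 f) : Continuous f := hf.locAC.continuous

lemma integrable_sq (hf : InH1 f) : Integrable (fun x => f x ^ 2) := hf.memLp.integrable_sq

lemma integrable_deriv_sq (hf : InH1 f) : Integrable (fun x => deriv f x ^ 2) :=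
  hf.memLp_deriv.integrable_sq

lemma of_ae {f' : ℝ → ℝ} (hl : LocAC f) (h2 : MemLp f 2 volume)
    (h : ∀ᵐ x, HasDerivAt f (f' x) x) (h2' : MemLp f' 2 volume) : InH1 f :=
  ⟨h2, hl, (memLp_congr_ae (by filter_upwards [h] with x hx using hx.deriv)).2 h2'⟩

lemma add (hf : InH1 f) (hg : InH1 g) : InH1 (fun x => f x + g x) :=
  of_ae (f' := fun x => deriv f x + deriv g x) (hf.locAC.add hg.locAC) (hf.memLp.add hg.memLp)
    (by filter_upwards [hf.locAC.ae_hasDerivAt, hg.locAC.ae_hasDerivAt] with x h1 h2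
        exact h1.add h2) (hf.memLp_deriv.add hg.memLp_deriv)

lemma const_mul (c : ℝ) (hf : InH1 f) : InH1 (fun x => c * f x) :=
  of_ae (f' := fun x => c * deriv f x) (hf.locAC.const_mul c) (hf.memLp.const_mul c)
    (by filter_upwards [hf.locAC.ae_hasDerivAt] with x h1
        exact h1.const_mul c) (hf.memLp_deriv.const_mul c)

lemma sub (hf : InH1 f) (hg : InH1 g) : InH1 (fun x => f x - g x) := by
  have := hf.add (hg.const_mul (-1))
  simpa [sub_eq_add_neg] using this

/-- Agmon's inequality with a free parameter. -/
lemma sq_le (hf : InH1 f) {c : ℝ} (hc : 0 < c) (x : ℝ) :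
    f x ^ 2 ≤ c * (∫ z, f z ^ 2) + c⁻¹ * ∫ z, deriv f z ^ 2 := by
  have hd : (fun x => 2 * (deriv f x * f x)) =ᵐ[volume] deriv (fun x => f x * f x) := by
    filter_upwards [hf.locAC.ae_hasDerivAt] with x h1
    have h2 : HasDerivAt (fun x => f x * f x) (2 * (deriv f x * f x)) x :=
      (h1.mul h1).congr_deriv (by ring)
    exact h2.deriv.symm
  have i1 : Integrable (fun x => 2 * (deriv f x * f x)) :=
    (hf.memLp_deriv.integrable_mul hf.memLp).const_mul 2
  have h := (hf.locAC.mul hf.locAC).abs_le_integral_abs_deriv (hf.memLp.integrable_mul hf.memLp)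
    (i1.congr hd) x
  have he : ∫ z, |deriv (fun x => f x * f x) z| = ∫ z, |2 * (deriv f z * f z)| :=
    integral_congr_ae (by filter_upwards [hd] with z hz; rw [hz])
  rw [he] at h
  calc f x ^ 2 = |f x * f x| := by rw [abs_mul_self, sq]
    _ ≤ _ := h
    _ ≤ ∫ z, (c * f z ^ 2 + c⁻¹ * deriv f z ^ 2) := by
      refine integral_mono i1.abs ((hf.integrable_sq.const_mul _).add
        (hf.integrable_deriv_sq.const_mul _)) fun z => ?_
      have hci : c * c⁻¹ = 1 := mul_inv_cancel₀ hc.ne'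
      have hc' : 0 < c⁻¹ := inv_pos.2 hc
      have e1 : c * f z ^ 2 + c⁻¹ * deriv f z ^ 2 - 2 * (deriv f z * f z)
          = c * (f z - c⁻¹ * deriv f z) ^ 2 := by field
      have e2 : c * f z ^ 2 + c⁻¹ * deriv f z ^ 2 + 2 * (deriv f z * f z)
          = c * (f z + c⁻¹ * deriv f z) ^ 2 := by field
      have e1' := mul_nonneg hc.le (sq_nonneg (f z - c⁻¹ * deriv f z))
      have e2' := mul_nonneg hc.le (sq_nonneg (f z + c⁻¹ * deriv f z))
      change |_| ≤ _
      rw [abs_le]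
      constructor <;> linarith
    _ = _ := by
      rw [integral_add (hf.integrable_sq.const_mul _) (hf.integrable_deriv_sq.const_mul _),
        integral_const_mul, integral_const_mul]

lemma sq_le_add (hf : InH1 f) (x : ℝ) :
    f x ^ 2 ≤ (∫ z, f z ^ 2) + ∫ z, deriv f z ^ 2 := by
  simpa using hf.sq_le one_pos x

/-- Agmon's inequality. -/
lemma sq_le_sqrt (hf : InH1 f) {N : ℝ} (hN : 0 < N) (h : ∫ z, f z ^ 2 ≤ N ^ 2) (x : ℝ) :
    f x ^ 2 ≤ 2 * N * √(∫ z, deriv f z ^ 2) := by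
  set D := ∫ z, deriv f z ^ 2
  have hD : 0 ≤ D := integral_nonneg fun z => sq_nonneg _
  have key : ∀ ε > 0, f x ^ 2 ≤ 2 * N * (√D + ε) := by
    intro ε hε
    set X := √D + ε
    have hX : 0 < X := by positivity
    have h1 := hf.sq_le (c := X / N) (by positivity) x
    have h2 : X / N * (∫ z, f z ^ 2) ≤ X / N * N ^ 2 := by gcongr
    have h3 : (X / N)⁻¹ * D ≤ (X / N)⁻¹ * X ^ 2 := by
      gcongr
      calc D = √D ^ 2 := (Real.sq_sqrt hD).symm
        _ ≤ X ^ 2 := by gcongr; linarith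
    have e1 : X / N * N ^ 2 = N * X := by field
    have e2 : (X / N)⁻¹ * X ^ 2 = N * X := by field
    linarith
  refine le_of_forall_pos_le_add fun ε hε => ?_
  have := key (ε / (2 * N)) (by positivity)
  have e : 2 * N * (√D + ε / (2 * N)) = 2 * N * √D + ε := by field
  linarith

end InH1

/-- An `H¹` derivative makes the function classically differentiable. -/
lemma LocAC.hasDerivAt_of_continuous {f : ℝ → ℝ} (hf : LocAC f) (hc : Continuous (deriv f))
    (x : ℝ) : HasDerivAt f (deriv f x) x := by
  have e : f = fun y => f 0 + ∫ z in (0 : ℝ)..y, deriv f z := by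
    funext y; rw [← hf.sub_eq_integral]; ring
  have h := ((hc.integral_hasStrictDerivAt 0 x).hasDerivAt).const_add (f 0)
  exact h.congr_of_eventuallyEq (Eventually.of_forall fun y => congrFun e y)

lemma measurable_toContinuousMap {α : Type*} [MeasurableSpace α] (F : α → C(ℝ, ℝ))
    (h : ∀ x, Measurable fun i => F i x) : @Measurable α C(ℝ, ℝ) _ (borel _) F := by
  rw [borel_eq_generateFrom_of_subbasis ContinuousMap.compactOpen_eq]
  refine measurable_generateFrom ?_
  rintro _ ⟨K, hK, U, hU, rfl⟩
  have hU : IsOpen U := hU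
  obtain ⟨D, hDK, hDc, hKD⟩ :=
    (TopologicalSpace.IsSeparable.of_separableSpace K).exists_countable_dense_subset
  rcases eq_empty_or_nonempty Uᶜ with hU' | hU'
  · rw [compl_empty_iff] at hU'
    subst hU'
    simp [mapsTo_univ]
  have e : F ⁻¹' {f | MapsTo f K U} =
      ⋃ n : ℕ, ⋂ x ∈ D, {i | 1 / ((n : ℝ) + 1) ≤ Metric.infDist (F i x) Uᶜ} := by
    ext i
    simp only [mem_preimage, mem_ofPred_eq, mem_iUnion, mem_iInter]
    have hcont : Continuous fun x => Metric.infDist (F i x) Uᶜ :=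
      (Metric.continuous_infDist_pt _).comp (F i).continuous
    constructor
    · intro h
      rcases K.eq_empty_or_nonempty with rfl | hne
      · exact ⟨0, fun x hx => absurd (hDK hx) (by simp)⟩
      obtain ⟨x₀, hx₀, hmin⟩ := hK.exists_isMinOn hne hcont.continuousOn
      have hpos : 0 < Metric.infDist (F i x₀) Uᶜ :=
        (hU.isClosed_compl.notMem_iff_infDist_pos hU').1 (fun h' => h' (h hx₀))
      obtain ⟨n, hn⟩ := exists_nat_one_div_lt hpos
      exact ⟨n, fun x hx => hn.le.trans (hmin (hDK hx))⟩
    · rintro ⟨n, hn⟩ x hx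
      have hx' : x ∈ closure D := hKD hx
      have hcl : IsClosed {x | 1 / ((n : ℝ) + 1) ≤ Metric.infDist (F i x) Uᶜ} :=
        isClosed_le continuous_const hcont
      have h1 : 1 / ((n : ℝ) + 1) ≤ Metric.infDist (F i x) Uᶜ :=
        closure_minimal (fun x hx => hn x hx) hcl hx'
      have h2 : 0 < Metric.infDist (F i x) Uᶜ := lt_of_lt_of_le (by positivity) h1
      by_contra hU2
      exact (hU.isClosed_compl.notMem_iff_infDist_pos hU').2 h2 hU2
  rw [e]
  refine MeasurableSet.iUnion fun n => MeasurableSet.biInter hDc fun x _ => ?_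
  exact measurableSet_le measurable_const ((Metric.continuous_infDist_pt _).measurable.comp (h x))

/-- The derivative in the second variable of a Carathéodory function is jointly measurable. -/
lemma measurable_deriv_of_caratheodory {α : Type*} [MeasurableSpace α] {f : α → ℝ → ℝ}
    (hm : ∀ x, Measurable fun i => f i x) (hc : ∀ i, Continuous (f i)) :
    Measurable fun p : α × ℝ => deriv (f p.1) p.2 := by
  let F : α → C(ℝ, ℝ) := fun i => ⟨f i, hc i⟩
  let _ : MeasurableSpace C(ℝ, ℝ) := borel _
  have : BorelSpace C(ℝ, ℝ) := ⟨rfl⟩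
  have hF : Measurable F := measurable_toContinuousMap F hm
  have h1 : Measurable fun p : C(ℝ, ℝ) × ℝ => deriv (fun x => p.1 x) p.2 :=
    measurable_deriv_with_param (f := fun (g : C(ℝ, ℝ)) x => g x) (by fun_prop)
  exact h1.comp ((hF.comp measurable_fst).prodMk measurable_snd)

/-! ### The stress function near the degenerate point -/

/-- The one-sided second derivative of the stress on `[a, ∞)`. -/
def stress2 (σ : ℝ → ℝ) (a v : ℝ) : ℝ := derivWithin (deriv σ) (Ici a) v

/-- The one-sided third derivative of the stress on `[a, ∞)`. -/
def stress3 (σ : ℝ → ℝ) (a v : ℝ) : ℝ := derivWithin (stress2 σ a) (Ici a) v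

/-- The nonlinear part `σ(v) - b v` of the stress; it vanishes on `[-a, a]`. -/
def nl (σ : ℝ → ℝ) (b v : ℝ) : ℝ := σ v - b * v

/-- The relative quantity `F(v) - F(w) - F'(w) (v - w)` of `F = nl σ b`, which is also the relative
quantity of `σ`. -/
def nlRel (σ : ℝ → ℝ) (b v w : ℝ) : ℝ := nl σ b v - nl σ b w - (deriv σ w - b) * (v - w)

/-- The relative potential `∫_w^v (F(z) - F(w)) dz` of `F = nl σ b`. -/
def nlPot (σ : ℝ → ℝ) (b v w : ℝ) : ℝ :=
  (∫ z in (0 : ℝ)..v, nl σ b z) - (∫ z in (0 : ℝ)..w, nl σ b z) - nl σ b w * (v - w)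

namespace IsStress

variable {a b : ℝ} {σ : ℝ → ℝ} (hσ : IsStress a b σ)
include hσ

lemma hasDerivAt (v : ℝ) : HasDerivAt σ (deriv σ v) v :=
  (hσ.contDiff.differentiable (by norm_num) v).hasDerivAt

lemma continuous_deriv : Continuous (deriv σ) := hσ.contDiff.continuous_deriv le_rfl

lemma continuous : Continuous σ := hσ.contDiff.continuous

lemma deriv_eq {v : ℝ} (hv : v ∈ Ioc (-a) a) : deriv σ v = b := by
  have h0 := hσ.a_pos
  have h1 : ∀ v ∈ Ioo (-a) a, deriv σ v = b := fun v hv => by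
    have : σ =ᶠ[𝓝 v] fun v => b * v := by
      filter_upwards [Ioo_mem_nhds hv.1 hv.2] with w hw using hσ.linear w hw
    rw [this.deriv_eq]
    simp
  have h2 : closure (Ioo (-a) a) ⊆ {v | deriv σ v = b} :=
    closure_minimal h1 (isClosed_eq hσ.continuous_deriv continuous_const)
  rw [closure_Ioo (by linarith)] at h2
  exact h2 (Ioc_subset_Icc_self hv)

lemma eq_linear {v : ℝ} (hv : v ∈ Ioc (-a) a) : σ v = b * v := by
  have h0 := hσ.a_pos
  have h2 : closure (Ioo (-a) a) ⊆ {v | σ v = b * v} :=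
    closure_minimal hσ.linear (isClosed_eq hσ.continuous (by fun_prop))
  rw [closure_Ioo (by linarith)] at h2
  exact h2 (Ioc_subset_Icc_self hv)

lemma contDiffOn_deriv : ContDiffOn ℝ 2 (deriv σ) (Ici a) := by
  have h := (hσ.smooth_right).derivWithin (uniqueDiffOn_Ici a) (m := 2) (by norm_num)
  refine h.congr fun v hv => ?_
  exact ((hσ.hasDerivAt v).differentiableAt.derivWithin (uniqueDiffOn_Ici a v hv)).symm

lemma contDiffOn_stress2 : ContDiffOn ℝ 1 (stress2 σ a) (Ici a) :=
  (hσ.contDiffOn_deriv).derivWithin (uniqueDiffOn_Ici a) (by norm_num)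

lemma continuousOn_stress2 : ContinuousOn (stress2 σ a) (Ici a) :=
  hσ.contDiffOn_stress2.continuousOn

lemma continuousOn_stress3 : ContinuousOn (stress3 σ a) (Ici a) :=
  hσ.contDiffOn_stress2.continuousOn_derivWithin (uniqueDiffOn_Ici a) le_rfl

lemma hasDerivAt_deriv {v : ℝ} (hv : a < v) : HasDerivAt (deriv σ) (stress2 σ a v) v :=
  ((hσ.contDiffOn_deriv.differentiableOn (by norm_num) v hv.le).hasDerivWithinAt).hasDerivAt
    (Ici_mem_nhds hv)

lemma hasDerivAt_stress2 {v : ℝ} (hv : a < v) : HasDerivAt (stress2 σ a) (stress3 σ a v) v :=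
  ((hσ.contDiffOn_stress2.differentiableOn (by norm_num) v hv.le).hasDerivWithinAt).hasDerivAt
    (Ici_mem_nhds hv)

lemma stress2_pos {v : ℝ} (hv : a ≤ v) : 0 < stress2 σ a v := hσ.convex_right v hv

lemma strictMonoOn_deriv : StrictMonoOn (deriv σ) (Ici a) := by
  refine strictMonoOn_of_deriv_pos (convex_Ici a) hσ.continuous_deriv.continuousOn fun v hv => ?_
  rw [interior_Ici] at hv
  rw [(hσ.hasDerivAt_deriv hv).deriv]
  exact hσ.stress2_pos hv.le

lemma b_le_deriv {v : ℝ} (hv : -a < v) : b ≤ deriv σ v := by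
  rcases le_total v a with h | h
  · exact (hσ.deriv_eq ⟨hv, h⟩).ge
  · have h0 := hσ.a_pos
    rw [← hσ.deriv_eq (v := a) ⟨by linarith, le_rfl⟩]
    exact hσ.strictMonoOn_deriv.monotoneOn self_mem_Ici h h

lemma lam_a : lam σ a = √b := by
  have h0 := hσ.a_pos
  rw [lam, hσ.deriv_eq ⟨by linarith, le_rfl⟩]

lemma lam_pos {v : ℝ} (hv : -a < v) : 0 < lam σ v :=
  Real.sqrt_pos.2 (hσ.b_pos.trans_le (hσ.b_le_deriv hv))

lemma lam_sq {v : ℝ} (hv : -a < v) : lam σ v ^ 2 = deriv σ v :=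
  Real.sq_sqrt (hσ.b_pos.le.trans (hσ.b_le_deriv hv))

lemma continuous_lam : Continuous (lam σ) := Real.continuous_sqrt.comp hσ.continuous_deriv

lemma strictMonoOn_lam : StrictMonoOn (lam σ) (Ici a) := fun x hx y hy hxy =>
  Real.sqrt_lt_sqrt (hσ.b_pos.le.trans (hσ.b_le_deriv (by linarith [hσ.a_pos, mem_Ici.1 hx])))
    (hσ.strictMonoOn_deriv hx hy hxy)

lemma hasDerivAt_lam {v : ℝ} (hv : a < v) :
    HasDerivAt (lam σ) (stress2 σ a v / (2 * lam σ v)) v := by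
  have h0 := hσ.a_pos
  exact (hσ.hasDerivAt_deriv hv).sqrt
    (hσ.b_pos.trans_le (hσ.b_le_deriv (by linarith))).ne'

lemma hasDerivAt_nl (v : ℝ) : HasDerivAt (nl σ b) (deriv σ v - b) v :=
  ((hσ.hasDerivAt v).sub ((hasDerivAt_id v).const_mul b)).congr_deriv (by simp)

lemma continuous_nl : Continuous (nl σ b) :=
  continuous_iff_continuousAt.2 fun v => (hσ.hasDerivAt_nl v).continuousAt

lemma nl_eq_zero {v : ℝ} (hv : v ∈ Ioc (-a) a) : nl σ b v = 0 := by
  rw [nl, hσ.eq_linear hv, sub_self]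

lemma hasDerivAt_integral_nl (v : ℝ) :
    HasDerivAt (fun v => ∫ z in (0 : ℝ)..v, nl σ b z) (nl σ b v) v :=
  (hσ.continuous_nl.integral_hasStrictDerivAt 0 v).hasDerivAt

end IsStress

/-- Two-sided bounds for the derivatives of the stress on `[a, a + 1]`. -/
structure StressBounds (a b κ K : ℝ) (σ : ℝ → ℝ) : Prop extends IsStress a b σ where
  κ_pos : 0 < κ
  one_le : 1 ≤ K
  deriv_le : ∀ v ∈ Icc a (a + 1), deriv σ v ≤ K
  le_stress2 : ∀ v ∈ Icc a (a + 1), κ ≤ stress2 σ a v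
  stress2_le : ∀ v ∈ Icc a (a + 1), stress2 σ a v ≤ K
  stress3_le : ∀ v ∈ Icc a (a + 1), |stress3 σ a v| ≤ K

lemma IsStress.exists_bounds {a b : ℝ} {σ : ℝ → ℝ} (hσ : IsStress a b σ) :
    ∃ κ K, StressBounds a b κ K σ := by
  have hsub : Icc a (a + 1) ⊆ Ici a := Icc_subset_Ici_self
  have hne : (Icc a (a + 1)).Nonempty := nonempty_Icc.2 (by linarith)
  obtain ⟨x, hx, hmin⟩ := isCompact_Icc.exists_isMinOn hne (hσ.continuousOn_stress2.mono hsub)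
  obtain ⟨K2, h2⟩ := isCompact_Icc.exists_bound_of_continuousOn
    (hσ.continuousOn_stress2.mono hsub)
  obtain ⟨K3, h3⟩ := isCompact_Icc.exists_bound_of_continuousOn
    (hσ.continuousOn_stress3.mono hsub)
  obtain ⟨K1, h1⟩ := isCompact_Icc.exists_bound_of_continuousOn
    (hσ.continuous_deriv.continuousOn (s := Icc a (a + 1)))
  refine ⟨stress2 σ a x, 1 + |K1| + |K2| + |K3|, hσ, hσ.stress2_pos (hsub hx), ?_, ?_,
    fun v hv => hmin hv, ?_, ?_⟩
  · linarith [abs_nonneg K1, abs_nonneg K2, abs_nonneg K3]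
  · intro v hv
    have := h1 v hv
    rw [Real.norm_eq_abs] at this
    linarith [abs_nonneg K1, abs_nonneg K2, abs_nonneg K3, le_abs_self K1,
      le_abs_self (deriv σ v)]
  · intro v hv
    have := h2 v hv
    rw [Real.norm_eq_abs] at this
    linarith [abs_nonneg K1, abs_nonneg K2, abs_nonneg K3, le_abs_self K2,
      le_abs_self (stress2 σ a v)]
  · intro v hv
    have := h3 v hv
    rw [Real.norm_eq_abs] at this
    linarith [abs_nonneg K1, abs_nonneg K2, abs_nonneg K3, le_abs_self K3]

namespace StressBounds

variable {a b κ K : ℝ} {σ : ℝ → ℝ} (hσ : StressBounds a b κ K σ)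
include hσ

lemma K_pos : 0 < K := one_pos.trans_le hσ.one_le

lemma deriv_sub {x y : ℝ} (hx : a ≤ x) (hxy : x ≤ y) (hy : y ≤ a + 1) :
    κ * (y - x) ≤ deriv σ y - deriv σ x ∧ deriv σ y - deriv σ x ≤ K * (y - x) := by
  rcases hxy.eq_or_lt with rfl | h
  · simp
  obtain ⟨c, hc, he⟩ := exists_hasDerivAt_eq_slope (deriv σ) (stress2 σ a) h
    hσ.continuous_deriv.continuousOn fun z hz => hσ.hasDerivAt_deriv (hx.trans_lt hz.1)
  rw [eq_div_iff (by linarith)] at he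
  rw [← he]
  have hc' : c ∈ Icc a (a + 1) := ⟨by linarith [hc.1], by linarith [hc.2]⟩
  have h1 : 0 ≤ y - x := by linarith
  exact ⟨mul_le_mul_of_nonneg_right (hσ.le_stress2 c hc') h1,
    mul_le_mul_of_nonneg_right (hσ.stress2_le c hc') h1⟩

lemma deriv_eq_max {v : ℝ} (hv : -a < v) : deriv σ v = deriv σ (max v a) := by
  have h0 := hσ.a_pos
  rcases le_total v a with h | h
  · rw [max_eq_right h, hσ.deriv_eq ⟨hv, h⟩, hσ.deriv_eq ⟨by linarith, le_rfl⟩]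
  · rw [max_eq_left h]

lemma slope_bounds {v : ℝ} (hv : v ∈ Ioc (-a) (a + 1)) :
    κ * max (v - a) 0 ≤ deriv σ v - b ∧ deriv σ v - b ≤ K * max (v - a) 0 := by
  have h0 := hσ.a_pos
  have h := hσ.deriv_sub le_rfl (le_max_right v a) (max_le hv.2 (by linarith))
  rw [← hσ.deriv_eq_max hv.1, hσ.deriv_eq (v := a) ⟨by linarith, le_rfl⟩] at h
  rwa [show max (v - a) 0 = max v a - a by rw [← sub_self a, max_sub_sub_right]]

lemma deriv_mono {x y : ℝ} (hx : -a < x) (hxy : x ≤ y) : deriv σ x ≤ deriv σ y := by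
  rw [hσ.deriv_eq_max hx, hσ.deriv_eq_max (hx.trans_le hxy)]
  exact hσ.strictMonoOn_deriv.monotoneOn (mem_Ici.2 (le_max_right _ _))
    (mem_Ici.2 (le_max_right _ _)) (max_le_max_right _ hxy)

lemma abs_deriv_sub_le {x y : ℝ} (hx : x ∈ Ioc (-a) (a + 1)) (hy : y ∈ Ioc (-a) (a + 1)) :
    |deriv σ y - deriv σ x| ≤ K * |y - x| := by
  have h0 := hσ.a_pos
  wlog h : x ≤ y generalizing x y
  · rw [abs_sub_comm, abs_sub_comm y]
    exact this hy hx (le_of_not_ge h)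
  rw [abs_of_nonneg (sub_nonneg.2 (hσ.deriv_mono hx.1 h)), abs_of_nonneg (by linarith)]
  have h1 := (hσ.deriv_sub (le_max_right x a) (max_le_max_right a h)
    (max_le hy.2 (by linarith))).2
  rw [← hσ.deriv_eq_max hx.1, ← hσ.deriv_eq_max hy.1] at h1
  refine h1.trans (mul_le_mul_of_nonneg_left ?_ hσ.K_pos.le)
  rcases le_total x a with hxa | hxa <;> rcases le_total y a with hya | hya <;>
    simp only [max_eq_left, max_eq_right, hxa, hya] <;> linarith

/-- Mean value form of the increments of the nonlinear part. -/
lemma nl_sub_eq (v w : ℝ) : ∃ ξ ∈ uIcc w v, nl σ b v - nl σ b w = (deriv σ ξ - b) * (v - w) := by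
  rcases lt_trichotomy w v with h | h | h
  · obtain ⟨c, hc, he⟩ := exists_hasDerivAt_eq_slope (nl σ b) (fun z => deriv σ z - b) h
      hσ.continuous_nl.continuousOn fun z _ => hσ.hasDerivAt_nl z
    exact ⟨c, Icc_subset_uIcc (Ioo_subset_Icc_self hc), by
      rw [he, div_mul_cancel₀ _ (by linarith)]⟩
  · exact ⟨w, left_mem_uIcc, by rw [h]; ring⟩
  · obtain ⟨c, hc, he⟩ := exists_hasDerivAt_eq_slope (nl σ b) (fun z => deriv σ z - b) h
      hσ.continuous_nl.continuousOn fun z _ => hσ.hasDerivAt_nl z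
    refine ⟨c, Icc_subset_uIcc' (Ioo_subset_Icc_self hc), ?_⟩
    rw [he, show v - w = -(w - v) by ring, mul_neg, div_mul_cancel₀ _ (by linarith)]; ring

omit hσ in
lemma uIcc_subset {v w : ℝ} (hv : v ∈ Ioc (-a) (a + 1)) (hw : w ∈ Ioc (-a) (a + 1)) :
    uIcc w v ⊆ Ioc (-a) (a + 1) := ordConnected_Ioc.uIcc_subset hw hv

lemma nl_mono {v w : ℝ} (hv : -a < v) (h : v ≤ w) : nl σ b v ≤ nl σ b w := by
  obtain ⟨ξ, hξ, he⟩ := hσ.nl_sub_eq w v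
  rw [uIcc_of_le h] at hξ
  have := hσ.b_le_deriv (hv.trans_le hξ.1)
  have := mul_nonneg (sub_nonneg.2 this) (sub_nonneg.2 h)
  linarith

lemma abs_nl_sub_le_max {v w : ℝ} (hv : v ∈ Ioc (-a) (a + 1)) (hw : w ∈ Ioc (-a) (a + 1)) :
    |nl σ b v - nl σ b w| ≤ K * max (max (v - a) (w - a)) 0 * |v - w| := by
  obtain ⟨ξ, hξ, he⟩ := hσ.nl_sub_eq v w
  have hξ' := uIcc_subset hv hw hξ
  have h1 := hσ.b_le_deriv hξ'.1
  rw [he, abs_mul, abs_of_nonneg (by linarith)]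
  refine mul_le_mul_of_nonneg_right ((hσ.slope_bounds hξ').2.trans ?_) (abs_nonneg _)
  refine mul_le_mul_of_nonneg_left (max_le_max_right _ ?_) hσ.K_pos.le
  rw [max_sub_sub_right, max_comm]
  exact sub_le_sub_right hξ.2 _

lemma abs_nl_sub_le {v w : ℝ} (hv : v ∈ Ioc (-a) (a + 1)) (hw : w ∈ Ioc (-a) (a + 1)) :
    |nl σ b v - nl σ b w| ≤ K * |v - w| * (|v - w| + max (w - a) 0) := by
  refine (hσ.abs_nl_sub_le_max hv hw).trans ?_
  rw [mul_right_comm]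
  refine mul_le_mul_of_nonneg_left ?_ (mul_nonneg hσ.K_pos.le (abs_nonneg _))
  have h1 := le_abs_self (v - w)
  have h2 := abs_nonneg (v - w)
  have h3 := le_max_left (w - a) 0
  have h4 := le_max_right (w - a) 0
  exact max_le (max_le (by linarith) (by linarith)) (by linarith)

lemma abs_nl_sub_le_lip {v w : ℝ} (hv : v ∈ Ioc (-a) (a + 1)) (hw : w ∈ Ioc (-a) (a + 1)) :
    |nl σ b v - nl σ b w| ≤ K * |v - w| := by
  refine (hσ.abs_nl_sub_le_max hv hw).trans ?_
  have : max (max (v - a) (w - a)) 0 ≤ 1 :=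
    max_le (max_le (by linarith [hv.2]) (by linarith [hw.2])) one_pos.le
  exact mul_le_mul_of_nonneg_right (mul_le_of_le_one_right hσ.K_pos.le this) (abs_nonneg _)

lemma nl_bounds {v : ℝ} (hv : v ∈ Ioc (-a) (a + 1)) :
    0 ≤ nl σ b v ∧ nl σ b v ≤ K * max (v - a) 0 ^ 2 := by
  have h0 := hσ.a_pos
  rcases le_total v a with h | h
  · rw [hσ.nl_eq_zero ⟨hv.1, h⟩]
    exact ⟨le_rfl, mul_nonneg hσ.K_pos.le (sq_nonneg _)⟩
  · have ha : a ∈ Ioc (-a) (a + 1) := ⟨by linarith, by linarith⟩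
    have h1 := hσ.nl_mono (by linarith) h
    have h2 := hσ.abs_nl_sub_le_max hv ha
    rw [hσ.nl_eq_zero ⟨by linarith, le_rfl⟩] at h1 h2
    rw [sub_zero, abs_of_nonneg h1, sub_self, max_eq_left (by linarith : (0:ℝ) ≤ v - a),
      abs_of_nonneg (by linarith : (0:ℝ) ≤ v - a)] at h2
    rw [max_eq_left (by linarith : (0:ℝ) ≤ v - a)] at h2 ⊢
    exact ⟨h1, by linarith⟩

omit hσ in
lemma nlRel_eq (v w : ℝ) : nlRel σ b v w = σ v - σ w - deriv σ w * (v - w) := by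
  unfold nlRel nl; ring

/-- Strict convexity on `[a, a + 1]`. -/
lemma le_nlRel_of_le {v w : ℝ} (hv : v ∈ Icc a (a + 1)) (hw : w ∈ Icc a (a + 1)) :
    κ / 2 * (v - w) ^ 2 ≤ nlRel σ b v w := by
  set g : ℝ → ℝ := fun v => nlRel σ b v w - κ / 2 * (v - w) ^ 2 with hg
  have hd : ∀ z, HasDerivAt g (deriv σ z - deriv σ w - κ * (z - w)) z := by
    intro z
    have h1 := (((hσ.hasDerivAt_nl z).sub_const (nl σ b w)).sub
      (((hasDerivAt_id z).sub_const w).const_mul (deriv σ w - b))).sub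
      ((((hasDerivAt_id z).sub_const w).pow 2).const_mul (κ / 2))
    refine h1.congr_deriv ?_
    simp only [id_eq]
    ring
  have hgc : ∀ s, ContinuousOn g s := fun s => continuousOn_of_forall_continuousAt fun z _ =>
    (hd z).continuousAt
  have hgw : g w = 0 := by simp [hg, nlRel]
  suffices 0 ≤ g v by simp only [hg] at this; linarith
  rcases le_total w v with h | h
  · have hm : MonotoneOn g (Icc w v) := by
      refine monotoneOn_of_deriv_nonneg (convex_Icc _ _) (hgc _)
        (fun z _ => (hd z).differentiableAt.differentiableWithinAt) fun z hz => ?_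
      rw [interior_Icc] at hz
      rw [(hd z).deriv]
      linarith [(hσ.deriv_sub hw.1 hz.1.le (hz.2.le.trans hv.2)).1]
    exact hgw ▸ hm ⟨le_rfl, h⟩ ⟨h, le_rfl⟩ h
  · have hm : AntitoneOn g (Icc v w) := by
      refine antitoneOn_of_deriv_nonpos (convex_Icc _ _) (hgc _)
        (fun z _ => (hd z).differentiableAt.differentiableWithinAt) fun z hz => ?_
      rw [interior_Icc] at hz
      rw [(hd z).deriv]
      linarith [(hσ.deriv_sub (hv.1.trans hz.1.le) hz.2.le hw.2).1]
    exact hgw ▸ hm ⟨le_rfl, h⟩ ⟨h, le_rfl⟩ h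

lemma nlRel_nonneg {v w : ℝ} (hv : v ∈ Ioc (-a) (a + 1)) (hw : w ∈ Ioc (-a) (a + 1)) :
    0 ≤ nlRel σ b v w := by
  obtain ⟨ξ, hξ, he⟩ := hσ.nl_sub_eq v w
  have : nlRel σ b v w = (deriv σ ξ - deriv σ w) * (v - w) := by
    unfold nlRel; linear_combination he
  rw [this]
  rcases le_total w v with h | h
  · rw [uIcc_of_le h] at hξ
    exact mul_nonneg (sub_nonneg.2 (hσ.deriv_mono hw.1 hξ.1)) (sub_nonneg.2 h)
  · rw [uIcc_of_ge h] at hξ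
    exact mul_nonneg_of_nonpos_of_nonpos
      (sub_nonpos.2 (hσ.deriv_mono (hv.1.trans_le hξ.1) hξ.2)) (sub_nonpos.2 h)

lemma nlRel_le {v w : ℝ} (hv : v ∈ Ioc (-a) (a + 1)) (hw : w ∈ Ioc (-a) (a + 1)) :
    nlRel σ b v w ≤ K * (v - w) ^ 2 := by
  obtain ⟨ξ, hξ, he⟩ := hσ.nl_sub_eq v w
  have : nlRel σ b v w = (deriv σ ξ - deriv σ w) * (v - w) := by
    unfold nlRel; linear_combination he
  rw [this]
  have h1 := hσ.abs_deriv_sub_le hw (uIcc_subset hv hw hξ)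
  have h2 : |ξ - w| ≤ |v - w| := abs_sub_left_of_mem_uIcc hξ
  calc (deriv σ ξ - deriv σ w) * (v - w) ≤ |deriv σ ξ - deriv σ w| * |v - w| := by
        rw [← abs_mul]; exact le_abs_self _
    _ ≤ K * |v - w| * |v - w| := by
      gcongr
      exact h1.trans (mul_le_mul_of_nonneg_left h2 hσ.K_pos.le)
    _ = K * (v - w) ^ 2 := by rw [← sq_abs (v - w)]; ring

/-- The linear part of the flux difference is controlled by the relative stress, although the
latter is degenerate when `v` lies in the linear region. -/
lemma slope_mul_sq_le {v w : ℝ} (hv : v ∈ Ioc (-a) (a + 1)) (hw : w ∈ Ioc (-a) (a + 1)) :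
    (deriv σ w - b) * (v - w) ^ 2 ≤
      2 * K / κ * (max (w - a) 0 + |v - w|) * nlRel σ b v w := by
  have hκ := hσ.κ_pos
  have hK := hσ.K_pos
  have hR := hσ.nlRel_nonneg hv hw
  have h0 := hσ.a_pos
  rcases le_total w a with hwa | hwa
  · rw [hσ.deriv_eq ⟨hw.1, hwa⟩, sub_self, zero_mul]
    positivity
  have hs := hσ.slope_bounds hw
  have hm : (0 : ℝ) ≤ w - a := by linarith
  rw [max_eq_left hm] at hs ⊢
  have hwI : w ∈ Icc a (a + 1) := ⟨hwa, hw.2⟩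
  have hsq : (deriv σ w - b) * (v - w) ^ 2 ≤ K * (w - a) * (v - w) ^ 2 :=
    mul_le_mul_of_nonneg_right hs.2 (sq_nonneg _)
  refine hsq.trans ?_
  suffices hh : κ / 2 * ((w - a) * (v - w) ^ 2) ≤ (w - a + |v - w|) * nlRel σ b v w by
    calc K * (w - a) * (v - w) ^ 2 = 2 * K / κ * (κ / 2 * ((w - a) * (v - w) ^ 2)) := by field
      _ ≤ 2 * K / κ * ((w - a + |v - w|) * nlRel σ b v w) := by gcongr
      _ = _ := by ring
  rcases le_total a v with hva | hva
  · have h1 := hσ.le_nlRel_of_le ⟨hva, hv.2⟩ hwI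
    have h2 := mul_le_mul_of_nonneg_left h1 hm
    have h3 := mul_nonneg (abs_nonneg (v - w)) hR
    linarith
  · have ha1 : a ∈ Icc a (a + 1) := ⟨le_rfl, by linarith⟩
    have h1 := hσ.le_nlRel_of_le ha1 hwI
    have e : nlRel σ b v w = nlRel σ b a w + (deriv σ w - b) * (a - v) := by
      unfold nlRel
      rw [hσ.nl_eq_zero ⟨hv.1, hva⟩, hσ.nl_eq_zero (v := a) ⟨by linarith, le_rfl⟩]; ring
    have h2 := mul_le_mul_of_nonneg_right hs.1 (sub_nonneg.2 hva)
    have habs : |v - w| = w - v := by rw [abs_of_nonpos (by linarith)]; ring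
    have h3 : κ / 2 * (w - a) * (w - v) ≤ nlRel σ b v w := by
      have : 0 ≤ κ / 2 * ((w - a) * (a - v)) := by
        have : 0 ≤ a - v := by linarith
        positivity
      rw [e]
      nlinarith
    have h4 := mul_le_mul_of_nonneg_left h3 (show 0 ≤ w - v by linarith)
    have h5 := mul_nonneg hm hR
    rw [habs]
    nlinarith

lemma nlPot_bounds {v w : ℝ} (hv : v ∈ Ioc (-a) (a + 1)) (hw : w ∈ Ioc (-a) (a + 1)) :
    0 ≤ nlPot σ b v w ∧ nlPot σ b v w ≤ |nl σ b v - nl σ b w| * |v - w| := by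
  have hmv : ∃ ξ ∈ uIcc w v, nlPot σ b v w = (nl σ b ξ - nl σ b w) * (v - w) := by
    have hd := hσ.hasDerivAt_integral_nl
    have hc : Continuous fun v => ∫ z in (0 : ℝ)..v, nl σ b z :=
      continuous_iff_continuousAt.2 fun v => (hd v).continuousAt
    rcases lt_trichotomy w v with h | h | h
    · obtain ⟨c, hc, he⟩ := exists_hasDerivAt_eq_slope _ _ h hc.continuousOn fun z _ => hd z
      refine ⟨c, Icc_subset_uIcc (Ioo_subset_Icc_self hc), ?_⟩
      rw [eq_div_iff (by linarith)] at he
      unfold nlPot; linear_combination -he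
    · exact ⟨w, left_mem_uIcc, by subst h; simp [nlPot]⟩
    · obtain ⟨c, hc, he⟩ := exists_hasDerivAt_eq_slope _ _ h hc.continuousOn fun z _ => hd z
      refine ⟨c, Icc_subset_uIcc' (Ioo_subset_Icc_self hc), ?_⟩
      rw [eq_div_iff (by linarith)] at he
      unfold nlPot; linear_combination he
  obtain ⟨ξ, hξ, he⟩ := hmv
  rw [he]
  have hξ' := uIcc_subset hv hw hξ
  rcases le_total w v with h | h
  · rw [uIcc_of_le h] at hξ
    have h1 := hσ.nl_mono hw.1 hξ.1
    have h2 := hσ.nl_mono hξ'.1 hξ.2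
    have h3 : 0 ≤ v - w := by linarith
    rw [abs_of_nonneg (by linarith), abs_of_nonneg h3]
    exact ⟨mul_nonneg (by linarith) h3, mul_le_mul_of_nonneg_right (by linarith) h3⟩
  · rw [uIcc_of_ge h] at hξ
    have h1 := hσ.nl_mono hv.1 hξ.1
    have h2 := hσ.nl_mono hξ'.1 hξ.2
    have h3 : v - w ≤ 0 := by linarith
    rw [abs_of_nonpos (by linarith : nl σ b v - nl σ b w ≤ 0), abs_of_nonpos h3]
    constructor <;> nlinarith

lemma lam_sub {x y : ℝ} (hx : a ≤ x) (hxy : x ≤ y) (hy : y ≤ a + 1) :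
    κ / (2 * √K) * (y - x) ≤ lam σ y - lam σ x ∧ lam σ y - lam σ x ≤ K / √b * (y - x) := by
  have h0 := hσ.a_pos
  have hsb : 0 < √b := Real.sqrt_pos.2 hσ.b_pos
  have hK := hσ.K_pos
  have hsK : 0 < √K := Real.sqrt_pos.2 hK
  have h1 := hσ.deriv_sub hx hxy hy
  have e1 := hσ.lam_sq (v := y) (by linarith)
  have e2 := hσ.lam_sq (v := x) (by linarith)
  have hm : lam σ x ≤ lam σ y := hσ.strictMonoOn_lam.monotoneOn hx (hx.trans hxy) hxy
  have hma : √b ≤ lam σ x := hσ.lam_a ▸ hσ.strictMonoOn_lam.monotoneOn self_mem_Ici hx hx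
  have hlK : lam σ y ≤ √K := Real.sqrt_le_sqrt (hσ.deriv_le y ⟨hx.trans hxy, hy⟩)
  have e3 : deriv σ y - deriv σ x = (lam σ y - lam σ x) * (lam σ y + lam σ x) := by
    rw [← e1, ← e2]; ring
  rw [e3] at h1
  constructor
  · rw [div_mul_eq_mul_div, div_le_iff₀ (by positivity)]
    refine h1.1.trans (mul_le_mul_of_nonneg_left (by linarith) (by linarith))
  · rw [div_mul_eq_mul_div, le_div_iff₀ hsb]
    refine le_trans (mul_le_mul_of_nonneg_left ?_ (by linarith)) h1.2
    linarith

end StressBounds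

/-! ### The diffusion wave -/

/-- The width `√(2μ(1+t))` of the diffusion wave. -/
def width (μ t : ℝ) : ℝ := √(2 * μ * (1 + t))

/-- The self-similar variable of the diffusion wave. -/
def selfSim (b μ x t : ℝ) : ℝ := (x - √b * t) / width μ t

/-- The first space derivative of `Xi`. -/
def Xi1 (a b μ vm x t : ℝ) : ℝ := (a - vm) / √Real.pi * heatWeight b μ x t

/-- The second space derivative of `Xi`. -/
def Xi2 (a b μ vm x t : ℝ) : ℝ := -(2 * selfSim b μ x t / width μ t) * Xi1 a b μ vm x t

/-- The third space derivative of `Xi`. -/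
def Xi3 (a b μ vm x t : ℝ) : ℝ :=
  (4 * selfSim b μ x t ^ 2 - 2) / width μ t ^ 2 * Xi1 a b μ vm x t

/-- Joint continuity of a function of `(x, t)` on `t ≥ 0`. -/
def ContForward (f : ℝ → ℝ → ℝ) : Prop :=
  ContinuousOn (fun p : ℝ × ℝ => f p.1 p.2) (univ ×ˢ Ici 0)

namespace ContForward

variable {f g : ℝ → ℝ → ℝ}

lemma of_continuous (h : Continuous fun p : ℝ × ℝ => f p.1 p.2) : ContForward f := h.continuousOn

lemma add (hf : ContForward f) (hg : ContForward g) : ContForward fun x t => f x t + g x t :=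
  ContinuousOn.add hf hg

lemma sub (hf : ContForward f) (hg : ContForward g) : ContForward fun x t => f x t - g x t :=
  ContinuousOn.sub hf hg

lemma mul (hf : ContForward f) (hg : ContForward g) : ContForward fun x t => f x t * g x t :=
  ContinuousOn.mul hf hg

lemma const (c : ℝ) : ContForward fun _ _ => c := continuousOn_const

lemma neg (hf : ContForward f) : ContForward fun x t => -f x t := ContinuousOn.neg hf

lemma pow (hf : ContForward f) (n : ℕ) : ContForward fun x t => f x t ^ n := ContinuousOn.pow hf n

lemma div (hf : ContForward f) (hg : ContForward g) (h0 : ∀ x t, 0 ≤ t → g x t ≠ 0) :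
    ContForward fun x t => f x t / g x t := ContinuousOn.div hf hg fun p hp => h0 p.1 p.2 hp.2

lemma comp {F : ℝ → ℝ} (hF : Continuous F) (hf : ContForward f) : ContForward fun x t => F (f x t) :=
  hF.comp_continuousOn hf

lemma comp_on {F : ℝ → ℝ} {s : Set ℝ} (hF : ContinuousOn F s) (hf : ContForward f)
    (h : ∀ x t, 0 ≤ t → f x t ∈ s) : ContForward fun x t => F (f x t) :=
  hF.comp hf fun p hp => h p.1 p.2 hp.2

lemma space (hf : ContForward f) {t : ℝ} (ht : 0 ≤ t) : Continuous fun x => f x t := by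
  have : ContinuousOn (fun x : ℝ => f x t) univ :=
    ContinuousOn.comp (t := univ ×ˢ Ici 0) (g := fun p : ℝ × ℝ => f p.1 p.2)
      (f := fun x : ℝ => (x, t)) hf (by fun_prop) fun x _ => ⟨mem_univ _, ht⟩
  exact continuousOn_univ.1 this

lemma time (hf : ContForward f) (x : ℝ) : ContinuousOn (fun t => f x t) (Ici 0) :=
  ContinuousOn.comp (t := univ ×ˢ Ici 0) (g := fun p : ℝ × ℝ => f p.1 p.2)
      (f := fun t : ℝ => (x, t)) hf (by fun_prop) fun t ht => ⟨mem_univ _, ht⟩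

end ContForward

section profile

variable {a b μ vm x t : ℝ}

lemma width_pos (hμ : 0 < μ) (ht : -1 < t) : 0 < width μ t :=
  Real.sqrt_pos.2 (by have : 0 < 1 + t := by linarith
                      positivity)

lemma width_sq (hμ : 0 < μ) (ht : -1 < t) : width μ t ^ 2 = 2 * μ * (1 + t) :=
  Real.sq_sqrt (by have : 0 < 1 + t := by linarith
                   positivity)

lemma heatWeight_eq (hμ : 0 < μ) (ht : -1 < t) :
    heatWeight b μ x t = Real.exp (-selfSim b μ x t ^ 2) / width μ t := by
  unfold heatWeight selfSim
  rw [div_pow, width_sq hμ ht, neg_div, width]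
  ring

lemma heatWeight_nonneg : 0 ≤ heatWeight b μ x t := by unfold heatWeight; positivity

lemma hasDerivAt_width (hμ : 0 < μ) (ht : -1 < t) :
    HasDerivAt (width μ) (μ / width μ t) t := by
  have h1 : HasDerivAt (fun t => 2 * μ * (1 + t)) (2 * μ) t := by
    simpa using ((hasDerivAt_id t).const_add 1).const_mul (2 * μ)
  have h0 : 2 * μ * (1 + t) ≠ 0 := by
    have : 0 < 1 + t := by linarith
    positivity
  refine (h1.sqrt h0).congr_deriv ?_
  have := width_pos hμ ht
  change 2 * μ / (2 * width μ t) = _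
  field

lemma hasDerivAt_selfSim_space :
    HasDerivAt (fun y => selfSim b μ y t) (1 / width μ t) x :=
  ((hasDerivAt_id x).sub_const (√b * t)).div_const (width μ t)

lemma hasDerivAt_selfSim_time (hμ : 0 < μ) (ht : -1 < t) :
    HasDerivAt (fun τ => selfSim b μ x τ)
      (-√b / width μ t - selfSim b μ x t / (2 * (1 + t))) t := by
  have hL := width_pos hμ ht
  have hL2 := width_sq hμ ht
  have h1 : HasDerivAt (fun τ => x - √b * τ) (-√b) t := by
    simpa using ((hasDerivAt_id t).const_mul (√b)).const_sub x
  refine (h1.div (hasDerivAt_width hμ ht) hL.ne').congr_deriv ?_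
  have h1t : 1 + t = width μ t ^ 2 / (2 * μ) := by rw [hL2]; field
  unfold selfSim
  rw [h1t]
  field_simp

lemma hasDerivAt_heatWeight_space (hμ : 0 < μ) (ht : -1 < t) :
    HasDerivAt (fun y => heatWeight b μ y t)
      (-(2 * selfSim b μ x t / width μ t) * heatWeight b μ x t) x := by
  have e : (fun y => heatWeight b μ y t) =
      fun y => Real.exp (-selfSim b μ y t ^ 2) / width μ t :=
    funext fun y => heatWeight_eq hμ ht
  rw [e, heatWeight_eq hμ ht]
  refine (((hasDerivAt_selfSim_space.pow 2).neg.exp).div_const (width μ t)).congr_deriv ?_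
  simp only [Pi.neg_apply, Pi.pow_apply]
  ring

lemma hasDerivAt_heatWeight_time (hμ : 0 < μ) (ht : -1 < t) :
    HasDerivAt (fun τ => heatWeight b μ x τ)
      (-√b * (-(2 * selfSim b μ x t / width μ t) * heatWeight b μ x t) +
        μ / 2 * ((4 * selfSim b μ x t ^ 2 - 2) / width μ t ^ 2 * heatWeight b μ x t)) t := by
  have hL := width_pos hμ ht
  have hL2 := width_sq hμ ht
  have e : (fun τ => heatWeight b μ x τ) =ᶠ[𝓝 t]
      fun τ => Real.exp (-selfSim b μ x τ ^ 2) / width μ τ := by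
    filter_upwards [lt_mem_nhds ht] with τ hτ using heatWeight_eq hμ hτ
  refine HasDerivAt.congr_of_eventuallyEq ?_ e
  rw [heatWeight_eq hμ ht]
  refine ((((hasDerivAt_selfSim_time hμ ht).pow 2).neg.exp).div
    (hasDerivAt_width hμ ht) hL.ne').congr_deriv ?_
  simp only [Pi.neg_apply, Pi.pow_apply]
  have h1t : 1 + t = width μ t ^ 2 / (2 * μ) := by rw [hL2]; field
  rw [h1t]
  field_simp
  ring

lemma hasDerivAt_integral_gaussian (s : ℝ) :
    HasDerivAt (fun s => ∫ ξ in Iic s, Real.exp (-ξ ^ 2)) (Real.exp (-s ^ 2)) s := by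
  have hi : Integrable fun ξ : ℝ => Real.exp (-ξ ^ 2) := by
    simpa using integrable_exp_neg_mul_sq one_pos
  have hc : Continuous fun ξ : ℝ => Real.exp (-ξ ^ 2) := by fun_prop
  have e : (fun s => ∫ ξ in Iic s, Real.exp (-ξ ^ 2)) =
      fun s => (∫ ξ in Iic (0 : ℝ), Real.exp (-ξ ^ 2)) + ∫ ξ in (0 : ℝ)..s, Real.exp (-ξ ^ 2) := by
    funext s
    rw [← intervalIntegral.integral_Iic_sub_Iic hi.integrableOn hi.integrableOn]; ring
  rw [e]
  exact ((hc.integral_hasStrictDerivAt 0 s).hasDerivAt).const_add _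

lemma hasDerivAt_Xi_space (hμ : 0 < μ) (ht : -1 < t) :
    HasDerivAt (fun y => Xi a b μ vm y t) (Xi1 a b μ vm x t) x := by
  have h := (((hasDerivAt_integral_gaussian (selfSim b μ x t)).comp x
    hasDerivAt_selfSim_space).const_mul ((a - vm) / √Real.pi)).const_add vm
  refine HasDerivAt.congr_deriv h ?_
  rw [Xi1, heatWeight_eq hμ ht]
  ring

lemma hasDerivAt_Xi_time (hμ : 0 < μ) (ht : -1 < t) :
    HasDerivAt (fun τ => Xi a b μ vm x τ)
      (-√b * Xi1 a b μ vm x t + μ / 2 * Xi2 a b μ vm x t) t := by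
  have h := (((hasDerivAt_integral_gaussian (selfSim b μ x t)).comp t
    (hasDerivAt_selfSim_time hμ ht)).const_mul ((a - vm) / √Real.pi)).const_add vm
  refine HasDerivAt.congr_deriv h ?_
  have hL := width_pos hμ ht
  have h1t : 1 + t = width μ t ^ 2 / (2 * μ) := by rw [width_sq hμ ht]; field
  rw [Xi2, Xi1, heatWeight_eq hμ ht, h1t]
  field_simp
  ring

lemma dx_Xi (hμ : 0 < μ) (ht : -1 < t) : dx (Xi a b μ vm) x t = Xi1 a b μ vm x t :=
  (hasDerivAt_Xi_space hμ ht).deriv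

lemma hasDerivAt_Xi1_space (hμ : 0 < μ) (ht : -1 < t) :
    HasDerivAt (fun y => Xi1 a b μ vm y t) (Xi2 a b μ vm x t) x := by
  refine ((hasDerivAt_heatWeight_space (b := b) (x := x) hμ ht).const_mul
    ((a - vm) / √Real.pi)).congr_deriv ?_
  unfold Xi2 Xi1; ring

lemma hasDerivAt_Xi1_time (hμ : 0 < μ) (ht : -1 < t) :
    HasDerivAt (fun τ => Xi1 a b μ vm x τ)
      (-√b * Xi2 a b μ vm x t + μ / 2 * Xi3 a b μ vm x t) t := by
  refine ((hasDerivAt_heatWeight_time (b := b) (x := x) hμ ht).const_mul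
    ((a - vm) / √Real.pi)).congr_deriv ?_
  unfold Xi2 Xi3 Xi1; ring

lemma hasDerivAt_Xi2_space (hμ : 0 < μ) (ht : -1 < t) :
    HasDerivAt (fun y => Xi2 a b μ vm y t) (Xi3 a b μ vm x t) x := by
  have hL := width_pos hμ ht
  refine ((((hasDerivAt_selfSim_space (b := b) (μ := μ) (t := t) (x := x)).const_mul
    2).div_const (width μ t)).neg.mul (hasDerivAt_Xi1_space (a := a) (vm := vm) hμ ht)).congr_deriv ?_
  simp only [Pi.neg_apply]
  unfold Xi3 Xi2
  field_simp
  ring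

lemma contForward_width : ContForward fun _ t => width μ t :=
  .of_continuous (by unfold width; fun_prop)

lemma contForward_selfSim (hμ : 0 < μ) : ContForward (selfSim b μ) :=
  .div (.of_continuous (by fun_prop)) (contForward_width) fun _ t ht =>
    (width_pos hμ (by linarith)).ne'

lemma contForward_heatWeight (hμ : 0 < μ) : ContForward (heatWeight b μ) := by
  have h : ContForward fun x t => Real.exp (-selfSim b μ x t ^ 2) / width μ t :=
    .div (.comp Real.continuous_exp ((contForward_selfSim hμ).pow 2).neg)
      (contForward_width) fun _ t ht => (width_pos hμ (by linarith)).ne'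
  refine ContinuousOn.congr h fun p hp => ?_
  have : 0 ≤ p.2 := hp.2
  exact heatWeight_eq hμ (by linarith)

lemma contForward_Xi (hμ : 0 < μ) : ContForward (Xi a b μ vm) := by
  have hg : Continuous fun s => ∫ ξ in Iic s, Real.exp (-ξ ^ 2) :=
    continuous_iff_continuousAt.2 fun s => (hasDerivAt_integral_gaussian s).continuousAt
  exact (ContForward.const vm).add ((ContForward.const _).mul
    ((ContForward.comp hg (contForward_selfSim (b := b) hμ))))

lemma contForward_Xi1 (hμ : 0 < μ) : ContForward (Xi1 a b μ vm) :=
  (ContForward.const _).mul (contForward_heatWeight hμ)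

lemma contForward_Xi2 (hμ : 0 < μ) : ContForward (Xi2 a b μ vm) :=
  (((ContForward.const 2).mul (contForward_selfSim hμ)).div (contForward_width)
    fun _ t ht => (width_pos hμ (by linarith)).ne').neg.mul (contForward_Xi1 hμ)

lemma contForward_Xi3 (hμ : 0 < μ) : ContForward (Xi3 a b μ vm) :=
  ((((ContForward.const 4).mul ((contForward_selfSim hμ).pow 2)).sub (.const 2)).div
    ((contForward_width).pow 2)
    fun _ t ht => pow_ne_zero 2 (width_pos hμ (by linarith)).ne').mul (contForward_Xi1 hμ)

/-! ### Pointwise bounds for the diffusion wave -/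

lemma Xi1_nonneg (hvm : vm ≤ a) : 0 ≤ Xi1 a b μ vm x t :=
  mul_nonneg (div_nonneg (by linarith) (Real.sqrt_nonneg _)) heatWeight_nonneg

lemma one_le_sqrt_pi : 1 ≤ √Real.pi := Real.one_le_sqrt.2 (by linarith [Real.pi_gt_three])

lemma Xi1_le (hvm : vm ≤ a) : Xi1 a b μ vm x t ≤ (a - vm) * heatWeight b μ x t :=
  mul_le_mul_of_nonneg_right (div_le_self (by linarith) one_le_sqrt_pi) heatWeight_nonneg

lemma integral_Iic_gaussian (s : ℝ) :
    (∫ ξ in Iic s, Real.exp (-ξ ^ 2)) = √Real.pi - ∫ ξ in Ioi s, Real.exp (-ξ ^ 2) := by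
  have hi : Integrable fun ξ : ℝ => Real.exp (-ξ ^ 2) := by
    simpa using integrable_exp_neg_mul_sq one_pos
  have h1 : ∫ ξ : ℝ, Real.exp (-ξ ^ 2) = √Real.pi := by simpa using integral_gaussian 1
  have h2 := setIntegral_union (Iic_disjoint_Ioi (le_refl s)) measurableSet_Ioi
    hi.integrableOn hi.integrableOn
  rw [Iic_union_Ioi, setIntegral_univ, h1] at h2
  linarith

lemma Xi_eq : Xi a b μ vm x t =
    a - (a - vm) / √Real.pi * ∫ ξ in Ioi (selfSim b μ x t), Real.exp (-ξ ^ 2) := by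
  have hp : √Real.pi ≠ 0 := by positivity
  change vm + (a - vm) / √Real.pi * (∫ ξ in Iic (selfSim b μ x t), Real.exp (-ξ ^ 2)) = _
  rw [integral_Iic_gaussian]
  field_simp
  ring

lemma integral_Ioi_gaussian_le (s : ℝ) :
    (∫ ξ in Ioi s, Real.exp (-ξ ^ 2)) ≤ √Real.pi ∧
    (0 ≤ s → (∫ ξ in Ioi s, Real.exp (-ξ ^ 2)) ≤ √Real.pi * Real.exp (-s ^ 2)) := by
  have hi : Integrable fun ξ : ℝ => Real.exp (-ξ ^ 2) := by
    simpa using integrable_exp_neg_mul_sq one_pos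
  have h1 : ∫ ξ : ℝ, Real.exp (-ξ ^ 2) = √Real.pi := by simpa using integral_gaussian 1
  refine ⟨h1 ▸ setIntegral_le_integral hi (ae_of_all _ fun _ => (Real.exp_pos _).le), fun hs => ?_⟩
  have hi2 : Integrable fun ξ : ℝ => Real.exp (-(ξ - s) ^ 2) := hi.comp_sub_right s
  have h2 : ∫ ξ : ℝ, Real.exp (-(ξ - s) ^ 2) = √Real.pi := by
    rw [← h1]; exact integral_sub_right_eq_self (fun ξ : ℝ => Real.exp (-ξ ^ 2)) s
  calc (∫ ξ in Ioi s, Real.exp (-ξ ^ 2))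
      ≤ ∫ ξ in Ioi s, Real.exp (-(ξ - s) ^ 2) * Real.exp (-s ^ 2) := by
        refine setIntegral_mono_on hi.integrableOn (hi2.mul_const _).integrableOn
          measurableSet_Ioi fun ξ hξ => ?_
        rw [← Real.exp_add]
        refine Real.exp_le_exp.2 ?_
        have : s < ξ := hξ
        nlinarith
    _ ≤ ∫ ξ, Real.exp (-(ξ - s) ^ 2) * Real.exp (-s ^ 2) :=
      setIntegral_le_integral (hi2.mul_const _) (ae_of_all _ fun _ => by positivity)
    _ = _ := by rw [integral_mul_const, h2]

lemma Xi_le (hvm : vm ≤ a) : Xi a b μ vm x t ≤ a := by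
  rw [Xi_eq]
  have : 0 ≤ (a - vm) / √Real.pi * ∫ ξ in Ioi (selfSim b μ x t), Real.exp (-ξ ^ 2) :=
    mul_nonneg (div_nonneg (by linarith) (Real.sqrt_nonneg _))
      (integral_nonneg fun _ => (Real.exp_pos _).le)
  linarith

lemma sub_Xi_le (hvm : vm ≤ a) : a - Xi a b μ vm x t ≤ a - vm := by
  rw [Xi_eq]
  have h := mul_le_mul_of_nonneg_left (integral_Ioi_gaussian_le (selfSim b μ x t)).1
    (div_nonneg (by linarith : 0 ≤ a - vm) (Real.sqrt_nonneg Real.pi))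
  rw [div_mul_cancel₀ _ (by positivity)] at h
  linarith

lemma sub_Xi_le_exp (hvm : vm ≤ a) (hs : 0 ≤ selfSim b μ x t) :
    a - Xi a b μ vm x t ≤ (a - vm) * Real.exp (-selfSim b μ x t ^ 2) := by
  rw [Xi_eq]
  have h := mul_le_mul_of_nonneg_left ((integral_Ioi_gaussian_le (selfSim b μ x t)).2 hs)
    (div_nonneg (by linarith : 0 ≤ a - vm) (Real.sqrt_nonneg Real.pi))
  rw [← mul_assoc, div_mul_cancel₀ _ (by positivity)] at h
  linarith

/-- Gaussian integrals in the self-similar variable. -/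
lemma integral_exp_selfSim (hμ : 0 < μ) (ht : -1 < t) {c : ℝ} (hc : 0 < c) :
    Integrable (fun x => Real.exp (-c * selfSim b μ x t ^ 2)) ∧
    ∫ x, Real.exp (-c * selfSim b μ x t ^ 2) = width μ t * √(Real.pi / c) := by
  have hL := width_pos hμ ht
  have hi := integrable_exp_neg_mul_sq hc
  have e : (fun x => Real.exp (-c * selfSim b μ x t ^ 2)) =
      fun x => (fun y => (fun s => Real.exp (-c * s ^ 2)) (y / width μ t)) (x - √b * t) := rfl
  constructor
  · rw [e]
    exact (hi.comp_div hL.ne').comp_sub_right (√b * t)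
  · rw [e, integral_sub_right_eq_self (fun y => (fun s => Real.exp (-c * s ^ 2)) (y / width μ t)),
      Measure.integral_comp_div (fun s => Real.exp (-c * s ^ 2)), integral_gaussian,
      abs_of_pos hL, smul_eq_mul]

lemma sq_mul_exp_le (s : ℝ) : s ^ 2 * Real.exp (-s ^ 2) ≤ 1 := by
  have h := Real.add_one_le_exp (s ^ 2)
  rw [Real.exp_neg, ← div_eq_mul_inv, div_le_one (Real.exp_pos _)]
  linarith

lemma abs_mul_exp_le (s : ℝ) : |s| * Real.exp (-s ^ 2) ≤ 1 := by
  have h := Real.add_one_le_exp (s ^ 2)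
  rw [Real.exp_neg, ← div_eq_mul_inv, div_le_one (Real.exp_pos _)]
  nlinarith [sq_abs s, sq_nonneg (|s| - 1)]

lemma integral_Xi2_sq_le (hμ : 0 < μ) (ht : -1 < t) (hvm : vm ≤ a) (h1 : a - vm ≤ 1) :
    Integrable (fun x => Xi2 a b μ vm x t ^ 2) ∧
    ∫ x, Xi2 a b μ vm x t ^ 2 ≤ 4 * √Real.pi / width μ t ^ 3 := by
  have hL := width_pos hμ ht
  obtain ⟨hi, he⟩ := integral_exp_selfSim (b := b) hμ ht one_pos
  have hp : ∀ x, Xi2 a b μ vm x t ^ 2 ≤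
      4 / width μ t ^ 4 * Real.exp (-1 * selfSim b μ x t ^ 2) := by
    intro x
    have hX0 : 0 ≤ Xi1 a b μ vm x t := Xi1_nonneg hvm
    have hX : Xi1 a b μ vm x t ≤ Real.exp (-selfSim b μ x t ^ 2) / width μ t := by
      rw [← heatWeight_eq hμ ht]
      exact (Xi1_le hvm).trans (mul_le_of_le_one_left heatWeight_nonneg h1)
    have hX2 : Xi1 a b μ vm x t ^ 2 ≤ (Real.exp (-selfSim b μ x t ^ 2) / width μ t) ^ 2 := by
      gcongr
    have hs := sq_mul_exp_le (selfSim b μ x t)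
    calc Xi2 a b μ vm x t ^ 2
        = 4 * selfSim b μ x t ^ 2 / width μ t ^ 2 * Xi1 a b μ vm x t ^ 2 := by
          unfold Xi2; field
      _ ≤ 4 * selfSim b μ x t ^ 2 / width μ t ^ 2 *
          (Real.exp (-selfSim b μ x t ^ 2) / width μ t) ^ 2 := by gcongr
      _ = 4 / width μ t ^ 4 * (selfSim b μ x t ^ 2 * Real.exp (-selfSim b μ x t ^ 2)) *
          Real.exp (-selfSim b μ x t ^ 2) := by field
      _ ≤ 4 / width μ t ^ 4 * 1 * Real.exp (-selfSim b μ x t ^ 2) := by gcongr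
      _ = _ := by rw [mul_one, neg_one_mul]
  have hc : Continuous fun x => Xi2 a b μ vm x t :=
    continuous_iff_continuousAt.2 fun x => (hasDerivAt_Xi2_space hμ ht).continuousAt
  have hint : Integrable (fun x => Xi2 a b μ vm x t ^ 2) :=
    (hi.const_mul (4 / width μ t ^ 4)).mono' (hc.pow 2).aestronglyMeasurable
      (ae_of_all _ fun x => by rw [Real.norm_eq_abs, abs_of_nonneg (sq_nonneg _)]; exact hp x)
  refine ⟨hint, (integral_mono hint (hi.const_mul _) hp).trans_eq ?_⟩
  rw [integral_const_mul, he, div_one]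
  field

lemma abs_Xi3_le (hμ : 0 < μ) (ht : -1 < t) (hvm : vm ≤ a) (h1 : a - vm ≤ 1) (x : ℝ) :
    |Xi3 a b μ vm x t| ≤ 10 / width μ t ^ 3 * Real.exp (-(1 / 2) * selfSim b μ x t ^ 2) := by
  have hL := width_pos hμ ht
  have hX0 : 0 ≤ Xi1 a b μ vm x t := Xi1_nonneg hvm
  set s := selfSim b μ x t with hs
  have hX : Xi1 a b μ vm x t ≤ Real.exp (-s ^ 2) / width μ t := by
    rw [← heatWeight_eq hμ ht]
    exact (Xi1_le hvm).trans (mul_le_of_le_one_left heatWeight_nonneg h1)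
  have he : Real.exp (-s ^ 2) = Real.exp (-(1 / 2) * s ^ 2) * Real.exp (-(1 / 2) * s ^ 2) := by
    rw [← Real.exp_add]; ring_nf
  have h4 : |4 * s ^ 2 - 2| * Real.exp (-(1 / 2) * s ^ 2) ≤ 10 := by
    have h := Real.add_one_le_exp (1 / 2 * s ^ 2)
    have h' : |4 * s ^ 2 - 2| ≤ 8 * (1 / 2 * s ^ 2 + 1) := by
      rw [abs_le]; constructor <;> nlinarith [sq_nonneg s]
    rw [neg_mul, Real.exp_neg, ← div_eq_mul_inv, div_le_iff₀ (Real.exp_pos _)]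
    linarith [Real.exp_pos (1 / 2 * s ^ 2)]
  calc |Xi3 a b μ vm x t| = |4 * s ^ 2 - 2| / width μ t ^ 2 * Xi1 a b μ vm x t := by
        unfold Xi3; rw [abs_mul, abs_div, abs_of_nonneg hX0, abs_of_pos (pow_pos hL 2)]
    _ ≤ |4 * s ^ 2 - 2| / width μ t ^ 2 * (Real.exp (-s ^ 2) / width μ t) := by gcongr
    _ = (|4 * s ^ 2 - 2| * Real.exp (-(1 / 2) * s ^ 2)) / width μ t ^ 3 *
        Real.exp (-(1 / 2) * s ^ 2) := by rw [he]; field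
    _ ≤ _ := by gcongr

lemma integral_Xi3_sq_le (hμ : 0 < μ) (ht : -1 < t) (hvm : vm ≤ a) (h1 : a - vm ≤ 1) :
    Integrable (fun x => Xi3 a b μ vm x t ^ 2) ∧
    ∫ x, Xi3 a b μ vm x t ^ 2 ≤ 100 * √Real.pi / width μ t ^ 5 := by
  have hL := width_pos hμ ht
  obtain ⟨hi, he⟩ := integral_exp_selfSim (b := b) hμ ht one_pos
  have hp : ∀ x, Xi3 a b μ vm x t ^ 2 ≤
      100 / width μ t ^ 6 * Real.exp (-1 * selfSim b μ x t ^ 2) := by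
    intro x
    rw [← sq_abs]
    calc |Xi3 a b μ vm x t| ^ 2
        ≤ (10 / width μ t ^ 3 * Real.exp (-(1 / 2) * selfSim b μ x t ^ 2)) ^ 2 := by
          gcongr; exact abs_Xi3_le hμ ht hvm h1 x
      _ = _ := by
          rw [mul_pow, ← Real.exp_nat_mul]
          ring_nf
  have hc : Continuous fun x => Xi3 a b μ vm x t := by
      have h1 : Continuous fun x => Xi1 a b μ vm x t :=
        continuous_iff_continuousAt.2 fun x => (hasDerivAt_Xi1_space hμ ht).continuousAt
      have h2 : Continuous fun x => selfSim b μ x t := by unfold selfSim; fun_prop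
      unfold Xi3
      fun_prop
  have hint : Integrable (fun x => Xi3 a b μ vm x t ^ 2) :=
    (hi.const_mul (100 / width μ t ^ 6)).mono' (hc.pow 2).aestronglyMeasurable
      (ae_of_all _ fun x => by rw [Real.norm_eq_abs, abs_of_nonneg (sq_nonneg _)]; exact hp x)
  refine ⟨hint, (integral_mono hint (hi.const_mul _) hp).trans_eq ?_⟩
  rw [integral_const_mul, he, div_one]
  field

end profile

/-! ### The Burgers profile -/

/-- The derivative of `burgersData`. -/
def burgersSlope (wl wr y : ℝ) : ℝ := (wr - wl) / 2 * (1 / Real.cosh y ^ 2)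

/-- The first space derivative of `burgers`. -/
def burgers1 (wl wr x t : ℝ) : ℝ :=
  burgersSlope wl wr (burgersFoot wl wr x t) / (1 + t * burgersSlope wl wr (burgersFoot wl wr x t))

/-- The second space derivative of `burgers`. -/
def burgers2 (wl wr x t : ℝ) : ℝ :=
  -(2 * Real.tanh (burgersFoot wl wr x t)) * burgersSlope wl wr (burgersFoot wl wr x t) /
    (1 + t * burgersSlope wl wr (burgersFoot wl wr x t)) ^ 3

/-- A continuous derivative is integrable as soon as its integrals over large symmetric
intervals are bounded. -/
lemma integrable_of_intervalIntegral_abs_le {f : ℝ → ℝ} {B R₀ : ℝ} (hf : Continuous f)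
    (h : ∀ R ≥ R₀, ∫ x in (-R)..R, |f x| ≤ B) : Integrable f ∧ ∫ x, |f x| ≤ B := by
  have hi : Integrable f := integrable_of_intervalIntegral_norm_bounded (ι := ℝ) (l := atTop)
    (a := fun R => -R) (b := fun R => R) B (fun R => hf.integrableOn_Ioc)
    tendsto_neg_atTop_atBot tendsto_id (by
      filter_upwards [eventually_ge_atTop R₀] with R hR using h R hR)
  refine ⟨hi, le_of_tendsto (intervalIntegral_tendsto_integral hi.abs
    tendsto_neg_atTop_atBot tendsto_id) ?_⟩
  filter_upwards [eventually_ge_atTop R₀] with R hR using h R hR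

lemma integrable_deriv_of_nonneg {f f' : ℝ → ℝ} {l u : ℝ} (hd : ∀ x, HasDerivAt f (f' x) x)
    (hc : Continuous f') (h0 : ∀ x, 0 ≤ f' x) (hb : ∀ x, f x ∈ Icc l u) :
    Integrable f' ∧ ∫ x, |f' x| ≤ u - l := by
  refine integrable_of_intervalIntegral_abs_le (R₀ := 0) hc fun R _ => ?_
  simp only [fun x => abs_of_nonneg (h0 x)]
  rw [intervalIntegral.integral_eq_sub_of_hasDerivAt (fun x _ => hd x) (hc.intervalIntegrable _ _)]
  linarith [(hb R).2, (hb (-R)).1]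

/-- The derivative of a bounded unimodal function is integrable. -/
lemma integrable_deriv_of_unimodal {f f' : ℝ → ℝ} {x₀ B : ℝ} (hd : ∀ x, HasDerivAt f (f' x) x)
    (hc : Continuous f') (h0 : ∀ x ≤ x₀, 0 ≤ f' x) (h1 : ∀ x ≥ x₀, f' x ≤ 0)
    (hb : ∀ x, f x ∈ Icc 0 B) : Integrable f' ∧ ∫ x, |f' x| ≤ 2 * B := by
  refine integrable_of_intervalIntegral_abs_le (R₀ := |x₀|) hc fun R hR => ?_
  have hR' := abs_le.1 hR
  rw [← intervalIntegral.integral_add_adjacent_intervals (b := x₀)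
    (hc.abs.intervalIntegrable _ _) (hc.abs.intervalIntegrable _ _)]
  have e1 : ∫ x in (-R)..x₀, |f' x| = f x₀ - f (-R) := by
    rw [← intervalIntegral.integral_eq_sub_of_hasDerivAt (fun x _ => hd x)
      (hc.intervalIntegrable _ _)]
    refine intervalIntegral.integral_congr fun x hx => ?_
    rw [uIcc_of_le hR'.1] at hx
    exact abs_of_nonneg (h0 x hx.2)
  have e2 : ∫ x in x₀..R, |f' x| = -(f R - f x₀) := by
    rw [← intervalIntegral.integral_eq_sub_of_hasDerivAt (fun x _ => hd x)
      (hc.intervalIntegrable _ _), ← intervalIntegral.integral_neg]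
    refine intervalIntegral.integral_congr fun x hx => ?_
    rw [uIcc_of_le hR'.2] at hx
    exact abs_of_nonpos (h1 x hx.1)
  rw [e1, e2]
  linarith [(hb x₀).2, (hb (-R)).1, (hb R).1]

section burgers

variable {wl wr x t : ℝ}

lemma hasDerivAt_burgersData' (y : ℝ) :
    HasDerivAt (burgersData wl wr) (burgersSlope wl wr y) y := hasDerivAt_burgersData wl wr y

lemma hasDerivAt_burgersSlope (y : ℝ) :
    HasDerivAt (burgersSlope wl wr) (-(2 * Real.tanh y) * burgersSlope wl wr y) y := by
  have hc := (Real.cosh_pos y).ne'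
  have h := ((((Real.hasDerivAt_cosh y).pow 2).fun_inv (pow_ne_zero 2 hc))).const_mul
    ((wr - wl) / 2)
  have e : burgersSlope wl wr = fun y => (wr - wl) / 2 * (Real.cosh y ^ 2)⁻¹ := by
    funext y; rw [burgersSlope, one_div]
  rw [e]
  refine h.congr_deriv ?_
  simp only [Pi.pow_apply]
  rw [Real.tanh_eq_sinh_div_cosh]
  field

lemma burgersSlope_nonneg (h : wl ≤ wr) (y : ℝ) : 0 ≤ burgersSlope wl wr y := by
  have : 0 ≤ wr - wl := by linarith
  unfold burgersSlope; positivity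

lemma burgersSlope_le (h : wl ≤ wr) (y : ℝ) : burgersSlope wl wr y ≤ (wr - wl) / 2 := by
  unfold burgersSlope
  refine mul_le_of_le_one_right (by linarith) ?_
  rw [div_le_one (by positivity)]
  exact one_le_pow₀ (Real.one_le_cosh y)

lemma burgers1_den_pos (h : wl ≤ wr) (ht : 0 ≤ t) (y : ℝ) : 0 < 1 + t * burgersSlope wl wr y := by
  have := burgersSlope_nonneg h y
  positivity

lemma abs_burgersFoot_sub_le (h0 : 0 < wl) (h : wl ≤ wr) {x' s : ℝ} (ht : 0 ≤ t) (hs : 0 ≤ s) :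
    |burgersFoot wl wr x' s - burgersFoot wl wr x t| ≤ |x' - x| + |s - t| * wr := by
  have e1 := burgersFoot_spec h x' hs
  have e2 := burgersFoot_spec h x ht
  unfold burgers at e1 e2
  set Z := burgersFoot wl wr x' s
  set Y := burgersFoot wl wr x t
  have b2 := burgersData_mem h Z
  have hZ : 0 < burgersData wl wr Z := h0.trans_le b2.1
  have hb : |(s - t) * burgersData wl wr Z| ≤ |s - t| * wr := by
    rw [abs_mul, abs_of_pos hZ]
    exact mul_le_mul_of_nonneg_left b2.2 (abs_nonneg _)
  have e3 : Z - Y + t * (burgersData wl wr Z - burgersData wl wr Y) =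
      x' - x - ((s - t) * burgersData wl wr Z) := by linarith
  have hb' := abs_le.1 hb
  have hx := abs_le.1 (le_refl |x' - x|)
  rw [abs_le]
  rcases le_total Z Y with hl | hl
  · have := mul_le_mul_of_nonneg_left (burgersData_mono h hl) ht
    constructor <;> nlinarith [abs_nonneg (s - t), abs_nonneg (x' - x)]
  · have := mul_le_mul_of_nonneg_left (burgersData_mono h hl) ht
    constructor <;> nlinarith [abs_nonneg (s - t), abs_nonneg (x' - x)]

lemma contForward_burgersFoot (h0 : 0 < wl) (h : wl ≤ wr) : ContForward (burgersFoot wl wr) := by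
  rintro ⟨x, t⟩ hp
  have ht : 0 ≤ t := hp.2
  rw [ContinuousWithinAt, tendsto_iff_norm_sub_tendsto_zero]
  have hz : Tendsto (fun p : ℝ × ℝ => |p.1 - x| + |p.2 - t| * wr) (𝓝[univ ×ˢ Ici 0] (x, t))
      (𝓝 0) := by
    have : Continuous fun p : ℝ × ℝ => |p.1 - x| + |p.2 - t| * wr := by fun_prop
    simpa using (this.tendsto (x, t)).mono_left nhdsWithin_le_nhds
  refine squeeze_zero' (Eventually.of_forall fun _ => norm_nonneg _) ?_ hz
  filter_upwards [self_mem_nhdsWithin] with p hp'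
  exact abs_burgersFoot_sub_le h0 h ht hp'.2

lemma hasDerivAt_burgersFoot_space (h0 : 0 < wl) (h : wl ≤ wr) (ht : 0 ≤ t) :
    HasDerivAt (fun y => burgersFoot wl wr y t)
      (1 + t * burgersSlope wl wr (burgersFoot wl wr x t))⁻¹ x :=
  HasDerivAt.of_local_left_inverse (f := fun y => y + t * burgersData wl wr y)
    ((contForward_burgersFoot h0 h).space ht).continuousAt
    ((hasDerivAt_id _).add ((hasDerivAt_burgersData' _).const_mul t)) (burgers1_den_pos h ht _).ne'
    (Eventually.of_forall fun y => burgersFoot_spec h y ht)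

lemma hasDerivAt_burgersFoot_time (h0 : 0 < wl) (h : wl ≤ wr) (ht : 0 < t) :
    HasDerivAt (fun s => burgersFoot wl wr x s) (-(burgers wl wr x t) /
      (1 + t * burgersSlope wl wr (burgersFoot wl wr x t))) t := by
  set g := burgersData wl wr with hg
  set Y := burgersFoot wl wr x t with hY
  have hgpos : ∀ y, 0 < g y := fun y => h0.trans_le (burgersData_mem h y).1
  have hden := burgers1_den_pos h ht.le Y
  have hYeq : Y + t * g Y = x := burgersFoot_spec h x ht.le
  have gY := (hgpos Y).ne'
  have hf : HasDerivAt (fun y => (x - y) / g y) (-(1 + t * burgersSlope wl wr Y) / g Y) Y := by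
    have := ((hasDerivAt_const Y x).sub (hasDerivAt_id Y)).div (hasDerivAt_burgersData' Y) gY
    refine this.congr_deriv ?_
    simp only [Pi.sub_apply, id_eq]
    rw [show x - Y = t * g Y by linarith]
    field
  have ct : ContinuousAt (fun s => burgersFoot wl wr x s) t :=
    ((contForward_burgersFoot h0 h).time x).continuousAt (Ici_mem_nhds ht)
  refine (HasDerivAt.of_local_left_inverse ct hf
    (div_ne_zero (neg_ne_zero.2 hden.ne') gY) ?_).congr_deriv ?_
  · filter_upwards [lt_mem_nhds ht] with s hs
    have e1 := burgersFoot_spec h x hs.le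
    unfold burgers at e1
    rw [div_eq_iff (hgpos _).ne']
    linarith
  · change _ = -(g Y) / _
    field

lemma hasDerivAt_burgers_space (h0 : 0 < wl) (h : wl ≤ wr) (ht : 0 ≤ t) :
    HasDerivAt (fun y => burgers wl wr y t) (burgers1 wl wr x t) x :=
  ((hasDerivAt_burgersData' _).comp x (hasDerivAt_burgersFoot_space h0 h ht)).congr_deriv
    (div_eq_mul_inv _ _).symm

lemma hasDerivAt_burgers_time (h0 : 0 < wl) (h : wl ≤ wr) (ht : 0 < t) :
    HasDerivAt (fun s => burgers wl wr x s) (-(burgers wl wr x t) * burgers1 wl wr x t) t := by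
  refine ((hasDerivAt_burgersData' _).comp t
    (hasDerivAt_burgersFoot_time h0 h ht)).congr_deriv ?_
  unfold burgers1; ring

lemma hasDerivAt_burgers1_space (h0 : 0 < wl) (h : wl ≤ wr) (ht : 0 ≤ t) :
    HasDerivAt (fun y => burgers1 wl wr y t) (burgers2 wl wr x t) x := by
  have h1 := (hasDerivAt_burgersSlope (wl := wl) (wr := wr) (burgersFoot wl wr x t)).comp x
    (hasDerivAt_burgersFoot_space h0 h ht)
  have hd := burgers1_den_pos h ht (burgersFoot wl wr x t)
  refine (h1.div ((h1.const_mul t).const_add 1) hd.ne').congr_deriv ?_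
  simp only [Function.comp_apply]
  unfold burgers2
  field

lemma contForward_burgers (h0 : 0 < wl) (h : wl ≤ wr) : ContForward (burgers wl wr) :=
  .comp (F := burgersData wl wr) (continuous_iff_continuousAt.2 fun y =>
    (hasDerivAt_burgersData' y).continuousAt) (contForward_burgersFoot h0 h)

lemma continuous_burgersSlope : Continuous (burgersSlope wl wr) :=
  continuous_iff_continuousAt.2 fun y => (hasDerivAt_burgersSlope y).continuousAt

lemma continuous_tanh : Continuous Real.tanh :=
  continuous_iff_continuousAt.2 fun y => (hasDerivAt_tanh y).continuousAt

lemma contForward_burgers1 (h0 : 0 < wl) (h : wl ≤ wr) : ContForward (burgers1 wl wr) := by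
  have h1 : ContForward fun x t => burgersSlope wl wr (burgersFoot wl wr x t) :=
    .comp continuous_burgersSlope (contForward_burgersFoot h0 h)
  exact h1.div ((ContForward.const 1).add ((ContForward.of_continuous continuous_snd).mul h1))
    fun x t ht => (burgers1_den_pos h ht _).ne'

lemma contForward_burgers2 (h0 : 0 < wl) (h : wl ≤ wr) : ContForward (burgers2 wl wr) := by
  have h1 : ContForward fun x t => burgersSlope wl wr (burgersFoot wl wr x t) :=
    .comp continuous_burgersSlope (contForward_burgersFoot h0 h)
  have h2 : ContForward fun x t => Real.tanh (burgersFoot wl wr x t) :=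
    .comp continuous_tanh (contForward_burgersFoot h0 h)
  exact ((((ContForward.const 2).mul h2).neg).mul h1).div
    (((ContForward.const 1).add ((ContForward.of_continuous continuous_snd).mul h1)).pow 3)
    fun x t ht => pow_ne_zero 3 (burgers1_den_pos h ht _).ne'

lemma burgers1_nonneg (h : wl ≤ wr) (ht : 0 ≤ t) : 0 ≤ burgers1 wl wr x t :=
  div_nonneg (burgersSlope_nonneg h _) (burgers1_den_pos h ht _).le

lemma burgers1_le (h : wl ≤ wr) (h1 : wr - wl ≤ 1) (ht : 0 ≤ t) :
    burgers1 wl wr x t ≤ 2 / (1 + t) := by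
  have hs := burgersSlope_nonneg h (burgersFoot wl wr x t)
  have hs' := burgersSlope_le h (burgersFoot wl wr x t)
  unfold burgers1
  rw [div_le_div_iff₀ (burgers1_den_pos h ht _) (by linarith)]
  nlinarith [mul_nonneg ht hs]

lemma integral_burgers1 (h0 : 0 < wl) (h : wl ≤ wr) (ht : 0 ≤ t) :
    Integrable (fun x => burgers1 wl wr x t) ∧ ∫ x, |burgers1 wl wr x t| ≤ wr - wl :=
  integrable_deriv_of_nonneg (fun _ => hasDerivAt_burgers_space h0 h ht)
    ((contForward_burgers1 h0 h).space ht) (fun _ => burgers1_nonneg h ht)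
    fun _ => burgersData_mem h _

/-- The slope of the Burgers profile increases up to the characteristic issued from the origin
and decreases afterwards, so its total variation is of order `1 / (1 + t)`. -/
lemma integral_burgers2 (h0 : 0 < wl) (h : wl ≤ wr) (h1 : wr - wl ≤ 1) (ht : 0 ≤ t) :
    Integrable (fun x => burgers2 wl wr x t) ∧ ∫ x, |burgers2 wl wr x t| ≤ 2 * (2 / (1 + t)) := by
  have hf0 : burgersFoot wl wr (t * burgersData wl wr 0) t = 0 :=
    burgersFoot_unique h ht (by simp)
  have hmono : Monotone fun x => burgersFoot wl wr x t := by
    refine monotone_of_deriv_nonneg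
      (fun x => (hasDerivAt_burgersFoot_space h0 h ht).differentiableAt) fun x => ?_
    rw [(hasDerivAt_burgersFoot_space h0 h ht).deriv]
    exact inv_nonneg.2 (burgers1_den_pos h ht _).le
  have htanh : ∀ y : ℝ, 0 ≤ y → 0 ≤ Real.tanh y := fun y hy => by
    rw [Real.tanh_eq_sinh_div_cosh]
    exact div_nonneg (Real.sinh_nonneg_iff.2 hy) (Real.cosh_pos y).le
  have hs := fun x => burgersSlope_nonneg h (burgersFoot wl wr x t)
  have hd := fun x => pow_pos (burgers1_den_pos h ht (burgersFoot wl wr x t)) 3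
  refine integrable_deriv_of_unimodal (x₀ := t * burgersData wl wr 0)
    (fun _ => hasDerivAt_burgers1_space h0 h ht) ((contForward_burgers2 h0 h).space ht) ?_ ?_
    fun x => ⟨burgers1_nonneg h ht, burgers1_le h h1 ht⟩
  · intro x hx
    have h2 : burgersFoot wl wr x t ≤ 0 := hf0 ▸ hmono hx
    have h3 := htanh (-burgersFoot wl wr x t) (by linarith)
    rw [Real.tanh_neg] at h3
    exact div_nonneg (mul_nonneg (by linarith) (hs x)) (hd x).le
  · intro x hx
    have h2 : 0 ≤ burgersFoot wl wr x t := hf0 ▸ hmono hx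
    have h3 := htanh _ h2
    exact div_nonpos_of_nonpos_of_nonneg
      (mul_nonpos_of_nonpos_of_nonneg (by linarith) (hs x)) (hd x).le

lemma burgersData_sub_le (h : wl ≤ wr) (y : ℝ) :
    burgersData wl wr y - wl ≤ (wr - wl) * Real.exp (2 * y) := by
  have e : burgersData wl wr y - wl = (wr - wl) * ((1 + Real.tanh y) / 2) := by
    unfold burgersData; ring
  rw [e]
  refine mul_le_mul_of_nonneg_left ?_ (by linarith)
  rw [Real.tanh_eq_sinh_div_cosh, Real.sinh_eq, Real.cosh_eq]
  have h1 := Real.exp_pos y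
  have h2 := Real.exp_pos (-y)
  have h3 : Real.exp (2 * y) * Real.exp (-y) = Real.exp y := by rw [← Real.exp_add]; ring_nf
  have h4 := Real.exp_pos (2 * y)
  have e2 : (1 + (Real.exp y - Real.exp (-y)) / 2 / ((Real.exp y + Real.exp (-y)) / 2)) / 2 =
      Real.exp y / (Real.exp y + Real.exp (-y)) := by field_simp; ring
  rw [e2, div_le_iff₀ (by positivity)]
  nlinarith [mul_pos h4 h1]

lemma burgers_sub_le_exp (h : wl ≤ wr) (ht : 0 ≤ t) :
    burgers wl wr x t - wl ≤ (wr - wl) * Real.exp (2 * (x - wl * t)) := by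
  have h1 := burgersFoot_spec h x ht
  have h2 := (burgersData_mem h (burgersFoot wl wr x t)).1
  refine (burgersData_sub_le h _).trans (mul_le_mul_of_nonneg_left (Real.exp_le_exp.2 ?_)
    (by linarith))
  have := mul_le_mul_of_nonneg_left h2 ht
  change _ + t * burgersData wl wr _ = x at h1
  linarith

/-- Near the contact characteristic, `burgers` differs from its left state by at most the fan
value `(x - √b t) / t` plus `O(t^{-1/2})`. -/
lemma burgers_sub_le_fan {b μ : ℝ} (h : √b ≤ wr) (h1 : wr - √b ≤ 1) (hμ : 0 < μ) (ht : 0 ≤ t) :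
    burgers (√b) wr x t - √b ≤
      4 * (1 + √(2 * μ)) * (1 + max (selfSim b μ x t) 0) / √(1 + t) := by
  have hspec := burgersFoot_spec h x ht
  have hmem := burgersData_mem h (burgersFoot (√b) wr x t)
  have hexp := burgersData_sub_le h (burgersFoot (√b) wr x t)
  change burgersFoot (√b) wr x t + t * burgers (√b) wr x t = x at hspec
  change burgers (√b) wr x t ∈ _ at hmem
  change burgers (√b) wr x t - √b ≤ _ at hexp
  set Y := burgersFoot (√b) wr x t
  set W := burgers (√b) wr x t
  set m := √(2 * μ)
  set s := selfSim b μ x t with hs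
  have hm : 0 ≤ m := Real.sqrt_nonneg _
  have hsp : 0 ≤ max s 0 := le_max_right _ _
  have hρ : 0 < √(1 + t) := Real.sqrt_pos.2 (by linarith)
  have hρ2 : √(1 + t) ^ 2 = 1 + t := Real.sq_sqrt (by linarith)
  set ρ := √(1 + t)
  have hζ : x - √b * t = s * (m * ρ) := by
    have hw : width μ t = m * ρ := Real.sqrt_mul (by positivity) _
    rw [hs, selfSim, ← hw, div_mul_cancel₀ _ (width_pos hμ (by linarith)).ne']
  have hζ' : x - √b * t ≤ max s 0 * (m * ρ) := by
    rw [hζ]; exact mul_le_mul_of_nonneg_right (le_max_left _ _) (by positivity)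
  rw [le_div_iff₀ hρ]
  have hU1 : W - √b ≤ 1 := by linarith [hmem.2]
  have hU0 : 0 ≤ W - √b := by linarith [hmem.1]
  have hbase : 1 ≤ (1 + m) * (1 + max s 0) := by nlinarith [mul_nonneg hm hsp]
  rcases le_total t 1 with ht1 | ht1
  · have : ρ ≤ 2 := by nlinarith
    nlinarith [mul_nonneg hU0 hρ.le]
  have hst : √t ≤ ρ := Real.sqrt_le_sqrt (by linarith)
  have hst2 : √t ^ 2 = t := Real.sq_sqrt ht
  have hst0 : 0 ≤ √t := Real.sqrt_nonneg t
  rcases le_total (-√t) Y with hY | hY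
  · -- here `t (W - √b) = x - √b t - Y ≤ x - √b t + √t`
    have h2 : t * (W - √b) ≤ max s 0 * (m * ρ) + ρ := by nlinarith
    have h3 : ρ ^ 2 * (W - √b) ≤ 2 * (max s 0 * (m * ρ) + ρ) := by
      rw [hρ2]; nlinarith
    have h4 : ρ * (ρ * (W - √b)) ≤ ρ * (2 * (max s 0 * m + 1)) := by nlinarith
    have h5 := le_of_mul_le_mul_left h4 hρ
    nlinarith [mul_nonneg hm hsp]
  · -- far to the left along the data the profile is exponentially close to its left state
    have h2 : W - √b ≤ Real.exp (-(2 * √t)) := by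
      refine hexp.trans ?_
      calc (wr - √b) * Real.exp (2 * Y) ≤ 1 * Real.exp (2 * Y) := by gcongr
        _ ≤ _ := by rw [one_mul]; exact Real.exp_le_exp.2 (by linarith)
    have h3 : Real.exp (-(2 * √t)) * (1 + 2 * √t) ≤ 1 := by
      rw [Real.exp_neg, inv_mul_le_iff₀ (Real.exp_pos _)]
      linarith [Real.add_one_le_exp (2 * √t)]
    have h4 : ρ ≤ 1 + 2 * √t := by
      refine abs_le_of_sq_le_sq' ?_ (by linarith) |>.2
      nlinarith
    have h5 : (W - √b) * ρ ≤ 1 :=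
      (mul_le_mul h2 h4 hρ.le (Real.exp_pos _).le).trans h3
    linarith

end burgers

/-! ### The rarefaction wave -/

/-- The space derivative of `vr`. -/
def vr1 (σ : ℝ → ℝ) (a vp x t : ℝ) : ℝ :=
  2 * burgers (lam σ a) (lam σ vp) x t * burgers1 (lam σ a) (lam σ vp) x t /
    stress2 σ a (vr σ a vp x t)

/-- The space derivative of `ur`. -/
def ur1 (σ : ℝ → ℝ) (a vp x t : ℝ) : ℝ := -(burgers (lam σ a) (lam σ vp) x t * vr1 σ a vp x t)

/-- The second space derivative of `ur`. -/
def ur2 (σ : ℝ → ℝ) (a vp x t : ℝ) : ℝ :=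
  -(4 * burgers (lam σ a) (lam σ vp) x t * burgers1 (lam σ a) (lam σ vp) x t ^ 2 +
      2 * burgers (lam σ a) (lam σ vp) x t ^ 2 * burgers2 (lam σ a) (lam σ vp) x t) /
      stress2 σ a (vr σ a vp x t) +
    2 * burgers (lam σ a) (lam σ vp) x t ^ 2 * burgers1 (lam σ a) (lam σ vp) x t *
      stress3 σ a (vr σ a vp x t) * vr1 σ a vp x t / stress2 σ a (vr σ a vp x t) ^ 2

namespace StressBounds

variable {a b κ K : ℝ} {σ : ℝ → ℝ} (hσ : StressBounds a b κ K σ) {vp x t : ℝ}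
include hσ

lemma lam_a_pos : 0 < lam σ a := hσ.lam_pos (by linarith [hσ.a_pos])

lemma lam_le (hvp : vp ∈ Icc a (a + 1)) : lam σ a ≤ lam σ vp :=
  hσ.strictMonoOn_lam.monotoneOn self_mem_Ici hvp.1 hvp.1

lemma lamInv_spec (hvp : vp ∈ Icc a (a + 1)) {w : ℝ} (hw : w ∈ Icc (lam σ a) (lam σ vp)) :
    Function.invFunOn (lam σ) (Ici a) w ∈ Icc a vp ∧
      lam σ (Function.invFunOn (lam σ) (Ici a) w) = w := by
  obtain ⟨v, hv, hvw⟩ := intermediate_value_Icc hvp.1 hσ.continuous_lam.continuousOn hw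
  have hex : ∃ v ∈ Ici a, lam σ v = w := ⟨v, hv.1, hvw⟩
  have h1 := Function.invFunOn_mem hex
  have h2 := Function.invFunOn_eq hex
  refine ⟨⟨h1, ?_⟩, h2⟩
  exact (hσ.strictMonoOn_lam.le_iff_le h1 hvp.1).1 (h2.le.trans hw.2)

lemma vr_spec (hvp : vp ∈ Icc a (a + 1)) :
    vr σ a vp x t ∈ Icc a vp ∧ lam σ (vr σ a vp x t) = burgers (lam σ a) (lam σ vp) x t :=
  hσ.lamInv_spec hvp (burgersData_mem (hσ.lam_le hvp) _)

lemma vr_mem (hvp : vp ∈ Icc a (a + 1)) : vr σ a vp x t ∈ Icc a (a + 1) :=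
  ⟨(hσ.vr_spec hvp).1.1, (hσ.vr_spec hvp).1.2.trans hvp.2⟩

lemma vr_sub_le (hvp : vp ∈ Icc a (a + 1)) :
    vr σ a vp x t - a ≤ 2 * √K / κ * (burgers (lam σ a) (lam σ vp) x t - lam σ a) := by
  have hm := hσ.vr_mem hvp (x := x) (t := t)
  have h := (hσ.lam_sub le_rfl hm.1 hm.2).1
  rw [(hσ.vr_spec hvp).2] at h
  have hκ := hσ.κ_pos
  have hK : 0 < √K := Real.sqrt_pos.2 hσ.K_pos
  calc vr σ a vp x t - a = 2 * √K / κ * (κ / (2 * √K) * (vr σ a vp x t - a)) := by field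
    _ ≤ _ := by gcongr

lemma continuousOn_lamInv (hvp : vp ∈ Icc a (a + 1)) :
    ContinuousOn (Function.invFunOn (lam σ) (Ici a)) (Icc (lam σ a) (lam σ vp)) := by
  have hκ := hσ.κ_pos
  have hK : 0 < √K := Real.sqrt_pos.2 hσ.K_pos
  have key : ∀ w ∈ Icc (lam σ a) (lam σ vp), ∀ w' ∈ Icc (lam σ a) (lam σ vp), w ≤ w' →
      |Function.invFunOn (lam σ) (Ici a) w - Function.invFunOn (lam σ) (Ici a) w'| ≤
        2 * √K / κ * |w - w'| := by
    intro w hw w' hw' hle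
    obtain ⟨h1, e1⟩ := hσ.lamInv_spec hvp hw
    obtain ⟨h2, e2⟩ := hσ.lamInv_spec hvp hw'
    set v := Function.invFunOn (lam σ) (Ici a) w
    set v' := Function.invFunOn (lam σ) (Ici a) w'
    have hvv : v ≤ v' := (hσ.strictMonoOn_lam.le_iff_le h1.1 h2.1).1 (by rw [e1, e2]; exact hle)
    have h := (hσ.lam_sub h1.1 hvv (h2.2.trans hvp.2)).1
    rw [e1, e2] at h
    rw [abs_of_nonpos (by linarith), abs_of_nonpos (by linarith)]
    calc -(v - v') = 2 * √K / κ * (κ / (2 * √K) * (v' - v)) := by field_simp; ring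
      _ ≤ 2 * √K / κ * (w' - w) := by gcongr
      _ = _ := by ring
  refine LipschitzOnWith.continuousOn (K := (2 * √K / κ).toNNReal)
    (LipschitzOnWith.of_dist_le_mul fun w hw w' hw' => ?_)
  rw [Real.coe_toNNReal _ (by positivity), Real.dist_eq, Real.dist_eq]
  rcases le_total w w' with hle | hle
  · exact key w hw w' hw' hle
  · rw [abs_sub_comm, abs_sub_comm w]; exact key w' hw' w hw hle

lemma hasDerivAt_lamInv (hvp : vp ∈ Icc a (a + 1)) {w : ℝ}
    (hw : w ∈ Ioo (lam σ a) (lam σ vp)) :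
    HasDerivAt (Function.invFunOn (lam σ) (Ici a))
      (2 * w / stress2 σ a (Function.invFunOn (lam σ) (Ici a) w)) w := by
  obtain ⟨h1, e1⟩ := hσ.lamInv_spec hvp (Ioo_subset_Icc_self hw)
  set v := Function.invFunOn (lam σ) (Ici a) w
  have hav : a < v := (hσ.strictMonoOn_lam.lt_iff_lt self_mem_Ici h1.1).1 (by rw [e1]; exact hw.1)
  have hs := hσ.stress2_pos hav.le
  have hl := hσ.lam_pos (v := v) (by linarith [hσ.a_pos])
  refine (HasDerivAt.of_local_left_inverse ((hσ.continuousOn_lamInv hvp).continuousAt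
    (Icc_mem_nhds hw.1 hw.2)) (hσ.hasDerivAt_lam hav) (by positivity) ?_).congr_deriv ?_
  · filter_upwards [Icc_mem_nhds hw.1 hw.2] with z hz using (hσ.lamInv_spec hvp hz).2
  · rw [e1, inv_div]

omit hσ in
lemma burgersData_mem_Ioo {wl wr : ℝ} (h : wl < wr) (y : ℝ) :
    burgersData wl wr y ∈ Ioo wl wr := by
  have hc := Real.cosh_pos y
  have h1 : Real.tanh y < 1 := by
    rw [Real.tanh_eq_sinh_div_cosh, div_lt_one hc]; exact Real.sinh_lt_cosh y
  have h2 : -1 < Real.tanh y := by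
    rw [Real.tanh_eq_sinh_div_cosh, lt_div_iff₀ hc]
    have := Real.sinh_lt_cosh (-y)
    rw [Real.sinh_neg, Real.cosh_neg] at this; linarith
  constructor <;> unfold burgersData <;> nlinarith

lemma burgers_mem_Ioo (h : a < vp) :
    burgers (lam σ a) (lam σ vp) x t ∈ Ioo (lam σ a) (lam σ vp) :=
  burgersData_mem_Ioo (hσ.strictMonoOn_lam self_mem_Ici h.le h) _

omit hσ in
lemma burgers1_of_eq : burgers1 (lam σ a) (lam σ a) x t = 0 := by
  simp [burgers1, burgersSlope]

omit hσ in
lemma burgers2_of_eq : burgers2 (lam σ a) (lam σ a) x t = 0 := by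
  simp [burgers2, burgersSlope]

lemma vr_of_eq : vr σ a a x t = a := by
  have h := (hσ.vr_spec (vp := a) ⟨le_rfl, by linarith⟩ (x := x) (t := t)).1
  exact le_antisymm h.2 h.1

lemma hasDerivAt_vr_space (hvp : vp ∈ Icc a (a + 1)) (ht : 0 ≤ t) :
    HasDerivAt (fun y => vr σ a vp y t) (vr1 σ a vp x t) x := by
  rcases hvp.1.eq_or_lt with h | h
  · subst h
    simp only [hσ.vr_of_eq, vr1, burgers1_of_eq, mul_zero, zero_div]
    exact hasDerivAt_const _ _
  · have h1 := hσ.hasDerivAt_lamInv hvp (hσ.burgers_mem_Ioo h (x := x) (t := t))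
    have h2 := hasDerivAt_burgers_space hσ.lam_a_pos (hσ.lam_le hvp) ht (x := x)
    refine HasDerivAt.congr_deriv (h1.comp x h2) ?_
    unfold vr1 vr; ring

lemma hasDerivAt_vr_time (hvp : vp ∈ Icc a (a + 1)) (ht : 0 < t) :
    HasDerivAt (fun s => vr σ a vp x s) (ur1 σ a vp x t) t := by
  rcases hvp.1.eq_or_lt with h | h
  · subst h
    simp only [hσ.vr_of_eq, ur1, vr1, burgers1_of_eq, mul_zero, zero_div, neg_zero]
    exact hasDerivAt_const _ _
  · have h1 := hσ.hasDerivAt_lamInv hvp (hσ.burgers_mem_Ioo h (x := x) (t := t))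
    have h2 := hasDerivAt_burgers_time hσ.lam_a_pos (hσ.lam_le hvp) ht (x := x)
    refine HasDerivAt.congr_deriv (h1.comp t h2) ?_
    unfold ur1 vr1 vr; ring

lemma hasDerivAt_ur_space (hvp : vp ∈ Icc a (a + 1)) (up : ℝ) (ht : 0 ≤ t) :
    HasDerivAt (fun y => ur σ a vp up y t) (ur1 σ a vp x t) x := by
  have h0 := (hσ.continuous_lam.integral_hasStrictDerivAt a (vr σ a vp x t)).hasDerivAt
  have h := (h0.comp x (hσ.hasDerivAt_vr_space hvp ht)).const_sub (ua σ a vp up)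
  refine HasDerivAt.congr_deriv (f := fun z => ur σ a vp up z t) h ?_
  rw [(hσ.vr_spec hvp).2, ur1]

lemma hasDerivAt_ur_time (hvp : vp ∈ Icc a (a + 1)) (up : ℝ) (ht : 0 < t) :
    HasDerivAt (fun s => ur σ a vp up x s)
      (deriv σ (vr σ a vp x t) * vr1 σ a vp x t) t := by
  have h0 := (hσ.continuous_lam.integral_hasStrictDerivAt a (vr σ a vp x t)).hasDerivAt
  have h := (h0.comp t (hσ.hasDerivAt_vr_time hvp ht)).const_sub (ua σ a vp up)
  refine HasDerivAt.congr_deriv (f := fun z => ur σ a vp up x z) h ?_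
  have hm := hσ.vr_mem hvp (x := x) (t := t)
  rw [← hσ.lam_sq (by linarith [hσ.a_pos, hm.1]), (hσ.vr_spec hvp).2, ur1]
  ring

lemma hasDerivAt_ur1_space (hvp : vp ∈ Icc a (a + 1)) (ht : 0 ≤ t) :
    HasDerivAt (fun y => ur1 σ a vp y t) (ur2 σ a vp x t) x := by
  rcases hvp.1.eq_or_lt with h | h
  · subst h
    simp only [ur2, ur1, vr1, burgers1_of_eq, burgers2_of_eq]
    simpa using hasDerivAt_const x (0 : ℝ)
  · have hav : a < vr σ a vp x t := by
      refine (hσ.strictMonoOn_lam.lt_iff_lt self_mem_Ici (hσ.vr_spec hvp).1.1).1 ?_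
      rw [(hσ.vr_spec hvp).2]; exact (hσ.burgers_mem_Ioo h).1
    have hS := (hσ.stress2_pos hav.le).ne'
    have hW := hasDerivAt_burgers_space hσ.lam_a_pos (hσ.lam_le hvp) ht (x := x)
    have h1 := hasDerivAt_burgers1_space hσ.lam_a_pos (hσ.lam_le hvp) ht (x := x)
    have h2 := (hσ.hasDerivAt_stress2 hav).comp x (hσ.hasDerivAt_vr_space hvp ht)
    refine ((hW.mul (((hW.const_mul 2).mul h1).div h2 hS)).neg).congr_deriv ?_
    simp only [Pi.mul_apply, Pi.div_apply, Function.comp_apply]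
    unfold ur2
    field_simp
    ring

lemma contForward_vr (hvp : vp ∈ Icc a (a + 1)) : ContForward (vr σ a vp) :=
  .comp_on (hσ.continuousOn_lamInv hvp) (contForward_burgers hσ.lam_a_pos (hσ.lam_le hvp))
    fun _ _ _ => burgersData_mem (hσ.lam_le hvp) _

lemma contForward_stress2_vr (hvp : vp ∈ Icc a (a + 1)) :
    ContForward fun x t => stress2 σ a (vr σ a vp x t) :=
  .comp_on hσ.continuousOn_stress2 (hσ.contForward_vr hvp) fun _ _ _ => (hσ.vr_mem hvp).1

lemma contForward_vr1 (hvp : vp ∈ Icc a (a + 1)) : ContForward (vr1 σ a vp) :=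
  (((ContForward.const 2).mul (contForward_burgers hσ.lam_a_pos (hσ.lam_le hvp))).mul
    (contForward_burgers1 hσ.lam_a_pos (hσ.lam_le hvp))).div (hσ.contForward_stress2_vr hvp)
    fun _ _ _ => (hσ.stress2_pos (hσ.vr_mem hvp).1).ne'

lemma contForward_ur1 (hvp : vp ∈ Icc a (a + 1)) : ContForward (ur1 σ a vp) :=
  ((contForward_burgers hσ.lam_a_pos (hσ.lam_le hvp)).mul (hσ.contForward_vr1 hvp)).neg

lemma contForward_ur (hvp : vp ∈ Icc a (a + 1)) (up : ℝ) : ContForward (ur σ a vp up) := by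
  have hc : Continuous fun v => ∫ s in a..v, lam σ s := continuous_iff_continuousAt.2 fun v =>
    (hσ.continuous_lam.integral_hasStrictDerivAt a v).hasDerivAt.continuousAt
  exact (ContForward.const _).sub (.comp hc (hσ.contForward_vr hvp))

lemma contForward_ur2 (hvp : vp ∈ Icc a (a + 1)) : ContForward (ur2 σ a vp) := by
  have hW := contForward_burgers hσ.lam_a_pos (hσ.lam_le hvp)
  have h1 := contForward_burgers1 hσ.lam_a_pos (hσ.lam_le hvp)
  have h2 := contForward_burgers2 hσ.lam_a_pos (hσ.lam_le hvp)
  have hS := hσ.contForward_stress2_vr hvp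
  have hS3 : ContForward fun x t => stress3 σ a (vr σ a vp x t) :=
    .comp_on hσ.continuousOn_stress3 (hσ.contForward_vr hvp) fun _ _ _ => (hσ.vr_mem hvp).1
  have h0 : ∀ x t, 0 ≤ t → stress2 σ a (vr σ a vp x t) ≠ 0 :=
    fun _ _ _ => (hσ.stress2_pos (hσ.vr_mem hvp).1).ne'
  exact (((((ContForward.const 4).mul hW).mul (h1.pow 2)).add
    (((ContForward.const 2).mul (hW.pow 2)).mul h2)).neg.div hS h0).add
    ((((((ContForward.const 2).mul (hW.pow 2)).mul h1).mul hS3).mul (hσ.contForward_vr1 hvp)).div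
      (hS.pow 2) fun x t ht => pow_ne_zero 2 (h0 x t ht))

lemma vr1_nonneg (hvp : vp ∈ Icc a (a + 1)) (ht : 0 ≤ t) : 0 ≤ vr1 σ a vp x t := by
  have h1 := burgers1_nonneg (hσ.lam_le hvp) ht (x := x)
  have h2 := (hσ.stress2_pos (hσ.vr_mem hvp (x := x) (t := t)).1)
  have h3 := hσ.lam_a_pos.le.trans (burgersData_mem (hσ.lam_le hvp)
    (burgersFoot (lam σ a) (lam σ vp) x t)).1
  exact div_nonneg (mul_nonneg (mul_nonneg (by norm_num) h3) h1) h2.le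

lemma ur1_nonpos (hvp : vp ∈ Icc a (a + 1)) (ht : 0 ≤ t) : ur1 σ a vp x t ≤ 0 := by
  have h3 := hσ.lam_a_pos.le.trans (burgersData_mem (hσ.lam_le hvp)
    (burgersFoot (lam σ a) (lam σ vp) x t)).1
  exact neg_nonpos.2 (mul_nonneg h3 (hσ.vr1_nonneg hvp ht))

lemma burgers_le (hvp : vp ∈ Icc a (a + 1)) :
    0 ≤ burgers (lam σ a) (lam σ vp) x t ∧ burgers (lam σ a) (lam σ vp) x t ≤ K := by
  have hm := burgersData_mem (hσ.lam_le hvp) (burgersFoot (lam σ a) (lam σ vp) x t)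
  refine ⟨hσ.lam_a_pos.le.trans hm.1, hm.2.trans ?_⟩
  refine (Real.sqrt_le_sqrt (hσ.deriv_le vp hvp)).trans ?_
  rw [Real.sqrt_le_left hσ.K_pos.le]
  nlinarith [hσ.one_le]

lemma vr1_le (hvp : vp ∈ Icc a (a + 1)) (ht : 0 ≤ t) :
    vr1 σ a vp x t ≤ 2 * K / κ * burgers1 (lam σ a) (lam σ vp) x t := by
  have h1 := burgers1_nonneg (hσ.lam_le hvp) ht (x := x)
  have hκ := hσ.κ_pos
  have h2 := hσ.le_stress2 _ (hσ.vr_mem hvp (x := x) (t := t))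
  have h3 := hσ.burgers_le hvp (x := x) (t := t)
  have hK := hσ.K_pos
  calc vr1 σ a vp x t ≤ 2 * K * burgers1 (lam σ a) (lam σ vp) x t / κ := by
        unfold vr1; gcongr; exact h3.2
    _ = _ := by ring

lemma abs_ur2_le (hvp : vp ∈ Icc a (a + 1)) (ht : 0 ≤ t) :
    |ur2 σ a vp x t| ≤ (4 * K / κ + 4 * K ^ 4 / κ ^ 3) * burgers1 (lam σ a) (lam σ vp) x t ^ 2 +
      2 * K ^ 2 / κ * |burgers2 (lam σ a) (lam σ vp) x t| := by
  have h1 := burgers1_nonneg (hσ.lam_le hvp) ht (x := x)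
  have hκ := hσ.κ_pos
  have hm := hσ.vr_mem hvp (x := x) (t := t)
  have h2 := hσ.le_stress2 _ hm
  have h5 := hσ.stress3_le _ hm
  have h3 := hσ.burgers_le hvp (x := x) (t := t)
  have h4 := hσ.vr1_le hvp ht (x := x)
  have h6 := hσ.vr1_nonneg hvp ht (x := x)
  have hK := hσ.K_pos
  set W := burgers (lam σ a) (lam σ vp) x t
  set W1 := burgers1 (lam σ a) (lam σ vp) x t
  set W2 := burgers2 (lam σ a) (lam σ vp) x t
  set S := stress2 σ a (vr σ a vp x t)
  set S3 := stress3 σ a (vr σ a vp x t)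
  set V := vr1 σ a vp x t
  have hS : 0 < S := hκ.trans_le h2
  have A : |-(4 * W * W1 ^ 2 + 2 * W ^ 2 * W2) / S| ≤ (4 * K * W1 ^ 2 + 2 * K ^ 2 * |W2|) / κ := by
    rw [abs_div, abs_neg, abs_of_pos hS]
    gcongr
    refine (abs_add_le _ _).trans (add_le_add ?_ ?_)
    · rw [abs_of_nonneg (by have := h3.1; positivity)]
      gcongr; exact h3.2
    · rw [abs_mul, abs_of_nonneg (by positivity : 0 ≤ 2 * W ^ 2)]
      have := h3.1
      gcongr; exact h3.2
  have B : |2 * W ^ 2 * W1 * S3 * V / S ^ 2| ≤ 2 * K ^ 2 * W1 * K * (2 * K / κ * W1) / κ ^ 2 := by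
    rw [abs_div, abs_of_pos (pow_pos hS 2), abs_mul, abs_mul,
      abs_of_nonneg (by positivity : 0 ≤ 2 * W ^ 2 * W1), abs_of_nonneg h6]
    have := h3.1
    gcongr; exact h3.2
  calc |ur2 σ a vp x t| ≤ _ := abs_add_le _ _
    _ ≤ _ := add_le_add A B
    _ = _ := by field_simp; ring

lemma integral_ur2 (hvp : vp ∈ Icc a (a + 1)) (h1 : lam σ vp - lam σ a ≤ 1) (ht : 0 ≤ t) :
    Integrable (fun x => ur2 σ a vp x t) ∧
    ∫ x, |ur2 σ a vp x t| ≤ (8 * K / κ + 8 * K ^ 4 / κ ^ 3 + 8 * K ^ 2 / κ) / (1 + t) := by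
  have hκ := hσ.κ_pos
  have hK := hσ.K_pos
  have hl := hσ.lam_le hvp
  have ht1 : 0 < 1 + t := by linarith
  obtain ⟨i1, e1⟩ := integral_burgers1 hσ.lam_a_pos hl ht
  obtain ⟨i2, e2⟩ := integral_burgers2 hσ.lam_a_pos hl h1 ht
  set A := 4 * K / κ + 4 * K ^ 4 / κ ^ 3
  set B := 2 * K ^ 2 / κ
  have hA : 0 ≤ A := by positivity
  have hB : 0 ≤ B := by positivity
  have hp : ∀ x, |ur2 σ a vp x t| ≤ A * (2 / (1 + t)) * |burgers1 (lam σ a) (lam σ vp) x t| +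
      B * |burgers2 (lam σ a) (lam σ vp) x t| := by
    intro x
    refine (hσ.abs_ur2_le hvp ht).trans (add_le_add_left ?_ _)
    have hn := burgers1_nonneg hl ht (x := x)
    have hle := burgers1_le hl h1 ht (x := x)
    rw [abs_of_nonneg hn, mul_assoc, sq]
    gcongr
  have hi : Integrable (fun x => A * (2 / (1 + t)) * |burgers1 (lam σ a) (lam σ vp) x t| +
      B * |burgers2 (lam σ a) (lam σ vp) x t|) := (i1.abs.const_mul _).add (i2.abs.const_mul _)
  have hc := (hσ.contForward_ur2 hvp).space ht
  have hint : Integrable (fun x => ur2 σ a vp x t) :=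
    hi.mono' hc.aestronglyMeasurable (ae_of_all _ hp)
  refine ⟨hint, (integral_mono hint.abs hi hp).trans ?_⟩
  rw [integral_add (i1.abs.const_mul _) (i2.abs.const_mul _), integral_const_mul,
    integral_const_mul]
  calc A * (2 / (1 + t)) * (∫ x, |burgers1 (lam σ a) (lam σ vp) x t|) +
        B * ∫ x, |burgers2 (lam σ a) (lam σ vp) x t|
      ≤ A * (2 / (1 + t)) * 1 + B * (2 * (2 / (1 + t))) := by gcongr; linarith
    _ = _ := by simp only [A, B]; field_simp; ring

end StressBounds

/-! ### The composite wave -/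

/-- The fourth root of `1 + t`, in which all decay rates are integer powers. -/
def qrt (t : ℝ) : ℝ := √√(1 + t)

/-- The space derivative of `vhat`. -/
def vhatX (σ : ℝ → ℝ) (a b μ vm vp x t : ℝ) : ℝ :=
  Xi1 a b μ vm x t + μ / (4 * √b) * Xi2 a b μ vm x t + vr1 σ a vp x t

/-- The time derivative of `vhat`. -/
def vhatT (σ : ℝ → ℝ) (a b μ vm vp x t : ℝ) : ℝ :=
  (-√b * Xi1 a b μ vm x t + μ / 2 * Xi2 a b μ vm x t) +
    μ / (4 * √b) * (-√b * Xi2 a b μ vm x t + μ / 2 * Xi3 a b μ vm x t) + ur1 σ a vp x t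

/-- The space derivative of `uhat`. -/
def uhatX (σ : ℝ → ℝ) (a b μ vm vp x t : ℝ) : ℝ :=
  √b * (μ / (4 * √b) * Xi2 a b μ vm x t - Xi1 a b μ vm x t) + ur1 σ a vp x t

/-- The second space derivative of `uhat`. -/
def uhatXX (σ : ℝ → ℝ) (a b μ vm vp x t : ℝ) : ℝ :=
  √b * (μ / (4 * √b) * Xi3 a b μ vm x t - Xi2 a b μ vm x t) + ur2 σ a vp x t

/-- The time derivative of `uhat`. -/
def uhatT (σ : ℝ → ℝ) (a b μ vm vp x t : ℝ) : ℝ :=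
  √b * (μ / (4 * √b) * (-√b * Xi2 a b μ vm x t + μ / 2 * Xi3 a b μ vm x t) -
    (-√b * Xi1 a b μ vm x t + μ / 2 * Xi2 a b μ vm x t)) +
    deriv σ (vr σ a vp x t) * vr1 σ a vp x t

/-- End states close to `a`, so that the composite wave stays in `(-a, a + 1]`. -/
structure NearStates (σ : ℝ → ℝ) (a b μ vm vp : ℝ) : Prop where
  neg_a_lt : -a < vm
  vm_le : vm ≤ a
  sub_vm_le : a - vm ≤ 1
  le_vp : a ≤ vp
  lam_sub_le : lam σ vp - lam σ a ≤ 1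
  sum_le : (vp - a) + μ / (4 * √b) / √(2 * μ) * (a - vm) ≤ 1

section qrt

variable {t : ℝ}

lemma qrt_sq (t : ℝ) : qrt t ^ 2 = √(1 + t) := Real.sq_sqrt (Real.sqrt_nonneg _)

lemma qrt_pow_four (ht : 0 ≤ t) : qrt t ^ 4 = 1 + t := by
  rw [show 4 = 2 * 2 from rfl, pow_mul, qrt_sq, Real.sq_sqrt (by linarith)]

lemma one_le_qrt (ht : 0 ≤ t) : 1 ≤ qrt t :=
  Real.one_le_sqrt.2 (Real.one_le_sqrt.2 (by linarith))

lemma qrt_pos (ht : 0 ≤ t) : 0 < qrt t := one_pos.trans_le (one_le_qrt ht)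

lemma width_eq {μ : ℝ} (hμ : 0 < μ) : width μ t = √(2 * μ) * qrt t ^ 2 := by
  rw [qrt_sq, width, Real.sqrt_mul (by positivity)]

lemma continuous_qrt : Continuous qrt := by unfold qrt; fun_prop

/-- The decay rate `(1+t)^{-5/4}` is integrable in time. -/
lemma integral_qrt_le (ht : 0 ≤ t) : ∫ τ in (0 : ℝ)..t, 1 / qrt τ ^ 5 ≤ 4 := by
  have hd : ∀ τ ∈ uIcc 0 t, HasDerivAt (fun τ => -4 / qrt τ) (1 / qrt τ ^ 5) τ := by
    intro τ hτ
    rw [uIcc_of_le ht] at hτ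
    have hp := qrt_pos hτ.1
    have h0 : (0 : ℝ) < 1 + τ := by linarith [hτ.1]
    have h1 : HasDerivAt qrt (1 / (2 * √(1 + τ)) / (2 * √√(1 + τ))) τ :=
      (((hasDerivAt_id τ).const_add 1).sqrt h0.ne').sqrt (Real.sqrt_pos.2 h0).ne'
    refine ((hasDerivAt_const τ (-4 : ℝ)).div h1 hp.ne').congr_deriv ?_
    rw [show √√(1 + τ) = qrt τ from rfl, ← qrt_sq]
    field
  have hc : ContinuousOn (fun τ => 1 / qrt τ ^ 5) (uIcc 0 t) := by
    rw [uIcc_of_le ht]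
    exact continuousOn_const.div (continuous_qrt.pow 5).continuousOn
      fun τ hτ => pow_ne_zero 5 (qrt_pos hτ.1).ne'
  rw [intervalIntegral.integral_eq_sub_of_hasDerivAt hd hc.intervalIntegrable]
  have h1 : 0 ≤ 4 / qrt t := div_nonneg (by norm_num) (qrt_pos ht).le
  have h2 : qrt 0 = 1 := by simp [qrt]
  rw [h2, neg_div]
  linarith

end qrt

section wave

variable {a b μ κ K : ℝ} {σ : ℝ → ℝ} {vm vp um up x t : ℝ}

lemma hasDerivAt_vhat_space (hσ : StressBounds a b κ K σ) (hμ : 0 < μ) (hvp : vp ∈ Icc a (a + 1))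
    (ht : 0 ≤ t) :
    HasDerivAt (fun y => vhat σ a b μ vm vp y t) (vhatX σ a b μ vm vp x t) x := by
  have ht' : -1 < t := by linarith
  have e : (fun y => vhat σ a b μ vm vp y t) = fun y => Xi a b μ vm y t +
      μ / (4 * √b) * Xi1 a b μ vm y t + vr σ a vp y t - a := by
    funext y; simp only [vhat, vc, dx_Xi hμ ht']
  rw [e]
  exact (((hasDerivAt_Xi_space hμ ht').add ((hasDerivAt_Xi1_space hμ ht').const_mul _)).add
    (hσ.hasDerivAt_vr_space hvp ht)).sub_const a

lemma hasDerivAt_vhat_time (hσ : StressBounds a b κ K σ) (hμ : 0 < μ) (hvp : vp ∈ Icc a (a + 1))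
    (ht : 0 < t) :
    HasDerivAt (fun s => vhat σ a b μ vm vp x s) (vhatT σ a b μ vm vp x t) t := by
  have ht' : -1 < t := by linarith
  have e : (fun s => vhat σ a b μ vm vp x s) =ᶠ[𝓝 t] fun s => Xi a b μ vm x s +
      μ / (4 * √b) * Xi1 a b μ vm x s + vr σ a vp x s - a := by
    filter_upwards [lt_mem_nhds ht'] with s hs
    simp only [vhat, vc, dx_Xi hμ hs]
  refine HasDerivAt.congr_of_eventuallyEq ?_ e
  exact (((hasDerivAt_Xi_time hμ ht').add ((hasDerivAt_Xi1_time hμ ht').const_mul _)).add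
    (hσ.hasDerivAt_vr_time hvp ht)).sub_const a

lemma hasDerivAt_uhat_space (hσ : StressBounds a b κ K σ) (hμ : 0 < μ) (hvp : vp ∈ Icc a (a + 1))
    (ht : 0 ≤ t) :
    HasDerivAt (fun y => uhat σ a b μ vm vp um up y t) (uhatX σ a b μ vm vp x t) x := by
  have ht' : -1 < t := by linarith
  have e : (fun y => uhat σ a b μ vm vp um up y t) = fun y =>
      √b * (μ / (4 * √b) * Xi1 a b μ vm y t - Xi a b μ vm y t) + (um + √b * vm) +
        ur σ a vp up y t - ua σ a vp up := by
    funext y; simp only [uhat, uc, dx_Xi hμ ht']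
  rw [e]
  exact ((((((hasDerivAt_Xi1_space hμ ht').const_mul _).sub
    (hasDerivAt_Xi_space hμ ht')).const_mul _).add_const _).add
    (hσ.hasDerivAt_ur_space hvp up ht)).sub_const _

lemma hasDerivAt_uhatX_space (hσ : StressBounds a b κ K σ) (hμ : 0 < μ) (hvp : vp ∈ Icc a (a + 1))
    (ht : 0 ≤ t) :
    HasDerivAt (fun y => uhatX σ a b μ vm vp y t) (uhatXX σ a b μ vm vp x t) x := by
  have ht' : -1 < t := by linarith
  exact ((((hasDerivAt_Xi2_space hμ ht').const_mul _).sub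
    (hasDerivAt_Xi1_space hμ ht')).const_mul _).add (hσ.hasDerivAt_ur1_space hvp ht)

lemma hasDerivAt_uhat_time (hσ : StressBounds a b κ K σ) (hμ : 0 < μ) (hvp : vp ∈ Icc a (a + 1))
    (ht : 0 < t) :
    HasDerivAt (fun s => uhat σ a b μ vm vp um up x s) (uhatT σ a b μ vm vp x t) t := by
  have ht' : -1 < t := by linarith
  have e : (fun s => uhat σ a b μ vm vp um up x s) =ᶠ[𝓝 t] fun s =>
      √b * (μ / (4 * √b) * Xi1 a b μ vm x s - Xi a b μ vm x s) + (um + √b * vm) +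
        ur σ a vp up x s - ua σ a vp up := by
    filter_upwards [lt_mem_nhds ht'] with s hs
    simp only [uhat, uc, dx_Xi hμ hs]
  refine HasDerivAt.congr_of_eventuallyEq ?_ e
  exact ((((((hasDerivAt_Xi1_time hμ ht').const_mul _).sub
    (hasDerivAt_Xi_time hμ ht')).const_mul _).add_const _).add
    (hσ.hasDerivAt_ur_time hvp up ht)).sub_const _

lemma dx_uhat1 (hσ : StressBounds a b κ K σ) (hμ : 0 < μ) (hvp : vp ∈ Icc a (a + 1))
    (ht : 0 ≤ t) :
    dx (uhat1 σ a b μ vm vp up) x t = ur1 σ a vp x t - √b * Xi1 a b μ vm x t :=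
  ((hσ.hasDerivAt_ur_space hvp up ht).sub
    ((hasDerivAt_Xi_space hμ (by linarith)).const_mul _)).deriv

lemma vhatT_sub_uhatX (hb : 0 < b) :
    vhatT σ a b μ vm vp x t - uhatX σ a b μ vm vp x t = μ ^ 2 / (8 * √b) * Xi3 a b μ vm x t := by
  have := Real.sqrt_pos.2 hb
  unfold vhatT uhatX; field_simp; ring

lemma uhatT_eq (hb : 0 < b) : uhatT σ a b μ vm vp x t =
    b * (Xi1 a b μ vm x t + μ / (4 * √b) * Xi2 a b μ vm x t) +
      deriv σ (vr σ a vp x t) * vr1 σ a vp x t +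
      μ * (uhatXX σ a b μ vm vp x t - ur2 σ a vp x t) - μ ^ 2 / 8 * Xi3 a b μ vm x t := by
  have := Real.sqrt_pos.2 hb
  have h2 : b = √b ^ 2 := (Real.sq_sqrt hb.le).symm
  unfold uhatT uhatXX
  generalize √b = β at *
  subst h2
  field_simp; ring

lemma vhatT_sub_vhatX (hb : 0 < b) :
    vhatT σ a b μ vm vp x t - √b * vhatX σ a b μ vm vp x t =
      -2 * √b * Xi1 a b μ vm x t - (√b * vr1 σ a vp x t - ur1 σ a vp x t) +
      μ ^ 2 / (8 * √b) * Xi3 a b μ vm x t := by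
  have := Real.sqrt_pos.2 hb
  unfold vhatT vhatX; field_simp; ring

lemma contForward_vhat (hσ : StressBounds a b κ K σ) (hμ : 0 < μ) (hvp : vp ∈ Icc a (a + 1)) :
    ContForward (vhat σ a b μ vm vp) := by
  refine ContinuousOn.congr ((((contForward_Xi (a := a) (vm := vm) (b := b) hμ).add
    ((ContForward.const (μ / (4 * √b))).mul (contForward_Xi1 (a := a) (vm := vm) (b := b) hμ))).add
    (hσ.contForward_vr hvp)).sub (.const a)) fun p hp => ?_
  have : 0 ≤ p.2 := hp.2
  simp only [vhat, vc, dx_Xi hμ (by linarith : -1 < p.2)]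

lemma contForward_uhat (hσ : StressBounds a b κ K σ) (hμ : 0 < μ) (hvp : vp ∈ Icc a (a + 1)) :
    ContForward (uhat σ a b μ vm vp um up) := by
  refine ContinuousOn.congr (((((ContForward.const (√b)).mul
    (((ContForward.const (μ / (4 * √b))).mul (contForward_Xi1 (a := a) (vm := vm) (b := b) hμ)).sub
    (contForward_Xi (a := a) (vm := vm) (b := b) hμ))).add (.const (um + √b * vm))).add
    (hσ.contForward_ur hvp up)).sub (.const (ua σ a vp up))) fun p hp => ?_
  have : 0 ≤ p.2 := hp.2
  simp only [uhat, uc, dx_Xi hμ (by linarith : -1 < p.2)]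

lemma contForward_vhatX (hσ : StressBounds a b κ K σ) (hμ : 0 < μ) (hvp : vp ∈ Icc a (a + 1)) :
    ContForward (vhatX σ a b μ vm vp) :=
  ((contForward_Xi1 hμ).add ((ContForward.const _).mul (contForward_Xi2 hμ))).add
    (hσ.contForward_vr1 hvp)

lemma contForward_vhatT (hσ : StressBounds a b κ K σ) (hμ : 0 < μ) (hvp : vp ∈ Icc a (a + 1)) :
    ContForward (vhatT σ a b μ vm vp) :=
  (((((ContForward.const (-√b)).mul (contForward_Xi1 hμ)).add
    ((ContForward.const _).mul (contForward_Xi2 hμ))).add ((ContForward.const _).mul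
    (((ContForward.const (-√b)).mul (contForward_Xi2 hμ)).add
    ((ContForward.const _).mul (contForward_Xi3 hμ)))))).add (hσ.contForward_ur1 hvp)

lemma contForward_uhatX (hσ : StressBounds a b κ K σ) (hμ : 0 < μ) (hvp : vp ∈ Icc a (a + 1)) :
    ContForward (uhatX σ a b μ vm vp) :=
  ((ContForward.const _).mul (((ContForward.const _).mul (contForward_Xi2 hμ)).sub
    (contForward_Xi1 hμ))).add (hσ.contForward_ur1 hvp)

lemma contForward_uhatT (hσ : StressBounds a b κ K σ) (hμ : 0 < μ) (hvp : vp ∈ Icc a (a + 1)) :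
    ContForward (uhatT σ a b μ vm vp) :=
  ((ContForward.const _).mul ((((ContForward.const _).mul
    (((ContForward.const (-√b)).mul (contForward_Xi2 hμ)).add
    ((ContForward.const _).mul (contForward_Xi3 hμ))))).sub
    (((ContForward.const (-√b)).mul (contForward_Xi1 hμ)).add
    ((ContForward.const _).mul (contForward_Xi2 hμ))))).add
    ((ContForward.comp hσ.continuous_deriv (hσ.contForward_vr hvp)).mul (hσ.contForward_vr1 hvp))

/-! ### Bounds for the composite wave -/

namespace NearStates

variable (hs : NearStates σ a b μ vm vp)
include hs

lemma vp_mem (hμ : 0 < μ) : vp ∈ Icc a (a + 1) := by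
  refine ⟨hs.le_vp, ?_⟩
  have h1 := hs.sum_le
  have h2 : 0 ≤ μ / (4 * √b) / √(2 * μ) * (a - vm) :=
    mul_nonneg (by positivity) (by linarith [hs.vm_le])
  linarith

lemma Xi1_le_of_nonneg (hμ : 0 < μ) (ht : 0 ≤ t) :
    Xi1 a b μ vm x t ≤ (a - vm) * (Real.exp (-selfSim b μ x t ^ 2) / (√(2 * μ) * qrt t ^ 2)) := by
  rw [← width_eq hμ, ← heatWeight_eq hμ (by linarith)]
  exact Xi1_le hs.vm_le

lemma Xi1_le_sub (hμ : 0 < μ) (ht : 0 ≤ t) :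
    Xi1 a b μ vm x t ≤ (a - vm) * (1 / √(2 * μ)) := by
  refine (hs.Xi1_le_of_nonneg hμ ht).trans (mul_le_mul_of_nonneg_left ?_ (by linarith [hs.vm_le]))
  have h1 : 1 ≤ qrt t ^ 2 := one_le_pow₀ (one_le_qrt ht)
  have h2 : 0 < √(2 * μ) := Real.sqrt_pos.2 (by positivity)
  refine div_le_div₀ zero_le_one (Real.exp_le_one_iff.2 (by nlinarith [sq_nonneg (selfSim b μ x t)])) h2 ?_
  exact le_mul_of_one_le_right h2.le h1

omit hs in
lemma vhat_eq (hμ : 0 < μ) (ht : 0 ≤ t) : vhat σ a b μ vm vp x t =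
    Xi a b μ vm x t + μ / (4 * √b) * Xi1 a b μ vm x t + vr σ a vp x t - a := by
  simp only [vhat, vc, dx_Xi hμ (by linarith : -1 < t)]

lemma vm_le_vhat (hσ : StressBounds a b κ K σ) (hμ : 0 < μ) (ht : 0 ≤ t) :
    vm ≤ vhat σ a b μ vm vp x t := by
  rw [vhat_eq hμ ht]
  have h1 := (hσ.vr_spec (hs.vp_mem hμ) (x := x) (t := t)).1.1
  have h2 := sub_Xi_le hs.vm_le (b := b) (μ := μ) (x := x) (t := t)
  have h3 : 0 ≤ μ / (4 * √b) * Xi1 a b μ vm x t :=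
    mul_nonneg (by positivity) (Xi1_nonneg hs.vm_le)
  linarith

/-- The excess of the composite wave over the critical strain `a`. -/
lemma vhat_sub_le (hμ : 0 < μ) (ht : 0 ≤ t) :
    vhat σ a b μ vm vp x t - a ≤
      (vr σ a vp x t - a) + μ / (4 * √b) * Xi1 a b μ vm x t := by
  rw [vhat_eq hμ ht]
  linarith [Xi_le hs.vm_le (b := b) (μ := μ) (x := x) (t := t)]

lemma vhat_sub_le_small (hσ : StressBounds a b κ K σ) (hμ : 0 < μ) (ht : 0 ≤ t) :
    vhat σ a b μ vm vp x t - a ≤ (vp - a) + μ / (4 * √b) / √(2 * μ) * (a - vm) := by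
  refine (hs.vhat_sub_le hμ ht).trans (add_le_add ?_ ?_)
  · linarith [(hσ.vr_spec (hs.vp_mem hμ) (x := x) (t := t)).1.2]
  · calc μ / (4 * √b) * Xi1 a b μ vm x t ≤ μ / (4 * √b) * ((a - vm) * (1 / √(2 * μ))) :=
        mul_le_mul_of_nonneg_left (hs.Xi1_le_sub hμ ht) (by positivity)
      _ = _ := by ring

lemma vhat_mem (hσ : StressBounds a b κ K σ) (hμ : 0 < μ) (ht : 0 ≤ t) :
    vhat σ a b μ vm vp x t ∈ Ioc (-a) (a + 1) :=
  ⟨hs.neg_a_lt.trans_le (hs.vm_le_vhat hσ hμ ht), by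
    linarith [hs.vhat_sub_le_small hσ hμ ht (x := x), hs.sum_le]⟩

lemma vr_sub_le_fan (hσ : StressBounds a b κ K σ) (hμ : 0 < μ) (ht : 0 ≤ t) :
    vr σ a vp x t - a ≤ 2 * √K / κ * (4 * (1 + √(2 * μ))) *
      ((1 + max (selfSim b μ x t) 0) / qrt t ^ 2) := by
  have hκ := hσ.κ_pos
  have hl := hσ.lam_le (hs.vp_mem hμ)
  have h1 := hs.lam_sub_le
  have h := hσ.vr_sub_le (hs.vp_mem hμ) (x := x) (t := t)
  rw [hσ.lam_a] at *
  have h2 := burgers_sub_le_fan hl h1 hμ ht (x := x)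
  rw [← qrt_sq] at h2
  calc _ ≤ _ := h
    _ ≤ 2 * √K / κ * (4 * (1 + √(2 * μ)) * (1 + max (selfSim b μ x t) 0) / qrt t ^ 2) := by gcongr
    _ = _ := by ring

lemma vr_sub_le_exp (hσ : StressBounds a b κ K σ) (hμ : 0 < μ) (ht : 0 ≤ t) :
    vr σ a vp x t - a ≤ 2 * √K / κ * Real.exp (2 * (x - √b * t)) := by
  have hκ := hσ.κ_pos
  have hl := hσ.lam_le (hs.vp_mem hμ)
  have h1 := hs.lam_sub_le
  have h := hσ.vr_sub_le (hs.vp_mem hμ) (x := x) (t := t)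
  rw [hσ.lam_a] at *
  have h2 := burgers_sub_le_exp hl ht (x := x)
  refine h.trans (mul_le_mul_of_nonneg_left (h2.trans ?_) (by positivity))
  exact mul_le_of_le_one_left (Real.exp_pos _).le h1

end NearStates

end wave

/-! ### Decay of the composite wave -/

/-- The decay properties of the composite wave, with a single constant `B`: the excess of the
strain over `a`, the interaction of contact wave and rarefaction wave, and the error terms. -/
structure WaveBounds (B : ℝ) (σ : ℝ → ℝ) (a b μ vm vp : ℝ) : Prop where
  one_le : 1 ≤ B
  gap_le : ∀ x t, 0 ≤ t → max (vhat σ a b μ vm vp x t - a) 0 ≤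
    B * ((1 + max (selfSim b μ x t) 0) / qrt t ^ 2)
  gap_le_small : ∀ x t, 0 ≤ t → max (vhat σ a b μ vm vp x t - a) 0 ≤ B * (vp - vm)
  integrable_inter : ∀ t, 0 ≤ t →
    Integrable fun x => (nl σ b (vhat σ a b μ vm vp x t) - nl σ b (vr σ a vp x t)) ^ 2
  inter_le : ∀ t, 0 ≤ t →
    ∫ x, (nl σ b (vhat σ a b μ vm vp x t) - nl σ b (vr σ a vp x t)) ^ 2 ≤ B / qrt t ^ 5
  ur2_le : ∀ t, 0 ≤ t → ∫ x, |ur2 σ a vp x t| ≤ B / qrt t ^ 4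
  Xi2_le : ∀ t, 0 ≤ t → ∫ x, Xi2 a b μ vm x t ^ 2 ≤ B / qrt t ^ 5
  Xi3_le : ∀ t, 0 ≤ t → ∫ x, Xi3 a b μ vm x t ^ 2 ≤ B / qrt t ^ 10
  abs_Xi3_le : ∀ x t, 0 ≤ t → |Xi3 a b μ vm x t| ≤ B / qrt t ^ 5

lemma one_add_pow_mul_exp_le {s : ℝ} (hs : 0 ≤ s) :
    (1 + s) ^ 7 * Real.exp (-s ^ 2) ≤ 8 ^ 7 * Real.exp (-(1 / 2) * s ^ 2) := by
  have h1 : 1 + s ≤ 8 * Real.exp (s ^ 2 / 16) := by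
    have := Real.add_one_le_exp (s ^ 2 / 16)
    nlinarith [sq_nonneg (s - 1)]
  calc (1 + s) ^ 7 * Real.exp (-s ^ 2) ≤ (8 * Real.exp (s ^ 2 / 16)) ^ 7 * Real.exp (-s ^ 2) := by
        gcongr
    _ = 8 ^ 7 * Real.exp (-(9 / 16) * s ^ 2) := by
        rw [mul_pow, ← Real.exp_nat_mul, mul_assoc, ← Real.exp_add]; ring_nf
    _ ≤ _ := by
        refine mul_le_mul_of_nonneg_left (Real.exp_le_exp.2 ?_) (by norm_num)
        nlinarith [sq_nonneg s]

lemma exp_two_mul_le {z : ℝ} (hz : z ≤ 0) : Real.exp (2 * z) ≤ (1 + z ^ 2)⁻¹ := by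
  have h := Real.quadratic_le_exp_of_nonneg (x := -2 * z) (by linarith)
  rw [show 2 * z = -(-2 * z) by ring, Real.exp_neg]
  exact inv_anti₀ (by positivity) (by nlinarith)

/-- Interpolation of a bound `K A²` without decay in space and a bound `K A |z|` with Gaussian
decay, for `A = O((1 + s) p⁻²)`. -/
lemma inter_sq_le_right {s p A K I z c d : ℝ} (hs : 0 ≤ s) (hp : 1 ≤ p) (hA0 : 0 ≤ A) (hK : 0 ≤ K)
    (hd : 0 ≤ d) (h1 : |I| ≤ K * A ^ 2) (h2 : |I| ≤ K * A * |z|)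
    (hz : |z| ≤ d * Real.exp (-s ^ 2)) (hA : A ≤ c * ((1 + s) / p ^ 2)) :
    I ^ 2 ≤ (1 + K ^ 4 * c ^ 7 * d * 8 ^ 7) * (Real.exp (-(1 / 4) * s ^ 2) / p ^ 7) := by
  have hp0 : 0 < p := by linarith
  have hc : 0 ≤ c := by
    have h : 0 < (1 + s) / p ^ 2 := by positivity
    exact nonneg_of_mul_nonneg_left (hA0.trans hA) h
  obtain ⟨D, hD⟩ : ∃ D, D = K ^ 4 * c ^ 7 * d * 8 ^ 7 := ⟨_, rfl⟩
  have hDp : 0 ≤ D := by rw [hD]; positivity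
  rw [← hD]
  set E := Real.exp (-(1 / 4) * s ^ 2) / p ^ 7 with hE
  have hE0 : 0 < E := by positivity
  have hI4 : (I ^ 2) ^ 2 ≤ ((1 + D) * E) ^ 2 := by
    calc (I ^ 2) ^ 2 = |I| ^ 3 * |I| := by rw [← sq_abs I]; ring
      _ ≤ (K * A ^ 2) ^ 3 * (K * A * |z|) := by gcongr
      _ = K ^ 4 * A ^ 7 * |z| := by ring
      _ ≤ K ^ 4 * (c * ((1 + s) / p ^ 2)) ^ 7 * (d * Real.exp (-s ^ 2)) := by gcongr
      _ = K ^ 4 * c ^ 7 * d * ((1 + s) ^ 7 * Real.exp (-s ^ 2)) / p ^ 14 := by field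
      _ ≤ K ^ 4 * c ^ 7 * d * (8 ^ 7 * Real.exp (-(1 / 2) * s ^ 2)) / p ^ 14 := by
          gcongr ?_ / _
          exact mul_le_mul_of_nonneg_left (one_add_pow_mul_exp_le hs) (by positivity)
      _ = D * E ^ 2 := by
          rw [hD, hE, div_pow, ← Real.exp_nat_mul]
          ring_nf
      _ ≤ (1 + D) ^ 2 * E ^ 2 := by
          refine mul_le_mul_of_nonneg_right ?_ (sq_nonneg E)
          nlinarith
      _ = _ := by ring
  exact (pow_le_pow_iff_left₀ (sq_nonneg I) (by positivity) two_ne_zero).1 hI4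

section

variable {a b μ κ K : ℝ} {σ : ℝ → ℝ} {vm vp x t : ℝ}

set_option maxHeartbeats 400000 in
/-- Pointwise form of the interaction estimate. On the side of the contact wave the rarefaction
wave is exponentially small; on the other side the two bounds `K A²` and `K A |v^c - a|` for the
interaction, `A` being the sum of the two excesses, are interpolated. -/
lemma NearStates.inter_sq_le (hσ : StressBounds a b κ K σ) (hμ : 0 < μ) :
    ∃ C ≥ 0, ∀ vm vp x t, NearStates σ a b μ vm vp → 0 ≤ t →
    (nl σ b (vhat σ a b μ vm vp x t) - nl σ b (vr σ a vp x t)) ^ 2 ≤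
      C * (Real.exp (-(1 / 4) * selfSim b μ x t ^ 2) / qrt t ^ 7 +
        (1 + (x - √b * t) ^ 2)⁻¹ / qrt t ^ 6) := by
  have hK := hσ.K_pos
  have hκ := hσ.κ_pos
  have hb := Real.sqrt_pos.2 hσ.b_pos
  have hm : 0 < √(2 * μ) := Real.sqrt_pos.2 (by positivity)
  set m := √(2 * μ)
  obtain ⟨R0, hR0⟩ : ∃ R0, R0 = 2 * √K / κ * (4 * (1 + m)) := ⟨_, rfl⟩
  obtain ⟨R1, hR1⟩ : ∃ R1, R1 = 2 * √K / κ := ⟨_, rfl⟩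
  obtain ⟨c1, hc1⟩ : ∃ c1, c1 = μ / (4 * √b) := ⟨_, rfl⟩
  obtain ⟨c2, hc2⟩ : ∃ c2, c2 = c1 / m := ⟨_, rfl⟩
  have hR0p : 0 ≤ R0 := by rw [hR0]; positivity
  have hR1p : 0 ≤ R1 := by rw [hR1]; positivity
  have hc1p : 0 ≤ c1 := by rw [hc1]; positivity
  have hc2p : 0 ≤ c2 := by rw [hc2]; positivity
  obtain ⟨D, hD⟩ : ∃ D, D = K ^ 4 * (R0 + c2) ^ 7 * (1 + c2) * 8 ^ 7 := ⟨_, rfl⟩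
  have hDp : 0 ≤ D := by rw [hD]; positivity
  refine ⟨(1 + D) + 8 * K ^ 2 * (R0 ^ 3 * R1 + c2 ^ 4), by positivity, ?_⟩
  intro vm vp x t hs ht
  have hp := one_le_qrt ht
  have hp0 := qrt_pos ht
  set p := qrt t
  have hvp := hs.vp_mem hμ
  have hvm := hs.vm_le
  have h1vm := hs.sub_vm_le
  have hfan := hs.vr_sub_le_fan hσ hμ ht (x := x)
  have hexp := hs.vr_sub_le_exp hσ hμ ht (x := x)
  have hX := hs.Xi1_le_of_nonneg hμ ht (x := x)
  have hX0 := Xi1_nonneg hvm (b := b) (μ := μ) (x := x) (t := t)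
  have hhat := vhat_eq (σ := σ) (a := a) (b := b) (vm := vm) (vp := vp) hμ ht (x := x)
  have hmem := hs.vhat_mem hσ hμ ht (x := x)
  have hrmem := hσ.vr_mem hvp (x := x) (t := t)
  have hsub := hs.vhat_sub_le hμ ht (x := x)
  have hXile := Xi_le hvm (b := b) (μ := μ) (x := x) (t := t)
  rw [← hR0] at hfan
  rw [← hR1] at hexp
  rw [← hc1] at hhat hsub
  set s := selfSim b μ x t with hs_def
  set r := vr σ a vp x t - a with hr
  have hr0 : 0 ≤ r := by linarith [hrmem.1]
  set Y := c1 * Xi1 a b μ vm x t with hY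
  have hY0 : 0 ≤ Y := by positivity
  have hYle : Y ≤ c2 * (Real.exp (-s ^ 2) / p ^ 2) := by
    calc Y ≤ c1 * (1 * (Real.exp (-s ^ 2) / (m * p ^ 2))) := by
          refine mul_le_mul_of_nonneg_left (hX.trans ?_) hc1p
          gcongr
      _ = _ := by rw [hc2]; field
  set I := nl σ b (vhat σ a b μ vm vp x t) - nl σ b (vr σ a vp x t) with hI
  have hrmem' : vr σ a vp x t ∈ Ioc (-a) (a + 1) := ⟨by linarith [hσ.a_pos, hrmem.1], hrmem.2⟩
  set z := vhat σ a b μ vm vp x t - vr σ a vp x t with hz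
  have hI1 : |I| ≤ K * (r + Y) ^ 2 := by
    have h1 := hσ.nl_bounds hmem
    have h2 := hσ.nl_bounds hrmem'
    have h3 : max (vhat σ a b μ vm vp x t - a) 0 ^ 2 ≤ (r + Y) ^ 2 :=
      pow_le_pow_left₀ (le_max_right _ _) (max_le hsub (by positivity)) 2
    have h4 : max (vr σ a vp x t - a) 0 ^ 2 ≤ (r + Y) ^ 2 :=
      pow_le_pow_left₀ (le_max_right _ _) (max_le (by linarith) (by positivity)) 2
    have h3' := mul_le_mul_of_nonneg_left h3 hK.le
    have h4' := mul_le_mul_of_nonneg_left h4 hK.le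
    rw [abs_le]
    constructor <;> linarith
  have hE0 : 0 < Real.exp (-(1 / 4) * s ^ 2) / p ^ 7 := by positivity
  have hF0 : 0 < (1 + (x - √b * t) ^ 2)⁻¹ / p ^ 6 := by positivity
  set E := Real.exp (-(1 / 4) * s ^ 2) / p ^ 7 with hE
  set F := (1 + (x - √b * t) ^ 2)⁻¹ / p ^ 6 with hF
  rcases le_total 0 s with h0 | h0
  · have hI2 : |I| ≤ K * (r + Y) * |z| := by
      refine (hσ.abs_nl_sub_le_max hmem hrmem').trans ?_
      gcongr
      exact max_le (max_le hsub (by linarith)) (by positivity)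
    have hzle : |z| ≤ (1 + c2) * Real.exp (-s ^ 2) := by
      have h1 := sub_Xi_le_exp (b := b) (μ := μ) (x := x) (t := t) hvm h0
      rw [← hs_def] at h1
      have h2 : (a - vm) * Real.exp (-s ^ 2) ≤ 1 * Real.exp (-s ^ 2) := by gcongr
      have h3 : c2 * (Real.exp (-s ^ 2) / p ^ 2) ≤ c2 * Real.exp (-s ^ 2) := by
        gcongr
        exact div_le_self (Real.exp_pos _).le (one_le_pow₀ hp)
      have hE0 := Real.exp_pos (-s ^ 2)
      have h4 : 0 ≤ c2 * Real.exp (-s ^ 2) := by positivity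
      rw [hz, hhat, abs_le]
      constructor <;> linarith
    have hA : r + Y ≤ (R0 + c2) * ((1 + s) / p ^ 2) := by
      rw [max_eq_left h0] at hfan
      have : c2 * (Real.exp (-s ^ 2) / p ^ 2) ≤ c2 * ((1 + s) / p ^ 2) := by
        gcongr
        exact (Real.exp_le_one_iff.2 (neg_nonpos.2 (sq_nonneg s))).trans (by linarith)
      linarith
    have := inter_sq_le_right h0 hp (by linarith) hK.le (by linarith) hI1 hI2 hzle hA
    rw [← hD] at this
    refine this.trans ?_
    have h5 : 0 ≤ (1 + D) * F := by positivity
    have h6 : 0 ≤ 8 * K ^ 2 * (R0 ^ 3 * R1 + c2 ^ 4) * (E + F) := by positivity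
    linarith
  · rw [max_eq_right h0, add_zero] at hfan
    have hζ : x - √b * t ≤ 0 := by
      by_contra! h
      have : 0 < s := div_pos h (width_pos hμ (by linarith))
      linarith
    have hr4 : r ^ 4 ≤ R0 ^ 3 * R1 * F := by
      calc r ^ 4 = r ^ 3 * r := by ring
        _ ≤ (R0 * (1 / p ^ 2)) ^ 3 * (R1 * (1 + (x - √b * t) ^ 2)⁻¹) := by
            gcongr
            exact hexp.trans (mul_le_mul_of_nonneg_left (exp_two_mul_le hζ) hR1p)
        _ = _ := by rw [hF]; field
    have hY4 : Y ^ 4 ≤ c2 ^ 4 * E := by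
      calc Y ^ 4 ≤ (c2 * (Real.exp (-s ^ 2) / p ^ 2)) ^ 4 := by gcongr
        _ = c2 ^ 4 * (Real.exp (-4 * s ^ 2) / p ^ 8) := by
            rw [mul_pow, div_pow, ← Real.exp_nat_mul]; ring_nf
        _ ≤ c2 ^ 4 * (Real.exp (-(1 / 4) * s ^ 2) / p ^ 7) := by
            gcongr
            · nlinarith [sq_nonneg s]
            · norm_num
    have hA4 : (r + Y) ^ 4 ≤ 8 * (r ^ 4 + Y ^ 4) := by
      have h := add_pow_le hr0 hY0 4
      norm_num at h
      exact h
    calc I ^ 2 = |I| ^ 2 := (sq_abs I).symm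
      _ ≤ (K * (r + Y) ^ 2) ^ 2 := pow_le_pow_left₀ (abs_nonneg _) hI1 2
      _ = K ^ 2 * (r + Y) ^ 4 := by ring
      _ ≤ K ^ 2 * (8 * (R0 ^ 3 * R1 * F + c2 ^ 4 * E)) := by
          gcongr
          linarith
      _ ≤ _ := by
          have h1 : 0 ≤ 8 * K ^ 2 * (R0 ^ 3 * R1) * E := by positivity
          have h2 : 0 ≤ 8 * K ^ 2 * c2 ^ 4 * F := by positivity
          have h3 : 0 ≤ (1 + D) * (E + F) := by positivity
          linarith

lemma integrable_inv_one_add_sq_shift (c : ℝ) : Integrable (fun x : ℝ => (1 + (x - c) ^ 2)⁻¹) ∧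
    ∫ x : ℝ, (1 + (x - c) ^ 2)⁻¹ = Real.pi :=
  ⟨integrable_inv_one_add_sq.comp_sub_right c, by
    rw [integral_sub_right_eq_self (fun x : ℝ => (1 + x ^ 2)⁻¹) c]
    exact integral_univ_inv_one_add_sq⟩

/-- The decay constants depend only on `σ` and `μ`, not on the end states. -/
lemma NearStates.exists_waveBounds (hσ : StressBounds a b κ K σ) (hμ : 0 < μ) :
    ∃ B, ∀ vm vp, NearStates σ a b μ vm vp → WaveBounds B σ a b μ vm vp := by
  obtain ⟨C, hC, hI⟩ := NearStates.inter_sq_le hσ hμ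
  have hK := hσ.K_pos
  have hκ := hσ.κ_pos
  have hm : 0 < √(2 * μ) := Real.sqrt_pos.2 (by positivity)
  set m := √(2 * μ) with hm_def
  have hb := Real.sqrt_pos.2 hσ.b_pos
  obtain ⟨b1, hb1⟩ : ∃ B, B = 2 * √K / κ * (4 * (1 + m)) + μ / (4 * √b) / m := ⟨_, rfl⟩
  obtain ⟨b2, hb2⟩ : ∃ B, B = 1 + μ / (4 * √b) / m := ⟨_, rfl⟩
  obtain ⟨b3, hb3⟩ : ∃ B, B = C * (m * √(Real.pi / (1 / 4)) + Real.pi) := ⟨_, rfl⟩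
  obtain ⟨b4, hb4⟩ : ∃ B, B = 8 * K / κ + 8 * K ^ 4 / κ ^ 3 + 8 * K ^ 2 / κ := ⟨_, rfl⟩
  obtain ⟨b5, hb5⟩ : ∃ B, B = 4 * √Real.pi / m ^ 3 := ⟨_, rfl⟩
  obtain ⟨b6, hb6⟩ : ∃ B, B = 100 * √Real.pi / m ^ 5 := ⟨_, rfl⟩
  obtain ⟨b7, hb7⟩ : ∃ B, B = 10 / m ^ 3 := ⟨_, rfl⟩
  have p1 : 0 ≤ b1 := by rw [hb1]; positivity
  have p2 : 0 ≤ b2 := by rw [hb2]; positivity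
  have p3 : 0 ≤ b3 := by rw [hb3]; positivity
  have p4 : 0 ≤ b4 := by rw [hb4]; positivity
  have p5 : 0 ≤ b5 := by rw [hb5]; positivity
  have p6 : 0 ≤ b6 := by rw [hb6]; positivity
  have p7 : 0 ≤ b7 := by rw [hb7]; positivity
  refine ⟨1 + b1 + b2 + b3 + b4 + b5 + b6 + b7, fun vm vp hs => ?_⟩
  set B := 1 + b1 + b2 + b3 + b4 + b5 + b6 + b7 with hB
  have hvm := hs.vm_le
  have hvp := hs.vp_mem hμ
  have hci : ∀ t, 0 ≤ t →
      Continuous fun x => nl σ b (vhat σ a b μ vm vp x t) - nl σ b (vr σ a vp x t) := fun t ht =>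
    (hσ.continuous_nl.comp ((contForward_vhat hσ hμ hvp).space ht)).sub
      (hσ.continuous_nl.comp ((hσ.contForward_vr hvp).space ht))
  have hint : ∀ t, 0 ≤ t → Integrable (fun x => Real.exp (-(1 / 4) * selfSim b μ x t ^ 2) / qrt t ^ 7 +
        (1 + (x - √b * t) ^ 2)⁻¹ / qrt t ^ 6) := fun t ht =>
    ((integral_exp_selfSim hμ (by linarith) (by norm_num : (0:ℝ) < 1 / 4)).1.div_const _).add
      ((integrable_inv_one_add_sq_shift _).1.div_const _)
  have hi : ∀ t, 0 ≤ t → Integrable fun x =>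
      (nl σ b (vhat σ a b μ vm vp x t) - nl σ b (vr σ a vp x t)) ^ 2 := fun t ht =>
    ((hint t ht).const_mul C).mono' ((hci t ht).pow 2).aestronglyMeasurable
      (ae_of_all _ fun x => by
        rw [Real.norm_eq_abs, abs_of_nonneg (sq_nonneg _)]; exact hI vm vp x t hs ht)
  refine ⟨by linarith, fun x t ht => ?_, fun x t ht => ?_, hi, fun t ht => ?_, fun t ht => ?_,
    fun t ht => ?_, fun t ht => ?_, fun x t ht => ?_⟩
  · have hp := qrt_pos ht
    have hs0 : 0 ≤ max (selfSim b μ x t) 0 := le_max_right _ _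
    refine max_le ?_ (by positivity)
    refine (hs.vhat_sub_le hμ ht).trans ((add_le_add (hs.vr_sub_le_fan hσ hμ ht)
      (?_ : _ ≤ μ / (4 * √b) / m * ((1 + max (selfSim b μ x t) 0) / qrt t ^ 2))).trans ?_)
    · have h1 := hs.Xi1_le_of_nonneg hμ ht (x := x)
      have h2 : (a - vm) * (Real.exp (-selfSim b μ x t ^ 2) / (m * qrt t ^ 2)) ≤
          1 * ((1 + max (selfSim b μ x t) 0) / (m * qrt t ^ 2)) := by
        have h3 := hs.sub_vm_le
        have h4 : Real.exp (-selfSim b μ x t ^ 2) ≤ 1 + max (selfSim b μ x t) 0 :=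
          (Real.exp_le_one_iff.2 (by nlinarith [sq_nonneg (selfSim b μ x t)])).trans (by linarith)
        gcongr
      calc _ ≤ μ / (4 * √b) * (1 * ((1 + max (selfSim b μ x t) 0) / (m * qrt t ^ 2))) :=
            mul_le_mul_of_nonneg_left (h1.trans h2) (by positivity)
        _ = _ := by field
    · rw [← add_mul, ← hb1]
      gcongr
      linarith
  · have h0 : 0 ≤ vp - vm := by linarith [hs.le_vp]
    refine max_le ((hs.vhat_sub_le_small hσ hμ ht).trans ?_) (mul_nonneg (by linarith) h0)
    have h1 : b2 * (vp - vm) ≤ B * (vp - vm) := by gcongr; linarith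
    have h2 : 0 ≤ μ / (4 * √b) / m * (vp - a) :=
      mul_nonneg (by positivity) (by linarith [hs.le_vp])
    rw [hb2] at h1
    linarith
  · have hp := one_le_qrt ht
    have hp0 := qrt_pos ht
    calc _ ≤ ∫ x, C * (Real.exp (-(1 / 4) * selfSim b μ x t ^ 2) / qrt t ^ 7 +
        (1 + (x - √b * t) ^ 2)⁻¹ / qrt t ^ 6) :=
          integral_mono (hi t ht) ((hint t ht).const_mul C) fun x => hI vm vp x t hs ht
      _ = C * (m * √(Real.pi / (1 / 4)) / qrt t ^ 5 + Real.pi / qrt t ^ 6) := by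
          rw [integral_const_mul, integral_add
            ((integral_exp_selfSim hμ (by linarith) (by norm_num : (0:ℝ) < 1 / 4)).1.div_const _)
            ((integrable_inv_one_add_sq_shift _).1.div_const _), integral_div, integral_div,
            (integral_exp_selfSim hμ (by linarith) (by norm_num : (0:ℝ) < 1 / 4)).2,
            (integrable_inv_one_add_sq_shift _).2, width_eq hμ]
          field
      _ ≤ C * (m * √(Real.pi / (1 / 4)) / qrt t ^ 5 + Real.pi / qrt t ^ 5) := by
          gcongr
          · norm_num
      _ = b3 / qrt t ^ 5 := by rw [hb3]; ring
      _ ≤ _ := by gcongr; linarith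
  · rw [qrt_pow_four ht]
    refine (hσ.integral_ur2 hvp hs.lam_sub_le ht).2.trans ?_
    rw [← hb4]
    gcongr
    linarith
  · have hp := one_le_qrt ht
    have hp0 := qrt_pos ht
    refine (integral_Xi2_sq_le hμ (by linarith) hvm hs.sub_vm_le).2.trans ?_
    rw [width_eq hμ]
    calc _ = b5 / qrt t ^ 6 := by rw [hb5]; field
      _ ≤ B / qrt t ^ 5 := by
        gcongr
        · linarith
        · norm_num
  · have hp0 := qrt_pos ht
    refine (integral_Xi3_sq_le hμ (by linarith) hvm hs.sub_vm_le).2.trans ?_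
    rw [width_eq hμ]
    calc _ = b6 / qrt t ^ 10 := by rw [hb6]; field
      _ ≤ B / qrt t ^ 10 := by
        gcongr
        linarith
  · have hp := one_le_qrt ht
    have hp0 := qrt_pos ht
    refine (Viscoelastic.abs_Xi3_le hμ (by linarith) hvm hs.sub_vm_le x).trans ?_
    rw [width_eq hμ]
    calc _ ≤ 10 / (m * qrt t ^ 2) ^ 3 * 1 := by
          gcongr
          exact Real.exp_le_one_iff.2 (by nlinarith [sq_nonneg (selfSim b μ x t)])
      _ = b7 / qrt t ^ 6 := by rw [hb7]; field
      _ ≤ B / qrt t ^ 5 := by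
        gcongr
        · linarith
        · norm_num

end

/-! ### The weights -/

/-- The increasing negative weight `(arctan s - π/2) / √(1+t)`. -/
def wtA (b μ x t : ℝ) : ℝ := (Real.arctan (selfSim b μ x t) - Real.pi / 2) / qrt t ^ 2

/-- The space derivative of `wtA`. -/
def wtA1 (b μ x t : ℝ) : ℝ := 1 / ((1 + selfSim b μ x t ^ 2) * (√(2 * μ) * qrt t ^ 4))

/-- The time derivative of `wtA`. -/
def wtAt (b μ x t : ℝ) : ℝ := -√b * wtA1 b μ x t -
  (Real.arctan (selfSim b μ x t) - Real.pi / 2 + selfSim b μ x t / (1 + selfSim b μ x t ^ 2)) /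
    (2 * qrt t ^ 6)

/-- The weight `1 - e^{-2s²}`, which vanishes on the characteristic of the contact wave. -/
def wtB (b μ x t : ℝ) : ℝ := 1 - Real.exp (-2 * selfSim b μ x t ^ 2)

/-- The space derivative of `wtB`. -/
def wtB1 (b μ x t : ℝ) : ℝ :=
  4 * selfSim b μ x t * Real.exp (-selfSim b μ x t ^ 2) * heatWeight b μ x t

/-- The time derivative of `wtB`. -/
def wtBt (b μ x t : ℝ) : ℝ :=
  -√b * wtB1 b μ x t - 4 * μ * (selfSim b μ x t ^ 2 * heatWeight b μ x t ^ 2)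

/-- The weight `s e^{-s²} w`, whose space derivative is `(1 - 4s²) w²`. -/
def wtC (b μ x t : ℝ) : ℝ :=
  selfSim b μ x t * Real.exp (-selfSim b μ x t ^ 2) * heatWeight b μ x t

/-- The space derivative of `wtC`. -/
def wtC1 (b μ x t : ℝ) : ℝ := (1 - 4 * selfSim b μ x t ^ 2) * heatWeight b μ x t ^ 2

section

variable {b μ x t : ℝ}

lemma heatWeight_eq_qrt (hμ : 0 < μ) (ht : 0 ≤ t) :
    heatWeight b μ x t = Real.exp (-selfSim b μ x t ^ 2) / (√(2 * μ) * qrt t ^ 2) := by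
  rw [heatWeight_eq hμ (by linarith), width_eq hμ]

lemma hasDerivAt_qrt_sq (ht : 0 ≤ t) :
    HasDerivAt (fun τ => qrt τ ^ 2) (1 / (2 * qrt t ^ 2)) t := by
  have h := ((hasDerivAt_id t).const_add 1).sqrt (by simp only [id]; linarith)
  simp_rw [qrt_sq]
  exact h

lemma hasDerivAt_selfSim_time_qrt (hμ : 0 < μ) (ht : 0 ≤ t) :
    HasDerivAt (fun τ => selfSim b μ x τ)
      (-√b / (√(2 * μ) * qrt t ^ 2) - selfSim b μ x t / (2 * qrt t ^ 4)) t := by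
  rw [← width_eq hμ, qrt_pow_four ht]
  exact hasDerivAt_selfSim_time hμ (by linarith)

lemma hasDerivAt_selfSim_space_qrt (hμ : 0 < μ) :
    HasDerivAt (fun y => selfSim b μ y t) (1 / (√(2 * μ) * qrt t ^ 2)) x := by
  rw [← width_eq hμ]
  exact hasDerivAt_selfSim_space

lemma sqrt_two_mul_pos (hμ : 0 < μ) : 0 < √(2 * μ) := Real.sqrt_pos.2 (by positivity)

lemma hasDerivAt_wtA_space (hμ : 0 < μ) (ht : 0 ≤ t) :
    HasDerivAt (fun y => wtA b μ y t) (wtA1 b μ x t) x := by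
  have hp := qrt_pos ht
  have hm := sqrt_two_mul_pos hμ
  have h := ((((hasDerivAt_selfSim_space_qrt (b := b) (x := x) (t := t) hμ).arctan).sub_const
    (Real.pi / 2)).div_const (qrt t ^ 2))
  refine HasDerivAt.congr_deriv h ?_
  unfold wtA1
  field

lemma hasDerivAt_wtA_time (hμ : 0 < μ) (ht : 0 ≤ t) :
    HasDerivAt (fun τ => wtA b μ x τ) (wtAt b μ x t) t := by
  have hp := qrt_pos ht
  have hm := sqrt_two_mul_pos hμ
  have h := ((((hasDerivAt_selfSim_time_qrt (b := b) (x := x) hμ ht).arctan).sub_const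
    (Real.pi / 2)).div (hasDerivAt_qrt_sq ht) (by positivity))
  refine HasDerivAt.congr_deriv h ?_
  unfold wtAt wtA1
  field_simp
  ring

lemma exp_neg_two_mul (s : ℝ) : Real.exp (-2 * s ^ 2) = Real.exp (-s ^ 2) ^ 2 := by
  rw [← Real.exp_nat_mul]; ring_nf

lemma hasDerivAt_wtB_space (hμ : 0 < μ) (ht : 0 ≤ t) :
    HasDerivAt (fun y => wtB b μ y t) (wtB1 b μ x t) x := by
  have hp := qrt_pos ht
  have hm := sqrt_two_mul_pos hμ
  have h := ((((hasDerivAt_selfSim_space_qrt (b := b) (x := x) (t := t) hμ).pow 2).const_mul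
    (-2)).exp).const_sub 1
  refine HasDerivAt.congr_deriv h ?_
  simp only [Pi.pow_apply]
  unfold wtB1
  rw [heatWeight_eq_qrt hμ ht, exp_neg_two_mul]
  field

lemma hasDerivAt_wtB_time (hμ : 0 < μ) (ht : 0 ≤ t) :
    HasDerivAt (fun τ => wtB b μ x τ) (wtBt b μ x t) t := by
  have hp := qrt_pos ht
  have hm := sqrt_two_mul_pos hμ
  have hm2 : √(2 * μ) ^ 2 = 2 * μ := Real.sq_sqrt (by positivity)
  have hμ2 : μ = √(2 * μ) ^ 2 / 2 := by rw [hm2]; ring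
  have h := ((((hasDerivAt_selfSim_time_qrt (b := b) (x := x) hμ ht).pow 2).const_mul
    (-2)).exp).const_sub 1
  refine HasDerivAt.congr_deriv h ?_
  simp only [Pi.pow_apply]
  unfold wtBt wtB1
  rw [heatWeight_eq_qrt hμ ht, exp_neg_two_mul]
  generalize √(2 * μ) = m at *
  rw [hμ2]
  field_simp
  ring

lemma hasDerivAt_wtC_space (hμ : 0 < μ) (ht : 0 ≤ t) :
    HasDerivAt (fun y => wtC b μ y t) (wtC1 b μ x t) x := by
  have hp := qrt_pos ht
  have hm := sqrt_two_mul_pos hμ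
  have h := ((hasDerivAt_selfSim_space_qrt (b := b) (x := x) (t := t) hμ).mul
    (((hasDerivAt_selfSim_space_qrt (b := b) (x := x) (t := t) hμ).pow 2).neg.exp)).mul
      (hasDerivAt_heatWeight_space (b := b) (x := x) hμ (by linarith : -1 < t))
  refine HasDerivAt.congr_deriv h ?_
  simp only [Pi.pow_apply, Pi.neg_apply, Pi.mul_apply]
  unfold wtC1
  rw [width_eq hμ, heatWeight_eq_qrt hμ ht]
  field_simp
  ring

lemma wtA1_nonneg : 0 ≤ wtA1 b μ x t := by unfold wtA1; positivity

lemma wtA1_le (hμ : 0 < μ) (ht : 0 ≤ t) : wtA1 b μ x t ≤ 1 / (√(2 * μ) * qrt t ^ 4) := by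
  have hp := qrt_pos ht
  have hm := sqrt_two_mul_pos hμ
  unfold wtA1
  refine one_div_le_one_div_of_le (by positivity) (le_mul_of_one_le_left (by positivity) ?_)
  linarith [sq_nonneg (selfSim b μ x t)]

lemma abs_arctan_sub_le (s : ℝ) : |Real.arctan s - Real.pi / 2| ≤ 4 := by
  have h1 := Real.arctan_lt_pi_div_two s
  have h2 := Real.neg_pi_div_two_lt_arctan s
  have h3 := Real.pi_lt_d2
  rw [abs_le]; constructor <;> linarith

/-- The decay of `arctan s - π/2` at `+∞`. -/
lemma one_add_mul_abs_arctan_sub_le (s : ℝ) :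
    (1 + max s 0) * |Real.arctan s - Real.pi / 2| ≤ 4 := by
  rcases le_total s 0 with h | h
  · rw [max_eq_right h]; simpa using abs_arctan_sub_le s
  · rw [max_eq_left h]
    have hpi := Real.pi_lt_d2
    rcases h.eq_or_lt with rfl | h
    · simp only [Real.arctan_zero, zero_sub, abs_neg]
      rw [abs_of_pos (by positivity)]; linarith
    have e : Real.pi / 2 - Real.arctan s = Real.arctan s⁻¹ := by
      rw [Real.arctan_inv_of_pos h]
    have h0 : 0 < s⁻¹ := inv_pos.2 h
    have h2 := Real.arctan_lt_pi_div_two s⁻¹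
    have h3 : 0 < Real.arctan s⁻¹ := Real.arctan_pos.2 h0
    have h1 : Real.arctan s⁻¹ ≤ s⁻¹ := by
      simpa [Real.tan_arctan] using Real.le_tan h3.le h2
    rw [abs_sub_comm, e, abs_of_pos h3]
    have h4 : s * Real.arctan s⁻¹ ≤ s * s⁻¹ := by gcongr
    rw [mul_inv_cancel₀ h.ne'] at h4
    linarith

lemma abs_wtA_le (ht : 0 ≤ t) : |wtA b μ x t| ≤ 4 / qrt t ^ 2 := by
  have hp := qrt_pos ht
  rw [wtA, abs_div, abs_of_pos (pow_pos hp 2)]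
  exact div_le_div_of_nonneg_right (abs_arctan_sub_le _) (by positivity)

lemma one_add_mul_abs_wtA_le (ht : 0 ≤ t) :
    (1 + max (selfSim b μ x t) 0) * |wtA b μ x t| ≤ 4 / qrt t ^ 2 := by
  have hp := qrt_pos ht
  rw [wtA, abs_div, abs_of_pos (pow_pos hp 2), ← mul_div_assoc]
  exact div_le_div_of_nonneg_right (one_add_mul_abs_arctan_sub_le _) (by positivity)

lemma abs_wtAt_add_le (ht : 0 ≤ t) :
    |wtAt b μ x t + √b * wtA1 b μ x t| ≤ 3 / qrt t ^ 6 := by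
  have hp := qrt_pos ht
  have h1 := abs_arctan_sub_le (selfSim b μ x t)
  have h2 : |selfSim b μ x t / (1 + selfSim b μ x t ^ 2)| ≤ 1 := by
    rw [abs_div, abs_of_pos (by positivity : 0 < 1 + selfSim b μ x t ^ 2),
      div_le_one (by positivity)]
    nlinarith [sq_abs (selfSim b μ x t), sq_nonneg (|selfSim b μ x t| - 1)]
  have e : wtAt b μ x t + √b * wtA1 b μ x t =
    -(Real.arctan (selfSim b μ x t) - Real.pi / 2 + selfSim b μ x t / (1 + selfSim b μ x t ^ 2)) /
    (2 * qrt t ^ 6) := by unfold wtAt; ring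
  rw [e, abs_div, abs_of_pos (by positivity : 0 < 2 * qrt t ^ 6), abs_neg,
    div_le_div_iff₀ (by positivity) (by positivity)]
  have h3 := (abs_add_le _ _).trans (add_le_add h1 h2)
  have : 0 < qrt t ^ 6 := by positivity
  nlinarith

lemma wtB_nonneg : 0 ≤ wtB b μ x t := by
  unfold wtB
  linarith [Real.exp_le_one_iff.2 (by linarith [sq_nonneg (selfSim b μ x t)] :
    -2 * selfSim b μ x t ^ 2 ≤ 0)]

lemma wtB_le : wtB b μ x t ≤ 1 := by
  unfold wtB
  linarith [Real.exp_pos (-2 * selfSim b μ x t ^ 2)]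

lemma abs_wtB_le : |wtB b μ x t| ≤ 1 := by
  rw [abs_of_nonneg wtB_nonneg]; exact wtB_le

lemma abs_wtB1_le : |wtB1 b μ x t| ≤ 4 * heatWeight b μ x t := by
  have h := abs_mul_exp_le (selfSim b μ x t)
  rw [wtB1, abs_mul, abs_mul, abs_mul, abs_of_nonneg (heatWeight_nonneg),
    abs_of_pos (Real.exp_pos _), abs_of_pos (by norm_num : (0:ℝ) < 4), mul_assoc 4]
  exact mul_le_mul_of_nonneg_right (by linarith) heatWeight_nonneg

lemma abs_wtB1_le' : |wtB1 b μ x t| ≤ 4 * (|selfSim b μ x t| * heatWeight b μ x t) := by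
  have h : Real.exp (-selfSim b μ x t ^ 2) ≤ 1 :=
    Real.exp_le_one_iff.2 (neg_nonpos.2 (sq_nonneg _))
  rw [wtB1, abs_mul, abs_mul, abs_mul, abs_of_nonneg (heatWeight_nonneg),
    abs_of_pos (Real.exp_pos _), abs_of_pos (by norm_num : (0:ℝ) < 4), mul_assoc, mul_assoc]
  have := heatWeight_nonneg (b := b) (μ := μ) (x := x) (t := t)
  gcongr
  exact mul_le_of_le_one_left this h

lemma abs_wtC_le : |wtC b μ x t| ≤ |selfSim b μ x t| * heatWeight b μ x t := by
  have h : Real.exp (-selfSim b μ x t ^ 2) ≤ 1 :=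
    Real.exp_le_one_iff.2 (neg_nonpos.2 (sq_nonneg _))
  rw [wtC, abs_mul, abs_mul, abs_of_nonneg (heatWeight_nonneg), abs_of_pos (Real.exp_pos _)]
  refine mul_le_mul_of_nonneg_right (mul_le_of_le_one_right (abs_nonneg _) h) heatWeight_nonneg

lemma heatWeight_le (hμ : 0 < μ) (ht : 0 ≤ t) : heatWeight b μ x t ≤ 1 / √(2 * μ) := by
  have hp := one_le_qrt ht
  have hm := sqrt_two_mul_pos hμ
  rw [heatWeight_eq_qrt hμ ht]
  refine div_le_div₀ zero_le_one (Real.exp_le_one_iff.2 (neg_nonpos.2 (sq_nonneg _))) hm ?_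
  exact le_mul_of_one_le_right hm.le (one_le_pow₀ hp)

lemma abs_selfSim_mul_heatWeight_le (hμ : 0 < μ) (ht : 0 ≤ t) :
    |selfSim b μ x t| * heatWeight b μ x t ≤ 1 / √(2 * μ) := by
  have hp := one_le_qrt ht
  have hm := sqrt_two_mul_pos hμ
  rw [heatWeight_eq_qrt hμ ht, ← mul_div_assoc]
  refine div_le_div₀ zero_le_one (abs_mul_exp_le _) hm ?_
  exact le_mul_of_one_le_right hm.le (one_le_pow₀ hp)

/-- The weighted square of the heat kernel is dominated by the slope of `wtA`. -/
lemma one_add_sq_mul_heatWeight_sq_le (hμ : 0 < μ) (ht : 0 ≤ t) :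
    (1 + selfSim b μ x t ^ 2) * heatWeight b μ x t ^ 2 ≤ wtA1 b μ x t / √(2 * μ) := by
  have hp := qrt_pos ht
  have hm := sqrt_two_mul_pos hμ
  set s := selfSim b μ x t with hs
  have h : (1 + s ^ 2) * Real.exp (-s ^ 2) ≤ 1 := by
    rw [Real.exp_neg, ← div_eq_mul_inv, div_le_one (Real.exp_pos _)]
    linarith [Real.add_one_le_exp (s ^ 2)]
  have h2 : ((1 + s ^ 2) * Real.exp (-s ^ 2)) ^ 2 ≤ 1 := pow_le_one₀ (by positivity) h
  rw [heatWeight_eq_qrt hμ ht, wtA1, ← hs]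
  rw [div_pow, ← mul_div_assoc, div_div, div_le_div_iff₀ (by positivity) (by positivity)]
  calc _ = ((1 + s ^ 2) * Real.exp (-s ^ 2)) ^ 2 * (√(2 * μ) ^ 2 * qrt t ^ 4) := by ring
    _ ≤ 1 * (√(2 * μ) ^ 2 * qrt t ^ 4) := by gcongr
    _ = _ := by ring

lemma contForward_qrt : ContForward fun _ t => qrt t :=
  .of_continuous (continuous_qrt.comp continuous_snd)

lemma contForward_wtA (hμ : 0 < μ) : ContForward (wtA b μ) :=
  ContForward.div (((ContForward.comp Real.continuous_arctan (contForward_selfSim hμ)).sub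
    (.const _))) (contForward_qrt.pow 2) fun _ _ ht => pow_ne_zero 2 (qrt_pos ht).ne'

lemma contForward_wtA1 (hμ : 0 < μ) : ContForward (wtA1 b μ) := by
  have hm := sqrt_two_mul_pos hμ
  exact ContForward.div (.const 1) (((ContForward.const 1).add ((contForward_selfSim hμ).pow 2)).mul
    ((ContForward.const _).mul (contForward_qrt.pow 4)))
    fun x t ht => by have := qrt_pos ht; positivity

lemma contForward_wtAt (hμ : 0 < μ) : ContForward (wtAt b μ) := by
  refine ((ContForward.const _).mul (contForward_wtA1 hμ)).sub (ContForward.div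
    (((ContForward.comp Real.continuous_arctan (contForward_selfSim hμ)).sub (.const _)).add
      (ContForward.div (contForward_selfSim hμ) ((ContForward.const 1).add
        ((contForward_selfSim hμ).pow 2)) fun x t ht => by positivity))
    ((ContForward.const 2).mul (contForward_qrt.pow 6)) fun x t ht => ?_)
  have := qrt_pos ht; positivity

lemma contForward_wtB (hμ : 0 < μ) : ContForward (wtB b μ) :=
  (ContForward.const 1).sub (ContForward.comp Real.continuous_exp
    ((ContForward.const (-2)).mul ((contForward_selfSim hμ).pow 2)))

lemma contForward_wtB1 (hμ : 0 < μ) : ContForward (wtB1 b μ) :=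
  (((ContForward.const 4).mul (contForward_selfSim hμ)).mul (ContForward.comp Real.continuous_exp
    ((contForward_selfSim hμ).pow 2).neg)).mul (contForward_heatWeight hμ)

lemma contForward_wtBt (hμ : 0 < μ) : ContForward (wtBt b μ) :=
  ((ContForward.const _).mul (contForward_wtB1 hμ)).sub ((ContForward.const _).mul
    (((contForward_selfSim hμ).pow 2).mul ((contForward_heatWeight hμ).pow 2)))

lemma contForward_wtC1 (hμ : 0 < μ) : ContForward (wtC1 b μ) :=
  ((ContForward.const 1).sub ((ContForward.const 4).mul ((contForward_selfSim hμ).pow 2))).mul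
    ((contForward_heatWeight hμ).pow 2)

/-- Uniform bounds for the weights. -/
lemma exists_weight_bound (b : ℝ) (hμ : 0 < μ) : ∃ C, ∀ x t, 0 ≤ t →
    |wtA b μ x t| ≤ C ∧ |wtA1 b μ x t| ≤ C ∧ |wtAt b μ x t| ≤ C ∧ |wtB b μ x t| ≤ C ∧
    |wtB1 b μ x t| ≤ C ∧ |wtBt b μ x t| ≤ C ∧ |wtC b μ x t| ≤ C ∧ |wtC1 b μ x t| ≤ C := by
  have hm := sqrt_two_mul_pos hμ
  set n := 1 / √(2 * μ) with hn
  have hn0 : 0 < n := by positivity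
  have hb := Real.sqrt_nonneg b
  refine ⟨4 + √b * n + n + 3 + 1 + 4 * n + √b * (4 * n) + 4 * μ * n ^ 2 + 5 * n ^ 2,
    fun x t ht => ?_⟩
  have hp := one_le_qrt ht
  have hw0 := heatWeight_nonneg (b := b) (μ := μ) (x := x) (t := t)
  have hw := heatWeight_le (b := b) (x := x) hμ ht
  have hsw := abs_selfSim_mul_heatWeight_le (b := b) (x := x) hμ ht
  rw [← hn] at hw hsw
  have e0 : 0 ≤ √b * n := by positivity
  have e1 : 0 ≤ √b * (4 * n) := by positivity
  have e2 : 0 ≤ 4 * μ * n ^ 2 := by positivity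
  have e3 : 0 ≤ 5 * n ^ 2 := by positivity
  have hw2 : heatWeight b μ x t ^ 2 ≤ n ^ 2 := pow_le_pow_left₀ hw0 hw 2
  have hs2 : selfSim b μ x t ^ 2 * heatWeight b μ x t ^ 2 ≤ n ^ 2 := by
    have := pow_le_pow_left₀ (by positivity) hsw 2
    rwa [mul_pow, sq_abs] at this
  have hA : |wtA b μ x t| ≤ 4 := (abs_wtA_le ht).trans (div_le_self (by norm_num) (one_le_pow₀ hp))
  have hA1 : |wtA1 b μ x t| ≤ n := by
    rw [abs_of_nonneg wtA1_nonneg]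
    refine (wtA1_le hμ ht).trans (one_div_le_one_div_of_le hm ?_)
    exact le_mul_of_one_le_right hm.le (one_le_pow₀ hp)
  have hAt : |wtAt b μ x t| ≤ √b * n + 3 := by
    have h1 : |wtAt b μ x t + √b * wtA1 b μ x t| ≤ 3 :=
      (abs_wtAt_add_le ht).trans (div_le_self (by norm_num) (one_le_pow₀ hp))
    have h2 : |√b * wtA1 b μ x t| ≤ √b * n := by
      rw [abs_mul, abs_of_nonneg hb]; gcongr
    have h3 := abs_sub (wtAt b μ x t + √b * wtA1 b μ x t) (√b * wtA1 b μ x t)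
    rw [add_sub_cancel_right] at h3
    linarith
  have hB1 : |wtB1 b μ x t| ≤ 4 * n := abs_wtB1_le.trans (by linarith)
  have hBt : |wtBt b μ x t| ≤ √b * (4 * n) + 4 * μ * n ^ 2 := by
    refine (abs_sub _ _).trans (add_le_add ?_ ?_)
    · rw [abs_mul, abs_neg, abs_of_nonneg hb]; gcongr
    · rw [abs_mul, abs_of_pos (by positivity : 0 < 4 * μ), abs_of_nonneg (by positivity)]; gcongr
  have hC1 : |wtC1 b μ x t| ≤ 5 * n ^ 2 := by
    have : wtC1 b μ x t = heatWeight b μ x t ^ 2 -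
      4 * (selfSim b μ x t ^ 2 * heatWeight b μ x t ^ 2) := by unfold wtC1; ring
    have h0 : 0 ≤ selfSim b μ x t ^ 2 * heatWeight b μ x t ^ 2 := by positivity
    have h1 : 0 ≤ heatWeight b μ x t ^ 2 := by positivity
    rw [this, abs_le]
    constructor <;> linarith
  refine ⟨?_, ?_, ?_, abs_wtB_le.trans ?_, ?_, ?_, (abs_wtC_le.trans hsw).trans ?_, ?_⟩ <;> linarith

end

/-! ### Pointwise form of the weighted estimates -/

lemma sq_flux_mul_le {q η1 K φ g M ρ c d : ℝ} (hg0 : 0 ≤ g) (hη0 : 0 ≤ η1)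
    (hφ : |φ| ≤ M) (hq : |q| ≤ K * |φ| * (|φ| + g)) (e1 : M ^ 2 * η1 ≤ c * ρ)
    (e2 : g ^ 2 * η1 ≤ d * ρ) :
    η1 * q ^ 2 ≤ 2 * K ^ 2 * (c + d) * (φ ^ 2 * ρ) := by
  have hq2 : q ^ 2 ≤ K ^ 2 * φ ^ 2 * (2 * M ^ 2 + 2 * g ^ 2) := by
    calc q ^ 2 = |q| ^ 2 := (sq_abs q).symm
      _ ≤ (K * |φ| * (|φ| + g)) ^ 2 := by gcongr
      _ = K ^ 2 * φ ^ 2 * (|φ| + g) ^ 2 := by rw [mul_pow, mul_pow, sq_abs]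
      _ ≤ K ^ 2 * φ ^ 2 * (M + g) ^ 2 := by gcongr
      _ ≤ _ := by
        refine mul_le_mul_of_nonneg_left ?_ (by positivity)
        linarith [sq_nonneg (M - g)]
  calc η1 * q ^ 2 ≤ η1 * (K ^ 2 * φ ^ 2 * (2 * M ^ 2 + 2 * g ^ 2)) := by gcongr
    _ = 2 * (K ^ 2 * φ ^ 2) * (M ^ 2 * η1 + g ^ 2 * η1) := by ring
    _ ≤ 2 * (K ^ 2 * φ ^ 2) * (c * ρ + d * ρ) := by gcongr
    _ = _ := by ring

lemma flux_mul_slope_le {β μ dψ q I k η1 n Y : ℝ} (hβ : 0 < β) (hη0 : 0 ≤ η1) (hη1 : η1 ≤ n)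
    (hY : η1 * q ^ 2 ≤ Y) :
    -((μ * dψ + q + I) * (k * η1)) ≤ β / 2 * (η1 * k ^ 2) +
      3 / (2 * β) * ((μ ^ 2 + 1) * n * (dψ ^ 2 + I ^ 2) + Y) := by
  have e1 : -((μ * dψ + q + I) * (k * η1)) ≤
      β / 2 * (η1 * k ^ 2) + 1 / (2 * β) * (η1 * (μ * dψ + q + I) ^ 2) := by
    have : β / 2 * (η1 * k ^ 2) + 1 / (2 * β) * (η1 * (μ * dψ + q + I) ^ 2) +
        (μ * dψ + q + I) * (k * η1) =
        η1 / (2 * β) * (β * k + (μ * dψ + q + I)) ^ 2 := by field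
    have h : 0 ≤ η1 / (2 * β) * (β * k + (μ * dψ + q + I)) ^ 2 := by positivity
    linarith
  have e2 : (μ * dψ + q + I) ^ 2 ≤ 3 * ((μ ^ 2 + 1) * (dψ ^ 2 + I ^ 2)) + 3 * q ^ 2 := by
    have f1 : 0 ≤ μ ^ 2 * I ^ 2 := by positivity
    nlinarith [sq_nonneg (μ * dψ - q), sq_nonneg (μ * dψ - I), sq_nonneg (q - I),
      sq_nonneg dψ]
  have e3 : η1 * (μ * dψ + q + I) ^ 2 ≤ 3 * ((μ ^ 2 + 1) * n * (dψ ^ 2 + I ^ 2) + Y) := by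
    calc η1 * (μ * dψ + q + I) ^ 2 ≤
        η1 * (3 * ((μ ^ 2 + 1) * (dψ ^ 2 + I ^ 2)) + 3 * q ^ 2) := by gcongr
      _ = η1 * (3 * ((μ ^ 2 + 1) * (dψ ^ 2 + I ^ 2))) + 3 * (η1 * q ^ 2) := by ring
      _ ≤ n * (3 * ((μ ^ 2 + 1) * (dψ ^ 2 + I ^ 2))) + 3 * Y := by gcongr
      _ = _ := by ring
  have e4 := mul_le_mul_of_nonneg_left e3 (show 0 ≤ 1 / (2 * β) by positivity)
  have e5 : 1 / (2 * β) * (3 * ((μ ^ 2 + 1) * n * (dψ ^ 2 + I ^ 2) + Y)) =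
      3 / (2 * β) * ((μ ^ 2 + 1) * n * (dψ ^ 2 + I ^ 2) + Y) := by ring
  linarith

lemma flux_mul_deriv_le {q η K φ g M B p ρ dk : ℝ} (hp : 0 < p) (hK : 0 ≤ K) (hg0 : 0 ≤ g)
    (hη : |η| ≤ 4 / p ^ 2) (hgη : g * |η| ≤ B / p ^ 4)
    (hφ : |φ| ≤ M) (hq : |q| ≤ K * |φ| * (|φ| + g)) (h1 : M ^ 2 / p ^ 4 ≤ ρ)
    (h2 : 1 / p ^ 8 ≤ ρ) :
    -(q * (dk * η)) ≤ dk ^ 2 + 16 * K ^ 2 * (1 + B ^ 2) * (φ ^ 2 * ρ) := by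
  have hM : 0 ≤ M := (abs_nonneg _).trans hφ
  have hρ0 : 0 ≤ ρ := le_trans (by positivity) h1
  have hB : 0 ≤ B / p ^ 4 := le_trans (by positivity) hgη
  have e1 : |q * η| ≤ K * |φ| * (4 * (M / p ^ 2) + B / p ^ 4) := by
    rw [abs_mul]
    calc |q| * |η| ≤ K * |φ| * (|φ| + g) * |η| := by gcongr
      _ = K * |φ| * (|φ| * |η| + g * |η|) := by ring
      _ ≤ K * |φ| * (M * (4 / p ^ 2) + B / p ^ 4) := by gcongr
      _ = _ := by ring
  have e2 : (4 * (M / p ^ 2) + B / p ^ 4) ^ 2 ≤ 64 * (1 + B ^ 2) * ρ := by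
    calc (4 * (M / p ^ 2) + B / p ^ 4) ^ 2 ≤ 32 * (M / p ^ 2) ^ 2 + 2 * (B / p ^ 4) ^ 2 := by
          linarith [sq_nonneg (4 * (M / p ^ 2) - B / p ^ 4)]
      _ = 32 * (M ^ 2 / p ^ 4) + 2 * B ^ 2 * (1 / p ^ 8) := by field
      _ ≤ 32 * ρ + 2 * B ^ 2 * ρ := by gcongr
      _ ≤ _ := by linarith [mul_nonneg (sq_nonneg B) hρ0]
  have e3 : (q * η) ^ 2 ≤ 64 * K ^ 2 * (1 + B ^ 2) * (φ ^ 2 * ρ) := by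
    calc (q * η) ^ 2 = |q * η| ^ 2 := (sq_abs _).symm
      _ ≤ (K * |φ| * (4 * (M / p ^ 2) + B / p ^ 4)) ^ 2 := by gcongr
      _ = K ^ 2 * φ ^ 2 * (4 * (M / p ^ 2) + B / p ^ 4) ^ 2 := by
        rw [mul_pow, mul_pow, sq_abs]
      _ ≤ K ^ 2 * φ ^ 2 * (64 * (1 + B ^ 2) * ρ) := by gcongr
      _ = _ := by ring
  have := sq_nonneg (2 * dk + q * η)
  linarith

/-- The weighted estimate for `k`, with the weight `wtA`. -/
lemma pointwise_wtA {β μ m p B K M φ k dk dψ I q E η η1 γ g : ℝ} (hβ : 0 < β) (hμ : 0 < μ)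
    (hm : 0 < m) (hp : 1 ≤ p) (hB : 0 ≤ B) (hK : 0 ≤ K) (hM : 0 ≤ M)
    (hη : |η| ≤ 4 / p ^ 2) (hη0 : 0 ≤ η1) (hη1 : η1 ≤ 1 / (m * p ^ 4))
    (hγ : |γ| ≤ 3 / p ^ 6) (hg0 : 0 ≤ g) (hgη : g * |η| ≤ B / p ^ 4)
    (hgη1 : g ^ 2 * η1 ≤ B / p ^ 8)
    (hφ : |φ| ≤ M) (hk : |k| ≤ (1 + β) * M) (hq : |q| ≤ K * |φ| * (|φ| + g)) :
    1 / 2 * k ^ 2 * (γ - 2 * β * η1) - (μ * dψ + q + I) * (dk * η + k * η1) + μ * E * k * η ≤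
      -(β / 2 * (η1 * k ^ 2)) +
      (10 + 4 * μ ^ 2 + 3 * (μ ^ 2 + 1) / (2 * β * m) + 16 * K ^ 2 * (1 + B ^ 2) +
          3 * K ^ 2 / β * (1 / m + B) + 4 * μ * (1 + β)) *
        (dψ ^ 2 + dk ^ 2 + I ^ 2 + (φ ^ 2 + k ^ 2) * (M ^ 2 / p ^ 4 + 1 / p ^ 5) + M * |E|) := by
  have hp0 : 0 < p := by linarith
  have hp4 : 1 / p ^ 4 ≤ 1 := by
    rw [div_le_one (by positivity)]; exact one_le_pow₀ hp
  have hη1m : η1 ≤ 1 / m := hη1.trans (one_div_le_one_div_of_le hm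
    (le_mul_of_one_le_right hm.le (one_le_pow₀ hp)))
  have hη4 : |η| ≤ 4 := hη.trans (div_le_self (by norm_num) (one_le_pow₀ hp))
  obtain ⟨ρ, hρ⟩ : ∃ ρ, ρ = M ^ 2 / p ^ 4 + 1 / p ^ 5 := ⟨_, rfl⟩
  have hρ0 : 0 ≤ ρ := by rw [hρ]; positivity
  have hMρ : M ^ 2 / p ^ 4 ≤ ρ := by rw [hρ]; linarith [show 0 ≤ 1 / p ^ 5 by positivity]
  have h8ρ : 1 / p ^ 8 ≤ ρ := by
    have : 1 / p ^ 8 ≤ 1 / p ^ 5 :=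
      one_div_le_one_div_of_le (by positivity) (pow_le_pow_right₀ hp (by norm_num))
    rw [hρ]; linarith [show 0 ≤ M ^ 2 / p ^ 4 by positivity]
  have h6ρ : 1 / p ^ 6 ≤ ρ := by
    have : 1 / p ^ 6 ≤ 1 / p ^ 5 :=
      one_div_le_one_div_of_le (by positivity) (pow_le_pow_right₀ hp (by norm_num))
    rw [hρ]; linarith [show 0 ≤ M ^ 2 / p ^ 4 by positivity]
  rw [← hρ]
  -- the term with `γ`
  have h1 : 1 / 2 * k ^ 2 * γ ≤ 2 * (k ^ 2 * ρ) := by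
    have : γ ≤ 3 * ρ := by
      refine (le_abs_self γ).trans (hγ.trans ?_)
      rw [show 3 / p ^ 6 = 3 * (1 / p ^ 6) by ring]; linarith
    have h := mul_le_mul_of_nonneg_left this (sq_nonneg k)
    have := mul_nonneg (sq_nonneg k) hρ0
    linarith
  -- the flux difference against the slope of the weight
  have e1 : M ^ 2 * η1 ≤ 1 / m * ρ := by
    calc M ^ 2 * η1 ≤ M ^ 2 * (1 / (m * p ^ 4)) := by gcongr
      _ = 1 / m * (M ^ 2 / p ^ 4) := by field
      _ ≤ _ := by gcongr
  have e2 : g ^ 2 * η1 ≤ B * ρ := by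
    refine hgη1.trans ?_
    rw [div_eq_mul_one_div]; gcongr
  have h2 := flux_mul_slope_le (μ := μ) (dψ := dψ) (I := I) (k := k) hβ hη0 hη1m
    (sq_flux_mul_le hg0 hη0 hφ hq e1 e2)
  have e3 : 3 / (2 * β) * ((μ ^ 2 + 1) * (1 / m) * (dψ ^ 2 + I ^ 2) +
      2 * K ^ 2 * (1 / m + B) * (φ ^ 2 * ρ)) =
      3 * (μ ^ 2 + 1) / (2 * β * m) * (dψ ^ 2 + I ^ 2) +
        3 * K ^ 2 / β * (1 / m + B) * (φ ^ 2 * ρ) := by field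
  rw [e3] at h2
  -- the flux against the derivative of `k`
  have h3 : -((μ * dψ + I) * (dk * η)) ≤ 4 * μ ^ 2 * dψ ^ 2 + 4 * I ^ 2 + 2 * dk ^ 2 := by
    have e1 : -((μ * dψ + I) * (dk * η)) ≤ 4 * (|μ * dψ + I| * |dk|) := by
      refine (neg_le_abs _).trans ?_
      rw [abs_mul, abs_mul]
      calc |μ * dψ + I| * (|dk| * |η|) ≤ |μ * dψ + I| * (|dk| * 4) := by gcongr
        _ = _ := by ring
    have e2 := two_mul_le_add_sq |μ * dψ + I| |dk|
    rw [sq_abs, sq_abs] at e2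
    linarith [sq_nonneg (μ * dψ - I)]
  have h4 := flux_mul_deriv_le (dk := dk) hp0 hK hg0 hη hgη hφ hq hMρ h8ρ
  -- the viscous error
  have h5 : μ * E * k * η ≤ 4 * μ * (1 + β) * (M * |E|) := by
    refine (le_abs_self _).trans ?_
    rw [abs_mul, abs_mul, abs_mul, abs_of_pos hμ]
    calc μ * |E| * |k| * |η| ≤ μ * |E| * ((1 + β) * M) * 4 := by gcongr
      _ = _ := by ring
  have n1 : 0 ≤ dψ ^ 2 := sq_nonneg _
  have n2 : 0 ≤ dk ^ 2 := sq_nonneg _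
  have n3 : 0 ≤ I ^ 2 := sq_nonneg _
  have n4 : 0 ≤ φ ^ 2 * ρ := by positivity
  have n5 : 0 ≤ k ^ 2 * ρ := by positivity
  have n6 : 0 ≤ M * |E| := by positivity
  obtain ⟨X, hX⟩ : ∃ X, X = dψ ^ 2 + dk ^ 2 + I ^ 2 + (φ ^ 2 + k ^ 2) * ρ + M * |E| := ⟨_, rfl⟩
  have c1 : dψ ^ 2 + I ^ 2 ≤ X := by rw [hX]; linarith
  have c2 : φ ^ 2 * ρ ≤ X := by rw [hX]; linarith
  have c3 : M * |E| ≤ X := by rw [hX]; linarith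
  have c4 : 2 * (k ^ 2 * ρ) + 4 * I ^ 2 + 3 * dk ^ 2 ≤ 10 * X := by rw [hX]; linarith
  have c5 : dψ ^ 2 ≤ X := by rw [hX]; linarith
  rw [← hX]
  have d1 := mul_le_mul_of_nonneg_left c1 (show 0 ≤ 3 * (μ ^ 2 + 1) / (2 * β * m) by positivity)
  have d2 := mul_le_mul_of_nonneg_left c2 (show 0 ≤ 3 * K ^ 2 / β * (1 / m + B) by positivity)
  have d3 := mul_le_mul_of_nonneg_left c2 (show 0 ≤ 16 * K ^ 2 * (1 + B ^ 2) by positivity)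
  have d4 := mul_le_mul_of_nonneg_left c3 (show 0 ≤ 4 * μ * (1 + β) by positivity)
  have d5 := mul_le_mul_of_nonneg_left c5 (show 0 ≤ 4 * μ ^ 2 by positivity)
  have e : 1 / 2 * k ^ 2 * (γ - 2 * β * η1) - (μ * dψ + q + I) * (dk * η + k * η1) +
      μ * E * k * η = 1 / 2 * k ^ 2 * γ - β * (η1 * k ^ 2) + -((μ * dψ + q + I) * (k * η1)) +
      -((μ * dψ + I) * (dk * η)) + -(q * (dk * η)) + μ * E * k * η := by ring
  rw [e]
  linarith

lemma dissipation_mul_le {μ Z dh h θ θ1 s w : ℝ} (hμ : 0 < μ) (hθ : |θ| ≤ 1)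
    (hθ1 : |θ1| ≤ 4 * (|s| * w)) :
    -(Z * (dh * θ + h * θ1)) ≤ (1 + 8 / μ) * Z ^ 2 + dh ^ 2 + μ / 2 * (s ^ 2 * w ^ 2 * h ^ 2) := by
  have e1 : -(Z * (dh * θ)) ≤ |Z| * |dh| := by
    refine (neg_le_abs _).trans ?_
    rw [abs_mul, abs_mul]
    exact mul_le_mul_of_nonneg_left (mul_le_of_le_one_right (abs_nonneg _) hθ) (abs_nonneg _)
  have e2 : -(Z * (h * θ1)) ≤ 4 * |Z| * (|s| * w * |h|) := by
    refine (neg_le_abs _).trans ?_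
    rw [abs_mul, abs_mul]
    calc |Z| * (|h| * |θ1|) ≤ |Z| * (|h| * (4 * (|s| * w))) := by gcongr
      _ = _ := by ring
  have e3 : 4 * |Z| * (|s| * w * |h|) ≤ 8 / μ * Z ^ 2 + μ / 2 * (s ^ 2 * w ^ 2 * h ^ 2) := by
    have : 8 / μ * Z ^ 2 + μ / 2 * (s ^ 2 * w ^ 2 * h ^ 2) - 4 * |Z| * (|s| * w * |h|) =
        (1 / (2 * μ)) * (4 * |Z| - μ * (|s| * w * |h|)) ^ 2 := by
      rw [← sq_abs Z, ← sq_abs s, ← sq_abs h]; field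
    have h0 : 0 ≤ (1 / (2 * μ)) * (4 * |Z| - μ * (|s| * w * |h|)) ^ 2 := by positivity
    linarith
  have e4 := two_mul_le_add_sq |Z| |dh|
  rw [sq_abs, sq_abs] at e4
  linarith [sq_nonneg Z, sq_nonneg dh]

/-- The product of flux difference and perturbation is controlled by the relative stress. -/
lemma abs_flux_mul_le {q R f φ g ν B c : ℝ} (hc : 0 ≤ c) (hR : 0 ≤ R) (hf : 0 ≤ f)
    (hq : q = R + f * φ) (hfφ : f * φ ^ 2 ≤ c * (g + |φ|) * R) (hφ : |φ| ≤ ν) (hg : g ≤ B * ν) :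
    |q| * |φ| ≤ (1 + c * (B + 1)) * (ν * R) := by
  have e1 : |q| ≤ R + f * |φ| := by
    rw [hq]
    refine (abs_add_le _ _).trans_eq ?_
    rw [abs_of_nonneg hR, abs_mul, abs_of_nonneg hf]
  calc |q| * |φ| ≤ (R + f * |φ|) * |φ| := by gcongr
    _ = R * |φ| + f * φ ^ 2 := by rw [← sq_abs φ]; ring
    _ ≤ R * ν + c * (B * ν + ν) * R := by
      refine add_le_add (by gcongr) (hfφ.trans ?_)
      gcongr
    _ = _ := by ring

/-- Where the stress is nonlinear the composite wave exceeds `a` by little, so that the flux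
difference is controlled by the relative stress and by the estimate for `k`. -/
lemma abs_flux_mul_slope_le {β μ K B q R f φ g k h θ1 s w ν η : ℝ} (hβ : 0 < β) (hμ : 0 < μ)
    (hK : 0 ≤ K) (hB : 0 ≤ B) (hR : 0 ≤ R) (hf : 0 ≤ f) (hq : q = R + f * φ)
    (hφk : 2 * β * φ = k - h) (hk : |k| ≤ (1 + β) * ν) (hfg : f ≤ K * g)
    (hθ1 : |θ1| ≤ 4 * w) (hgθ1 : g * |θ1| ≤ B * ((1 + |s|) * |s| * w ^ 2))
    (hη : (1 + s ^ 2) * w ^ 2 ≤ η) :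
    |q| * |k| * |θ1| ≤ 4 * (1 + β) * (ν * (w * R)) + μ / 4 * (s ^ 2 * w ^ 2 * h ^ 2) +
      (2 * (K * B / (2 * β)) + 2 * (K * B / (2 * β)) ^ 2 / μ) * (η * k ^ 2) := by
  have e1 : |q| ≤ R + f * |φ| := by
    rw [hq]
    refine (abs_add_le _ _).trans_eq ?_
    rw [abs_of_nonneg hR, abs_mul, abs_of_nonneg hf]
  have e2 : |φ| ≤ (|k| + |h|) / (2 * β) := by
    rw [le_div_iff₀ (by positivity), mul_comm]
    calc 2 * β * |φ| = |2 * β * φ| := by rw [abs_mul, abs_of_pos (by positivity : 0 < 2 * β)]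
      _ ≤ _ := by rw [hφk]; exact abs_sub _ _
  obtain ⟨A, hA⟩ : ∃ A, A = K * B / (2 * β) := ⟨_, rfl⟩
  have hA0 : 0 ≤ A := by rw [hA]; positivity
  rw [← hA]
  have e3 : f * |φ| * |k| * |θ1| ≤ A * ((1 + |s|) * |s| * w ^ 2 * ((|k| + |h|) * |k|)) := by
    calc f * |φ| * |k| * |θ1| ≤ (K * g) * ((|k| + |h|) / (2 * β)) * |k| * |θ1| := by
          gcongr
          exact hf.trans hfg
      _ = K / (2 * β) * ((|k| + |h|) * |k|) * (g * |θ1|) := by field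
      _ ≤ K / (2 * β) * ((|k| + |h|) * |k|) * (B * ((1 + |s|) * |s| * w ^ 2)) := by gcongr
      _ = _ := by rw [hA]; field
  have e4 : (1 + |s|) * |s| * w ^ 2 * (|k| * |k|) ≤ 2 * (η * k ^ 2) := by
    have : (1 + |s|) * |s| ≤ 2 * (1 + s ^ 2) := by
      rw [← sq_abs s]; nlinarith [sq_nonneg (|s| - 1)]
    calc (1 + |s|) * |s| * w ^ 2 * (|k| * |k|) ≤ 2 * (1 + s ^ 2) * w ^ 2 * (|k| * |k|) := by gcongr
      _ = 2 * ((1 + s ^ 2) * w ^ 2) * k ^ 2 := by rw [abs_mul_abs_self]; ring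
      _ ≤ 2 * η * k ^ 2 := by gcongr
      _ = _ := by ring
  have e5 : A * ((1 + |s|) * |s| * w ^ 2 * (|h| * |k|)) ≤
      μ / 4 * (s ^ 2 * w ^ 2 * h ^ 2) + 2 * A ^ 2 / μ * (η * k ^ 2) := by
    have f1 : μ / 4 * (s ^ 2 * w ^ 2 * h ^ 2) + A ^ 2 / μ * ((1 + |s|) ^ 2 * w ^ 2 * k ^ 2) -
        A * ((1 + |s|) * |s| * w ^ 2 * (|h| * |k|)) =
        1 / (4 * μ) * (μ * (|s| * w * |h|) - 2 * A * ((1 + |s|) * w * |k|)) ^ 2 := by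
      rw [← sq_abs s, ← sq_abs h, ← sq_abs k]; field
    have f2 : 0 ≤ 1 / (4 * μ) * (μ * (|s| * w * |h|) - 2 * A * ((1 + |s|) * w * |k|)) ^ 2 := by
      positivity
    have f3 : (1 + |s|) ^ 2 ≤ 2 * (1 + s ^ 2) := by
      rw [← sq_abs s]; nlinarith [sq_nonneg (|s| - 1)]
    have f4 : (1 + |s|) ^ 2 * w ^ 2 * k ^ 2 ≤ 2 * (η * k ^ 2) := by
      calc (1 + |s|) ^ 2 * w ^ 2 * k ^ 2 ≤ 2 * (1 + s ^ 2) * w ^ 2 * k ^ 2 := by gcongr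
        _ = 2 * ((1 + s ^ 2) * w ^ 2) * k ^ 2 := by ring
        _ ≤ 2 * η * k ^ 2 := by gcongr
        _ = _ := by ring
    have f5 : A ^ 2 / μ * ((1 + |s|) ^ 2 * w ^ 2 * k ^ 2) ≤ A ^ 2 / μ * (2 * (η * k ^ 2)) := by
      gcongr
    have f6 : A ^ 2 / μ * (2 * (η * k ^ 2)) = 2 * A ^ 2 / μ * (η * k ^ 2) := by ring
    linarith
  have e6 : R * |k| * |θ1| ≤ 4 * (1 + β) * (ν * (w * R)) := by
    calc R * |k| * |θ1| ≤ R * ((1 + β) * ν) * (4 * w) := by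
          gcongr
          exact mul_nonneg hR ((abs_nonneg _).trans hk)
      _ = _ := by ring
  have e7 := mul_le_mul_of_nonneg_left e4 hA0
  calc |q| * |k| * |θ1| ≤ (R + f * |φ|) * |k| * |θ1| := by gcongr
    _ = R * |k| * |θ1| + f * |φ| * |k| * |θ1| := by ring
    _ ≤ 4 * (1 + β) * (ν * (w * R)) + A * ((1 + |s|) * |s| * w ^ 2 * ((|k| + |h|) * |k|)) :=
      add_le_add e6 e3
    _ = 4 * (1 + β) * (ν * (w * R)) + (A * ((1 + |s|) * |s| * w ^ 2 * (|k| * |k|)) +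
        A * ((1 + |s|) * |s| * w ^ 2 * (|h| * |k|))) := by ring
    _ ≤ _ := by linarith

lemma mul_gaussian_term_le {μ h dh χ s w : ℝ} (hμ : 0 < μ) (hχ : |χ| ≤ |s| * w) :
    -(μ / 5 * (h ^ 2 * ((1 - 4 * s ^ 2) * w ^ 2) + 2 * h * dh * χ)) ≤
      -(μ / 5 * (w ^ 2 * h ^ 2)) + μ * (s ^ 2 * w ^ 2 * h ^ 2) + μ / 5 * dh ^ 2 := by
  have e1 : -(2 * h * dh * χ) ≤ s ^ 2 * w ^ 2 * h ^ 2 + dh ^ 2 := by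
    calc -(2 * h * dh * χ) ≤ |2 * h * dh * χ| := neg_le_abs _
      _ = 2 * |h| * |dh| * |χ| := by rw [abs_mul, abs_mul, abs_mul, abs_two]
      _ ≤ 2 * |h| * |dh| * (|s| * w) := by gcongr
      _ = 2 * (|s| * w * |h|) * |dh| := by ring
      _ ≤ (|s| * w * |h|) ^ 2 + |dh| ^ 2 := two_mul_le_add_sq _ _
      _ = _ := by rw [mul_pow, mul_pow, sq_abs, sq_abs, sq_abs]
  have e2 := mul_le_mul_of_nonneg_left e1 (show 0 ≤ μ / 5 by positivity)
  linarith

/-- The weighted estimate for `h`, with the weight `wtB`. -/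
lemma pointwise_wtB {β μ c m p B K M ν φ k h dh dψ I X2 X3 D q R P f E θ θ1 χ s w g η1 : ℝ}
    (hβ : 0 < β) (hμ : 0 < μ) (hc : 0 ≤ c) (hp : 1 ≤ p) (hB : 0 ≤ B) (hK : 0 ≤ K)
    (hM : 0 ≤ M) (hw : 0 ≤ w) (hθ0 : 0 ≤ θ) (hθ : θ ≤ 1) (hθ1 : |θ1| ≤ 4 * w)
    (hθ1' : |θ1| ≤ 4 * (|s| * w)) (hχ : |χ| ≤ |s| * w)
    (hgθ1 : g * |θ1| ≤ B * ((1 + |s|) * |s| * w ^ 2)) (hη : (1 + s ^ 2) * w ^ 2 ≤ η1 / m)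
    (hφk : 2 * β * φ = k - h) (hφ : |φ| ≤ ν) (hk : |k| ≤ (1 + β) * ν) (hh : |h| ≤ (1 + β) * M)
    (hR0 : 0 ≤ R) (hR : R ≤ K * φ ^ 2) (hf : 0 ≤ f) (hfg : f ≤ K * g) (hg : g ≤ B * ν)
    (hq : q = R + f * φ) (hqφ : |q| ≤ K * |φ|) (hfφ : f * φ ^ 2 ≤ B * (g + |φ|) * R)
    (hP0 : 0 ≤ P) (hP : P ≤ |q| * |φ|) (hX3 : |X3| ≤ B / p ^ 5) (hD : D ≤ c * X3) :
    -(2 * μ * (s ^ 2 * w ^ 2 * h ^ 2)) - (μ * dψ + I + μ ^ 2 / 4 * X2) * (dh * θ + h * θ1) -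
      q * h * θ1 + μ * E * h * θ - c * q * X3 * θ + R * D * θ +
      P * (-(2 * β * θ1) - 4 * μ * (s ^ 2 * w ^ 2)) -
      μ / 5 * (h ^ 2 * ((1 - 4 * s ^ 2) * w ^ 2) + 2 * h * dh * χ) ≤
    -(μ / 5 * (w ^ 2 * h ^ 2)) +
      (2 * (K * B / (2 * β)) + 2 * (K * B / (2 * β)) ^ 2 / μ) / m * (η1 * k ^ 2) +
      ((1 + 8 / μ) * (3 * (1 + μ ^ 2 + μ ^ 4)) + (1 + μ / 5) + μ * (1 + β) + c * K * (1 + B) +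
        (4 * (1 + β) + 16 * β * (1 + B * (B + 1)))) *
      (dψ ^ 2 + dh ^ 2 + I ^ 2 + X2 ^ 2 + φ ^ 2 * (1 / p ^ 5) + p ^ 5 * X3 ^ 2 + M * |E| +
        ν * (w * R)) := by
  have hp0 : 0 < p := by linarith
  have hν : 0 ≤ ν := (abs_nonneg _).trans hφ
  have hθa : |θ| ≤ 1 := by rwa [abs_of_nonneg hθ0]
  have t1 := dissipation_mul_le (Z := μ * dψ + I + μ ^ 2 / 4 * X2) (dh := dh) (h := h) hμ hθa hθ1'
  have t2 := mul_gaussian_term_le (h := h) (dh := dh) hμ hχ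
  have t3 := abs_flux_mul_slope_le hβ hμ hK hB hR0 hf hq hφk hk hfg hθ1 hgθ1 hη
  have t4 := abs_flux_mul_le hB hR0 hf hq hfφ hφ hg
  have z1 : (μ * dψ + I + μ ^ 2 / 4 * X2) ^ 2 ≤
      3 * (1 + μ ^ 2 + μ ^ 4) * (dψ ^ 2 + I ^ 2 + X2 ^ 2) := by
    have f1 : (μ * dψ + I + μ ^ 2 / 4 * X2) ^ 2 ≤
        3 * (μ ^ 2 * dψ ^ 2 + I ^ 2 + μ ^ 4 / 16 * X2 ^ 2) := by
      linarith [sq_nonneg (μ * dψ - I), sq_nonneg (μ * dψ - μ ^ 2 / 4 * X2),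
        sq_nonneg (I - μ ^ 2 / 4 * X2)]
    have f2 : 0 ≤ dψ ^ 2 + I ^ 2 + X2 ^ 2 := by positivity
    have f3 : 0 ≤ μ ^ 2 * (I ^ 2 + X2 ^ 2) := by positivity
    have f4 : 0 ≤ μ ^ 4 * (dψ ^ 2 + I ^ 2) := by positivity
    have f5 : 0 ≤ μ ^ 4 * X2 ^ 2 := by positivity
    linarith [sq_nonneg dψ, sq_nonneg X2]
  have z2 := mul_le_mul_of_nonneg_left z1 (show 0 ≤ 1 + 8 / μ by positivity)
  -- the flux term
  have u1 : -(q * h * θ1) ≤ |q| * |k| * |θ1| + 8 * β * (1 + B * (B + 1)) * (ν * (w * R)) := by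
    have f1 : -(q * h * θ1) = -(q * k * θ1) + 2 * β * (q * φ * θ1) := by
      rw [show h = k - 2 * β * φ by linarith]; ring
    have f2 : -(q * k * θ1) ≤ |q| * |k| * |θ1| := by
      rw [← abs_mul, ← abs_mul]; exact neg_le_abs _
    have f3 : q * φ * θ1 ≤ (1 + B * (B + 1)) * (ν * R) * (4 * w) := by
      refine (le_abs_self _).trans ?_
      rw [abs_mul, abs_mul]
      gcongr
    have f4 := mul_le_mul_of_nonneg_left f3 (show 0 ≤ 2 * β by positivity)
    linarith
  have u2 : P * (-(2 * β * θ1) - 4 * μ * (s ^ 2 * w ^ 2)) ≤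
      8 * β * (1 + B * (B + 1)) * (ν * (w * R)) := by
    have f1 : P * (-(2 * β * θ1) - 4 * μ * (s ^ 2 * w ^ 2)) ≤ P * (2 * β * |θ1|) := by
      refine mul_le_mul_of_nonneg_left ?_ hP0
      have g1 := mul_le_mul_of_nonneg_left (neg_le_abs θ1) (show 0 ≤ 2 * β by positivity)
      have g2 : 0 ≤ 4 * μ * (s ^ 2 * w ^ 2) := by positivity
      linarith
    have f2 : P * (2 * β * |θ1|) ≤ (1 + B * (B + 1)) * (ν * R) * (2 * β * (4 * w)) := by
      gcongr
      exact hP.trans t4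
    linarith
  have u3 : μ * E * h * θ ≤ μ * (1 + β) * (M * |E|) := by
    refine (le_abs_self _).trans ?_
    rw [abs_mul, abs_mul, abs_mul, abs_of_pos hμ]
    calc μ * |E| * |h| * |θ| ≤ μ * |E| * ((1 + β) * M) * 1 := by gcongr
      _ = _ := by ring
  have u4 : -(c * q * X3 * θ) ≤ c * K * (φ ^ 2 * (1 / p ^ 5) + p ^ 5 * X3 ^ 2) := by
    have f1 : -(c * q * X3 * θ) ≤ c * (K * |φ|) * |X3| * 1 := by
      refine (neg_le_abs _).trans ?_
      rw [abs_mul, abs_mul, abs_mul, abs_of_nonneg hc]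
      gcongr
    have f2 : |φ| * |X3| ≤ φ ^ 2 * (1 / p ^ 5) + p ^ 5 * X3 ^ 2 := by
      have g1 : φ ^ 2 * (1 / p ^ 5) + p ^ 5 * X3 ^ 2 - 2 * (|φ| * |X3|) =
          1 / p ^ 5 * (|φ| - p ^ 5 * |X3|) ^ 2 := by
        rw [← sq_abs φ, ← sq_abs X3]; field
      have g2 : 0 ≤ 1 / p ^ 5 * (|φ| - p ^ 5 * |X3|) ^ 2 := by positivity
      have g3 : 0 ≤ |φ| * |X3| := by positivity
      linarith
    have f3 := mul_le_mul_of_nonneg_left f2 (show 0 ≤ c * K by positivity)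
    linarith
  have u5 : R * D * θ ≤ c * K * B * (φ ^ 2 * (1 / p ^ 5)) := by
    calc R * D * θ ≤ R * (c * (B / p ^ 5)) * θ := by
          gcongr
          exact hD.trans (mul_le_mul_of_nonneg_left ((le_abs_self _).trans hX3) hc)
      _ ≤ K * φ ^ 2 * (c * (B / p ^ 5)) * 1 := by gcongr
      _ = _ := by ring
  have n1 : 0 ≤ dψ ^ 2 := sq_nonneg _
  have n2 : 0 ≤ dh ^ 2 := sq_nonneg _
  have n3 : 0 ≤ I ^ 2 := sq_nonneg _
  have n4 : 0 ≤ X2 ^ 2 := sq_nonneg _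
  have n5 : 0 ≤ φ ^ 2 * (1 / p ^ 5) := by positivity
  have n6 : 0 ≤ p ^ 5 * X3 ^ 2 := by positivity
  have n7 : 0 ≤ M * |E| := by positivity
  have n8 : 0 ≤ ν * (w * R) := by positivity
  have n9 : 0 ≤ s ^ 2 * w ^ 2 * h ^ 2 := by positivity
  obtain ⟨X, hX⟩ : ∃ X, X = dψ ^ 2 + dh ^ 2 + I ^ 2 + X2 ^ 2 + φ ^ 2 * (1 / p ^ 5) +
    p ^ 5 * X3 ^ 2 + M * |E| + ν * (w * R) := ⟨_, rfl⟩
  rw [← hX]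
  have c1 : dψ ^ 2 + I ^ 2 + X2 ^ 2 ≤ X := by rw [hX]; linarith
  have c2 : dh ^ 2 ≤ X := by rw [hX]; linarith
  have c3 : M * |E| ≤ X := by rw [hX]; linarith
  have c4 : φ ^ 2 * (1 / p ^ 5) + p ^ 5 * X3 ^ 2 ≤ X := by rw [hX]; linarith
  have c5 : φ ^ 2 * (1 / p ^ 5) ≤ X := by linarith
  have c6 : ν * (w * R) ≤ X := by rw [hX]; linarith
  have d1 := mul_le_mul_of_nonneg_left c1
    (show 0 ≤ (1 + 8 / μ) * (3 * (1 + μ ^ 2 + μ ^ 4)) by positivity)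
  have d2 := mul_le_mul_of_nonneg_left c2 (show 0 ≤ 1 + μ / 5 by positivity)
  have d3 := mul_le_mul_of_nonneg_left c3 (show 0 ≤ μ * (1 + β) by positivity)
  have d4 := mul_le_mul_of_nonneg_left c4 (show 0 ≤ c * K by positivity)
  have d5 := mul_le_mul_of_nonneg_left c5 (show 0 ≤ c * K * B by positivity)
  have d6 := mul_le_mul_of_nonneg_left c6
    (show 0 ≤ 4 * (1 + β) + 16 * β * (1 + B * (B + 1)) by positivity)
  have d7 : 0 ≤ μ / 4 * (s ^ 2 * w ^ 2 * h ^ 2) := by positivity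
  have e8 : (2 * (K * B / (2 * β)) + 2 * (K * B / (2 * β)) ^ 2 / μ) * (η1 / m * k ^ 2) =
      (2 * (K * B / (2 * β)) + 2 * (K * B / (2 * β)) ^ 2 / μ) / m * (η1 * k ^ 2) := by ring
  rw [e8] at t3
  generalize (2 * (K * B / (2 * β)) + 2 * (K * B / (2 * β)) ^ 2 / μ) / m * (η1 * k ^ 2) = Y at *
  clear e8 n1 n2 n3 n4 n5 n6 n7 n8 hX c1 c2 c3 c4 c5 c6
  linarith

/-! ### Fluxes -/

/-- `f ∈ H¹` with derivative `f'` almost everywhere. -/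
structure H1Pair (f f' : ℝ → ℝ) : Prop where
  locAC : LocAC f
  memLp : MemLp f 2 volume
  hasDerivAt : ∀ᵐ x, HasDerivAt f (f' x) x
  memLp' : MemLp f' 2 volume

/-- `F ∈ W^{1,1}` with derivative `F'` almost everywhere. -/
structure IsFlux (F F' : ℝ → ℝ) : Prop where
  locAC : LocAC F
  integrable : Integrable F
  hasDerivAt : ∀ᵐ x, HasDerivAt F (F' x) x
  integrable' : Integrable F'

lemma integrable_mul_of_bounded {α : Type*} [MeasurableSpace α] {ν : Measure α} {f η : α → ℝ}
    {c : ℝ} (hf : Integrable f ν) (hη : AEStronglyMeasurable η ν) (hb : ∀ x, |η x| ≤ c) :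
    Integrable (fun x => f x * η x) ν :=
  hf.mul_bdd hη (ae_of_all _ hb)

namespace IsFlux

variable {F F' G G' : ℝ → ℝ}

lemma integral_eq_zero (h : IsFlux F F') : ∫ x, F' x = 0 := by
  have e : F' =ᵐ[volume] deriv F := by
    filter_upwards [h.hasDerivAt] with x hx using hx.deriv.symm
  rw [integral_congr_ae e]
  exact h.locAC.integral_deriv_eq_zero h.integrable (h.integrable'.congr e)

lemma add (hF : IsFlux F F') (hG : IsFlux G G') :
    IsFlux (fun x => F x + G x) (fun x => F' x + G' x) :=
  ⟨hF.locAC.add hG.locAC, hF.integrable.add hG.integrable, by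
    filter_upwards [hF.hasDerivAt, hG.hasDerivAt] with x h1 h2 using h1.add h2,
    hF.integrable'.add hG.integrable'⟩

lemma const_mul (c : ℝ) (hF : IsFlux F F') : IsFlux (fun x => c * F x) (fun x => c * F' x) :=
  ⟨hF.locAC.const_mul c, hF.integrable.const_mul c, by
    filter_upwards [hF.hasDerivAt] with x h1 using h1.const_mul c, hF.integrable'.const_mul c⟩

lemma mul_bounded {η η' : ℝ → ℝ} {c : ℝ} (hF : IsFlux F F') (h : ∀ x, HasDerivAt η (η' x) x)
    (hc : Continuous η') (hb : ∀ x, |η x| ≤ c) (hb' : ∀ x, |η' x| ≤ c) :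
    IsFlux (fun x => F x * η x) (fun x => F' x * η x + F x * η' x) := by
  have hl := LocAC.of_hasDerivAt h hc
  refine ⟨hF.locAC.mul hl, integrable_mul_of_bounded hF.integrable
    hl.continuous.aestronglyMeasurable hb, ?_, (integrable_mul_of_bounded hF.integrable'
    hl.continuous.aestronglyMeasurable hb).add (integrable_mul_of_bounded hF.integrable
    hc.aestronglyMeasurable hb')⟩
  filter_upwards [hF.hasDerivAt] with x h1 using h1.mul (h x)

end IsFlux

namespace H1Pair

variable {f f' g g' : ℝ → ℝ}

lemma of_inH1 (hf : InH1 f) : H1Pair f (deriv f) :=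
  ⟨hf.locAC, hf.memLp, hf.locAC.ae_hasDerivAt, hf.memLp_deriv⟩

lemma of_hasDerivAt (h : ∀ x, HasDerivAt f (f' x) x) (hc : Continuous f')
    (h2 : Integrable fun x => f x ^ 2) (h2' : Integrable fun x => f' x ^ 2) : H1Pair f f' := by
  have hl := LocAC.of_hasDerivAt h hc
  exact ⟨hl, (memLp_two_iff_integrable_sq hl.continuous.aestronglyMeasurable).2 h2, ae_of_all _ h,
    (memLp_two_iff_integrable_sq hc.aestronglyMeasurable).2 h2'⟩

lemma add (hf : H1Pair f f') (hg : H1Pair g g') :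
    H1Pair (fun x => f x + g x) (fun x => f' x + g' x) :=
  ⟨hf.locAC.add hg.locAC, hf.memLp.add hg.memLp, by
    filter_upwards [hf.hasDerivAt, hg.hasDerivAt] with x h1 h2 using h1.add h2,
    hf.memLp'.add hg.memLp'⟩

lemma const_mul (c : ℝ) (hf : H1Pair f f') : H1Pair (fun x => c * f x) (fun x => c * f' x) :=
  ⟨hf.locAC.const_mul c, hf.memLp.const_mul c, by
    filter_upwards [hf.hasDerivAt] with x h1 using h1.const_mul c, hf.memLp'.const_mul c⟩

lemma sub (hf : H1Pair f f') (hg : H1Pair g g') :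
    H1Pair (fun x => f x - g x) (fun x => f' x - g' x) :=
  ⟨hf.locAC.sub hg.locAC, hf.memLp.sub hg.memLp, by
    filter_upwards [hf.hasDerivAt, hg.hasDerivAt] with x h1 h2 using h1.sub h2,
    hf.memLp'.sub hg.memLp'⟩

lemma mul (hf : H1Pair f f') (hg : H1Pair g g') :
    IsFlux (fun x => f x * g x) (fun x => f' x * g x + f x * g' x) :=
  ⟨hf.locAC.mul hg.locAC, hf.memLp.integrable_mul hg.memLp, by
    filter_upwards [hf.hasDerivAt, hg.hasDerivAt] with x h1 h2 using h1.mul h2,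
    (hf.memLp'.integrable_mul hg.memLp).add (hf.memLp.integrable_mul hg.memLp')⟩

end H1Pair

/-! ### Uniform bounds for the derivatives of the composite wave -/

section

variable {a b μ κ K B : ℝ} {σ : ℝ → ℝ} {vm vp x t : ℝ}

lemma StressBounds.vr1_le_const (hσ : StressBounds a b κ K σ) (hvp : vp ∈ Icc a (a + 1))
    (h1 : lam σ vp - lam σ a ≤ 1) (ht : 0 ≤ t) : vr1 σ a vp x t ≤ 2 * K / κ * 2 := by
  have hκ := hσ.κ_pos
  have hK := hσ.K_pos
  refine (hσ.vr1_le hvp ht).trans (mul_le_mul_of_nonneg_left ?_ (by positivity))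
  refine (burgers1_le (hσ.lam_le hvp) h1 ht).trans ?_
  rw [div_le_iff₀ (by linarith)]
  linarith

lemma NearStates.Xi1_le_const (hs : NearStates σ a b μ vm vp) (hμ : 0 < μ) (ht : 0 ≤ t) :
    |Xi1 a b μ vm x t| ≤ 1 / √(2 * μ) := by
  rw [abs_of_nonneg (Xi1_nonneg hs.vm_le)]
  exact (hs.Xi1_le_sub hμ ht).trans (mul_le_of_le_one_left (by positivity) hs.sub_vm_le)

lemma NearStates.abs_Xi2_le_const (hs : NearStates σ a b μ vm vp) (hμ : 0 < μ) (ht : 0 ≤ t) :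
    |Xi2 a b μ vm x t| ≤ 2 / (2 * μ) := by
  have hm := sqrt_two_mul_pos hμ
  have hm2 : √(2 * μ) ^ 2 = 2 * μ := Real.sq_sqrt (by positivity)
  have hp := one_le_qrt ht
  have hL := width_pos (t := t) hμ (by linarith)
  have hLm : √(2 * μ) ≤ width μ t := by
    rw [width_eq hμ]; exact le_mul_of_one_le_right hm.le (one_le_pow₀ hp)
  have h1 : Xi1 a b μ vm x t ≤ heatWeight b μ x t :=
    (Xi1_le hs.vm_le).trans (mul_le_of_le_one_left heatWeight_nonneg hs.sub_vm_le)
  have h2 := abs_selfSim_mul_heatWeight_le (b := b) (x := x) hμ ht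
  rw [Xi2, abs_mul, abs_neg, abs_div, abs_mul, abs_two, abs_of_pos hL,
    abs_of_nonneg (Xi1_nonneg hs.vm_le), ← hm2]
  calc 2 * |selfSim b μ x t| / width μ t * Xi1 a b μ vm x t
      ≤ 2 * |selfSim b μ x t| / width μ t * heatWeight b μ x t := by gcongr
    _ = 2 * (|selfSim b μ x t| * heatWeight b μ x t) / width μ t := by ring
    _ ≤ 2 * (1 / √(2 * μ)) / √(2 * μ) := by gcongr
    _ = _ := by field

lemma WaveBounds.abs_Xi3_le_const (hw : WaveBounds B σ a b μ vm vp) (ht : 0 ≤ t) :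
    |Xi3 a b μ vm x t| ≤ B :=
  (hw.abs_Xi3_le x t ht).trans (div_le_self (by linarith [hw.one_le])
    (one_le_pow₀ (one_le_qrt ht)))

lemma NearStates.exists_deriv_bound (hσ : StressBounds a b κ K σ) (hμ : 0 < μ) (B : ℝ) :
    ∃ C, ∀ vm vp x t, NearStates σ a b μ vm vp → WaveBounds B σ a b μ vm vp → 0 ≤ t →
      |vhatX σ a b μ vm vp x t| ≤ C ∧ |vhatT σ a b μ vm vp x t| ≤ C := by
  have hκ := hσ.κ_pos
  have hK := hσ.K_pos
  obtain ⟨x1, hx1⟩ : ∃ c, c = 1 / √(2 * μ) := ⟨_, rfl⟩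
  obtain ⟨x2, hx2⟩ : ∃ c, c = 2 / (2 * μ) := ⟨_, rfl⟩
  obtain ⟨r1, hr1⟩ : ∃ c, c = 2 * K / κ * 2 := ⟨_, rfl⟩
  have p1 : 0 ≤ x1 := by rw [hx1]; positivity
  have p2 : 0 ≤ x2 := by rw [hx2]; positivity
  have p3 : 0 ≤ r1 := by rw [hr1]; positivity
  set c1 := μ / (4 * √b)
  have hc1 : 0 ≤ c1 := by positivity
  have hb := Real.sqrt_nonneg b
  refine ⟨(x1 + c1 * x2 + r1) + (√b * (c1 * x2 + x1) + K * r1 + μ ^ 2 / (8 * √b) * |B|),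
    fun vm vp x t hs hw ht => ?_⟩
  have q1 := hs.Xi1_le_const hμ ht (x := x)
  have q2 := hs.abs_Xi2_le_const hμ ht (x := x)
  have q3 := hw.abs_Xi3_le_const ht (x := x)
  have q4 := hσ.vr1_le_const (hs.vp_mem hμ) hs.lam_sub_le ht (x := x)
  have q5 := hσ.vr1_nonneg (hs.vp_mem hμ) ht (x := x)
  rw [← hx1] at q1
  rw [← hx2] at q2
  rw [← hr1] at q4
  have q2' : |c1 * Xi2 a b μ vm x t| ≤ c1 * x2 := by
    rw [abs_mul, abs_of_nonneg hc1]; gcongr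
  have n1 : 0 ≤ √b * (c1 * x2 + x1) + K * r1 + μ ^ 2 / (8 * √b) * |B| := by positivity
  have n2 : 0 ≤ x1 + c1 * x2 + r1 := by positivity
  constructor
  · have : |vhatX σ a b μ vm vp x t| ≤ x1 + c1 * x2 + r1 := by
      refine (abs_add_three _ _ _).trans ?_
      rw [abs_of_nonneg q5]
      linarith
    linarith
  · have e : vhatT σ a b μ vm vp x t = √b * (c1 * Xi2 a b μ vm x t - Xi1 a b μ vm x t) +
        ur1 σ a vp x t + μ ^ 2 / (8 * √b) * Xi3 a b μ vm x t := by
      linarith [vhatT_sub_uhatX (σ := σ) (a := a) (μ := μ) (vm := vm) (vp := vp) (x := x) (t := t)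
        hσ.b_pos, show uhatX σ a b μ vm vp x t = √b * (c1 * Xi2 a b μ vm x t - Xi1 a b μ vm x t) +
        ur1 σ a vp x t from rfl]
    have : |vhatT σ a b μ vm vp x t| ≤ √b * (c1 * x2 + x1) + K * r1 + μ ^ 2 / (8 * √b) * |B| := by
      rw [e]
      refine (abs_add_three _ _ _).trans (add_le_add (add_le_add ?_ ?_) ?_)
      · rw [abs_mul, abs_of_nonneg hb]
        gcongr
        exact (abs_sub _ _).trans (add_le_add q2' q1)
      · have hB := hσ.burgers_le (hs.vp_mem hμ) (x := x) (t := t)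
        rw [ur1, abs_neg, abs_mul, abs_of_nonneg hB.1, abs_of_nonneg q5]
        gcongr
        exact hB.2
      · rw [abs_mul, abs_of_nonneg (by positivity : 0 ≤ μ ^ 2 / (8 * √b))]
        exact mul_le_mul_of_nonneg_left (q3.trans (le_abs_self B)) (by positivity)
    linarith

end

/-! ### Square integrability of flux difference and interaction -/

section

variable {a b μ κ K B : ℝ} {σ : ℝ → ℝ} {vm vp x t : ℝ} {φ dφ : ℝ → ℝ}

/-- The space derivative of `nl (vhat + φ) - nl vhat`. -/
def fluxX (σ : ℝ → ℝ) (a b μ vm vp x t φ dφ : ℝ) : ℝ :=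
  (deriv σ (vhat σ a b μ vm vp x t + φ) - b) * (vhatX σ a b μ vm vp x t + dφ) -
    (deriv σ (vhat σ a b μ vm vp x t) - b) * vhatX σ a b μ vm vp x t

/-- The space derivative of `nl vhat - nl vr`. -/
def interX (σ : ℝ → ℝ) (a b μ vm vp x t : ℝ) : ℝ :=
  (deriv σ (vhat σ a b μ vm vp x t) - b) * vhatX σ a b μ vm vp x t -
    (deriv σ (vr σ a vp x t) - b) * vr1 σ a vp x t

lemma StressBounds.abs_slope_le (hσ : StressBounds a b κ K σ) {v : ℝ} (hv : v ∈ Ioc (-a) (a + 1)) :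
    |deriv σ v - b| ≤ K := by
  have := hσ.b_le_deriv hv.1
  rw [abs_of_nonneg (by linarith)]
  refine (hσ.slope_bounds hv).2.trans (mul_le_of_le_one_right hσ.K_pos.le (max_le ?_ zero_le_one))
  linarith [hv.2]

lemma abs_fluxX_le (hσ : StressBounds a b κ K σ) {C φ dφ : ℝ}
    (hmem : vhat σ a b μ vm vp x t ∈ Ioc (-a) (a + 1))
    (hv : vhat σ a b μ vm vp x t + φ ∈ Ioc (-a) (a + 1)) (hX : |vhatX σ a b μ vm vp x t| ≤ C) :
    |fluxX σ a b μ vm vp x t φ dφ| ≤ K * |dφ| + K * |φ| * C := by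
  have hK := hσ.K_pos
  have e : fluxX σ a b μ vm vp x t φ dφ =
      (deriv σ (vhat σ a b μ vm vp x t + φ) - b) * dφ +
      (deriv σ (vhat σ a b μ vm vp x t + φ) - deriv σ (vhat σ a b μ vm vp x t)) *
        vhatX σ a b μ vm vp x t := by unfold fluxX; ring
  have s2 := hσ.abs_slope_le hv
  have s3 := hσ.abs_deriv_sub_le hmem hv
  rw [add_sub_cancel_left] at s3
  rw [e]
  refine (abs_add_le _ _).trans (add_le_add ?_ ?_)
  · rw [abs_mul]; gcongr
  · rw [abs_mul]
    exact mul_le_mul s3 hX (abs_nonneg _) (by positivity)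

lemma abs_interX_le (hσ : StressBounds a b κ K σ) (hμ : 0 < μ) (hs : NearStates σ a b μ vm vp)
    (ht : 0 ≤ t) : |interX σ a b μ vm vp x t| ≤ K * |Xi1 a b μ vm x t| +
      K * (μ / (4 * √b)) * |Xi2 a b μ vm x t| + K * (2 * a + 1) * |vr1 σ a vp x t| := by
  have hK := hσ.K_pos
  have h0 := hσ.a_pos
  have hmem := hs.vhat_mem hσ hμ ht (x := x)
  have h := hσ.vr_mem (hs.vp_mem hμ) (x := x) (t := t)
  have hrmem : vr σ a vp x t ∈ Ioc (-a) (a + 1) := ⟨by linarith [h.1], h.2⟩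
  have e : interX σ a b μ vm vp x t = (deriv σ (vhat σ a b μ vm vp x t) - b) * Xi1 a b μ vm x t +
      (deriv σ (vhat σ a b μ vm vp x t) - b) * (μ / (4 * √b) * Xi2 a b μ vm x t) +
      (deriv σ (vhat σ a b μ vm vp x t) - deriv σ (vr σ a vp x t)) * vr1 σ a vp x t := by
    unfold interX vhatX; ring
  have s2 := hσ.abs_slope_le hmem
  have s3 : |deriv σ (vhat σ a b μ vm vp x t) - deriv σ (vr σ a vp x t)| ≤ K * (2 * a + 1) := by
    refine (hσ.abs_deriv_sub_le hrmem hmem).trans ?_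
    gcongr
    rw [abs_le]
    constructor <;> linarith [hmem.1, hmem.2, hrmem.1, hrmem.2]
  rw [e, mul_assoc K (μ / (4 * √b))]
  refine (abs_add_three _ _ _).trans (add_le_add (add_le_add ?_ ?_) ?_)
  · rw [abs_mul]; gcongr
  · rw [abs_mul, abs_mul (μ / (4 * √b)), abs_of_nonneg (by positivity : 0 ≤ μ / (4 * √b))]
    gcongr
  · rw [abs_mul]; gcongr

lemma IsStress.continuous_nlPot (hσ : IsStress a b σ) :
    Continuous fun p : ℝ × ℝ => nlPot σ b p.1 p.2 := by
  have hc : Continuous fun v => ∫ z in (0 : ℝ)..v, nl σ b z :=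
    continuous_iff_continuousAt.2 fun v => (hσ.hasDerivAt_integral_nl v).continuousAt
  have hn := hσ.continuous_nl
  unfold nlPot
  generalize (fun v => ∫ z in (0 : ℝ)..v, nl σ b z) = N at hc
  fun_prop

lemma IsStress.continuous_nlRel (hσ : IsStress a b σ) :
    Continuous fun p : ℝ × ℝ => nlRel σ b p.1 p.2 := by
  have hn := hσ.continuous_nl
  have hd := hσ.continuous_deriv
  unfold nlRel
  fun_prop

lemma StressBounds.lipschitzOnWith_nl (hσ : StressBounds a b κ K σ) :
    LipschitzOnWith K.toNNReal (nl σ b) (Ioc (-a) (a + 1)) :=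
  LipschitzOnWith.of_dist_le_mul fun v hv w hw => by
    rw [Real.dist_eq, Real.dist_eq, Real.coe_toNNReal _ hσ.K_pos.le]
    exact hσ.abs_nl_sub_le_lip hv hw

lemma memLp_of_abs_le {f g : ℝ → ℝ} (hf : AEStronglyMeasurable f) (hg : MemLp g 2 volume)
    (h : ∀ x, |f x| ≤ |g x|) : MemLp f 2 volume :=
  hg.of_le hf (ae_of_all _ fun x => by simpa only [Real.norm_eq_abs] using h x)

lemma memLp_abs {f : ℝ → ℝ} (hf : MemLp f 2 volume) : MemLp (fun x => |f x|) 2 volume := hf.norm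

variable (hσ : StressBounds a b κ K σ) (hμ : 0 < μ) (hs : NearStates σ a b μ vm vp)
include hσ hμ hs

lemma h1Pair_flux (hw : WaveBounds B σ a b μ vm vp) (ht : 0 ≤ t) (hφ : H1Pair φ dφ)
    (hv : ∀ x, vhat σ a b μ vm vp x t + φ x ∈ Ioc (-a) (a + 1)) :
    H1Pair (fun x => nl σ b (vhat σ a b μ vm vp x t + φ x) - nl σ b (vhat σ a b μ vm vp x t))
      (fun x => fluxX σ a b μ vm vp x t (φ x) (dφ x)) := by
  have hvp := hs.vp_mem hμ
  have hmem := fun x => hs.vhat_mem hσ hμ ht (x := x)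
  obtain ⟨C, hC⟩ := NearStates.exists_deriv_bound hσ hμ B
  have hX := fun x => (hC vm vp x t hs hw ht).1
  have hl := LocAC.of_hasDerivAt (fun x => hasDerivAt_vhat_space (vm := vm) (x := x) hσ hμ hvp ht)
    ((contForward_vhatX hσ hμ hvp).space ht)
  have hK := hσ.K_pos
  refine ⟨((hl.add hφ.locAC).comp_lipschitzOn hσ.lipschitzOnWith_nl hv).sub
    (hl.comp_lipschitzOn hσ.lipschitzOnWith_nl hmem), ?_, ?_, ?_⟩
  · refine memLp_of_abs_le (((hσ.continuous_nl.comp (hl.continuous.add hφ.locAC.continuous)).sub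
      (hσ.continuous_nl.comp hl.continuous)).aestronglyMeasurable) (hφ.memLp.const_mul K) fun x => ?_
    rw [abs_mul, abs_of_pos hK]
    simpa using hσ.abs_nl_sub_le_lip (hv x) (hmem x)
  · filter_upwards [hφ.hasDerivAt] with x hx
    have h1 := hasDerivAt_vhat_space (vm := vm) (x := x) hσ hμ hvp ht
    exact ((hσ.hasDerivAt_nl _).comp x (h1.add hx)).sub ((hσ.hasDerivAt_nl _).comp x h1)
  · have hm : AEStronglyMeasurable (fun x => fluxX σ a b μ vm vp x t (φ x) (dφ x)) := by
      unfold fluxX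
      have c1 := (contForward_vhatX hσ hμ hvp (vm := vm)).space ht
      exact ((((hσ.continuous_deriv.comp (hl.continuous.add hφ.locAC.continuous)).sub
        continuous_const).aestronglyMeasurable.mul
        (c1.aestronglyMeasurable.add hφ.memLp'.1)).sub
        (((hσ.continuous_deriv.comp hl.continuous).sub continuous_const).mul
          c1).aestronglyMeasurable)
    refine memLp_of_abs_le hm (((memLp_abs hφ.memLp').const_mul K).add
      ((memLp_abs hφ.memLp).const_mul (K * |C|))) fun x => ?_
    calc _ ≤ K * |dφ x| + K * |φ x| * |C| :=
          abs_fluxX_le hσ (hmem x) (hv x) ((hX x).trans (le_abs_self C))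
      _ = K * |dφ x| + K * |C| * |φ x| := by ring
      _ ≤ _ := le_abs_self _

omit hσ in
lemma memLp_Xi1 (ht : 0 ≤ t) : MemLp (fun x => Xi1 a b μ vm x t) 2 volume := by
  have hc := (contForward_Xi1 (a := a) (vm := vm) (b := b) hμ).space ht
  have ht' : -1 < t := by linarith
  obtain ⟨hi, -⟩ := integral_exp_selfSim (b := b) hμ ht' (by norm_num : (0:ℝ) < 2)
  refine (memLp_two_iff_integrable_sq hc.aestronglyMeasurable).2 ((hi.const_mul
    ((1 / width μ t) ^ 2)).mono' (hc.pow 2).aestronglyMeasurable (ae_of_all _ fun x => ?_))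
  have h0 := Xi1_nonneg (b := b) (μ := μ) (x := x) (t := t) hs.vm_le
  have h1 : Xi1 a b μ vm x t ≤ heatWeight b μ x t :=
    (Xi1_le hs.vm_le).trans (mul_le_of_le_one_left heatWeight_nonneg hs.sub_vm_le)
  rw [Real.norm_eq_abs, abs_of_nonneg (sq_nonneg _)]
  calc Xi1 a b μ vm x t ^ 2 ≤ heatWeight b μ x t ^ 2 := by gcongr
    _ = _ := by rw [heatWeight_eq hμ ht', exp_neg_two_mul]; ring

omit hσ in
lemma memLp_Xi2 (ht : 0 ≤ t) : MemLp (fun x => Xi2 a b μ vm x t) 2 volume :=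
  (memLp_two_iff_integrable_sq ((contForward_Xi2 hμ).space ht).aestronglyMeasurable).2
    (integral_Xi2_sq_le hμ (by linarith) hs.vm_le hs.sub_vm_le).1

omit hσ in
lemma memLp_Xi3 (ht : 0 ≤ t) : MemLp (fun x => Xi3 a b μ vm x t) 2 volume :=
  (memLp_two_iff_integrable_sq ((contForward_Xi3 hμ).space ht).aestronglyMeasurable).2
    (integral_Xi3_sq_le hμ (by linarith) hs.vm_le hs.sub_vm_le).1

omit hσ in
lemma h1Pair_Xi2 (ht : 0 ≤ t) :
    H1Pair (fun x => Xi2 a b μ vm x t) (fun x => Xi3 a b μ vm x t) :=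
  .of_hasDerivAt (fun x => hasDerivAt_Xi2_space hμ (by linarith)) ((contForward_Xi3 hμ).space ht)
    (memLp_Xi2 hμ hs ht).integrable_sq (memLp_Xi3 hμ hs ht).integrable_sq

lemma memLp_vr1 (ht : 0 ≤ t) : MemLp (fun x => vr1 σ a vp x t) 2 volume := by
  have hvp := hs.vp_mem hμ
  have hκ := hσ.κ_pos
  have hK := hσ.K_pos
  have hi := (integral_burgers1 hσ.lam_a_pos (hσ.lam_le hvp) ht).1
  have hc := (hσ.contForward_vr1 hvp).space ht
  refine (memLp_two_iff_integrable_sq hc.aestronglyMeasurable).2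
    ((hi.const_mul (2 * K / κ * 2 * (2 * K / κ))).mono' (hc.pow 2).aestronglyMeasurable
    (ae_of_all _ fun x => ?_))
  have h0 := hσ.vr1_nonneg hvp ht (x := x)
  have h1 := hσ.vr1_le_const hvp hs.lam_sub_le ht (x := x)
  have h2 := hσ.vr1_le hvp ht (x := x)
  rw [Real.norm_eq_abs, abs_of_nonneg (sq_nonneg _), sq, mul_assoc _ (2 * K / κ)]
  gcongr

lemma h1Pair_inter (hw : WaveBounds B σ a b μ vm vp) (ht : 0 ≤ t) :
    H1Pair (fun x => nl σ b (vhat σ a b μ vm vp x t) - nl σ b (vr σ a vp x t))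
      (fun x => interX σ a b μ vm vp x t) := by
  have hvp := hs.vp_mem hμ
  have c1 := (contForward_vhat hσ hμ hvp (vm := vm)).space ht
  have c2 := (contForward_vhatX hσ hμ hvp (vm := vm)).space ht
  have c3 := (hσ.contForward_vr hvp).space ht
  have c4 := (hσ.contForward_vr1 hvp).space ht
  have hc : Continuous fun x => interX σ a b μ vm vp x t :=
    (((hσ.continuous_deriv.comp c1).sub continuous_const).mul c2).sub
      (((hσ.continuous_deriv.comp c3).sub continuous_const).mul c4)
  refine .of_hasDerivAt (fun x => ?_) hc (hw.integrable_inter t ht) (MemLp.integrable_sq ?_)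
  · exact ((hσ.hasDerivAt_nl _).comp x (hasDerivAt_vhat_space hσ hμ hvp ht)).sub
      ((hσ.hasDerivAt_nl _).comp x (hσ.hasDerivAt_vr_space hvp ht))
  · refine memLp_of_abs_le hc.aestronglyMeasurable
      ((((memLp_abs (memLp_Xi1 hμ hs ht)).const_mul K).add
      ((memLp_abs (memLp_Xi2 hμ hs ht)).const_mul (K * (μ / (4 * √b))))).add
      ((memLp_abs (memLp_vr1 hσ hμ hs ht)).const_mul (K * (2 * a + 1)))) fun x => ?_
    exact (abs_interX_le hσ hμ hs ht).trans (le_abs_self _)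

/-- The relative potential is an admissible flux. -/
lemma isFlux_nlPot (hw : WaveBounds B σ a b μ vm vp) (ht : 0 ≤ t) (hφ : H1Pair φ dφ)
    (hv : ∀ x, vhat σ a b μ vm vp x t + φ x ∈ Ioc (-a) (a + 1)) :
    IsFlux (fun x => nlPot σ b (vhat σ a b μ vm vp x t + φ x) (vhat σ a b μ vm vp x t))
      (fun x => (nl σ b (vhat σ a b μ vm vp x t + φ x) - nl σ b (vhat σ a b μ vm vp x t)) * dφ x +
        nlRel σ b (vhat σ a b μ vm vp x t + φ x) (vhat σ a b μ vm vp x t) *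
          vhatX σ a b μ vm vp x t) := by
  have hvp := hs.vp_mem hμ
  have hmem := fun x => hs.vhat_mem hσ hμ ht (x := x)
  obtain ⟨C, hC⟩ := NearStates.exists_deriv_bound hσ hμ B
  have hX := fun x => (hC vm vp x t hs hw ht).1
  have hd := fun x => hasDerivAt_vhat_space (vm := vm) (x := x) hσ hμ hvp ht
  have c2 := (contForward_vhatX hσ hμ hvp (vm := vm)).space ht
  have hl := LocAC.of_hasDerivAt hd c2
  have hK := hσ.K_pos
  have hF := hσ.hasDerivAt_integral_nl
  have hlip : ∀ {f : ℝ → ℝ}, LocAC f → (∀ x, f x ∈ Ioc (-a) (a + 1)) →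
      LocAC fun x => ∫ z in (0 : ℝ)..f x, nl σ b z := by
    intro f hf hfm
    have h1 : ContDiff ℝ 1 fun v => ∫ z in (0 : ℝ)..v, nl σ b z := by
      rw [contDiff_one_iff_deriv]
      refine ⟨fun v => (hF v).differentiableAt, ?_⟩
      rw [show deriv (fun v => ∫ z in (0 : ℝ)..v, nl σ b z) = nl σ b from
        funext fun v => (hF v).deriv]
      exact hσ.continuous_nl
    obtain ⟨k, hk⟩ := h1.contDiffOn.exists_lipschitzOnWith one_ne_zero (convex_Icc (-a) (a + 1))
      isCompact_Icc
    exact hf.comp_lipschitzOn (g := fun v => ∫ z in (0 : ℝ)..v, nl σ b z) hk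
      fun x => Ioc_subset_Icc_self (hfm x)
  have hflux := h1Pair_flux hσ hμ hs hw ht hφ hv
  have hcont : Continuous fun x =>
      nlPot σ b (vhat σ a b μ vm vp x t + φ x) (vhat σ a b μ vm vp x t) := by
    have h1 := hl.continuous.add hφ.locAC.continuous
    exact hσ.continuous_nlPot.comp (h1.prodMk hl.continuous)
  refine ⟨((hlip (hl.add hφ.locAC) hv).sub (hlip hl hmem)).sub
    ((hl.comp_lipschitzOn hσ.lipschitzOnWith_nl hmem).mul ((hl.add hφ.locAC).sub hl)), ?_, ?_, ?_⟩
  · refine (hφ.memLp.integrable_sq.const_mul K).mono' hcont.aestronglyMeasurable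
      (ae_of_all _ fun x => ?_)
    have h1 := hσ.nlPot_bounds (hv x) (hmem x)
    have h2 := hσ.abs_nl_sub_le_lip (hv x) (hmem x)
    rw [Real.norm_eq_abs, abs_of_nonneg h1.1]
    rw [add_sub_cancel_left] at h1 h2
    refine h1.2.trans ?_
    calc _ ≤ K * |φ x| * |φ x| := by gcongr
      _ = _ := by rw [mul_assoc, abs_mul_abs_self]; ring
  · filter_upwards [hφ.hasDerivAt] with x hx
    have h1 := hd x
    have h2 := h1.add hx
    have h3 := (((hF _).comp x h2).sub ((hF _).comp x h1)).sub
      (((hσ.hasDerivAt_nl _).comp x h1).mul (h2.sub h1))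
    refine HasDerivAt.congr_deriv h3 ?_
    simp only [Pi.add_apply, Pi.sub_apply, Function.comp_apply]
    unfold nlRel
    ring
  · refine (hflux.memLp.integrable_mul hφ.memLp').add ?_
    refine integrable_mul_of_bounded (c := C) ?_ c2.aestronglyMeasurable hX
    have hc : Continuous fun x =>
        nlRel σ b (vhat σ a b μ vm vp x t + φ x) (vhat σ a b μ vm vp x t) := by
      have h1 := hl.continuous.add hφ.locAC.continuous
      exact hσ.continuous_nlRel.comp (h1.prodMk hl.continuous)
    refine (hφ.memLp.integrable_sq.const_mul K).mono' hc.aestronglyMeasurable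
      (ae_of_all _ fun x => ?_)
    have h1 := hσ.nlRel_nonneg (hv x) (hmem x)
    have h2 := hσ.nlRel_le (hv x) (hmem x)
    rw [add_sub_cancel_left] at h2
    rwa [Real.norm_eq_abs, abs_of_nonneg h1]

end

/-! ### The weighted energy and its rate of change -/

/-- The weighted energy density of the perturbation `(φ, ψ)` at the point `(x, t)`. The numbers `φ`,
`ψ` stand for the values of the perturbation; here and below `dφ`, `dψ`, `ddψ` stand for those of
its space derivatives. -/
def energy (Λ : ℝ) (σ : ℝ → ℝ) (a b μ vm vp x t φ ψ : ℝ) : ℝ :=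
  Λ * (1 / 2 * (ψ + √b * φ) ^ 2 * wtA b μ x t) +
    (1 / 2 * (ψ - √b * φ) ^ 2 +
      nlPot σ b (vhat σ a b μ vm vp x t + φ) (vhat σ a b μ vm vp x t)) * wtB b μ x t

/-- The time derivative of `energy` along a perturbation with time derivatives `φt`, `ψt`. -/
def energyRate (Λ : ℝ) (σ : ℝ → ℝ) (a b μ vm vp x t φ ψ φt ψt : ℝ) : ℝ :=
  Λ * ((ψ + √b * φ) * (ψt + √b * φt) * wtA b μ x t +
      1 / 2 * (ψ + √b * φ) ^ 2 * wtAt b μ x t) +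
    (((ψ - √b * φ) * (ψt - √b * φt) +
      ((nl σ b (vhat σ a b μ vm vp x t + φ) - nl σ b (vhat σ a b μ vm vp x t)) * φt +
        nlRel σ b (vhat σ a b μ vm vp x t + φ) (vhat σ a b μ vm vp x t) *
          vhatT σ a b μ vm vp x t)) * wtB b μ x t +
    (1 / 2 * (ψ - √b * φ) ^ 2 +
      nlPot σ b (vhat σ a b μ vm vp x t + φ) (vhat σ a b μ vm vp x t)) * wtBt b μ x t)

/-- The time derivative of `φ`, expressed through the equation. -/
def phiT (a b μ vm x t dψ : ℝ) : ℝ := dψ - μ ^ 2 / (8 * √b) * Xi3 a b μ vm x t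

/-- The time derivative of `ψ`, expressed through the equation. -/
def psiT (σ : ℝ → ℝ) (a b μ vm vp x t φ dφ ddψ : ℝ) : ℝ :=
  b * dφ + (fluxX σ a b μ vm vp x t φ dφ + interX σ a b μ vm vp x t) + μ * ddψ +
    μ * ur2 σ a vp x t + μ ^ 2 / 8 * Xi3 a b μ vm x t

/-- The rate of change of the energy up to an exact space derivative. -/
def reducedRate (Λ : ℝ) (σ : ℝ → ℝ) (a b μ vm vp x t φ ψ dφ dψ : ℝ) : ℝ :=
  let k := ψ + √b * φ
  let h := ψ - √b * φ
  let dk := dψ + √b * dφ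
  let dh := dψ - √b * dφ
  let v := vhat σ a b μ vm vp x t + φ
  let v₀ := vhat σ a b μ vm vp x t
  let q := nl σ b v - nl σ b v₀
  let I := nl σ b v₀ - nl σ b (vr σ a vp x t)
  let s := selfSim b μ x t
  let w := heatWeight b μ x t
  let E := ur2 σ a vp x t
  Λ * (1 / 2 * k ^ 2 * ((wtAt b μ x t + √b * wtA1 b μ x t) - 2 * √b * wtA1 b μ x t) -
      (μ * dψ + q + I) * (dk * wtA b μ x t + k * wtA1 b μ x t) + μ * E * k * wtA b μ x t) +
    (-(2 * μ * (s ^ 2 * w ^ 2 * h ^ 2)) -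
      (μ * dψ + I + μ ^ 2 / 4 * Xi2 a b μ vm x t) * (dh * wtB b μ x t + h * wtB1 b μ x t) -
      q * h * wtB1 b μ x t + μ * E * h * wtB b μ x t -
      μ ^ 2 / (8 * √b) * q * Xi3 a b μ vm x t * wtB b μ x t +
      nlRel σ b v v₀ * (vhatT σ a b μ vm vp x t - √b * vhatX σ a b μ vm vp x t) * wtB b μ x t +
      nlPot σ b v v₀ * (-(2 * √b * wtB1 b μ x t) - 4 * μ * (s ^ 2 * w ^ 2)) -
      μ / 5 * (h ^ 2 * ((1 - 4 * s ^ 2) * w ^ 2) + 2 * h * dh * wtC b μ x t))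

/-- The terms that control the rate of change of the energy, for a perturbation bounded by `M` and
by `ν`. In the application `M` is given by the dissipation and `ν` by the size of the data. -/
def errorDensity (σ : ℝ → ℝ) (a b μ vm vp M ν x t φ ψ dφ dψ : ℝ) : ℝ :=
  (dφ ^ 2 + dψ ^ 2) + (nl σ b (vhat σ a b μ vm vp x t) - nl σ b (vr σ a vp x t)) ^ 2 +
    Xi2 a b μ vm x t ^ 2 + (φ ^ 2 + ψ ^ 2) * (M ^ 2 / qrt t ^ 4 + 1 / qrt t ^ 5) +
    qrt t ^ 5 * Xi3 a b μ vm x t ^ 2 + M * |ur2 σ a vp x t| +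
    ν * (heatWeight b μ x t *
      nlRel σ b (vhat σ a b μ vm vp x t + φ) (vhat σ a b μ vm vp x t))

section

variable {a b μ κ K B : ℝ} {σ : ℝ → ℝ} {vm vp : ℝ}

lemma abs_burgers2_le {wl wr x t : ℝ} (h : wl ≤ wr) (h1 : wr - wl ≤ 1) (ht : 0 ≤ t) :
    |burgers2 wl wr x t| ≤ 1 := by
  have hs := burgersSlope_nonneg h (burgersFoot wl wr x t)
  have hs' := burgersSlope_le h (burgersFoot wl wr x t)
  have hd : 1 ≤ 1 + t * burgersSlope wl wr (burgersFoot wl wr x t) := by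
    linarith [mul_nonneg ht hs]
  have htanh : |Real.tanh (burgersFoot wl wr x t)| ≤ 1 :=
    abs_le.2 ⟨(Real.neg_one_lt_tanh _).le, (Real.tanh_lt_one _).le⟩
  unfold burgers2
  rw [abs_div, abs_of_pos (by positivity : 0 < (1 + t * burgersSlope wl wr (burgersFoot wl wr x t)) ^ 3)]
  refine div_le_one_of_le₀ (le_trans ?_ (one_le_pow₀ hd)) (by positivity)
  rw [abs_mul, abs_neg, abs_mul, abs_two, abs_of_nonneg hs]
  nlinarith [abs_nonneg (Real.tanh (burgersFoot wl wr x t))]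

lemma NearStates.exists_ur2_bound (hσ : StressBounds a b κ K σ) (hμ : 0 < μ) :
    ∃ C, ∀ vm vp x t, NearStates σ a b μ vm vp → 0 ≤ t → |ur2 σ a vp x t| ≤ C := by
  have hκ := hσ.κ_pos
  have hK := hσ.K_pos
  refine ⟨(4 * K / κ + 4 * K ^ 4 / κ ^ 3) * 4 + 2 * K ^ 2 / κ, fun vm vp x t hs ht => ?_⟩
  have hl := hσ.lam_le (hs.vp_mem hμ)
  refine (hσ.abs_ur2_le (hs.vp_mem hμ) ht).trans (add_le_add ?_ ?_)
  · have h0 := burgers1_nonneg hl ht (x := x)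
    have h1 : burgers1 (lam σ a) (lam σ vp) x t ≤ 2 :=
      (burgers1_le hl hs.lam_sub_le ht).trans (div_le_self (by norm_num) (by linarith))
    refine mul_le_mul_of_nonneg_left ?_ (by positivity)
    nlinarith
  · exact mul_le_of_le_one_right (by positivity) (abs_burgers2_le hl hs.lam_sub_le ht)

lemma WaveBounds.gap_sq_mul_wtA1_le (hw : WaveBounds B σ a b μ vm vp) (hμ : 0 < μ) {x t : ℝ}
    (ht : 0 ≤ t) : max (vhat σ a b μ vm vp x t - a) 0 ^ 2 * wtA1 b μ x t ≤
      2 * B ^ 2 / √(2 * μ) / qrt t ^ 8 := by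
  have hgap := hw.gap_le x t ht
  have hp0 := qrt_pos ht
  have hm := sqrt_two_mul_pos hμ
  have hA1 := wtA1_nonneg (b := b) (μ := μ) (x := x) (t := t)
  have h1 : (1 + max (selfSim b μ x t) 0) ^ 2 ≤ 2 * (1 + selfSim b μ x t ^ 2) := by
    rcases max_cases (selfSim b μ x t) 0 with h | h <;> rw [h.1]
    · linarith [sq_nonneg (selfSim b μ x t - 1)]
    · linarith [sq_nonneg (selfSim b μ x t)]
  calc _ ≤ (B * ((1 + max (selfSim b μ x t) 0) / qrt t ^ 2)) ^ 2 * wtA1 b μ x t :=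
        mul_le_mul_of_nonneg_right (pow_le_pow_left₀ (le_max_right _ _) hgap 2) hA1
    _ = B ^ 2 / qrt t ^ 4 * ((1 + max (selfSim b μ x t) 0) ^ 2 * wtA1 b μ x t) := by field
    _ ≤ B ^ 2 / qrt t ^ 4 * (2 * (1 + selfSim b μ x t ^ 2) * wtA1 b μ x t) :=
        mul_le_mul_of_nonneg_left (mul_le_mul_of_nonneg_right h1 hA1) (by positivity)
    _ = _ := by unfold wtA1; field

lemma WaveBounds.gap_mul_abs_wtA_le (hw : WaveBounds B σ a b μ vm vp) {x t : ℝ}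
    (ht : 0 ≤ t) : max (vhat σ a b μ vm vp x t - a) 0 * |wtA b μ x t| ≤ 4 * B / qrt t ^ 4 := by
  have hgap := hw.gap_le x t ht
  have hp0 := qrt_pos ht
  have hB1 := hw.one_le
  have hA' := one_add_mul_abs_wtA_le (b := b) (μ := μ) (x := x) ht
  calc _ ≤ B * ((1 + max (selfSim b μ x t) 0) / qrt t ^ 2) * |wtA b μ x t| :=
        mul_le_mul_of_nonneg_right hgap (abs_nonneg _)
    _ = B / qrt t ^ 2 * ((1 + max (selfSim b μ x t) 0) * |wtA b μ x t|) := by ring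
    _ ≤ B / qrt t ^ 2 * (4 / qrt t ^ 2) := mul_le_mul_of_nonneg_left hA' (by positivity)
    _ = 4 * B / qrt t ^ 4 := by field

lemma WaveBounds.gap_mul_abs_wtB1_le (hw : WaveBounds B σ a b μ vm vp) (hμ : 0 < μ) {x t : ℝ}
    (ht : 0 ≤ t) : max (vhat σ a b μ vm vp x t - a) 0 * |wtB1 b μ x t| ≤ 4 * B * √(2 * μ) *
      ((1 + |selfSim b μ x t|) * |selfSim b μ x t| * heatWeight b μ x t ^ 2) := by
  have hgap := hw.gap_le x t ht
  have hp0 := qrt_pos ht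
  have hB1 := hw.one_le
  have hm := sqrt_two_mul_pos hμ
  have hw0 := heatWeight_nonneg (b := b) (μ := μ) (x := x) (t := t)
  have h1 : |wtB1 b μ x t| =
      4 * |selfSim b μ x t| * heatWeight b μ x t ^ 2 * (√(2 * μ) * qrt t ^ 2) := by
    have hwq := heatWeight_eq_qrt (b := b) (x := x) hμ ht
    rw [wtB1, abs_mul, abs_mul, abs_mul, abs_of_nonneg hw0, abs_of_pos (Real.exp_pos _),
      abs_of_pos (by norm_num : (0 : ℝ) < 4), hwq]
    field
  have h2 : max (selfSim b μ x t) 0 ≤ |selfSim b μ x t| := max_le (le_abs_self _) (abs_nonneg _)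
  calc _ ≤ B * ((1 + |selfSim b μ x t|) / qrt t ^ 2) * |wtB1 b μ x t| := by
        refine mul_le_mul_of_nonneg_right (hgap.trans ?_) (abs_nonneg _)
        gcongr
    _ = _ := by rw [h1]; field

/-- The weight `w²` in terms of the weights of the two estimates. -/
lemma heatWeight_sq_mul_le {m b μ c1 w s η1 φ ψ β : ℝ} (hm : 0 < m) (hc1 : 0 < c1) (hβ2 : β ^ 2 = b)
    (hcm : c1 ≤ m) (hcμ : c1 ≤ μ / 5) (hwA : (1 + s ^ 2) * w ^ 2 ≤ η1 / m) :
    2 * c1 * min 1 b * (w ^ 2 * (φ ^ 2 + ψ ^ 2)) ≤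
      η1 * (ψ + β * φ) ^ 2 + μ / 5 * (w ^ 2 * (ψ - β * φ) ^ 2) := by
  have g1 : m * w ^ 2 ≤ η1 := by
    have : w ^ 2 ≤ η1 / m := by
      refine le_trans ?_ hwA
      linarith [mul_nonneg (sq_nonneg s) (sq_nonneg w)]
    rw [le_div_iff₀ hm] at this
    linarith
  have g2 : c1 * w ^ 2 * (ψ + β * φ) ^ 2 ≤ η1 * (ψ + β * φ) ^ 2 :=
    mul_le_mul_of_nonneg_right ((mul_le_mul_of_nonneg_right hcm (sq_nonneg w)).trans g1)
      (sq_nonneg _)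
  have g3 : c1 * (w ^ 2 * (ψ - β * φ) ^ 2) ≤ μ / 5 * (w ^ 2 * (ψ - β * φ) ^ 2) :=
    mul_le_mul_of_nonneg_right hcμ (by positivity)
  have g4 : (ψ + β * φ) ^ 2 + (ψ - β * φ) ^ 2 = 2 * (ψ ^ 2 + b * φ ^ 2) := by rw [← hβ2]; ring
  have g5 : min 1 b * (φ ^ 2 + ψ ^ 2) ≤ ψ ^ 2 + b * φ ^ 2 := by
    have l1 := mul_le_mul_of_nonneg_right (min_le_left 1 b) (sq_nonneg ψ)
    have l2 := mul_le_mul_of_nonneg_right (min_le_right 1 b) (sq_nonneg φ)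
    linarith
  calc _ = 2 * c1 * w ^ 2 * (min 1 b * (φ ^ 2 + ψ ^ 2)) := by ring
    _ ≤ 2 * c1 * w ^ 2 * (ψ ^ 2 + b * φ ^ 2) := by gcongr
    _ = c1 * w ^ 2 * ((ψ + β * φ) ^ 2 + (ψ - β * φ) ^ 2) := by rw [g4]; ring
    _ ≤ _ := by linarith

lemma error_terms_le {b β φ ψ dφ dψ I2 X2 ρ p5 X3 e r y : ℝ} (hb : 0 < b) (hβ2 : β ^ 2 = b)
    (hI : 0 ≤ I2) (hX2 : 0 ≤ X2) (hρ : 0 ≤ ρ) (hy : y ≤ ρ) (hX3 : 0 ≤ p5 * X3) (he : 0 ≤ e)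
    (hr : 0 ≤ r) :
    dψ ^ 2 + (dψ + β * dφ) ^ 2 + I2 + (φ ^ 2 + (ψ + β * φ) ^ 2) * ρ + e ≤ (3 + 2 * b) *
      (dφ ^ 2 + dψ ^ 2 + I2 + X2 + (φ ^ 2 + ψ ^ 2) * ρ + p5 * X3 + e + r) ∧
    dψ ^ 2 + (dψ - β * dφ) ^ 2 + I2 + X2 + φ ^ 2 * y + p5 * X3 + e + r ≤ (3 + 2 * b) *
      (dφ ^ 2 + dψ ^ 2 + I2 + X2 + (φ ^ 2 + ψ ^ 2) * ρ + p5 * X3 + e + r) := by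
  have n1 : 0 ≤ dψ ^ 2 := sq_nonneg _
  have n2 : 0 ≤ b * dφ ^ 2 := by positivity
  have n2' : 0 ≤ b * dψ ^ 2 := by positivity
  have n2'' : 0 ≤ dφ ^ 2 := by positivity
  have n5 : 0 ≤ φ ^ 2 * ρ := by positivity
  have n5' : 0 ≤ ψ ^ 2 * ρ := by positivity
  have bdk : (dψ + β * dφ) ^ 2 ≤ 2 * dψ ^ 2 + 2 * (b * dφ ^ 2) := by
    rw [← hβ2]; linarith [sq_nonneg (dψ - β * dφ)]
  have bdh : (dψ - β * dφ) ^ 2 ≤ 2 * dψ ^ 2 + 2 * (b * dφ ^ 2) := by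
    rw [← hβ2]; linarith [sq_nonneg (dψ + β * dφ)]
  have bk : (ψ + β * φ) ^ 2 * ρ ≤ 2 * (ψ ^ 2 * ρ) + 2 * b * (φ ^ 2 * ρ) := by
    have : (ψ + β * φ) ^ 2 ≤ 2 * ψ ^ 2 + 2 * (b * φ ^ 2) := by
      rw [← hβ2]; linarith [sq_nonneg (ψ - β * φ)]
    calc (ψ + β * φ) ^ 2 * ρ ≤ (2 * ψ ^ 2 + 2 * (b * φ ^ 2)) * ρ := by gcongr
      _ = _ := by ring
  have bφ : φ ^ 2 * y ≤ φ ^ 2 * ρ := by gcongr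
  have m1 : 0 ≤ b * I2 := by positivity
  have m2 : 0 ≤ b * X2 := by positivity
  have m3 : 0 ≤ b * (φ ^ 2 * ρ) := by positivity
  have m4 : 0 ≤ b * (ψ ^ 2 * ρ) := by positivity
  have m5 : 0 ≤ b * (p5 * X3) := by positivity
  have m6 : 0 ≤ b * e := by positivity
  have m7 : 0 ≤ b * r := by positivity
  constructor <;> linarith

/-- The pointwise estimate of the reduced rate. The factor `Λ` makes the good term of the estimate
for `k` absorb the terms in `k` of the estimate for `h`. -/
lemma reducedRate_le (hσ : StressBounds a b κ K σ) (hμ : 0 < μ) (B : ℝ) :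
    ∃ Λ ≥ 0, ∃ c₀ > 0, ∃ C ≥ 0, ∀ vm vp M ν x t φ ψ dφ dψ, NearStates σ a b μ vm vp →
      WaveBounds B σ a b μ vm vp → 0 ≤ t → vhat σ a b μ vm vp x t + φ ∈ Ioc (-a) (a + 1) →
      |φ| ≤ M → |ψ| ≤ M → |φ| ≤ ν → |ψ| ≤ ν → vp - vm ≤ ν →
      c₀ * (heatWeight b μ x t ^ 2 * (φ ^ 2 + ψ ^ 2)) +
        reducedRate Λ σ a b μ vm vp x t φ ψ dφ dψ ≤
      C * errorDensity σ a b μ vm vp M ν x t φ ψ dφ dψ := by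
  have hK := hσ.K_pos
  have hκ := hσ.κ_pos
  have hb := hσ.b_pos
  have hβ := Real.sqrt_pos.2 hb
  have hm := sqrt_two_mul_pos hμ
  have hβ2 : √b ^ 2 = b := Real.sq_sqrt hb.le
  set β := √b with hβ_def
  set m := √(2 * μ) with hm_def
  obtain ⟨BA, hBA⟩ : ∃ BA, BA = 4 * |B| + 2 * B ^ 2 / m := ⟨_, rfl⟩
  obtain ⟨BB, hBB⟩ : ∃ BB, BB = |B| + 4 * |B| * m + 2 * K / κ := ⟨_, rfl⟩
  have hBA0 : 0 ≤ BA := by rw [hBA]; positivity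
  have hBB0 : 0 ≤ BB := by rw [hBB]; positivity
  obtain ⟨CA, hCA⟩ : ∃ CA, CA = 10 + 4 * μ ^ 2 + 3 * (μ ^ 2 + 1) / (2 * β * m) +
    16 * K ^ 2 * (1 + BA ^ 2) + 3 * K ^ 2 / β * (1 / m + BA) + 4 * μ * (1 + β) := ⟨_, rfl⟩
  obtain ⟨Ck, hCk⟩ : ∃ Ck, Ck = (2 * (K * BB / (2 * β)) + 2 * (K * BB / (2 * β)) ^ 2 / μ) / m :=
    ⟨_, rfl⟩
  obtain ⟨c, hc⟩ : ∃ c, c = μ ^ 2 / (8 * β) := ⟨_, rfl⟩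
  have hc0 : 0 ≤ c := by rw [hc]; positivity
  obtain ⟨CB, hCB⟩ : ∃ CB, CB = (1 + 8 / μ) * (3 * (1 + μ ^ 2 + μ ^ 4)) + (1 + μ / 5) +
    μ * (1 + β) + c * K * (1 + BB) + (4 * (1 + β) + 16 * β * (1 + BB * (BB + 1))) := ⟨_, rfl⟩
  have hCA0 : 0 ≤ CA := by rw [hCA]; positivity
  have hCk0 : 0 ≤ Ck := by rw [hCk]; positivity
  have hCB0 : 0 ≤ CB := by rw [hCB]; positivity
  -- `Ck` is the constant of `η1 k²` in the estimate for `h`, `β / 2` that of the good term for `k`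
  obtain ⟨Λ, hΛ⟩ : ∃ Λ, Λ = (Ck + 1) * (2 / β) := ⟨_, rfl⟩
  have hΛ0 : 0 ≤ Λ := by rw [hΛ]; positivity
  have hΛβ : Λ * (β / 2) = Ck + 1 := by rw [hΛ]; field
  obtain ⟨c1, hc1⟩ : ∃ c1, c1 = min m (μ / 5) := ⟨_, rfl⟩
  have hc1p : 0 < c1 := by rw [hc1]; positivity
  have hb1 : 0 < min 1 b := by positivity
  refine ⟨Λ, hΛ0, 2 * c1 * min 1 b, by positivity, (Λ * CA + CB) * (3 + 2 * b), by positivity, ?_⟩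
  intro vm vp M ν x t φ ψ dφ dψ hs hw ht hv hφM hψM hφν hψν hδν
  have hp := one_le_qrt ht
  have hp0 := qrt_pos ht
  have hB1 := hw.one_le
  have hBabs : |B| = B := abs_of_nonneg (by linarith)
  rw [hBabs] at hBA hBB
  have hM : 0 ≤ M := (abs_nonneg _).trans hφM
  have hν : 0 ≤ ν := (abs_nonneg _).trans hφν
  have hmem := hs.vhat_mem hσ hμ ht (x := x)
  have hgap := hw.gap_le x t ht
  have hgap' := hw.gap_le_small x t ht
  have hqle := hσ.abs_nl_sub_le hv hmem
  have hqlip := hσ.abs_nl_sub_le_lip hv hmem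
  have hR0 := hσ.nlRel_nonneg hv hmem
  have hRle := hσ.nlRel_le hv hmem
  have hPb := hσ.nlPot_bounds hv hmem
  have hfφ := hσ.slope_mul_sq_le hv hmem
  have hfg := (hσ.slope_bounds hmem).2
  have hf0 := hσ.b_le_deriv hmem.1
  rw [add_sub_cancel_left] at hqle hqlip hRle hPb hfφ
  have hX3 := hw.abs_Xi3_le x t ht
  have hD := vhatT_sub_vhatX (σ := σ) (a := a) (μ := μ) (vm := vm) (vp := vp) (x := x) (t := t) hb
  have hX1 := Xi1_nonneg (b := b) (μ := μ) (x := x) (t := t) hs.vm_le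
  have hvr1 := hσ.vr1_nonneg (hs.vp_mem hμ) ht (x := x)
  have hur1 := hσ.ur1_nonpos (hs.vp_mem hμ) ht (x := x)
  have hA := abs_wtA_le (b := b) (μ := μ) (x := x) ht
  have hA' := one_add_mul_abs_wtA_le (b := b) (μ := μ) (x := x) ht
  have hA1 := wtA1_nonneg (b := b) (μ := μ) (x := x) (t := t)
  have hA1' := wtA1_le (b := b) (x := x) hμ ht
  have hγ := abs_wtAt_add_le (b := b) (μ := μ) (x := x) ht
  have hw0 := heatWeight_nonneg (b := b) (μ := μ) (x := x) (t := t)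
  have hwA := one_add_sq_mul_heatWeight_sq_le (b := b) (x := x) hμ ht
  have hB1w := abs_wtB1_le (b := b) (μ := μ) (x := x) (t := t)
  have hB1w' := abs_wtB1_le' (b := b) (μ := μ) (x := x) (t := t)
  have hCw := abs_wtC_le (b := b) (μ := μ) (x := x) (t := t)
  have hqR : nl σ b (vhat σ a b μ vm vp x t + φ) - nl σ b (vhat σ a b μ vm vp x t) =
      nlRel σ b (vhat σ a b μ vm vp x t + φ) (vhat σ a b μ vm vp x t) +
        (deriv σ (vhat σ a b μ vm vp x t) - b) * φ := by unfold nlRel; ring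
  have hB0 : 0 ≤ B := by linarith
  have l1 : 0 ≤ 4 * B * m := by positivity
  have l2 : 0 ≤ 2 * K / κ := by positivity
  have l3 : 0 ≤ 2 * B ^ 2 / m := by positivity
  have hBBB : B ≤ BB := by rw [hBB]; linarith
  have hBB1 : 4 * B * m ≤ BB := by rw [hBB]; linarith
  have hBB2 : 2 * K / κ ≤ BB := by rw [hBB]; linarith
  have hgη1 : max (vhat σ a b μ vm vp x t - a) 0 ^ 2 * wtA1 b μ x t ≤ BA / qrt t ^ 8 :=
    (hw.gap_sq_mul_wtA1_le hμ ht).trans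
      (div_le_div_of_nonneg_right (by rw [hBA]; linarith) (by positivity))
  have hgη : max (vhat σ a b μ vm vp x t - a) 0 * |wtA b μ x t| ≤ BA / qrt t ^ 4 :=
    (hw.gap_mul_abs_wtA_le ht).trans
      (div_le_div_of_nonneg_right (by rw [hBA]; linarith) (by positivity))
  have hgθ1 : max (vhat σ a b μ vm vp x t - a) 0 * |wtB1 b μ x t| ≤
      BB * ((1 + |selfSim b μ x t|) * |selfSim b μ x t| * heatWeight b μ x t ^ 2) :=
    (hw.gap_mul_abs_wtB1_le hμ ht).trans (mul_le_mul_of_nonneg_right hBB1 (by positivity))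
  have hgν : max (vhat σ a b μ vm vp x t - a) 0 ≤ BB * ν :=
    hgap'.trans ((mul_le_mul_of_nonneg_left hδν hB0).trans (mul_le_mul_of_nonneg_right hBBB hν))
  have hfφ' : (deriv σ (vhat σ a b μ vm vp x t) - b) * φ ^ 2 ≤
      BB * (max (vhat σ a b μ vm vp x t - a) 0 + |φ|) *
        nlRel σ b (vhat σ a b μ vm vp x t + φ) (vhat σ a b μ vm vp x t) := by
    refine hfφ.trans (mul_le_mul_of_nonneg_right (mul_le_mul_of_nonneg_right hBB2 ?_) hR0)
    exact add_nonneg (le_max_right _ _) (abs_nonneg _)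
  have hX3' : |Xi3 a b μ vm x t| ≤ BB / qrt t ^ 5 :=
    hX3.trans (div_le_div_of_nonneg_right hBBB (by positivity))
  have hD' : vhatT σ a b μ vm vp x t - β * vhatX σ a b μ vm vp x t ≤ c * Xi3 a b μ vm x t := by
    rw [hD, hc]; linarith [mul_nonneg hβ.le hX1, mul_nonneg hβ.le hvr1]
  set v₀ := vhat σ a b μ vm vp x t with hv0
  set v := v₀ + φ with hv_def
  set R := nlRel σ b v v₀ with hR_def
  set P := nlPot σ b v v₀ with hP_def
  set q := nl σ b v - nl σ b v₀ with hq_def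
  set I := nl σ b v₀ - nl σ b (vr σ a vp x t) with hI_def
  set s := selfSim b μ x t with hs_def
  set w := heatWeight b μ x t with hw_def
  set η := wtA b μ x t with hη_def
  set η1 := wtA1 b μ x t with hη1_def
  set θ := wtB b μ x t with hθ_def
  set θ1 := wtB1 b μ x t with hθ1_def
  set χ := wtC b μ x t with hχ_def
  set g := max (v₀ - a) 0 with hg_def
  set f := deriv σ v₀ - b with hf_def
  set E := ur2 σ a vp x t with hE_def
  set X2 := Xi2 a b μ vm x t with hX2_def
  set X3 := Xi3 a b μ vm x t with hX3_def
  set D := vhatT σ a b μ vm vp x t - β * vhatX σ a b μ vm vp x t with hD_def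
  set p := qrt t with hp_def
  obtain ⟨k, hk⟩ : ∃ k, k = ψ + β * φ := ⟨_, rfl⟩
  obtain ⟨h, hh⟩ : ∃ h, h = ψ - β * φ := ⟨_, rfl⟩
  obtain ⟨dk, hdk⟩ : ∃ k, k = dψ + β * dφ := ⟨_, rfl⟩
  obtain ⟨dh, hdh⟩ : ∃ h, h = dψ - β * dφ := ⟨_, rfl⟩
  have hkb : ∀ M, |φ| ≤ M → |ψ| ≤ M → |k| ≤ (1 + β) * M ∧ |h| ≤ (1 + β) * M := by
    intro M h1 h2
    have h3 : |β * φ| ≤ β * M := by rw [abs_mul, abs_of_pos hβ]; gcongr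
    rw [hk, hh]
    exact ⟨(abs_add_le _ _).trans (by linarith), (abs_sub _ _).trans (by linarith)⟩
  have eA := pointwise_wtA (dk := dk) (dψ := dψ) (I := I) (E := E) hβ hμ hm hp hBA0 hK.le hM hA hA1
    hA1' hγ (le_max_right _ _) hgη hgη1 hφM (hkb M hφM hψM).1 hqle
  have eB := pointwise_wtB (dh := dh) (dψ := dψ) (I := I) (E := E) (X2 := X2) (X3 := X3) (D := D)
    (h := h) hβ hμ hc0 hp hBB0 hK.le hM hw0
    (wtB_nonneg (b := b) (μ := μ) (x := x) (t := t)) wtB_le hB1w hB1w' hCw hgθ1 hwA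
    (by rw [hk, hh]; ring) hφν (hkb ν hφν hψν).1 (hkb M hφM hψM).2 hR0 hRle (sub_nonneg.2 hf0) hfg
    hgν hqR hqlip hfφ' hPb.1 hPb.2 hX3' hD'
  rw [← hCA] at eA
  rw [← hCk, ← hCB] at eB
  have hred : reducedRate Λ σ a b μ vm vp x t φ ψ dφ dψ =
      Λ * (1 / 2 * k ^ 2 * ((wtAt b μ x t + β * η1) - 2 * β * η1) -
        (μ * dψ + q + I) * (dk * η + k * η1) + μ * E * k * η) +
      (-(2 * μ * (s ^ 2 * w ^ 2 * h ^ 2)) - (μ * dψ + I + μ ^ 2 / 4 * X2) * (dh * θ + h * θ1) -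
        q * h * θ1 + μ * E * h * θ - c * q * X3 * θ + R * D * θ +
        P * (-(2 * β * θ1) - 4 * μ * (s ^ 2 * w ^ 2)) -
        μ / 5 * (h ^ 2 * ((1 - 4 * s ^ 2) * w ^ 2) + 2 * h * dh * χ)) := by
    rw [hk, hh, hdk, hdh, hc]; rfl
  have eA' := mul_le_mul_of_nonneg_left eA hΛ0
  have hgood := heatWeight_sq_mul_le (φ := φ) (ψ := ψ) hm hc1p hβ2 (hc1 ▸ min_le_left _ _)
    (hc1 ▸ min_le_right _ _) hwA
  rw [← hk, ← hh] at hgood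
  obtain ⟨ρ, hρ⟩ : ∃ ρ, ρ = M ^ 2 / p ^ 4 + 1 / p ^ 5 := ⟨_, rfl⟩
  have hρ0 : 0 ≤ ρ := by rw [hρ]; positivity
  have hρ5 : 1 / p ^ 5 ≤ ρ := by rw [hρ]; linarith [show 0 ≤ M ^ 2 / p ^ 4 by positivity]
  rw [← hρ] at eA'
  obtain ⟨X, hX⟩ : ∃ X, X = errorDensity σ a b μ vm vp M ν x t φ ψ dφ dψ := ⟨_, rfl⟩
  have hX' : X = dφ ^ 2 + dψ ^ 2 + I ^ 2 + X2 ^ 2 + (φ ^ 2 + ψ ^ 2) * ρ + p ^ 5 * X3 ^ 2 +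
      M * |E| + ν * (w * R) := by rw [hX, hρ]; rfl
  rw [← hX]
  obtain ⟨hXA, hXB⟩ := error_terms_le (φ := φ) (ψ := ψ) (dφ := dφ) (dψ := dψ) hb hβ2 (sq_nonneg I)
    (sq_nonneg X2) hρ0 hρ5 (mul_nonneg (pow_nonneg hp0.le 5) (sq_nonneg X3))
    (mul_nonneg hM (abs_nonneg E)) (mul_nonneg hν (mul_nonneg hw0 hR0))
  rw [← hX', ← hk, ← hdk] at hXA
  rw [← hX', ← hdh] at hXB
  have fA := mul_le_mul_of_nonneg_left hXA (mul_nonneg hΛ0 hCA0)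
  have fB := mul_le_mul_of_nonneg_left hXB hCB0
  have hΛ' : Λ * (β / 2 * (η1 * k ^ 2)) = (Ck + 1) * (η1 * k ^ 2) := by
    rw [← hΛβ]; ring
  rw [hred]
  clear hred hX' hX hXA hXB
  linarith

end

/-! ### The energy inequality at a fixed time -/

section

variable {a b μ κ K B : ℝ} {σ : ℝ → ℝ} {vm vp : ℝ}

lemma aestronglyMeasurable_energyRate {α : Type*} [MeasurableSpace α] {ρ : Measure α}
    {x t φ ψ φt ψt : α → ℝ} (Λ : ℝ) (hσ : IsStress a b σ)
    (hA : AEStronglyMeasurable (fun i => wtA b μ (x i) (t i)) ρ)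
    (hAt : AEStronglyMeasurable (fun i => wtAt b μ (x i) (t i)) ρ)
    (hB : AEStronglyMeasurable (fun i => wtB b μ (x i) (t i)) ρ)
    (hBt : AEStronglyMeasurable (fun i => wtBt b μ (x i) (t i)) ρ)
    (hv : AEStronglyMeasurable (fun i => vhat σ a b μ vm vp (x i) (t i)) ρ)
    (hvt : AEStronglyMeasurable (fun i => vhatT σ a b μ vm vp (x i) (t i)) ρ)
    (hφ : AEStronglyMeasurable φ ρ) (hψ : AEStronglyMeasurable ψ ρ)
    (hφt : AEStronglyMeasurable φt ρ) (hψt : AEStronglyMeasurable ψt ρ) :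
    AEStronglyMeasurable
      (fun i => energyRate Λ σ a b μ vm vp (x i) (t i) (φ i) (ψ i) (φt i) (ψt i)) ρ := by
  have hvφ := hv.add hφ
  have hn1 := hσ.continuous_nl.comp_aestronglyMeasurable hvφ
  have hn2 := hσ.continuous_nl.comp_aestronglyMeasurable hv
  have hR := hσ.continuous_nlRel.comp_aestronglyMeasurable (hvφ.prodMk hv)
  have hP := hσ.continuous_nlPot.comp_aestronglyMeasurable (hvφ.prodMk hv)
  have hk := hψ.add (hφ.const_mul √b)
  have hh := hψ.sub (hφ.const_mul √b)
  exact ((((hk.mul (hψt.add (hφt.const_mul √b))).mul hA).add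
    (((hk.pow 2).const_mul (1 / 2)).mul hAt)).const_mul Λ).add
    ((((hh.mul (hψt.sub (hφt.const_mul √b))).add (((hn1.sub hn2).mul hφt).add
      (hR.mul hvt))).mul hB).add ((((hh.pow 2).const_mul (1 / 2)).add hP).mul hBt))

lemma aestronglyMeasurable_energy {α : Type*} [MeasurableSpace α] {ρ : Measure α}
    {x t φ ψ : α → ℝ} (Λ : ℝ) (hσ : IsStress a b σ)
    (hA : AEStronglyMeasurable (fun i => wtA b μ (x i) (t i)) ρ)
    (hB : AEStronglyMeasurable (fun i => wtB b μ (x i) (t i)) ρ)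
    (hv : AEStronglyMeasurable (fun i => vhat σ a b μ vm vp (x i) (t i)) ρ)
    (hφ : AEStronglyMeasurable φ ρ) (hψ : AEStronglyMeasurable ψ ρ) :
    AEStronglyMeasurable
      (fun i => energy Λ σ a b μ vm vp (x i) (t i) (φ i) (ψ i)) ρ := by
  have hP := hσ.continuous_nlPot.comp_aestronglyMeasurable ((hv.add hφ).prodMk hv)
  have hk := hψ.add (hφ.const_mul √b)
  have hh := hψ.sub (hφ.const_mul √b)
  exact ((((hk.pow 2).const_mul (1 / 2)).mul hA).const_mul Λ).add
    ((((hh.pow 2).const_mul (1 / 2)).add hP).mul hB)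

lemma sq_add_mul_le {β b x y : ℝ} (hβ2 : β ^ 2 = b) :
    (x + β * y) ^ 2 ≤ 2 * (1 + b) * (x ^ 2 + y ^ 2) ∧
    (x - β * y) ^ 2 ≤ 2 * (1 + b) * (x ^ 2 + y ^ 2) := by
  have h : 0 ≤ b := hβ2 ▸ sq_nonneg β
  have h1 : 0 ≤ b * x ^ 2 := by positivity
  have h2 : 0 ≤ y ^ 2 := by positivity
  subst hβ2
  constructor
  · linarith [sq_nonneg (x - β * y)]
  · linarith [sq_nonneg (x + β * y)]

/-- The potential, the relative flux and the flux difference are quadratic, resp. linear, in `φ`. -/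
lemma StressBounds.perturbation_bounds (hσ : StressBounds a b κ K σ) {v₀ φ : ℝ}
    (hv : v₀ + φ ∈ Ioc (-a) (a + 1)) (hv₀ : v₀ ∈ Ioc (-a) (a + 1)) :
    |nlPot σ b (v₀ + φ) v₀| ≤ K * φ ^ 2 ∧ |nlRel σ b (v₀ + φ) v₀| ≤ K * φ ^ 2 ∧
    |nl σ b (v₀ + φ) - nl σ b v₀| ≤ K * |φ| := by
  have h1 := hσ.nlPot_bounds hv hv₀
  have h2 := hσ.abs_nl_sub_le_lip hv hv₀
  have h3 := hσ.nlRel_nonneg hv hv₀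
  have h4 := hσ.nlRel_le hv hv₀
  rw [add_sub_cancel_left] at h1 h2 h4
  refine ⟨?_, by rwa [abs_of_nonneg h3], h2⟩
  rw [abs_of_nonneg h1.1]
  refine h1.2.trans ?_
  calc _ ≤ K * |φ| * |φ| := by gcongr
    _ = _ := by rw [mul_assoc, abs_mul_abs_self]; ring

lemma abs_energy_le (hσ : StressBounds a b κ K σ) (hμ : 0 < μ) (Λ : ℝ) :
    ∃ C ≥ 0, ∀ vm vp x t φ ψ, NearStates σ a b μ vm vp → 0 ≤ t →
      vhat σ a b μ vm vp x t + φ ∈ Ioc (-a) (a + 1) →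
      |energy Λ σ a b μ vm vp x t φ ψ| ≤ C * (φ ^ 2 + ψ ^ 2) := by
  obtain ⟨W, hW⟩ := exists_weight_bound b hμ
  have hb := hσ.b_pos
  have hK := hσ.K_pos
  have hW0 : 0 ≤ W := (abs_nonneg _).trans (hW 0 0 le_rfl).1
  refine ⟨|Λ| * ((1 + b) * W) + ((1 + b) + K) * W, by positivity, fun vm vp x t φ ψ hs ht hv => ?_⟩
  obtain ⟨wA, -, -, wB, -⟩ := hW x t ht
  obtain ⟨hP, -, -⟩ := hσ.perturbation_bounds hv (hs.vhat_mem hσ hμ ht)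
  obtain ⟨hk, hh⟩ := sq_add_mul_le (x := ψ) (y := φ) (Real.sq_sqrt hb.le)
  have hq : φ ^ 2 ≤ φ ^ 2 + ψ ^ 2 := by linarith [sq_nonneg ψ]
  unfold energy
  calc _ ≤ |Λ| * (1 / 2 * (ψ + √b * φ) ^ 2 * |wtA b μ x t|) +
        (1 / 2 * (ψ - √b * φ) ^ 2 +
          |nlPot σ b (vhat σ a b μ vm vp x t + φ) (vhat σ a b μ vm vp x t)|) * |wtB b μ x t| := by
        refine (abs_add_le _ _).trans (add_le_add ?_ ?_)
        · rw [abs_mul, abs_mul, abs_of_nonneg (by positivity : 0 ≤ 1 / 2 * (ψ + √b * φ) ^ 2)]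
        · rw [abs_mul]
          refine mul_le_mul_of_nonneg_right ((abs_add_le _ _).trans ?_) (abs_nonneg _)
          rw [abs_of_nonneg (by positivity : 0 ≤ 1 / 2 * (ψ - √b * φ) ^ 2)]
    _ ≤ |Λ| * (1 / 2 * (2 * (1 + b) * (ψ ^ 2 + φ ^ 2)) * W) +
        (1 / 2 * (2 * (1 + b) * (ψ ^ 2 + φ ^ 2)) + K * (φ ^ 2 + ψ ^ 2)) * W := by
        have hP' := hP.trans (mul_le_mul_of_nonneg_left hq hK.le)
        gcongr
    _ = _ := by ring

lemma abs_energyRate_le (hσ : StressBounds a b κ K σ) (hμ : 0 < μ) (B Λ : ℝ) :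
    ∃ C ≥ 0, ∀ vm vp x t φ ψ φt ψt, NearStates σ a b μ vm vp → WaveBounds B σ a b μ vm vp →
      0 ≤ t → vhat σ a b μ vm vp x t + φ ∈ Ioc (-a) (a + 1) →
      |energyRate Λ σ a b μ vm vp x t φ ψ φt ψt| ≤
        C * ((φ ^ 2 + ψ ^ 2) + (φt ^ 2 + ψt ^ 2)) := by
  obtain ⟨W, hW⟩ := exists_weight_bound b hμ
  obtain ⟨D, hD⟩ := NearStates.exists_deriv_bound hσ hμ B
  have hb := hσ.b_pos
  have hK := hσ.K_pos
  have hW0 : 0 ≤ W := (abs_nonneg _).trans (hW 0 0 le_rfl).1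
  refine ⟨|Λ| * ((1 + b) * W + (1 + b) * W) + (((1 + b) + (K + K * |D|)) * W + ((1 + b) + K) * W),
    by positivity, fun vm vp x t φ ψ φt ψt hs hw ht hv => ?_⟩
  obtain ⟨wA, -, wAt, wB, -, wBt, -⟩ := hW x t ht
  have hT := (hD vm vp x t hs hw ht).2.trans (le_abs_self D)
  obtain ⟨hP, hR, hq⟩ := hσ.perturbation_bounds hv (hs.vhat_mem hσ hμ ht)
  obtain ⟨hk, hh⟩ := sq_add_mul_le (x := ψ) (y := φ) (Real.sq_sqrt hb.le)
  obtain ⟨hkt, hht⟩ := sq_add_mul_le (x := ψt) (y := φt) (Real.sq_sqrt hb.le)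
  obtain ⟨S, hS⟩ : ∃ S, S = (φ ^ 2 + ψ ^ 2) + (φt ^ 2 + ψt ^ 2) := ⟨_, rfl⟩
  have s1 := sq_nonneg φ
  have s2 := sq_nonneg ψ
  have s3 := sq_nonneg φt
  have s4 := sq_nonneg ψt
  have hφS : φ ^ 2 ≤ S := by linarith
  have hS0 : 0 ≤ S := by linarith
  have hyoung : ∀ y z : ℝ, |y| * |z| ≤ (y ^ 2 + z ^ 2) / 2 := fun y z => by
    rw [← sq_abs y, ← sq_abs z]; linarith [sq_nonneg (|y| - |z|)]
  have b1 : |(ψ + √b * φ) * (ψt + √b * φt)| ≤ (1 + b) * S := by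
    rw [abs_mul]
    refine (hyoung _ _).trans ?_
    rw [hS]; linarith
  have b2 : |(ψ - √b * φ) * (ψt - √b * φt)| ≤ (1 + b) * S := by
    rw [abs_mul]
    refine (hyoung _ _).trans ?_
    rw [hS]; linarith
  have bS : ψ ^ 2 + φ ^ 2 ≤ S := by linarith
  have hb1 : 0 ≤ 1 + b := by linarith
  have b3 : |1 / 2 * (ψ + √b * φ) ^ 2| ≤ (1 + b) * S := by
    rw [abs_of_nonneg (by positivity)]
    linarith [mul_le_mul_of_nonneg_left bS hb1]
  have b4 : |1 / 2 * (ψ - √b * φ) ^ 2| ≤ (1 + b) * S := by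
    rw [abs_of_nonneg (by positivity)]
    linarith [mul_le_mul_of_nonneg_left bS hb1]
  have b5 : |(nl σ b (vhat σ a b μ vm vp x t + φ) - nl σ b (vhat σ a b μ vm vp x t)) * φt| ≤
      K * S := by
    rw [abs_mul]
    calc _ ≤ K * |φ| * |φt| := by gcongr
      _ = K * (|φ| * |φt|) := by ring
      _ ≤ K * S := by gcongr; linarith [hyoung φ φt]
  have b6 : |nlRel σ b (vhat σ a b μ vm vp x t + φ) (vhat σ a b μ vm vp x t) *
      vhatT σ a b μ vm vp x t| ≤ K * |D| * S := by
    rw [abs_mul]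
    calc _ ≤ K * φ ^ 2 * |D| := mul_le_mul hR hT (abs_nonneg _) (by positivity)
      _ = K * |D| * φ ^ 2 := by ring
      _ ≤ _ := by gcongr
  have b7 := hP.trans (mul_le_mul_of_nonneg_left hφS hK.le)
  rw [← hS]
  have hm : ∀ {y z c : ℝ}, |y| ≤ c * S → |z| ≤ W → 0 ≤ c → |y * z| ≤ c * W * S := by
    intro y z c hy hz hc
    rw [abs_mul]
    calc _ ≤ c * S * W := mul_le_mul hy hz (abs_nonneg _) (by positivity)
      _ = _ := by ring
  have d1 := hm b1 wA hb1
  have d2 := hm b3 wAt hb1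
  have d3 : |(ψ - √b * φ) * (ψt - √b * φt) +
      ((nl σ b (vhat σ a b μ vm vp x t + φ) - nl σ b (vhat σ a b μ vm vp x t)) * φt +
        nlRel σ b (vhat σ a b μ vm vp x t + φ) (vhat σ a b μ vm vp x t) *
          vhatT σ a b μ vm vp x t)| ≤ ((1 + b) + (K + K * |D|)) * S := by
    refine (abs_add_le _ _).trans ((add_le_add b2 ((abs_add_le _ _).trans
      (add_le_add b5 b6))).trans_eq ?_)
    ring
  have d4 : |1 / 2 * (ψ - √b * φ) ^ 2 +
      nlPot σ b (vhat σ a b μ vm vp x t + φ) (vhat σ a b μ vm vp x t)| ≤ ((1 + b) + K) * S :=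
    (abs_add_le _ _).trans ((add_le_add b4 b7).trans_eq (by ring))
  have d5 := hm d3 wB (by positivity)
  have d6 := hm d4 wBt (by positivity)
  unfold energyRate
  calc _ ≤ |Λ| * ((1 + b) * W * S + (1 + b) * W * S) +
        (((1 + b) + (K + K * |D|)) * W * S + ((1 + b) + K) * W * S) := by
        refine (abs_add_le _ _).trans (add_le_add ?_ ((abs_add_le _ _).trans (add_le_add d5 d6)))
        rw [abs_mul]
        exact mul_le_mul_of_nonneg_left ((abs_add_le _ _).trans (add_le_add d1 d2)) (abs_nonneg _)
    _ = _ := by ring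

lemma memLp_ur2 (hσ : StressBounds a b κ K σ) (hμ : 0 < μ) (hs : NearStates σ a b μ vm vp) {t : ℝ}
    (ht : 0 ≤ t) : MemLp (fun x => ur2 σ a vp x t) 2 volume := by
  have hvp := hs.vp_mem hμ
  obtain ⟨C, hC⟩ := NearStates.exists_ur2_bound hσ hμ
  have hi := (hσ.integral_ur2 hvp hs.lam_sub_le ht).1
  refine (memLp_two_iff_integrable_sq hi.aestronglyMeasurable).2 ?_
  simp_rw [sq]
  exact integrable_mul_of_bounded hi hi.aestronglyMeasurable fun x => hC vm vp x t hs ht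

end

section

variable {a b μ κ K B : ℝ} {σ : ℝ → ℝ} {vm vp t : ℝ} {φ ψ : ℝ → ℝ}
  (hσ : StressBounds a b κ K σ) (hμ : 0 < μ) (hs : NearStates σ a b μ vm vp)
  (hw : WaveBounds B σ a b μ vm vp) (ht : 0 ≤ t) (hφ : InH1 φ) (hψ : InH1 ψ)
include hσ hμ hs ht hψ

omit hσ in
lemma memLp_phiT : MemLp (fun x => phiT a b μ vm x t (deriv ψ x)) 2 volume :=
  hψ.memLp_deriv.sub ((memLp_Xi3 hμ hs ht).const_mul _)

include hw hφ

omit hψ in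
lemma memLp_psiT (hψ' : InH1 (deriv ψ))
    (hv : ∀ x, vhat σ a b μ vm vp x t + φ x ∈ Ioc (-a) (a + 1)) :
    MemLp (fun x => psiT σ a b μ vm vp x t (φ x) (deriv φ x) (deriv (deriv ψ) x)) 2 volume :=
  ((((hφ.memLp_deriv.const_mul b).add ((h1Pair_flux hσ hμ hs hw ht (.of_inH1 hφ) hv).memLp'.add
    (h1Pair_inter hσ hμ hs hw ht).memLp')).add (hψ'.memLp_deriv.const_mul μ)).add
    ((memLp_ur2 hσ hμ hs ht).const_mul μ)).add ((memLp_Xi3 hμ hs ht).const_mul _)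

lemma integrable_energyRate (Λ : ℝ) (hψ' : InH1 (deriv ψ))
    (hv : ∀ x, vhat σ a b μ vm vp x t + φ x ∈ Ioc (-a) (a + 1)) :
    Integrable fun x => energyRate Λ σ a b μ vm vp x t (φ x) (ψ x)
      (phiT a b μ vm x t (deriv ψ x))
      (psiT σ a b μ vm vp x t (φ x) (deriv φ x) (deriv (deriv ψ) x)) := by
  have hvp := hs.vp_mem hμ
  obtain ⟨C, -, hC⟩ := abs_energyRate_le hσ hμ B Λ
  have h1 := memLp_phiT hμ hs ht hψ
  have h2 := memLp_psiT hσ hμ hs hw ht hφ hψ' hv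
  refine (((hφ.integrable_sq.add hψ.integrable_sq).add
    (h1.integrable_sq.add h2.integrable_sq)).const_mul C).mono'
    (aestronglyMeasurable_energyRate Λ hσ.toIsStress
      ((contForward_wtA hμ).space ht).aestronglyMeasurable
      ((contForward_wtAt hμ).space ht).aestronglyMeasurable
      ((contForward_wtB hμ).space ht).aestronglyMeasurable
      ((contForward_wtBt hμ).space ht).aestronglyMeasurable
      ((contForward_vhat hσ hμ hvp).space ht).aestronglyMeasurable
      ((contForward_vhatT hσ hμ hvp).space ht).aestronglyMeasurable
      hφ.continuous.aestronglyMeasurable hψ.continuous.aestronglyMeasurable h1.1 h2.1)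
    (ae_of_all _ fun x => hC vm vp x t _ _ _ _ hs hw ht (hv x))

/-- Up to an exact derivative, the rate of change of the energy is the reduced rate. The flux of
`wtC` implements a Hardy type inequality, which recovers the weight `w²` from `s² w²`. -/
lemma integral_energyRate_eq (Λ : ℝ) (hψ' : InH1 (deriv ψ))
    (hv : ∀ x, vhat σ a b μ vm vp x t + φ x ∈ Ioc (-a) (a + 1)) :
    (Integrable fun x => reducedRate Λ σ a b μ vm vp x t (φ x) (ψ x) (deriv φ x) (deriv ψ x)) ∧
    ∫ x, energyRate Λ σ a b μ vm vp x t (φ x) (ψ x) (phiT a b μ vm x t (deriv ψ x))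
      (psiT σ a b μ vm vp x t (φ x) (deriv φ x) (deriv (deriv ψ) x)) =
    ∫ x, reducedRate Λ σ a b μ vm vp x t (φ x) (ψ x) (deriv φ x) (deriv ψ x) := by
  have hb := hσ.b_pos
  have hsb : 0 < √b := Real.sqrt_pos.2 hb
  obtain ⟨W, hW⟩ := exists_weight_bound b hμ
  have pφ := H1Pair.of_inH1 hφ
  have pψ := H1Pair.of_inH1 hψ
  have pk := pψ.add (pφ.const_mul √b)
  have ph := pψ.sub (pφ.const_mul √b)
  have pZ0 := ((H1Pair.of_inH1 hψ').const_mul μ).add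
    ((h1Pair_flux hσ hμ hs hw ht pφ hv).add (h1Pair_inter hσ hμ hs hw ht))
  have pZ := pZ0.add ((h1Pair_Xi2 hμ hs ht).const_mul (μ ^ 2 / 4))
  -- the fluxes of the estimate for `k`, of the estimate for `h` and of the Hardy type inequality
  have FA := (((pk.mul pk).const_mul (√b / 2)).add (pk.mul pZ0)).mul_bounded
    (fun x => hasDerivAt_wtA_space (b := b) hμ ht) ((contForward_wtA1 hμ).space ht)
    (fun x => (hW x t ht).1) (fun x => (hW x t ht).2.1)
  have FB := ((((ph.mul ph).const_mul (-√b / 2)).add (ph.mul pZ)).add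
    ((isFlux_nlPot hσ hμ hs hw ht pφ hv).const_mul √b)).mul_bounded
    (fun x => hasDerivAt_wtB_space (b := b) hμ ht) ((contForward_wtB1 hμ).space ht)
    (fun x => (hW x t ht).2.2.2.1) (fun x => (hW x t ht).2.2.2.2.1)
  have FC := ((ph.mul ph).mul_bounded (fun x => hasDerivAt_wtC_space (b := b) hμ ht)
    ((contForward_wtC1 hμ).space ht) (fun x => (hW x t ht).2.2.2.2.2.2.1)
    (fun x => (hW x t ht).2.2.2.2.2.2.2)).const_mul (μ / 5)
  have hrate := integrable_energyRate hσ hμ hs hw ht hφ hψ Λ hψ' hv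
  suffices key : ∃ F F', IsFlux F F' ∧
      ∀ x, reducedRate Λ σ a b μ vm vp x t (φ x) (ψ x) (deriv φ x) (deriv ψ x) =
        energyRate Λ σ a b μ vm vp x t (φ x) (ψ x) (phiT a b μ vm x t (deriv ψ x))
          (psiT σ a b μ vm vp x t (φ x) (deriv φ x) (deriv (deriv ψ) x)) - F' x by
    obtain ⟨F, F', hF, h⟩ := key
    refine ⟨(hrate.sub hF.integrable').congr (ae_of_all _ fun x => (h x).symm), ?_⟩
    rw [integral_congr_ae (ae_of_all _ h), integral_sub hrate hF.integrable', hF.integral_eq_zero,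
      sub_zero]
  refine ⟨_, _, ((FA.const_mul Λ).add FB).add FC, fun x => ?_⟩
  have e1 : psiT σ a b μ vm vp x t (φ x) (deriv φ x) (deriv (deriv ψ) x) =
      √b ^ 2 * deriv φ x + (fluxX σ a b μ vm vp x t (φ x) (deriv φ x) + interX σ a b μ vm vp x t) +
        μ * deriv (deriv ψ) x + μ * ur2 σ a vp x t +
        √b * (μ ^ 2 / (8 * √b) * Xi3 a b μ vm x t) := by
    rw [Real.sq_sqrt hb.le, psiT]
    field
  have e2 : μ ^ 2 / 4 * Xi3 a b μ vm x t =
      2 * (√b * (μ ^ 2 / (8 * √b) * Xi3 a b μ vm x t)) := by field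
  rw [e1]
  simp only [e2, energyRate, reducedRate, phiT, wtBt, wtC1]
  generalize μ ^ 2 / (8 * √b) = c
  ring

end

/-- The weights involving the amplitude `M` of the perturbation are absorbed by its dissipation. -/
lemma amplitude_le {D M p : ℝ} (hM : 0 ≤ M) (hp : 1 ≤ p) (hMD : M ^ 4 = 4 * D) :
    M ^ 2 / p ^ 4 ≤ 4 * D + 1 / p ^ 5 ∧ M / p ^ 4 ≤ 4 * D + 1 / p ^ 5 := by
  have hp0 : 0 < p := by linarith
  have hp5 : 0 ≤ 1 / p ^ 5 := by positivity
  constructor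
  · have h1 : 1 / p ^ 8 ≤ 1 / p ^ 5 :=
      one_div_le_one_div_of_le (by positivity) (pow_le_pow_right₀ hp (by norm_num))
    have h2 : M ^ 2 / p ^ 4 ≤ M ^ 4 + 1 / p ^ 8 := by
      have e : M ^ 4 + 1 / p ^ 8 - M ^ 2 / p ^ 4 =
          (M ^ 2 - 1 / p ^ 4) ^ 2 + M ^ 2 / p ^ 4 := by field
      have : 0 ≤ (M ^ 2 - 1 / p ^ 4) ^ 2 + M ^ 2 / p ^ 4 := by positivity
      linarith
    linarith
  · rcases le_total (M * p) 1 with h | h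
    · have : M / p ^ 4 ≤ 1 / p ^ 5 := by
        rw [div_le_div_iff₀ (by positivity) (by positivity)]
        calc M * p ^ 5 = M * p * p ^ 4 := by ring
          _ ≤ 1 * p ^ 4 := by gcongr
      nlinarith [pow_nonneg hM 4]
    · have h3 : 1 ≤ (M * p) ^ 3 := one_le_pow₀ h
      have : M / p ^ 4 ≤ M ^ 4 := by
        rw [div_le_iff₀ (by positivity)]
        calc M ≤ M * ((M * p) ^ 3 * p) :=
              le_mul_of_one_le_right hM (by nlinarith)
          _ = _ := by ring
      linarith

section

variable {a b μ κ K : ℝ} {σ : ℝ → ℝ}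

/-- The energy inequality at a fixed time, in integrated form. -/
lemma exists_energy_inequality (hσ : StressBounds a b κ K σ) (hμ : 0 < μ) (B : ℝ) :
    ∃ Λ ≥ 0, ∃ c₀ > 0, ∃ C ≥ 0, ∀ vm vp ν t φ ψ, NearStates σ a b μ vm vp →
      WaveBounds B σ a b μ vm vp → 0 ≤ t → InH1 φ → InH1 ψ → InH1 (deriv ψ) →
      (∀ x, vhat σ a b μ vm vp x t + φ x ∈ Ioc (-a) (a + 1)) →
      (∫ x, φ x ^ 2) + ∫ x, ψ x ^ 2 ≤ 1 → (∀ x, |φ x| ≤ ν) → (∀ x, |ψ x| ≤ ν) → vp - vm ≤ ν →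
      c₀ * (∫ x, heatWeight b μ x t ^ 2 * (φ x ^ 2 + ψ x ^ 2)) +
        ∫ x, energyRate Λ σ a b μ vm vp x t (φ x) (ψ x) (phiT a b μ vm x t (deriv ψ x))
          (psiT σ a b μ vm vp x t (φ x) (deriv φ x) (deriv (deriv ψ) x)) ≤
      C * (((∫ x, deriv φ x ^ 2) + ∫ x, deriv ψ x ^ 2) + 1 / qrt t ^ 5 +
        ν * ∫ x, heatWeight b μ x t *
          nlRel σ b (vhat σ a b μ vm vp x t + φ x) (vhat σ a b μ vm vp x t)) := by
  obtain ⟨Λ, hΛ, c₀, hc₀, C, hC, H⟩ := reducedRate_le hσ hμ B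
  refine ⟨Λ, hΛ, c₀, hc₀, C * (6 + 4 * |B|), by positivity, ?_⟩
  intro vm vp ν t φ ψ hs hw ht hφ hψ hψ' hv hn hφν hψν hδν
  have hp := one_le_qrt ht
  have hp0 := qrt_pos ht
  have hB1 := hw.one_le
  have hB0 : 0 ≤ B := by linarith
  rw [abs_of_nonneg hB0]
  obtain ⟨D, hD⟩ : ∃ D, D = (∫ x, deriv φ x ^ 2) + ∫ x, deriv ψ x ^ 2 := ⟨_, rfl⟩
  obtain ⟨n, hn'⟩ : ∃ n, n = (∫ x, φ x ^ 2) + ∫ x, ψ x ^ 2 := ⟨_, rfl⟩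
  have i1 : 0 ≤ ∫ x, deriv φ x ^ 2 := integral_nonneg fun x => sq_nonneg _
  have i2 : 0 ≤ ∫ x, deriv ψ x ^ 2 := integral_nonneg fun x => sq_nonneg _
  have i3 : 0 ≤ ∫ x, φ x ^ 2 := integral_nonneg fun x => sq_nonneg _
  have i4 : 0 ≤ ∫ x, ψ x ^ 2 := integral_nonneg fun x => sq_nonneg _
  have hD0 : 0 ≤ D := by linarith
  have hn0 : 0 ≤ n := by linarith
  -- the bound for the perturbation in terms of its dissipation given by Agmon's inequality
  obtain ⟨M, hM⟩ : ∃ M, M = √(2 * √D) := ⟨_, rfl⟩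
  have hM0 : 0 ≤ M := by rw [hM]; positivity
  have hM4 : M ^ 4 = 4 * D := by
    rw [hM, show 4 = 2 * 2 from rfl, pow_mul, Real.sq_sqrt (by positivity), mul_pow,
      Real.sq_sqrt hD0]
    norm_num
  have hφM : ∀ x, |φ x| ≤ M := fun x => by
    rw [hM]
    refine Real.abs_le_sqrt ((hφ.sq_le_sqrt one_pos (by linarith) x).trans ?_)
    rw [mul_one, hD]
    gcongr
    linarith
  have hψM : ∀ x, |ψ x| ≤ M := fun x => by
    rw [hM]
    refine Real.abs_le_sqrt ((hψ.sq_le_sqrt one_pos (by linarith) x).trans ?_)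
    rw [mul_one, hD]
    gcongr
    linarith
  have hν : 0 ≤ ν := (abs_nonneg _).trans (hφν 0)
  obtain ⟨hir, he⟩ := integral_energyRate_eq hσ hμ hs hw ht hφ hψ Λ hψ' hv
  have hcw := (contForward_heatWeight (b := b) hμ).space ht
  have hW : ∀ x, |heatWeight b μ x t| ≤ 1 / √(2 * μ) := fun x => by
    rw [abs_of_nonneg heatWeight_nonneg]; exact heatWeight_le hμ ht
  have hiw : Integrable fun x => heatWeight b μ x t ^ 2 * (φ x ^ 2 + ψ x ^ 2) := by
    have := integrable_mul_of_bounded (η := fun x => heatWeight b μ x t ^ 2)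
      (c := (1 / √(2 * μ)) ^ 2) (hφ.integrable_sq.add hψ.integrable_sq)
      (hcw.pow 2).aestronglyMeasurable fun x => by
        rw [abs_pow]; exact pow_le_pow_left₀ (abs_nonneg _) (hW x) 2
    exact this.congr (ae_of_all _ fun x => mul_comm _ _)
  have hvp := hs.vp_mem hμ
  have hcv := (contForward_vhat hσ hμ hvp (vm := vm)).space ht
  have hiR : Integrable fun x => heatWeight b μ x t *
      nlRel σ b (vhat σ a b μ vm vp x t + φ x) (vhat σ a b μ vm vp x t) := by
    refine (hφ.integrable_sq.const_mul (1 / √(2 * μ) * K)).mono'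
      (hcw.mul (hσ.continuous_nlRel.comp
        ((hcv.add hφ.continuous).prodMk hcv))).aestronglyMeasurable (ae_of_all _ fun x => ?_)
    rw [Real.norm_eq_abs, abs_mul, mul_assoc]
    exact mul_le_mul (hW x) (hσ.perturbation_bounds (hv x) (hs.vhat_mem hσ hμ ht)).2.1
      (abs_nonneg _) (by positivity)
  have j1 := hφ.integrable_deriv_sq.add hψ.integrable_deriv_sq
  have j2 := hw.integrable_inter t ht
  have j3 := (memLp_Xi2 hμ hs ht).integrable_sq
  have j4 := (hφ.integrable_sq.add hψ.integrable_sq).mul_const (M ^ 2 / qrt t ^ 4 + 1 / qrt t ^ 5)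
  have j5 := ((memLp_Xi3 hμ hs ht).integrable_sq).const_mul (qrt t ^ 5)
  have j6 := ((hσ.integral_ur2 hvp hs.lam_sub_le ht).1.abs).const_mul M
  have j7 := hiR.const_mul ν
  have j12 := j1.add j2
  have j13 := j12.add j3
  have j14 := j13.add j4
  have j15 := j14.add j5
  have j16 := j15.add j6
  have hie : Integrable fun x =>
      errorDensity σ a b μ vm vp M ν x t (φ x) (ψ x) (deriv φ x) (deriv ψ x) := j16.add j7
  have hes : ∫ x, errorDensity σ a b μ vm vp M ν x t (φ x) (ψ x) (deriv φ x) (deriv ψ x) =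
      D + (∫ x, (nl σ b (vhat σ a b μ vm vp x t) - nl σ b (vr σ a vp x t)) ^ 2) +
      (∫ x, Xi2 a b μ vm x t ^ 2) + n * (M ^ 2 / qrt t ^ 4 + 1 / qrt t ^ 5) +
      qrt t ^ 5 * (∫ x, Xi3 a b μ vm x t ^ 2) + M * (∫ x, |ur2 σ a vp x t|) +
      ν * ∫ x, heatWeight b μ x t *
        nlRel σ b (vhat σ a b μ vm vp x t + φ x) (vhat σ a b μ vm vp x t) := by
    have r7 := integral_add j16 j7
    have r6 := integral_add j15 j6
    have r5 := integral_add j14 j5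
    have r4 := integral_add j13 j4
    have r3 := integral_add j12 j3
    have r2 := integral_add j1 j2
    have r1 := integral_add hφ.integrable_deriv_sq hψ.integrable_deriv_sq
    have r0 := integral_add hφ.integrable_sq hψ.integrable_sq
    simp only [integral_const_mul, integral_mul_const] at r7 r6 r5 r4
    rw [hD, hn', ← r0, ← r1]
    simp only [Pi.add_apply] at r7 r6 r5 r4 r3 r2 r1 r0 ⊢
    unfold errorDensity
    linarith
  obtain ⟨J, hJ⟩ : ∃ J, J = ∫ x, heatWeight b μ x t *
        nlRel σ b (vhat σ a b μ vm vp x t + φ x) (vhat σ a b μ vm vp x t) := ⟨_, rfl⟩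
  have hJ0 : 0 ≤ J := by
    rw [hJ]
    exact integral_nonneg fun x => mul_nonneg heatWeight_nonneg
      (hσ.nlRel_nonneg (hv x) (hs.vhat_mem hσ hμ ht))
  obtain ⟨a1, a2⟩ := amplitude_le hM0 hp hM4
  have m1 := hw.inter_le t ht
  have m2 := hw.Xi2_le t ht
  have m3 : qrt t ^ 5 * (∫ x, Xi3 a b μ vm x t ^ 2) ≤ B * (1 / qrt t ^ 5) := by
    calc _ ≤ qrt t ^ 5 * (B / qrt t ^ 10) := by
          exact mul_le_mul_of_nonneg_left (hw.Xi3_le t ht) (by positivity)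
      _ = _ := by field
  have m4 : M * (∫ x, |ur2 σ a vp x t|) ≤ B * (4 * D + 1 / qrt t ^ 5) := by
    calc _ ≤ M * (B / qrt t ^ 4) := mul_le_mul_of_nonneg_left (hw.ur2_le t ht) hM0
      _ = B * (M / qrt t ^ 4) := by ring
      _ ≤ _ := mul_le_mul_of_nonneg_left a2 hB0
  obtain ⟨y, hy⟩ : ∃ y, y = 1 / qrt t ^ 5 := ⟨_, rfl⟩
  have hy0 : 0 ≤ y := by rw [hy]; positivity
  have m5 : n * (M ^ 2 / qrt t ^ 4 + 1 / qrt t ^ 5) ≤ 4 * D + 2 * y := by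
    refine (mul_le_of_le_one_left (by positivity) (hn' ▸ hn)).trans ?_
    rw [← hy] at a1 ⊢
    linarith
  rw [div_eq_mul_one_div, ← hy] at m1 m2
  rw [← hy] at m3 m4
  have herr : ∫ x, errorDensity σ a b μ vm vp M ν x t (φ x) (ψ x) (deriv φ x) (deriv ψ x) ≤
      (6 + 4 * B) * (D + y + ν * J) := by
    rw [hes, ← hJ]
    have q1 : 0 ≤ B * y := mul_nonneg hB0 hy0
    have q2 : 0 ≤ B * (ν * J) := mul_nonneg hB0 (mul_nonneg hν hJ0)
    have q3 : 0 ≤ ν * J := mul_nonneg hν hJ0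
    linarith
  rw [he, ← integral_const_mul, ← integral_add (hiw.const_mul c₀) hir, ← hD, ← hJ, ← hy, mul_assoc]
  refine (integral_mono ((hiw.const_mul c₀).add hir) (hie.const_mul C) fun x => ?_).trans ?_
  · exact H vm vp M ν x t _ _ _ _ hs hw ht (hv x) (hφM x) (hψM x) (hφν x) (hψν x) hδν
  · rw [integral_const_mul]
    exact mul_le_mul_of_nonneg_left herr hC

end

/-! ### Absolutely continuous functions of time -/

/-- `f` is absolutely continuous on `[0, T]` with derivative `f'` almost everywhere. -/
structure TimePair (T : ℝ) (f f' : ℝ → ℝ) : Prop where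
  ac : AbsolutelyContinuousOnInterval f 0 T
  hasDerivAt : ∀ᵐ τ, τ ∈ Ioo 0 T → HasDerivAt f (f' τ) τ

lemma absolutelyContinuousOnInterval_congr {f g : ℝ → ℝ} {x y : ℝ}
    (hf : AbsolutelyContinuousOnInterval f x y) (h : EqOn g f (uIcc x y)) :
    AbsolutelyContinuousOnInterval g x y := by
  rw [absolutelyContinuousOnInterval_iff] at hf ⊢
  intro ε hε
  obtain ⟨δ, hδ, H⟩ := hf ε hε
  refine ⟨δ, hδ, fun E hE hlt => lt_of_eq_of_lt (Finset.sum_congr rfl fun i hi => ?_) (H E hE hlt)⟩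
  rw [h (hE.1 i hi).1, h (hE.1 i hi).2]

namespace TimePair

variable {T : ℝ} {f f' g g' : ℝ → ℝ}

lemma of_integral (hT : 0 ≤ T) (hi : IntervalIntegrable f' volume 0 T)
    (h : ∀ t ∈ Icc 0 T, f t - f 0 = ∫ τ in (0 : ℝ)..t, f' τ) : TimePair T f f' := by
  have h' : EqOn f (fun t => f 0 + ∫ τ in (0 : ℝ)..t, f' τ) (Icc 0 T) := fun t ht => by
    linarith [h t ht]
  constructor
  · refine absolutelyContinuousOnInterval_congr (AbsolutelyContinuousOnInterval.add
      (f := fun _ => f 0) ?_ (hi.absolutelyContinuousOnInterval_intervalIntegral left_mem_uIcc)) ?_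
    · exact (contDiff_const (n := 1)).contDiffOn.absolutelyContinuousOnInterval
    · rw [uIcc_of_le hT]; exact h'
  · filter_upwards [hi.ae_hasDerivAt_integral] with τ hτ hτ'
    rw [uIcc_of_le hT] at hτ
    refine ((hτ (Ioo_subset_Icc_self hτ') 0 (left_mem_Icc.2 hT)).const_add (f 0))
      |>.congr_of_eventuallyEq ?_
    filter_upwards [Icc_mem_nhds hτ'.1 hτ'.2] with t ht using h' ht

lemma of_continuousOn (hT : 0 ≤ T) (hf : ContinuousOn f (Icc 0 T)) (hf' : ContinuousOn f' (Icc 0 T))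
    (h : ∀ τ, 0 < τ → HasDerivAt f (f' τ) τ) : TimePair T f f' := by
  have hi : IntervalIntegrable f' volume 0 T :=
    ContinuousOn.intervalIntegrable (by rwa [uIcc_of_le hT])
  refine of_integral hT hi fun t ht => ?_
  have hsub : Icc 0 t ⊆ Icc 0 T := Icc_subset_Icc_right ht.2
  rw [intervalIntegral.integral_eq_sub_of_hasDerivAt_of_le ht.1 (hf.mono hsub)
    (fun τ hτ => h τ hτ.1) (ContinuousOn.intervalIntegrable (by
      rw [uIcc_of_le ht.1]; exact hf'.mono hsub))]

lemma congr (hf : TimePair T f f') (h : ∀ τ ∈ Ioo 0 T, f' τ = g' τ) : TimePair T f g' :=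
  ⟨hf.ac, by filter_upwards [hf.hasDerivAt] with τ h1 h2 using h τ h2 ▸ h1 h2⟩

lemma mono (hf : TimePair T f f') {t : ℝ} (ht : t ∈ Icc 0 T) : TimePair t f f' :=
  ⟨hf.ac.mono (by
    rw [uIcc_of_le ht.1, uIcc_of_le (ht.1.trans ht.2)]
    exact Icc_subset_Icc_right ht.2),
    by filter_upwards [hf.hasDerivAt] with τ h1 h2 using h1 ⟨h2.1, h2.2.trans_le ht.2⟩⟩

lemma add (hf : TimePair T f f') (hg : TimePair T g g') :
    TimePair T (fun τ => f τ + g τ) (fun τ => f' τ + g' τ) :=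
  ⟨hf.ac.add hg.ac, by
    filter_upwards [hf.hasDerivAt, hg.hasDerivAt] with τ h1 h2 h using (h1 h).add (h2 h)⟩

lemma sub (hf : TimePair T f f') (hg : TimePair T g g') :
    TimePair T (fun τ => f τ - g τ) (fun τ => f' τ - g' τ) :=
  ⟨hf.ac.sub hg.ac, by
    filter_upwards [hf.hasDerivAt, hg.hasDerivAt] with τ h1 h2 h using (h1 h).sub (h2 h)⟩

lemma mul (hf : TimePair T f f') (hg : TimePair T g g') :
    TimePair T (fun τ => f τ * g τ) (fun τ => f' τ * g τ + f τ * g' τ) :=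
  ⟨hf.ac.mul hg.ac, by
    filter_upwards [hf.hasDerivAt, hg.hasDerivAt] with τ h1 h2 h using (h1 h).mul (h2 h)⟩

lemma const_mul (c : ℝ) (hf : TimePair T f f') :
    TimePair T (fun τ => c * f τ) (fun τ => c * f' τ) :=
  ⟨hf.ac.const_mul c, by filter_upwards [hf.hasDerivAt] with τ h1 h using (h1 h).const_mul c⟩

lemma comp (hf : TimePair T f f') (hg : ∀ v, HasDerivAt g (g' v) v) (hc : Continuous g') :
    TimePair T (fun τ => g (f τ)) (fun τ => g' (f τ) * f' τ) := by
  have h1 : ContDiff ℝ 1 g := by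
    rw [contDiff_one_iff_deriv]
    refine ⟨fun v => (hg v).differentiableAt, ?_⟩
    rwa [show deriv g = g' from funext fun v => (hg v).deriv]
  obtain ⟨M, hM⟩ := hf.ac.exists_bound
  obtain ⟨k, hk⟩ := h1.contDiffOn.exists_lipschitzOnWith one_ne_zero (convex_Icc (-M) M)
    isCompact_Icc
  exact ⟨absolutelyContinuousOnInterval_comp hf.ac hk fun τ hτ => abs_le.1 (hM τ hτ), by
    filter_upwards [hf.hasDerivAt] with τ h1 h using (hg _).comp τ (h1 h)⟩

lemma sub_eq_integral (hT : 0 ≤ T) (hf : TimePair T f f') :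
    f T - f 0 = ∫ τ in (0 : ℝ)..T, f' τ := by
  refine sub_eq_integral_of_ae_hasDerivAt hf.ac ?_
  have h0 : ∀ᵐ τ : ℝ, τ ≠ 0 := by simp [ae_iff, measure_singleton]
  have h1 : ∀ᵐ τ : ℝ, τ ≠ T := by simp [ae_iff, measure_singleton]
  filter_upwards [hf.hasDerivAt, h0, h1] with τ h h0 h1 hτ
  rw [uIcc_of_le hT] at hτ
  exact h ⟨lt_of_le_of_ne hτ.1 h0.symm, lt_of_le_of_ne hτ.2 h1⟩

end TimePair

/-- If an integral identity in time holds for each time almost everywhere in space, then it holds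
almost everywhere in space for all times. -/
lemma ae_forall_sub_eq_integral {T : ℝ} {f g : ℝ → ℝ → ℝ}
    (h : ∀ t ∈ Icc 0 T, ∀ᵐ x, f x t - f x 0 = ∫ τ in (0 : ℝ)..t, g x τ)
    (hc : ∀ x, ContinuousOn (f x) (Icc 0 T))
    (hi : ∀ᵐ x, IntegrableOn (g x) (Icc 0 T)) :
    ∀ᵐ x, ∀ t ∈ Icc 0 T, f x t - f x 0 = ∫ τ in (0 : ℝ)..t, g x τ := by
  obtain ⟨S, hSc, hSd⟩ := TopologicalSpace.exists_countable_dense (Icc (0 : ℝ) T)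
  have : Countable S := hSc
  have h1 : ∀ᵐ x, ∀ s : S, f x s - f x 0 = ∫ τ in (0 : ℝ)..(s : Icc (0 : ℝ) T), g x τ :=
    ae_all_iff.2 fun s => h _ s.1.2
  filter_upwards [h1, hi] with x hx hxi t ht
  have c1 : Continuous fun s : Icc (0 : ℝ) T => f x s - f x 0 :=
    ((hc x).domRestrict).sub continuous_const
  have c2 : Continuous fun s : Icc (0 : ℝ) T => ∫ τ in (0 : ℝ)..s, g x τ := by
    have hT : (0 : ℝ) ≤ T := ht.1.trans ht.2
    have := intervalIntegral.continuousOn_primitive_interval (a := 0) (b := T) (f := g x)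
      (by rwa [uIcc_of_le hT])
    rw [uIcc_of_le hT] at this
    exact this.domRestrict
  exact congrFun (c1.ext_on hSd c2 fun s hs => hx ⟨s, hs⟩) ⟨t, ht⟩

/-! ### Measurability in space-time -/

/-- Lebesgue measure on `[0, T] × ℝ`, with the time as first coordinate. -/
abbrev slab (T : ℝ) : Measure (ℝ × ℝ) := (volume.restrict (Icc 0 T)).prod volume

section

variable {T : ℝ} {A A' : ℝ × ℝ → ℝ}

lemma ae_slab_of_ae_time {P : ℝ → Prop} (h : ∀ᵐ τ ∂(volume.restrict (Icc 0 T)), P τ) :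
    ∀ᵐ p ∂slab T, P p.1 := Measure.quasiMeasurePreserving_fst.ae h

lemma ae_slab_mem : ∀ᵐ p ∂slab T, p.1 ∈ Icc 0 T :=
  ae_slab_of_ae_time (ae_restrict_mem measurableSet_Icc)

lemma ae_ae_swap {P : ℝ × ℝ → Prop} (h : ∀ᵐ p ∂slab T, P p) :
    ∀ᵐ x, ∀ᵐ τ ∂(volume.restrict (Icc 0 T)), P (τ, x) :=
  Measure.ae_ae_of_ae_prod (Measure.measurePreserving_swap.quasiMeasurePreserving.ae h)

lemma ae_eq_slab (hA : AEStronglyMeasurable A (slab T)) (hA' : AEStronglyMeasurable A' (slab T))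
    (h : ∀ᵐ τ ∂(volume.restrict (Icc 0 T)), ∀ᵐ x, A (τ, x) = A' (τ, x)) : A =ᵐ[slab T] A' := by
  have h1 := hA.ae_eq_mk
  have h2 := hA'.ae_eq_mk
  have h3 : hA.mk A =ᵐ[slab T] hA'.mk A' := by
    refine (Measure.ae_prod_iff_ae_ae (measurableSet_eq_fun hA.stronglyMeasurable_mk.measurable
      hA'.stronglyMeasurable_mk.measurable)).2 ?_
    filter_upwards [h, Measure.ae_ae_of_ae_prod h1, Measure.ae_ae_of_ae_prod h2] with τ k k1 k2
    filter_upwards [k, k1, k2] with x l l1 l2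
    rw [← l1, ← l2, l]
  exact h1.trans (h3.trans h2.symm)

lemma aestronglyMeasurable_slab_of_continuousOn {f : ℝ → ℝ → ℝ}
    (hf : ContinuousOn (fun p : ℝ × ℝ => f p.1 p.2) (univ ×ˢ Icc 0 T)) :
    AEStronglyMeasurable (fun p : ℝ × ℝ => f p.2 p.1) (slab T) := by
  have e : slab T = (volume.prod volume).restrict (Icc 0 T ×ˢ univ) := by
    rw [slab, ← Measure.prod_restrict, Measure.restrict_univ]
  rw [e]
  refine ContinuousOn.aestronglyMeasurable ?_ (measurableSet_Icc.prod MeasurableSet.univ)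
  exact hf.comp continuous_swap.continuousOn fun p hp => ⟨mem_univ _, hp.1⟩

lemma ContForward.aestronglyMeasurable_slab {f : ℝ → ℝ → ℝ} (hf : ContForward f) :
    AEStronglyMeasurable (fun p : ℝ × ℝ => f p.2 p.1) (slab T) :=
  aestronglyMeasurable_slab_of_continuousOn
    (ContinuousOn.mono hf (prod_mono_right fun _ h => h.1))

lemma aestronglyMeasurable_slab_dx {f g : ℝ → ℝ → ℝ} (hm : ∀ x, Measurable fun τ => g τ x)
    (hc : ∀ τ, Continuous (g τ))
    (h : ∀ᵐ τ ∂(volume.restrict (Icc 0 T)), ∀ x, f x τ = g τ x) :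
    AEStronglyMeasurable (fun p : ℝ × ℝ => dx f p.2 p.1) (slab T) := by
  refine (measurable_deriv_of_caratheodory hm hc).aestronglyMeasurable.congr ?_
  filter_upwards [ae_slab_of_ae_time h] with p hp
  rw [dx, show (fun y => f y p.1) = g p.1 from funext hp]

lemma integrable_slab {C : ℝ} (hA : AEStronglyMeasurable A (slab T))
    (h1 : ∀ᵐ τ ∂(volume.restrict (Icc 0 T)), Integrable fun x => A (τ, x))
    (h2 : ∀ᵐ τ ∂(volume.restrict (Icc 0 T)), ∫ x, ‖A (τ, x)‖ ≤ C) : Integrable A (slab T) := by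
  refine (integrable_prod_iff hA).2 ⟨h1, ?_⟩
  refine (integrable_const C).mono' hA.norm.integral_prod_right' ?_
  filter_upwards [h2] with τ h
  rwa [Real.norm_of_nonneg (integral_nonneg fun _ => norm_nonneg _)]

/-- On almost every line `x = const` a square integrable function is integrable in time. -/
lemma ae_integrableOn_of_sq (hA : AEStronglyMeasurable A (slab T))
    (h : Integrable (fun p => A p ^ 2) (slab T)) :
    ∀ᵐ x, IntegrableOn (fun τ => A (τ, x)) (Icc 0 T) := by
  filter_upwards [h.prod_left_ae, hA.prod_swap.prodMk_left] with x h1 h2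
  refine ((integrable_const (1 : ℝ)).add h1).mono' h2 (ae_of_all _ fun τ => ?_)
  change |A (τ, x)| ≤ 1 + A (τ, x) ^ 2
  rw [← sq_abs]
  nlinarith [sq_nonneg (|A (τ, x)| - 1), abs_nonneg (A (τ, x))]

end

/-- The projection of the real line to `[0, T]`. -/
def clamp (T τ : ℝ) : ℝ := max 0 (min τ T)

lemma continuous_clamp (T : ℝ) : Continuous (clamp T) := by unfold clamp; fun_prop

lemma clamp_mem {T : ℝ} (hT : 0 ≤ T) (τ : ℝ) : clamp T τ ∈ Icc 0 T :=
  ⟨le_max_left _ _, max_le hT (min_le_right _ _)⟩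

lemma clamp_eq {T τ : ℝ} (h : τ ∈ Icc 0 T) : clamp T τ = τ := by
  rw [clamp, min_eq_left h.2, max_eq_right h.1]

lemma continuous_clamp_comp {T : ℝ} (hT : 0 ≤ T) {f : ℝ → ℝ → ℝ}
    (hf : ContinuousOn (fun p : ℝ × ℝ => f p.1 p.2) (univ ×ˢ Icc 0 T)) :
    Continuous fun p : ℝ × ℝ => f p.2 (clamp T p.1) :=
  hf.comp_continuous (continuous_snd.prodMk ((continuous_clamp T).comp continuous_fst))
    fun _ => ⟨mem_univ _, clamp_mem hT _⟩

/-! ### The solution space -/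

namespace InX

variable {T : ℝ} {φ ψ : ℝ → ℝ → ℝ}

lemma l2Sq_nonneg {f g : ℝ → ℝ} : 0 ≤ l2Sq f g :=
  add_nonneg (integral_nonneg fun _ => sq_nonneg _) (integral_nonneg fun _ => sq_nonneg _)

lemma h1Norm_sq {f g : ℝ → ℝ} : h1Norm f g ^ 2 = l2Sq f g + l2Sq (deriv f) (deriv g) :=
  Real.sq_sqrt (add_nonneg l2Sq_nonneg l2Sq_nonneg)

lemma integral_sq_add_le {f g : ℝ → ℝ} (hf : MemLp f 2 volume) (hg : MemLp g 2 volume) :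
    ∫ x, (f x + g x) ^ 2 ≤ 2 * (∫ x, f x ^ 2) + 2 * ∫ x, g x ^ 2 := by
  rw [← integral_const_mul, ← integral_const_mul,
    ← integral_add (hf.integrable_sq.const_mul 2) (hg.integrable_sq.const_mul 2)]
  refine integral_mono (hf.add hg).integrable_sq ((hf.integrable_sq.const_mul 2).add
    (hg.integrable_sq.const_mul 2)) fun x => ?_
  change (f x + g x) ^ 2 ≤ 2 * f x ^ 2 + 2 * g x ^ 2
  linarith [sq_nonneg (f x - g x)]

lemma h1Norm_sq_add_le {f₁ f₂ g₁ g₂ : ℝ → ℝ} (h1 : InH1 f₁) (h2 : InH1 f₂) (h3 : InH1 g₁)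
    (h4 : InH1 g₂) : h1Norm (fun x => f₁ x + f₂ x) (fun x => g₁ x + g₂ x) ^ 2 ≤
      2 * h1Norm f₁ g₁ ^ 2 + 2 * h1Norm f₂ g₂ ^ 2 := by
  have hd : ∀ {f g : ℝ → ℝ}, InH1 f → InH1 g → ∫ x, deriv (fun x => f x + g x) x ^ 2 =
      ∫ x, (deriv f x + deriv g x) ^ 2 := fun {f g} hf hg => integral_congr_ae (by
    filter_upwards [hf.locAC.ae_hasDerivAt, hg.locAC.ae_hasDerivAt] with x k1 k2
    rw [show deriv (fun x => f x + g x) x = deriv f x + deriv g x from (k1.add k2).deriv])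
  simp only [h1Norm_sq, l2Sq]
  rw [hd h1 h2, hd h3 h4]
  linarith [integral_sq_add_le h1.memLp h2.memLp, integral_sq_add_le h3.memLp h4.memLp,
    integral_sq_add_le h1.memLp_deriv h2.memLp_deriv,
    integral_sq_add_le h3.memLp_deriv h4.memLp_deriv]

lemma h1Norm_nonneg {f g : ℝ → ℝ} : 0 ≤ h1Norm f g := Real.sqrt_nonneg _

lemma abs_le_h1Norm {f g : ℝ → ℝ} (hf : InH1 f) (hg : InH1 g) (x : ℝ) :
    |f x| ≤ h1Norm f g ∧ |g x| ≤ h1Norm f g := by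
  have k : ∀ {h : ℝ → ℝ}, 0 ≤ ∫ x, h x ^ 2 := integral_nonneg fun _ => sq_nonneg _
  constructor <;> refine abs_le_of_sq_le_sq ?_ h1Norm_nonneg <;> rw [h1Norm_sq, l2Sq, l2Sq]
  · linarith [hf.sq_le_add x, k (h := g), k (h := deriv g)]
  · linarith [hg.sq_le_add x, k (h := f), k (h := deriv f)]

variable (hX : InX T φ ψ)
include hX

lemma bddAbove : BddAbove ((fun τ => h1Norm (fun x => φ x τ) (fun x => ψ x τ)) '' Icc 0 T) := by
  suffices h : ∃ C, ∀ τ ∈ Icc 0 T, h1Norm (fun x => φ x τ) (fun x => ψ x τ) ≤ C by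
    obtain ⟨C, hC⟩ := h
    exact ⟨C, by rintro _ ⟨τ, hτ, rfl⟩; exact hC τ hτ⟩
  refine isCompact_Icc.induction_on
    (p := fun s => ∃ C, ∀ τ ∈ s, h1Norm (fun x => φ x τ) (fun x => ψ x τ) ≤ C)
    ⟨0, fun _ h => h.elim⟩ (fun s t hst ⟨C, hC⟩ => ⟨C, fun τ hτ => hC τ (hst hτ)⟩)
    (fun s t ⟨C, hC⟩ ⟨D, hD⟩ => ⟨max C D, fun τ hτ => hτ.elim
      (fun h => (hC τ h).trans (le_max_left _ _)) fun h => (hD τ h).trans (le_max_right _ _)⟩)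
    fun t ht => ?_
  refine ⟨{τ | τ ∈ Icc 0 T ∧ h1Norm (fun x => φ x τ - φ x t) (fun x => ψ x τ - ψ x t) < 1},
    ?_, √(2 + 2 * h1Norm (fun x => φ x t) (fun x => ψ x t) ^ 2), ?_⟩
  · exact inter_mem self_mem_nhdsWithin ((hX.cont t ht).eventually (gt_mem_nhds one_pos))
  · rintro τ ⟨hτ, h1⟩
    refine Real.le_sqrt_of_sq_le ?_
    have h := h1Norm_sq_add_le ((hX.phi_H1 τ hτ).sub (hX.phi_H1 t ht)) (hX.phi_H1 t ht)
      ((hX.psi_H1 τ hτ).sub (hX.psi_H1 t ht)) (hX.psi_H1 t ht)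
    simp only [sub_add_cancel] at h
    have h0 := h1Norm_nonneg (f := fun x => φ x τ - φ x t) (g := fun x => ψ x τ - ψ x t)
    nlinarith

lemma h1Norm_le_NT {τ : ℝ} (hτ : τ ∈ Icc 0 T) :
    h1Norm (fun x => φ x τ) (fun x => ψ x τ) ≤ NT T φ ψ :=
  le_csSup hX.bddAbove ⟨τ, hτ, rfl⟩

lemma abs_le_NT {τ : ℝ} (hτ : τ ∈ Icc 0 T) (x : ℝ) : |φ x τ| ≤ NT T φ ψ ∧ |ψ x τ| ≤ NT T φ ψ :=
  have h := abs_le_h1Norm (hX.phi_H1 τ hτ) (hX.psi_H1 τ hτ) x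
  ⟨h.1.trans (hX.h1Norm_le_NT hτ), h.2.trans (hX.h1Norm_le_NT hτ)⟩

lemma l2Sq_le_NT {τ : ℝ} (hτ : τ ∈ Icc 0 T) :
    l2Sq (fun x => φ x τ) (fun x => ψ x τ) ≤ NT T φ ψ ^ 2 := by
  have h := pow_le_pow_left₀ h1Norm_nonneg (hX.h1Norm_le_NT hτ) 2
  rw [h1Norm_sq] at h
  linarith [l2Sq_nonneg (f := deriv fun x => φ x τ) (g := deriv fun x => ψ x τ)]

lemma continuousOn : ContinuousOn (fun p : ℝ × ℝ => φ p.1 p.2) (univ ×ˢ Icc 0 T) ∧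
    ContinuousOn (fun p : ℝ × ℝ => ψ p.1 p.2) (univ ×ˢ Icc 0 T) := by
  have key : ∀ {f : ℝ → ℝ → ℝ}, (∀ t ∈ Icc 0 T, Continuous fun x => f x t) →
      (∀ t ∈ Icc 0 T, ∀ τ ∈ Icc 0 T, ∀ x, |f x τ - f x t| ≤
        h1Norm (fun x => φ x τ - φ x t) (fun x => ψ x τ - ψ x t)) →
      ContinuousOn (fun p : ℝ × ℝ => f p.1 p.2) (univ ×ˢ Icc 0 T) := by
    rintro f hc hb ⟨x₀, t⟩ ⟨-, ht⟩
    rw [ContinuousWithinAt, tendsto_iff_norm_sub_tendsto_zero]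
    have h2 : Tendsto (fun p : ℝ × ℝ => p.2) (𝓝[univ ×ˢ Icc 0 T] (x₀, t)) (𝓝[Icc 0 T] t) :=
      tendsto_nhdsWithin_of_tendsto_nhds_of_eventually_within _
        (continuous_snd.tendsto' _ _ rfl |>.mono_left nhdsWithin_le_nhds)
        (by filter_upwards [self_mem_nhdsWithin] with p hp using hp.2)
    have h1 : Tendsto (fun p : ℝ × ℝ => |f p.1 t - f x₀ t|) (𝓝[univ ×ˢ Icc 0 T] (x₀, t)) (𝓝 0) := by
      have : Continuous fun p : ℝ × ℝ => |f p.1 t - f x₀ t| :=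
        (((hc t ht).comp continuous_fst).sub continuous_const).abs
      exact (this.tendsto' _ _ (by simp)).mono_left nhdsWithin_le_nhds
    have h3 := ((hX.cont t ht).comp h2).add h1
    rw [add_zero] at h3
    refine squeeze_zero' (Eventually.of_forall fun _ => norm_nonneg _) ?_ h3
    filter_upwards [self_mem_nhdsWithin] with p hp
    refine (norm_sub_le_norm_sub_add_norm_sub (f p.1 p.2) (f p.1 t) (f x₀ t)).trans ?_
    exact add_le_add (hb t ht p.2 hp.2 p.1) le_rfl
  refine ⟨key (fun t ht => (hX.phi_H1 t ht).continuous) fun t ht τ hτ x => ?_,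
    key (fun t ht => (hX.psi_H1 t ht).continuous) fun t ht τ hτ x => ?_⟩
  · exact (abs_le_h1Norm ((hX.phi_H1 τ hτ).sub (hX.phi_H1 t ht))
      ((hX.psi_H1 τ hτ).sub (hX.psi_H1 t ht)) x).1
  · exact (abs_le_h1Norm ((hX.phi_H1 τ hτ).sub (hX.phi_H1 t ht))
      ((hX.psi_H1 τ hτ).sub (hX.psi_H1 t ht)) x).2

end InX

/-! ### Square integrability of the time derivatives -/

/-- The sum of the squares of the derivatives of the composite wave that enter the equations. -/
def source (σ : ℝ → ℝ) (a b μ vm vp x t : ℝ) : ℝ :=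
  Xi1 a b μ vm x t ^ 2 + Xi2 a b μ vm x t ^ 2 + vr1 σ a vp x t ^ 2 + ur2 σ a vp x t ^ 2 +
    Xi3 a b μ vm x t ^ 2

section

variable {a b μ κ K B : ℝ} {σ : ℝ → ℝ} {vm vp x t : ℝ}

lemma source_nonneg : 0 ≤ source σ a b μ vm vp x t := by unfold source; positivity

lemma contForward_source (hσ : StressBounds a b κ K σ) (hμ : 0 < μ)
    (hs : NearStates σ a b μ vm vp) : ContForward (source σ a b μ vm vp) := by
  have hvp := hs.vp_mem hμ
  exact (((((contForward_Xi1 hμ).pow 2).add ((contForward_Xi2 hμ).pow 2)).add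
    ((hσ.contForward_vr1 hvp).pow 2)).add ((hσ.contForward_ur2 hvp).pow 2)).add
    ((contForward_Xi3 hμ).pow 2)

lemma integrable_source (hσ : StressBounds a b κ K σ) (hμ : 0 < μ)
    (hs : NearStates σ a b μ vm vp) (ht : 0 ≤ t) :
    Integrable fun x => source σ a b μ vm vp x t :=
  ((((memLp_Xi1 hμ hs ht).integrable_sq.add (memLp_Xi2 hμ hs ht).integrable_sq).add
    (memLp_vr1 hσ hμ hs ht).integrable_sq).add (memLp_ur2 hσ hμ hs ht).integrable_sq).add
    (memLp_Xi3 hμ hs ht).integrable_sq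

lemma exists_source_bound (hσ : StressBounds a b κ K σ) (hμ : 0 < μ) (B : ℝ) :
    ∃ C, ∀ vm vp t, NearStates σ a b μ vm vp → WaveBounds B σ a b μ vm vp → 0 ≤ t →
      ∫ x, source σ a b μ vm vp x t ≤ C := by
  have hκ := hσ.κ_pos
  have hK := hσ.K_pos
  have hm := sqrt_two_mul_pos hμ
  obtain ⟨E, hE⟩ := NearStates.exists_ur2_bound hσ hμ
  refine ⟨1 / √(2 * μ) * √Real.pi + B + 2 * K / κ * 2 * (2 * K / κ) + |E| * B + B,
    fun vm vp t hs hw ht => ?_⟩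
  have hvp := hs.vp_mem hμ
  have hp := one_le_qrt ht
  have hp0 := qrt_pos ht
  have ht' : -1 < t := by linarith
  have hB0 : 0 ≤ B := by linarith [hw.one_le]
  have i1 := (memLp_Xi1 hμ hs ht).integrable_sq
  have i2 := (memLp_Xi2 hμ hs ht).integrable_sq
  have i3 := (memLp_vr1 hσ hμ hs ht).integrable_sq
  have i4 := (memLp_ur2 hσ hμ hs ht).integrable_sq
  have i5 := (memLp_Xi3 hμ hs ht).integrable_sq
  have e1 := integral_add i1 i2
  have e2 := integral_add (i1.add i2) i3
  have e3 := integral_add ((i1.add i2).add i3) i4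
  have e4 := integral_add (((i1.add i2).add i3).add i4) i5
  simp only [Pi.add_apply] at e1 e2 e3 e4
  have hb5 : B / qrt t ^ 5 ≤ B := div_le_self hB0 (one_le_pow₀ hp)
  have hb4 : B / qrt t ^ 4 ≤ B := div_le_self hB0 (one_le_pow₀ hp)
  have hb10 : B / qrt t ^ 10 ≤ B := div_le_self hB0 (one_le_pow₀ hp)
  have m1 : ∫ x, Xi1 a b μ vm x t ^ 2 ≤ 1 / √(2 * μ) * √Real.pi := by
    obtain ⟨hi, he⟩ := integral_exp_selfSim (b := b) hμ ht' one_pos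
    have hL := width_pos hμ ht'
    rw [div_one] at he
    calc _ ≤ ∫ x, 1 / √(2 * μ) * (1 / width μ t * Real.exp (-1 * selfSim b μ x t ^ 2)) := by
          refine integral_mono i1 ((hi.const_mul _).const_mul _) fun x => ?_
          have h0 := Xi1_nonneg (b := b) (μ := μ) (x := x) (t := t) hs.vm_le
          have h1 : Xi1 a b μ vm x t ≤ heatWeight b μ x t :=
            (Xi1_le hs.vm_le).trans (mul_le_of_le_one_left heatWeight_nonneg hs.sub_vm_le)
          have h2 : heatWeight b μ x t = 1 / width μ t * Real.exp (-1 * selfSim b μ x t ^ 2) := by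
            rw [heatWeight_eq hμ ht']; ring_nf
          change Xi1 a b μ vm x t ^ 2 ≤ _
          rw [← h2, sq]
          exact mul_le_mul (h1.trans (heatWeight_le hμ ht)) h1 h0 (by positivity)
      _ = _ := by
          rw [integral_const_mul, integral_const_mul, he]
          field
  have m3 : ∫ x, vr1 σ a vp x t ^ 2 ≤ 2 * K / κ * 2 * (2 * K / κ) := by
    obtain ⟨hi, he⟩ := integral_burgers1 hσ.lam_a_pos (hσ.lam_le hvp) ht
    calc _ ≤ ∫ x, 2 * K / κ * 2 * (2 * K / κ) * |burgers1 (lam σ a) (lam σ vp) x t| := by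
          refine integral_mono i3 (hi.abs.const_mul _) fun x => ?_
          have h0 := hσ.vr1_nonneg hvp ht (x := x)
          have h1 := hσ.vr1_le_const hvp hs.lam_sub_le ht (x := x)
          have h2 := (hσ.vr1_le hvp ht (x := x)).trans (mul_le_mul_of_nonneg_left
            (le_abs_self (burgers1 (lam σ a) (lam σ vp) x t)) (by positivity))
          change vr1 σ a vp x t ^ 2 ≤ _
          rw [sq, mul_assoc _ (2 * K / κ)]
          exact mul_le_mul h1 h2 h0 (by positivity)
      _ ≤ _ := by
          rw [integral_const_mul]
          exact mul_le_of_le_one_right (by positivity) (he.trans hs.lam_sub_le)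
  have m4 : ∫ x, ur2 σ a vp x t ^ 2 ≤ |E| * B := by
    have hi := (hσ.integral_ur2 hvp hs.lam_sub_le ht).1
    calc _ ≤ ∫ x, |E| * |ur2 σ a vp x t| := by
          refine integral_mono i4 (hi.abs.const_mul _) fun x => ?_
          change ur2 σ a vp x t ^ 2 ≤ _
          rw [← sq_abs, sq]
          exact mul_le_mul_of_nonneg_right ((hE vm vp x t hs ht).trans (le_abs_self E)) (abs_nonneg _)
      _ ≤ _ := by
          rw [integral_const_mul]
          exact mul_le_mul_of_nonneg_left ((hw.ur2_le t ht).trans hb4) (abs_nonneg _)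
  have m2 := (hw.Xi2_le t ht).trans hb5
  have m5 := (hw.Xi3_le t ht).trans hb10
  unfold source
  linarith

lemma sq_add_four_le (a₁ a₂ a₃ a₄ : ℝ) :
    (a₁ + a₂ + a₃ + a₄) ^ 2 ≤ 4 * (a₁ ^ 2 + a₂ ^ 2 + a₃ ^ 2 + a₄ ^ 2) := by
  linarith [sq_nonneg (a₁ - a₂), sq_nonneg (a₁ - a₃), sq_nonneg (a₁ - a₄), sq_nonneg (a₂ - a₃),
    sq_nonneg (a₂ - a₄), sq_nonneg (a₃ - a₄)]

lemma exists_timeDeriv_bound (hσ : StressBounds a b κ K σ) (hμ : 0 < μ) (B : ℝ) :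
    ∃ C ≥ 0, ∀ vm vp x t φ dφ dψ ddψ, NearStates σ a b μ vm vp → WaveBounds B σ a b μ vm vp →
      0 ≤ t → vhat σ a b μ vm vp x t + φ ∈ Ioc (-a) (a + 1) →
      phiT a b μ vm x t dψ ^ 2 + psiT σ a b μ vm vp x t φ dφ ddψ ^ 2 ≤
        C * (φ ^ 2 + dφ ^ 2 + dψ ^ 2 + ddψ ^ 2 + source σ a b μ vm vp x t) := by
  obtain ⟨D, hD⟩ := NearStates.exists_deriv_bound hσ hμ B
  have hb := hσ.b_pos
  have hK := hσ.K_pos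
  have ha := hσ.a_pos
  obtain ⟨c, hc⟩ : ∃ c, c = μ ^ 2 / (8 * √b) := ⟨_, rfl⟩
  obtain ⟨k, hk⟩ : ∃ k, k = b + K + K * |D| + K * (μ / (4 * √b)) + K * (2 * a + 1) + 3 * μ + μ ^ 2 :=
    ⟨_, rfl⟩
  have hsb : 0 < √b := Real.sqrt_pos.2 hb
  have n1 : 0 ≤ K * |D| := by positivity
  have n2 : 0 ≤ K * (μ / (4 * √b)) := by positivity
  have n3 : 0 ≤ K * (2 * a + 1) := by positivity
  have n4 : 0 ≤ μ ^ 2 := by positivity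
  have hk0 : 0 ≤ k := by rw [hk]; positivity
  refine ⟨2 + 2 * c ^ 2 + 16 * k ^ 2, by positivity,
    fun vm vp x t φ dφ dψ ddψ hs hw ht hv => ?_⟩
  have hX := (hD vm vp x t hs hw ht).1.trans (le_abs_self D)
  have hF := abs_fluxX_le (dφ := dφ) hσ (hs.vhat_mem hσ hμ ht) hv hX
  have hI := abs_interX_le hσ hμ hs ht (x := x)
  have h1 : phiT a b μ vm x t dψ ^ 2 ≤ 2 * dψ ^ 2 + 2 * c ^ 2 * Xi3 a b μ vm x t ^ 2 := by
    unfold phiT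
    rw [← hc]
    linarith [sq_nonneg (dψ + c * Xi3 a b μ vm x t)]
  obtain ⟨X1, hX1⟩ : ∃ y, y = |Xi1 a b μ vm x t| := ⟨_, rfl⟩
  obtain ⟨X2, hX2⟩ : ∃ y, y = |Xi2 a b μ vm x t| := ⟨_, rfl⟩
  obtain ⟨X3, hX3⟩ : ∃ y, y = |Xi3 a b μ vm x t| := ⟨_, rfl⟩
  obtain ⟨R, hR⟩ : ∃ y, y = |vr1 σ a vp x t| := ⟨_, rfl⟩
  obtain ⟨U, hU⟩ : ∃ y, y = |ur2 σ a vp x t| := ⟨_, rfl⟩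
  have hX1' : 0 ≤ X1 := hX1 ▸ abs_nonneg _
  have hX2' : 0 ≤ X2 := hX2 ▸ abs_nonneg _
  have hX3' : 0 ≤ X3 := hX3 ▸ abs_nonneg _
  have hR' : 0 ≤ R := hR ▸ abs_nonneg _
  have hU' : 0 ≤ U := hU ▸ abs_nonneg _
  have hS : source σ a b μ vm vp x t = X1 ^ 2 + X2 ^ 2 + R ^ 2 + U ^ 2 + X3 ^ 2 := by
    rw [hX1, hX2, hX3, hR, hU]
    simp only [sq_abs]
    rfl
  rw [← hX1, ← hX2, ← hR] at hI
  have h2 : |psiT σ a b μ vm vp x t φ dφ ddψ| ≤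
      k * ((|φ| + |dφ| + |ddψ| + X1) + (X2 + X3 + R + U)) := by
    have t1 : |b * dφ| = b * |dφ| := by rw [abs_mul, abs_of_pos hb]
    have t2 : |μ * ddψ| = μ * |ddψ| := by rw [abs_mul, abs_of_pos hμ]
    have t3 : |μ * ur2 σ a vp x t| = μ * U := by rw [abs_mul, abs_of_pos hμ, hU]
    have t4 : |μ ^ 2 / 8 * Xi3 a b μ vm x t| = μ ^ 2 / 8 * X3 := by
      rw [abs_mul, abs_of_nonneg (by positivity : 0 ≤ μ ^ 2 / 8), hX3]
    have hsum : |psiT σ a b μ vm vp x t φ dφ ddψ| ≤ b * |dφ| + (K * |dφ| + K * |φ| * |D| +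
        (K * X1 + K * (μ / (4 * √b)) * X2 + K * (2 * a + 1) * R)) + μ * |ddψ| + μ * U +
        μ ^ 2 / 8 * X3 := by
      unfold psiT
      refine (abs_add_le _ _).trans (add_le_add ((abs_add_le _ _).trans (add_le_add
        ((abs_add_le _ _).trans (add_le_add ((abs_add_le _ _).trans (add_le_add t1.le
        ((abs_add_le _ _).trans (add_le_add hF hI)))) t2.le)) t3.le)) t4.le)
    refine hsum.trans ?_
    have g1 : (b + K) * |dφ| ≤ k * |dφ| := by gcongr; rw [hk]; linarith
    have g2 : K * |D| * |φ| ≤ k * |φ| := by gcongr; rw [hk]; linarith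
    have g3 : K * X1 ≤ k * X1 := by gcongr; rw [hk]; linarith
    have g4 : K * (μ / (4 * √b)) * X2 ≤ k * X2 := by gcongr; rw [hk]; linarith
    have g5 : K * (2 * a + 1) * R ≤ k * R := by gcongr; rw [hk]; linarith
    have g6 : μ * |ddψ| ≤ k * |ddψ| := by gcongr; rw [hk]; linarith
    have g7 : μ * U ≤ k * U := by gcongr; rw [hk]; linarith
    have g8 : μ ^ 2 / 8 * X3 ≤ k * X3 := by gcongr; rw [hk]; linarith
    linarith
  have h3 : psiT σ a b μ vm vp x t φ dφ ddψ ^ 2 ≤ k ^ 2 * (8 * (φ ^ 2 + dφ ^ 2 + ddψ ^ 2 +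
      (X1 ^ 2 + X2 ^ 2 + R ^ 2 + U ^ 2 + X3 ^ 2))) := by
    rw [← sq_abs]
    refine (pow_le_pow_left₀ (abs_nonneg _) h2 2).trans ?_
    rw [mul_pow]
    refine mul_le_mul_of_nonneg_left ?_ (sq_nonneg k)
    have q1 := sq_add_four_le |φ| |dφ| |ddψ| X1
    have q2 := sq_add_four_le X2 X3 R U
    simp only [sq_abs] at q1
    linarith [sq_nonneg ((|φ| + |dφ| + |ddψ| + X1) - (X2 + X3 + R + U))]
  have h4 : Xi3 a b μ vm x t ^ 2 = X3 ^ 2 := by rw [hX3, sq_abs]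
  rw [h4] at h1
  rw [hS]
  have p1 : 0 ≤ φ ^ 2 := sq_nonneg _
  have p2 : 0 ≤ dφ ^ 2 := sq_nonneg _
  have p3 : 0 ≤ dψ ^ 2 := sq_nonneg _
  have p4 : 0 ≤ ddψ ^ 2 := sq_nonneg _
  have p5 : 0 ≤ X1 ^ 2 + X2 ^ 2 + R ^ 2 + U ^ 2 := by positivity
  have p6 : 0 ≤ X3 ^ 2 := sq_nonneg _
  obtain ⟨S, hS'⟩ : ∃ S, S = φ ^ 2 + dφ ^ 2 + dψ ^ 2 + ddψ ^ 2 +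
      (X1 ^ 2 + X2 ^ 2 + R ^ 2 + U ^ 2 + X3 ^ 2) := ⟨_, rfl⟩
  rw [← hS']
  have w1 : dψ ^ 2 ≤ S := by linarith
  have w2 : X3 ^ 2 ≤ S := by linarith
  have w3 : φ ^ 2 + dφ ^ 2 + ddψ ^ 2 + (X1 ^ 2 + X2 ^ 2 + R ^ 2 + U ^ 2 + X3 ^ 2) ≤ S := by
    linarith
  have w4 := mul_le_mul_of_nonneg_left w2 (by positivity : 0 ≤ 2 * c ^ 2)
  have w5 := mul_le_mul_of_nonneg_left w3 (by positivity : 0 ≤ k ^ 2 * 8)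
  have w6 : 0 ≤ k ^ 2 * S := mul_nonneg (sq_nonneg k) (p3.trans w1)
  linarith

end

/-! ### The evolution of the perturbation -/

lemma aestronglyMeasurable_slab_dx_of_continuousOn {T : ℝ} (hT : 0 ≤ T) {f : ℝ → ℝ → ℝ}
    (hf : ContinuousOn (fun p : ℝ × ℝ => f p.1 p.2) (univ ×ˢ Icc 0 T)) :
    AEStronglyMeasurable (fun p : ℝ × ℝ => dx f p.2 p.1) (slab T) := by
  have hc := continuous_clamp_comp hT hf
  refine aestronglyMeasurable_slab_dx (g := fun τ x => f x (clamp T τ))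
    (fun x => (hc.comp (continuous_id.prodMk continuous_const)).measurable)
    (fun τ => hc.comp (continuous_const.prodMk continuous_id)) ?_
  filter_upwards [ae_restrict_mem measurableSet_Icc] with τ hτ x
  rw [clamp_eq hτ]

namespace InX

variable {T : ℝ} {φ ψ : ℝ → ℝ → ℝ} (hX : InX T φ ψ)
include hX

lemma exists_regular_times : ∃ E : Set ℝ, MeasurableSet E ∧
    (∀ᵐ τ ∂(volume.restrict (Icc 0 T)), τ ∈ E) ∧
    ∀ τ ∈ E, τ ∈ Icc 0 T ∧ InH1 (fun x => dx ψ x τ) := by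
  have h := (ae_restrict_mem measurableSet_Icc).and hX.psi_x_H1
  obtain ⟨E, hE, hEm, hE'⟩ := h.exists_measurable_mem
  exact ⟨E, hEm, hE, hE'⟩

lemma hasDerivAt_psi {τ : ℝ} (hτ : τ ∈ Icc 0 T) (h : InH1 (fun x => dx ψ x τ)) (x : ℝ) :
    HasDerivAt (fun y => ψ y τ) (dx ψ x τ) x :=
  (hX.psi_H1 τ hτ).locAC.hasDerivAt_of_continuous h.continuous x

lemma aestronglyMeasurable_slab :
    AEStronglyMeasurable (fun p : ℝ × ℝ => φ p.2 p.1) (slab T) ∧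
    AEStronglyMeasurable (fun p : ℝ × ℝ => ψ p.2 p.1) (slab T) :=
  ⟨aestronglyMeasurable_slab_of_continuousOn hX.continuousOn.1,
    aestronglyMeasurable_slab_of_continuousOn hX.continuousOn.2⟩

lemma aestronglyMeasurable_slab_dx (hT : 0 ≤ T) :
    AEStronglyMeasurable (fun p : ℝ × ℝ => dx φ p.2 p.1) (slab T) ∧
    AEStronglyMeasurable (fun p : ℝ × ℝ => dx ψ p.2 p.1) (slab T) :=
  ⟨aestronglyMeasurable_slab_dx_of_continuousOn hT hX.continuousOn.1,
    aestronglyMeasurable_slab_dx_of_continuousOn hT hX.continuousOn.2⟩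

/-- Joint measurability of the derivative of `f = w + ψ_x`. The function `f` need not be jointly
continuous, but it is continuous in space at almost all times. -/
lemma aestronglyMeasurable_slab_dx_add (hT : 0 ≤ T) {f w : ℝ → ℝ → ℝ} (hw : ContForward w)
    (hf : ∀ᵐ τ ∂(volume.restrict (Icc 0 T)), ∀ x, f x τ = w x τ + dx ψ x τ) :
    AEStronglyMeasurable (fun p : ℝ × ℝ => dx f p.2 p.1) (slab T) := by
  obtain ⟨E, hEm, hE, hE'⟩ := hX.exists_regular_times
  have hcw := continuous_clamp_comp hT (ContinuousOn.mono hw (prod_mono_right fun _ h => h.1) :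
    ContinuousOn (fun p : ℝ × ℝ => w p.1 p.2) (univ ×ˢ Icc 0 T))
  have hcψ := continuous_clamp_comp hT hX.continuousOn.2
  have hd : Measurable fun p : ℝ × ℝ => deriv (fun y => ψ y (clamp T p.1)) p.2 :=
    measurable_deriv_of_caratheodory (f := fun τ y => ψ y (clamp T τ))
      (fun x => (hcψ.comp (continuous_id.prodMk continuous_const)).measurable)
      fun τ => hcψ.comp (continuous_const.prodMk continuous_id)
  refine Viscoelastic.aestronglyMeasurable_slab_dx (g := fun τ x => E.indicator
    (fun τ => w x (clamp T τ) + deriv (fun y => ψ y (clamp T τ)) x) τ)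
    (fun x => Measurable.indicator ?_ hEm) (fun τ => ?_) ?_
  · exact (hcw.comp (continuous_id.prodMk continuous_const)).measurable.add
      (hd.comp (measurable_id.prodMk measurable_const))
  · by_cases hτ : τ ∈ E
    · simp only [indicator_of_mem hτ]
      refine (hcw.comp (continuous_const.prodMk continuous_id)).add ?_
      have h := (hE' τ hτ).2.continuous
      rwa [← clamp_eq (hE' τ hτ).1] at h
    · simp only [indicator_of_notMem hτ]
      exact continuous_const
  · filter_upwards [hE, hf] with τ hτ h x
    rw [indicator_of_mem hτ, h x, clamp_eq (hE' τ hτ).1]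
    rfl

lemma aestronglyMeasurable_slab_dxx (hT : 0 ≤ T) :
    AEStronglyMeasurable (fun p : ℝ × ℝ => dx (dx ψ) p.2 p.1) (slab T) :=
  hX.aestronglyMeasurable_slab_dx_add hT (.const 0)
    (ae_of_all _ fun τ x => by rw [zero_add])

lemma integrable_slab_sq (hT : 0 ≤ T) :
    Integrable (fun p : ℝ × ℝ => φ p.2 p.1 ^ 2) (slab T) ∧
    Integrable (fun p : ℝ × ℝ => ψ p.2 p.1 ^ 2) (slab T) ∧
    Integrable (fun p : ℝ × ℝ => dx φ p.2 p.1 ^ 2) (slab T) ∧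
    Integrable (fun p : ℝ × ℝ => dx ψ p.2 p.1 ^ 2) (slab T) ∧
    Integrable (fun p : ℝ × ℝ => dx (dx ψ) p.2 p.1 ^ 2) (slab T) := by
  have hm := ae_restrict_mem (μ := volume) (measurableSet_Icc (a := (0 : ℝ)) (b := T))
  have h1 := hX.aestronglyMeasurable_slab
  have h2 := hX.aestronglyMeasurable_slab_dx hT
  have e : ∀ y : ℝ, ‖y ^ 2‖ = y ^ 2 := fun y => Real.norm_of_nonneg (sq_nonneg y)
  have k : ∀ {h : ℝ → ℝ}, 0 ≤ ∫ x, h x ^ 2 := integral_nonneg fun _ => sq_nonneg _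
  refine ⟨integrable_slab (C := NT T φ ψ ^ 2) (h1.1.pow 2) ?_ ?_,
    integrable_slab (C := NT T φ ψ ^ 2) (h1.2.pow 2) ?_ ?_,
    (integrable_prod_iff (h2.1.pow 2)).2 ⟨?_, ?_⟩, (integrable_prod_iff (h2.2.pow 2)).2 ⟨?_, ?_⟩,
    (integrable_prod_iff ((hX.aestronglyMeasurable_slab_dxx hT).pow 2)).2 ⟨?_, ?_⟩⟩
  · filter_upwards [hm] with τ hτ using (hX.phi_H1 τ hτ).integrable_sq
  · filter_upwards [hm] with τ hτ
    simp only [e]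
    exact le_trans (le_add_of_nonneg_right k) (hX.l2Sq_le_NT hτ)
  · filter_upwards [hm] with τ hτ using (hX.psi_H1 τ hτ).integrable_sq
  · filter_upwards [hm] with τ hτ
    simp only [e]
    exact le_trans (le_add_of_nonneg_left k) (hX.l2Sq_le_NT hτ)
  · filter_upwards [hm] with τ hτ using (hX.phi_H1 τ hτ).integrable_deriv_sq
  · simp only [Pi.pow_apply, e]; exact hX.phi_x_L2
  · filter_upwards [hm] with τ hτ using (hX.psi_H1 τ hτ).integrable_deriv_sq
  · simp only [Pi.pow_apply, e]; exact hX.psi_x_L2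
  · filter_upwards [hX.psi_x_H1] with τ hτ using hτ.integrable_deriv_sq
  · simp only [Pi.pow_apply, e]; exact hX.psi_xx_L2

end InX

section

variable {a b μ κ K B T : ℝ} {σ : ℝ → ℝ} {vm vp um up : ℝ} {φ ψ : ℝ → ℝ → ℝ}
  (hσ : StressBounds a b κ K σ) (hμ : 0 < μ) (hs : NearStates σ a b μ vm vp)
  (hw : WaveBounds B σ a b μ vm vp) (hT : 0 ≤ T) (hX : InX T φ ψ)
  (hv : ∀ x, ∀ τ ∈ Icc 0 T, vhat σ a b μ vm vp x τ + φ x τ ∈ Ioc (-a) (a + 1))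
include hσ hμ hs hT hX

lemma aestronglyMeasurable_timeDeriv :
    AEStronglyMeasurable (fun p : ℝ × ℝ => phiT a b μ vm p.2 p.1 (dx ψ p.2 p.1)) (slab T) ∧
    AEStronglyMeasurable (fun p : ℝ × ℝ => psiT σ a b μ vm vp p.2 p.1 (φ p.2 p.1)
      (dx φ p.2 p.1) (dx (dx ψ) p.2 p.1)) (slab T) := by
  have hvp := hs.vp_mem hμ
  obtain ⟨mφ, mψ⟩ := hX.aestronglyMeasurable_slab
  obtain ⟨mφ', mψ'⟩ := hX.aestronglyMeasurable_slab_dx hT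
  have mψ'' := hX.aestronglyMeasurable_slab_dxx hT
  have m3 := (contForward_Xi3 (a := a) (vm := vm) (b := b) hμ).aestronglyMeasurable_slab (T := T)
  have mv := (contForward_vhat (vm := vm) hσ hμ hvp).aestronglyMeasurable_slab (T := T)
  have mX := (contForward_vhatX (vm := vm) hσ hμ hvp).aestronglyMeasurable_slab (T := T)
  have mr := (hσ.contForward_vr hvp).aestronglyMeasurable_slab (T := T)
  have mr1 := (hσ.contForward_vr1 hvp).aestronglyMeasurable_slab (T := T)
  have mE := (hσ.contForward_ur2 hvp).aestronglyMeasurable_slab (T := T)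
  have hd : ∀ {f : ℝ × ℝ → ℝ}, AEStronglyMeasurable f (slab T) →
      AEStronglyMeasurable (fun p => deriv σ (f p) - b) (slab T) := fun hf =>
    (hσ.continuous_deriv.comp_aestronglyMeasurable hf).sub aestronglyMeasurable_const
  exact ⟨mψ'.sub (m3.const_mul _), ((((mφ'.const_mul b).add
    ((((hd (mv.add mφ)).mul (mX.add mφ')).sub ((hd mv).mul mX)).add
    (((hd mv).mul mX).sub ((hd mr).mul mr1)))).add (mψ''.const_mul μ)).add (mE.const_mul μ)).add
    (m3.const_mul _)⟩

include hw hv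

lemma integrable_timeDeriv_sq :
    Integrable (fun p : ℝ × ℝ => phiT a b μ vm p.2 p.1 (dx ψ p.2 p.1) ^ 2) (slab T) ∧
    Integrable (fun p : ℝ × ℝ => psiT σ a b μ vm vp p.2 p.1 (φ p.2 p.1)
      (dx φ p.2 p.1) (dx (dx ψ) p.2 p.1) ^ 2) (slab T) := by
  have hm := ae_restrict_mem (μ := volume) (measurableSet_Icc (a := (0 : ℝ)) (b := T))
  obtain ⟨i1, -, i3, i4, i5⟩ := hX.integrable_slab_sq hT
  obtain ⟨m1, m2⟩ := aestronglyMeasurable_timeDeriv hσ hμ hs hT hX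
  obtain ⟨S, hS⟩ := exists_source_bound hσ hμ B
  obtain ⟨C, -, hC⟩ := exists_timeDeriv_bound hσ hμ B
  have iS : Integrable (fun p : ℝ × ℝ => source σ a b μ vm vp p.2 p.1) (slab T) := by
    refine integrable_slab (C := S) (contForward_source hσ hμ hs).aestronglyMeasurable_slab ?_ ?_
    · filter_upwards [hm] with τ hτ using integrable_source hσ hμ hs hτ.1
    · filter_upwards [hm] with τ hτ
      simp only [Real.norm_of_nonneg source_nonneg]
      exact hS vm vp τ hs hw hτ.1
  have iD := ((((i1.add i3).add i4).add i5).add iS).const_mul C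
  constructor
  · refine iD.mono' (m1.pow 2) ?_
    filter_upwards [ae_slab_mem] with p hp
    have := hC vm vp p.2 p.1 (φ p.2 p.1) (dx φ p.2 p.1) (dx ψ p.2 p.1) (dx (dx ψ) p.2 p.1) hs hw
      hp.1 (hv _ _ hp)
    rw [Real.norm_of_nonneg (sq_nonneg _)]
    exact le_trans (le_add_of_nonneg_right (sq_nonneg _)) this
  · refine iD.mono' (m2.pow 2) ?_
    filter_upwards [ae_slab_mem] with p hp
    have := hC vm vp p.2 p.1 (φ p.2 p.1) (dx φ p.2 p.1) (dx ψ p.2 p.1) (dx (dx ψ) p.2 p.1) hs hw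
      hp.1 (hv _ _ hp)
    rw [Real.norm_of_nonneg (sq_nonneg _)]
    exact le_trans (le_add_of_nonneg_left (sq_nonneg _)) this

omit hw hv hT in
lemma dx_velocity {τ : ℝ} (hτ : τ ∈ Icc 0 T) (h : InH1 (fun x => dx ψ x τ)) (x : ℝ) :
    dx (fun x t => uhat σ a b μ vm vp um up x t + ψ x t) x τ =
      uhatX σ a b μ vm vp x τ + dx ψ x τ :=
  ((hasDerivAt_uhat_space hσ hμ (hs.vp_mem hμ) hτ.1).add (hX.hasDerivAt_psi hτ h x)).deriv

omit hw hv hT in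
/-- The velocity gradient of the solution in terms of the perturbation. -/
lemma ae_strain_rhs : ∀ x, ∀ᵐ τ ∂(volume.restrict (Icc 0 T)),
    dx (fun x t => uhat σ a b μ vm vp um up x t + ψ x t) x τ =
      phiT a b μ vm x τ (dx ψ x τ) + vhatT σ a b μ vm vp x τ := by
  intro x
  filter_upwards [ae_restrict_mem measurableSet_Icc, hX.psi_x_H1] with τ hτ h
  rw [dx_velocity hσ hμ hs hX hτ h x, phiT, ← vhatT_sub_uhatX (σ := σ) (vp := vp) hσ.b_pos]
  ring

omit hw hv in
/-- The right hand side of the momentum equation in terms of the perturbation. -/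
lemma ae_momentum_rhs : ∀ᵐ x, ∀ᵐ τ ∂(volume.restrict (Icc 0 T)),
    dx (fun y s => σ (vhat σ a b μ vm vp y s + φ y s)) x τ +
        μ * dx (dx fun x t => uhat σ a b μ vm vp um up x t + ψ x t) x τ =
      psiT σ a b μ vm vp x τ (φ x τ) (dx φ x τ) (dx (dx ψ) x τ) + uhatT σ a b μ vm vp x τ := by
  have hvp := hs.vp_mem hμ
  have hm := ae_restrict_mem (μ := volume) (measurableSet_Icc (a := (0 : ℝ)) (b := T))
  obtain ⟨-, m2⟩ := aestronglyMeasurable_timeDeriv hσ hμ hs hT hX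
  have muxx := hX.aestronglyMeasurable_slab_dx_add hT (contForward_uhatX (vm := vm) hσ hμ hvp)
    (f := dx fun x t => uhat σ a b μ vm vp um up x t + ψ x t) (by
      filter_upwards [hm, hX.psi_x_H1] with τ hτ h using dx_velocity hσ hμ hs hX hτ h)
  have hcv : ContinuousOn (fun p : ℝ × ℝ => σ (vhat σ a b μ vm vp p.1 p.2 + φ p.1 p.2))
      (univ ×ˢ Icc 0 T) :=
    hσ.continuous.comp_continuousOn ((ContinuousOn.mono (contForward_vhat (vm := vm) hσ hμ hvp)
      (prod_mono_right fun _ h => h.1)).add hX.continuousOn.1)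
  have msx := aestronglyMeasurable_slab_dx_of_continuousOn hT
    (f := fun y s => σ (vhat σ a b μ vm vp y s + φ y s)) hcv
  have mE := (contForward_uhatT (vm := vm) hσ hμ hvp).aestronglyMeasurable_slab (T := T)
  refine ae_ae_swap (ae_eq_slab (msx.add (muxx.const_mul μ)) (m2.add mE) ?_)
  filter_upwards [hm, hX.psi_x_H1] with τ ht h
  filter_upwards [(hX.phi_H1 τ ht).locAC.ae_hasDerivAt, h.locAC.ae_hasDerivAt] with x h1 h2
  have e1 : dx (fun y s => σ (vhat σ a b μ vm vp y s + φ y s)) x τ =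
      deriv σ (vhat σ a b μ vm vp x τ + φ x τ) * (vhatX σ a b μ vm vp x τ + dx φ x τ) :=
    ((hσ.hasDerivAt _).comp x ((hasDerivAt_vhat_space hσ hμ hvp ht.1).add h1)).deriv
  have e2 : dx (dx fun x t => uhat σ a b μ vm vp um up x t + ψ x t) x τ =
      uhatXX σ a b μ vm vp x τ + dx (dx ψ) x τ := by
    rw [dx, show (fun y => dx (fun x t => uhat σ a b μ vm vp um up x t + ψ x t) y τ) =
      fun y => uhatX σ a b μ vm vp y τ + dx ψ y τ from funext (dx_velocity hσ hμ hs hX ht h)]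
    exact ((hasDerivAt_uhatX_space hσ hμ hvp ht.1).add h2).deriv
  change dx (fun y s => σ (vhat σ a b μ vm vp y s + φ y s)) x τ +
      μ * dx (dx fun x t => uhat σ a b μ vm vp um up x t + ψ x t) x τ =
    psiT σ a b μ vm vp x τ (φ x τ) (dx φ x τ) (dx (dx ψ) x τ) + uhatT σ a b μ vm vp x τ
  rw [e1, e2, uhatT_eq hσ.b_pos, psiT, fluxX, interX]
  unfold vhatX
  ring

/-- On almost every line `x = const` the perturbation is absolutely continuous in time and solves
the perturbed equations. -/
lemma ae_timePair (hsol : IsSolution σ μ T (fun x t => vhat σ a b μ vm vp x t + φ x t)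
      (fun x t => uhat σ a b μ vm vp um up x t + ψ x t)) :
    ∀ᵐ x, TimePair T (φ x) (fun τ => phiT a b μ vm x τ (dx ψ x τ)) ∧
      TimePair T (ψ x) (fun τ => psiT σ a b μ vm vp x τ (φ x τ) (dx φ x τ) (dx (dx ψ) x τ)) := by
  have hvp := hs.vp_mem hμ
  obtain ⟨m1, m2⟩ := aestronglyMeasurable_timeDeriv hσ hμ hs hT hX
  obtain ⟨i1, i2⟩ := integrable_timeDeriv_sq hσ hμ hs hw hT hX hv
  have j1 := ae_integrableOn_of_sq m1 i1
  have j2 := ae_integrableOn_of_sq m2 i2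
  -- the composite wave as a primitive of its time derivative
  have cslice : ∀ {f : ℝ → ℝ → ℝ}, ContForward f → ∀ x, ContinuousOn (f x) (Icc 0 T) :=
    fun {f} hf x => ContinuousOn.comp (g := fun p : ℝ × ℝ => f p.1 p.2) hf
      (continuous_const.prodMk continuous_id).continuousOn fun τ hτ => ⟨mem_univ _, hτ.1⟩
  have primitive : ∀ {f f' : ℝ → ℝ → ℝ}, ContForward f → ContForward f' →
      (∀ x τ, 0 < τ → HasDerivAt (f x) (f' x τ) τ) → ∀ x, ∀ t ∈ Icc 0 T,
      f x t - f x 0 = ∫ τ in (0 : ℝ)..t, f' x τ := fun hf hf' hd x t ht =>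
    ((TimePair.of_continuousOn hT (cslice hf x) (cslice hf' x) (hd x)).mono ht).sub_eq_integral ht.1
  have hvt := primitive (contForward_vhat (vm := vm) hσ hμ hvp)
    (contForward_vhatT (vm := vm) hσ hμ hvp) fun x τ hτ => hasDerivAt_vhat_time hσ hμ hvp hτ
  have hut := primitive (contForward_uhat (vm := vm) (um := um) (up := up) hσ hμ hvp)
    (contForward_uhatT (vm := vm) hσ hμ hvp) fun x τ hτ => hasDerivAt_uhat_time hσ hμ hvp hτ
  have pslice : ∀ {f : ℝ → ℝ → ℝ}, ContinuousOn (fun p : ℝ × ℝ => f p.1 p.2) (univ ×ˢ Icc 0 T) →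
      ∀ x, ContinuousOn (f x) (Icc 0 T) := fun {f} hf x =>
    ContinuousOn.comp (g := fun p : ℝ × ℝ => f p.1 p.2) hf
      (continuous_const.prodMk continuous_id).continuousOn fun τ hτ => ⟨mem_univ _, hτ⟩
  have hvc := cslice (contForward_vhat (vm := vm) hσ hμ hvp)
  have huc := cslice (contForward_uhat (vm := vm) (um := um) (up := up) hσ hμ hvp)
  have hvTc := cslice (contForward_vhatT (vm := vm) hσ hμ hvp)
  have huTc := cslice (contForward_uhatT (vm := vm) hσ hμ hvp)
  have hmom := ae_momentum_rhs (um := um) (up := up) hσ hμ hs hT hX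
  have hstr : ∀ᵐ x, _ := ae_of_all _ (ae_strain_rhs (um := um) (up := up) hσ hμ hs hX)
  have toInterval : ∀ {f g : ℝ → ℝ}, (∀ᵐ τ ∂(volume.restrict (Icc 0 T)), f τ = g τ) →
      ∀ t ∈ Icc 0 T, ∫ τ in (0 : ℝ)..t, f τ = ∫ τ in (0 : ℝ)..t, g τ := fun h t ht => by
    rw [ae_restrict_iff' measurableSet_Icc] at h
    refine intervalIntegral.integral_congr_ae ?_
    filter_upwards [h] with τ hτ hτ'
    rw [uIoc_of_le ht.1] at hτ'
    exact hτ ⟨hτ'.1.le, hτ'.2.trans ht.2⟩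
  have hci : ∀ {f : ℝ → ℝ}, ContinuousOn f (Icc 0 T) → IntegrableOn f (Icc 0 T) :=
    fun hf => hf.integrableOn_compact isCompact_Icc
  have a1 := ae_forall_sub_eq_integral hsol.strain
    (fun x => (hvc x).add (pslice hX.continuousOn.1 x)) (by
      filter_upwards [hstr, j1] with x hx hj
      exact (hj.add (hci (hvTc x))).congr (by filter_upwards [hx] with τ hτ using hτ.symm))
  have a2 := ae_forall_sub_eq_integral hsol.momentum
    (fun x => (huc x).add (pslice hX.continuousOn.2 x)) (by
      filter_upwards [hmom, j2] with x hx hj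
      exact (hj.add (hci (huTc x))).congr (by filter_upwards [hx] with τ hτ using hτ.symm))
  have hii : ∀ {f : ℝ → ℝ}, IntegrableOn f (Icc 0 T) → ∀ t ∈ Icc 0 T,
      IntervalIntegrable f volume 0 t := fun hf t ht => by
    refine IntegrableOn.intervalIntegrable (hf.mono_set ?_)
    rw [uIcc_of_le ht.1]
    exact Icc_subset_Icc_right ht.2
  filter_upwards [a1, a2, hstr, hmom, j1, j2] with x h1 h2 h3 h4 k1 k2
  refine ⟨.of_integral hT (hii k1 T (right_mem_Icc.2 hT)) fun t ht => ?_,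
    .of_integral hT (hii k2 T (right_mem_Icc.2 hT)) fun t ht => ?_⟩
  · have e := h1 t ht
    rw [toInterval h3 t ht, intervalIntegral.integral_add (hii k1 t ht) (hii (hci (hvTc x)) t ht),
      ← hvt x t ht] at e
    linarith
  · have e := h2 t ht
    rw [toInterval h4 t ht, intervalIntegral.integral_add (hii k2 t ht) (hii (hci (huTc x)) t ht),
      ← hut x t ht] at e
    linarith

end

/-! ### The energy identity -/

lemma ContForward.continuousOn_time {T : ℝ} {f : ℝ → ℝ → ℝ} (hf : ContForward f) (x : ℝ) :
    ContinuousOn (f x) (Icc 0 T) :=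
  ContinuousOn.comp (g := fun p : ℝ × ℝ => f p.1 p.2) hf
    (continuous_const.prodMk continuous_id).continuousOn fun _ hτ => ⟨mem_univ _, hτ.1⟩

section

variable {a b μ κ K B T : ℝ} {σ : ℝ → ℝ} {vm vp um up : ℝ}
  (hσ : StressBounds a b κ K σ) (hμ : 0 < μ) (hs : NearStates σ a b μ vm vp)
include hσ hμ hs

/-- The chain rule for the energy along an absolutely continuous perturbation. -/
lemma timePair_energy (hT : 0 ≤ T) (Λ x : ℝ) {φ ψ φt ψt : ℝ → ℝ} (hφ : TimePair T φ φt)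
    (hψ : TimePair T ψ ψt) :
    TimePair T (fun τ => energy Λ σ a b μ vm vp x τ (φ τ) (ψ τ))
      (fun τ => energyRate Λ σ a b μ vm vp x τ (φ τ) (ψ τ) (φt τ) (ψt τ)) := by
  have hvp := hs.vp_mem hμ
  have hA : TimePair T (fun τ => wtA b μ x τ) (fun τ => wtAt b μ x τ) :=
    .of_continuousOn hT ((contForward_wtA hμ).continuousOn_time x)
      ((contForward_wtAt hμ).continuousOn_time x) fun τ hτ => hasDerivAt_wtA_time hμ hτ.le
  have hB : TimePair T (fun τ => wtB b μ x τ) (fun τ => wtBt b μ x τ) :=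
    .of_continuousOn hT ((contForward_wtB hμ).continuousOn_time x)
      ((contForward_wtBt hμ).continuousOn_time x) fun τ hτ => hasDerivAt_wtB_time hμ hτ.le
  have hv : TimePair T (fun τ => vhat σ a b μ vm vp x τ) (fun τ => vhatT σ a b μ vm vp x τ) :=
    .of_continuousOn hT ((contForward_vhat hσ hμ hvp).continuousOn_time x)
      ((contForward_vhatT hσ hμ hvp).continuousOn_time x)
      fun τ hτ => hasDerivAt_vhat_time hσ hμ hvp hτ
  have hk := hψ.add (hφ.const_mul √b)
  have hh := hψ.sub (hφ.const_mul √b)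
  have hN : ∀ {f f' : ℝ → ℝ}, TimePair T f f' →
      TimePair T (fun τ => ∫ z in (0 : ℝ)..f τ, nl σ b z) (fun τ => nl σ b (f τ) * f' τ) :=
    fun hf => hf.comp (g := fun v => ∫ z in (0 : ℝ)..v, nl σ b z) hσ.hasDerivAt_integral_nl
      hσ.continuous_nl
  have hn := hv.comp hσ.hasDerivAt_nl (hσ.continuous_deriv.sub continuous_const)
  have hvφ := hv.add hφ
  have hP := ((hN hvφ).sub (hN hv)).sub (hn.mul (hvφ.sub hv))
  have h := (((hk.mul hk).const_mul (1 / 2)).mul hA |>.const_mul Λ).add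
    ((((hh.mul hh).const_mul (1 / 2)).add hP).mul hB)
  have e : (fun τ => energy Λ σ a b μ vm vp x τ (φ τ) (ψ τ)) = fun τ =>
      Λ * (1 / 2 * ((ψ τ + √b * φ τ) * (ψ τ + √b * φ τ)) * wtA b μ x τ) +
      (1 / 2 * ((ψ τ - √b * φ τ) * (ψ τ - √b * φ τ)) +
        ((∫ z in (0 : ℝ)..(vhat σ a b μ vm vp x τ + φ τ), nl σ b z) -
          (∫ z in (0 : ℝ)..(vhat σ a b μ vm vp x τ), nl σ b z) -
          nl σ b (vhat σ a b μ vm vp x τ) *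
            (vhat σ a b μ vm vp x τ + φ τ - vhat σ a b μ vm vp x τ))) * wtB b μ x τ := by
    funext τ
    simp only [energy, nlPot, sq]
  rw [e]
  refine h.congr fun τ _ => ?_
  simp only [energyRate, nlRel, nlPot]
  ring

lemma integrable_energy {t : ℝ} (ht : 0 ≤ t) (Λ : ℝ) {φ ψ : ℝ → ℝ} (hφ : InH1 φ) (hψ : InH1 ψ)
    (hv : ∀ x, vhat σ a b μ vm vp x t + φ x ∈ Ioc (-a) (a + 1)) :
    Integrable fun x => energy Λ σ a b μ vm vp x t (φ x) (ψ x) := by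
  obtain ⟨C, -, hC⟩ := abs_energy_le hσ hμ Λ
  exact ((hφ.integrable_sq.add hψ.integrable_sq).const_mul C).mono'
    (aestronglyMeasurable_energy Λ hσ.toIsStress
      ((contForward_wtA hμ).space ht).aestronglyMeasurable
      ((contForward_wtB hμ).space ht).aestronglyMeasurable
      ((contForward_vhat hσ hμ (hs.vp_mem hμ)).space ht).aestronglyMeasurable
      hφ.continuous.aestronglyMeasurable hψ.continuous.aestronglyMeasurable)
    (ae_of_all _ fun x => hC vm vp x t _ _ hs ht (hv x))

end

section

variable {a b μ κ K B T : ℝ} {σ : ℝ → ℝ} {vm vp um up : ℝ} {φ ψ : ℝ → ℝ → ℝ}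
  (hσ : StressBounds a b κ K σ) (hμ : 0 < μ) (hs : NearStates σ a b μ vm vp)
  (hw : WaveBounds B σ a b μ vm vp) (hT : 0 ≤ T) (hX : InX T φ ψ)
  (hv : ∀ x, ∀ τ ∈ Icc 0 T, vhat σ a b μ vm vp x τ + φ x τ ∈ Ioc (-a) (a + 1))
include hσ hμ hs hw hT hX hv

lemma integrable_slab_energyRate (Λ : ℝ) :
    Integrable (fun p : ℝ × ℝ => energyRate Λ σ a b μ vm vp p.2 p.1 (φ p.2 p.1) (ψ p.2 p.1)
      (phiT a b μ vm p.2 p.1 (dx ψ p.2 p.1))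
      (psiT σ a b μ vm vp p.2 p.1 (φ p.2 p.1) (dx φ p.2 p.1) (dx (dx ψ) p.2 p.1))) (slab T) := by
  have hvp := hs.vp_mem hμ
  obtain ⟨C, -, hC⟩ := abs_energyRate_le hσ hμ B Λ
  obtain ⟨i1, i2, -⟩ := hX.integrable_slab_sq hT
  obtain ⟨m1, m2⟩ := aestronglyMeasurable_timeDeriv hσ hμ hs hT hX
  obtain ⟨j1, j2⟩ := integrable_timeDeriv_sq hσ hμ hs hw hT hX hv
  obtain ⟨n1, n2⟩ := hX.aestronglyMeasurable_slab
  refine (((i1.add i2).add (j1.add j2)).const_mul C).mono'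
    (aestronglyMeasurable_energyRate (x := fun p : ℝ × ℝ => p.2) (t := fun p : ℝ × ℝ => p.1) Λ
      hσ.toIsStress (contForward_wtA hμ).aestronglyMeasurable_slab
      (contForward_wtAt hμ).aestronglyMeasurable_slab
      (contForward_wtB hμ).aestronglyMeasurable_slab
      (contForward_wtBt hμ).aestronglyMeasurable_slab
      (contForward_vhat hσ hμ hvp).aestronglyMeasurable_slab
      (contForward_vhatT hσ hμ hvp).aestronglyMeasurable_slab n1 n2 m1 m2) ?_
  filter_upwards [ae_slab_mem] with p hp
  exact hC vm vp p.2 p.1 _ _ _ _ hs hw hp.1 (hv _ _ hp)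

lemma energy_identity (Λ : ℝ) (hsol : IsSolution σ μ T (fun x t => vhat σ a b μ vm vp x t + φ x t)
      (fun x t => uhat σ a b μ vm vp um up x t + ψ x t)) {t : ℝ} (ht : t ∈ Icc 0 T) :
    (∫ x, energy Λ σ a b μ vm vp x t (φ x t) (ψ x t)) -
      (∫ x, energy Λ σ a b μ vm vp x 0 (φ x 0) (ψ x 0)) =
    ∫ τ in (0 : ℝ)..t, ∫ x, energyRate Λ σ a b μ vm vp x τ (φ x τ) (ψ x τ)
      (phiT a b μ vm x τ (dx ψ x τ))
      (psiT σ a b μ vm vp x τ (φ x τ) (dx φ x τ) (dx (dx ψ) x τ)) := by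
  have h0 : (0 : ℝ) ∈ Icc 0 T := left_mem_Icc.2 hT
  have hi := integrable_slab_energyRate hσ hμ hs hw hT hX hv Λ
  have e : ∀ s : Set ℝ, (volume.restrict s).prod (volume : Measure ℝ) =
      (volume.prod volume).restrict (s ×ˢ univ) := fun s => by
    rw [← Measure.prod_restrict, Measure.restrict_univ]
  rw [slab, e] at hi
  have hi' := IntegrableOn.mono_set hi (prod_mono_left (t := univ)
    (Ioc_subset_Icc_self.trans (Icc_subset_Icc_right ht.2) : Ioc 0 t ⊆ Icc 0 T))
  rw [IntegrableOn, ← e] at hi'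
  rw [← integral_sub
    (integrable_energy hσ hμ hs ht.1 Λ (hX.phi_H1 t ht) (hX.psi_H1 t ht) fun x => hv x t ht)
    (integrable_energy hσ hμ hs le_rfl Λ (hX.phi_H1 0 h0) (hX.psi_H1 0 h0) fun x => hv x 0 h0),
    intervalIntegral.integral_of_le ht.1]
  rw [integral_integral_swap (f := fun τ x => energyRate Λ σ a b μ vm vp x τ (φ x τ) (ψ x τ)
      (phiT a b μ vm x τ (dx ψ x τ))
      (psiT σ a b μ vm vp x τ (φ x τ) (dx φ x τ) (dx (dx ψ) x τ))) hi']
  refine integral_congr_ae ?_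
  filter_upwards [ae_timePair hσ hμ hs hw hT hX hv hsol] with x hx
  rw [← intervalIntegral.integral_of_le ht.1]
  exact ((timePair_energy hσ hμ hs hT Λ x hx.1 hx.2).mono ht).sub_eq_integral ht.1

omit hw in
/-- Integrability in time of the terms of the estimate. -/
lemma integrableOn_terms :
    IntegrableOn (fun τ => ∫ x, heatWeight b μ x τ ^ 2 * (φ x τ ^ 2 + ψ x τ ^ 2)) (Icc 0 T) ∧
    IntegrableOn (fun τ => ∫ x, heatWeight b μ x τ *
      nlRel σ b (vhat σ a b μ vm vp x τ + φ x τ) (vhat σ a b μ vm vp x τ)) (Icc 0 T) := by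
  have hvp := hs.vp_mem hμ
  have hK := hσ.K_pos
  obtain ⟨i1, i2, -⟩ := hX.integrable_slab_sq hT
  obtain ⟨n1, n2⟩ := hX.aestronglyMeasurable_slab
  have mw := (contForward_heatWeight (b := b) hμ).aestronglyMeasurable_slab (T := T)
  have mv := (contForward_vhat (vm := vm) hσ hμ hvp).aestronglyMeasurable_slab (T := T)
  have hW : ∀ x τ, 0 ≤ τ → |heatWeight b μ x τ| ≤ 1 / √(2 * μ) := fun x τ hτ => by
    rw [abs_of_nonneg heatWeight_nonneg]; exact heatWeight_le hμ hτ
  have k1 : Integrable (fun p : ℝ × ℝ =>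
      heatWeight b μ p.2 p.1 ^ 2 * (φ p.2 p.1 ^ 2 + ψ p.2 p.1 ^ 2)) (slab T) := by
    refine ((i1.add i2).const_mul ((1 / √(2 * μ)) ^ 2)).mono'
      ((mw.pow 2).mul ((n1.pow 2).add (n2.pow 2))) ?_
    filter_upwards [ae_slab_mem] with p hp
    rw [Real.norm_of_nonneg (by positivity)]
    refine mul_le_mul_of_nonneg_right ?_ (by positivity)
    rw [← sq_abs]
    exact pow_le_pow_left₀ (abs_nonneg _) (hW p.2 p.1 hp.1) 2
  have k2 : Integrable (fun p : ℝ × ℝ => heatWeight b μ p.2 p.1 *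
      nlRel σ b (vhat σ a b μ vm vp p.2 p.1 + φ p.2 p.1) (vhat σ a b μ vm vp p.2 p.1))
      (slab T) := by
    refine (i1.const_mul (1 / √(2 * μ) * K)).mono' (mw.mul
      (hσ.continuous_nlRel.comp_aestronglyMeasurable ((mv.add n1).prodMk mv))) ?_
    filter_upwards [ae_slab_mem] with p hp
    rw [Real.norm_eq_abs, abs_mul, mul_assoc]
    exact mul_le_mul (hW p.2 p.1 hp.1) (hσ.perturbation_bounds (hv _ _ hp)
      (hs.vhat_mem hσ hμ hp.1)).2.1 (abs_nonneg _) (by positivity)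
  exact ⟨k1.integral_prod_left, k2.integral_prod_left⟩

end

/-! ### The heat kernel estimate -/

section

variable {a b μ κ K : ℝ} {σ : ℝ → ℝ}

/-- Small data: the states are near, and the perturbed strain stays in `(-a, a + 1]`. -/
lemma exists_smallness (hσ : StressBounds a b κ K σ) (hμ : 0 < μ) :
    ∃ ε₀ > 0, ε₀ ≤ 1 ∧ ∀ vm vp um up N, IsContactRarefaction σ a b vm vp um up →
      |vp - vm| ≤ ε₀ → N ≤ ε₀ → NearStates σ a b μ vm vp ∧
        ∀ x t φ, 0 ≤ t → |φ| ≤ N → vhat σ a b μ vm vp x t + φ ∈ Ioc (-a) (a + 1) := by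
  have hK := hσ.K_pos
  have ha := hσ.a_pos
  have hsb : 0 < √b := Real.sqrt_pos.2 hσ.b_pos
  obtain ⟨k, hk⟩ : ∃ k, k = μ / (4 * √b) / √(2 * μ) := ⟨_, rfl⟩
  obtain ⟨l, hl⟩ : ∃ l, l = K / √b := ⟨_, rfl⟩
  have hk0 : 0 ≤ k := by rw [hk]; positivity
  have hl0 : 0 ≤ l := by rw [hl]; positivity
  obtain ⟨ε, hε⟩ : ∃ ε, ε = min (a / 2) (1 / (2 * (1 + k + l))) := ⟨_, rfl⟩
  have hε0 : 0 < ε := by rw [hε]; positivity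
  have hεa : ε ≤ a / 2 := hε ▸ min_le_left _ _
  have hεk : ε * (1 + k + l) ≤ 1 / 2 := by
    have h : ε ≤ 1 / (2 * (1 + k + l)) := hε ▸ min_le_right _ _
    rw [le_div_iff₀ (by positivity)] at h
    linarith
  have n1 : 0 ≤ ε * k := by positivity
  have n2 : 0 ≤ ε * l := by positivity
  refine ⟨ε, hε0, by linarith, fun vm vp um up N hcr hδ hN => ?_⟩
  have h1 := hcr.vm_mem
  have h2 : a ≤ vp := hcr.vp_mem
  have h3 : vp - vm ≤ ε := (le_abs_self _).trans hδ
  have h4 : a - vm ≤ ε := by linarith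
  have h5 : vp - a ≤ ε := by linarith [h1.2]
  have h6 : k * (a - vm) ≤ ε * k := by rw [mul_comm ε]; gcongr
  have h7 : l * (vp - a) ≤ ε * l := by rw [mul_comm ε]; gcongr
  have hs : NearStates σ a b μ vm vp := by
    refine ⟨h1.1, h1.2.le, by linarith, h2, ?_, by rw [← hk]; linarith⟩
    have := (hσ.lam_sub le_rfl h2 (by linarith)).2
    rw [← hl] at this
    linarith
  refine ⟨hs, fun x t φ ht hφ => ?_⟩
  have h8 := hs.vm_le_vhat hσ hμ ht (x := x)
  have h9 := hs.vhat_sub_le_small hσ hμ ht (x := x)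
  rw [← hk] at h9
  have h10 := abs_le.1 hφ
  constructor <;> linarith

/-- The profile `û₁` decreases in space, so the functional `G` is nonnegative. -/
lemma G_nonneg (hσ : StressBounds a b κ K σ) (hμ : 0 < μ) {vm vp up t : ℝ}
    (hs : NearStates σ a b μ vm vp) (v : ℝ → ℝ → ℝ) (ht : 0 ≤ t) :
    0 ≤ G a v (vhat σ a b μ vm vp) (uhat1 σ a b μ vm vp up) t := by
  have hvp := hs.vp_mem hμ
  have key : ∀ (S : ℝ → Set ℝ) (f : ℝ → ℝ → ℝ),
      ∫ τ in (0 : ℝ)..t, ∫ x in S τ, dx (uhat1 σ a b μ vm vp up) x τ * f x τ ^ 2 ≤ 0 := by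
    intro S f
    rw [← neg_nonneg, ← intervalIntegral.integral_neg]
    refine intervalIntegral.integral_nonneg ht fun τ hτ => ?_
    rw [← integral_neg]
    refine integral_nonneg fun x => ?_
    rw [dx_uhat1 hσ hμ hvp hτ.1]
    have h1 := hσ.ur1_nonpos hvp hτ.1 (x := x)
    have h2 := mul_nonneg (Real.sqrt_nonneg b)
      (Xi1_nonneg (a := a) (vm := vm) (b := b) (μ := μ) (x := x) (t := τ) hs.vm_le)
    change 0 ≤ -((ur1 σ a vp x τ - √b * Xi1 a b μ vm x τ) * f x τ ^ 2)
    rw [← neg_mul]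
    exact mul_nonneg (by linarith) (sq_nonneg _)
  unfold G
  linarith [key (fun τ => {x | v x τ > a ∧ vhat σ a b μ vm vp x τ > a})
      (fun x τ => v x τ - vhat σ a b μ vm vp x τ),
    key (fun τ => {x | v x τ > a ∧ -a < vhat σ a b μ vm vp x τ ∧ vhat σ a b μ vm vp x τ ≤ a})
      (fun x τ => v x τ - a),
    key (fun τ => {x | -a < v x τ ∧ v x τ ≤ a ∧ vhat σ a b μ vm vp x τ > a})
      (fun x τ => a - vhat σ a b μ vm vp x τ)]

/-- The estimate in terms of the perturbation. -/
lemma exists_heat_kernel_estimate (hσ : StressBounds a b κ K σ) (hμ : 0 < μ) :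
    ∃ C > 0, ∀ vm vp um up T φ ψ, NearStates σ a b μ vm vp → InX T φ ψ → NT T φ ψ ≤ 1 →
      (∀ x, ∀ τ ∈ Icc 0 T, vhat σ a b μ vm vp x τ + φ x τ ∈ Ioc (-a) (a + 1)) →
      IsSolution σ μ T (fun x t => vhat σ a b μ vm vp x t + φ x t)
        (fun x t => uhat σ a b μ vm vp um up x t + ψ x t) →
      ∀ t ∈ Icc 0 T, ∫ τ in (0 : ℝ)..t, ∫ x, heatWeight b μ x τ ^ 2 * (φ x τ ^ 2 + ψ x τ ^ 2) ≤
        C * ((∫ τ in (0 : ℝ)..t, l2Sq (fun x => dx φ x τ) (fun x => dx ψ x τ)) + 1 +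
          (|vp - vm| + NT T φ ψ) * ∫ τ in (0 : ℝ)..t, ∫ x, heatWeight b μ x τ *
            nlRel σ b (vhat σ a b μ vm vp x τ + φ x τ) (vhat σ a b μ vm vp x τ)) := by
  obtain ⟨B, hB⟩ := NearStates.exists_waveBounds hσ hμ
  obtain ⟨Λ, -, c₀, hc₀, C, hC, H⟩ := exists_energy_inequality hσ hμ B
  obtain ⟨A, hA, hE⟩ := abs_energy_le hσ hμ Λ
  refine ⟨(4 * C + 2 * A + 1) / c₀, by positivity, fun vm vp um up T φ ψ hs hX hN hv hsol t ht => ?_⟩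
  have hw := hB vm vp hs
  have hT : 0 ≤ T := ht.1.trans ht.2
  have h0 : (0 : ℝ) ∈ Icc 0 T := left_mem_Icc.2 hT
  have hN0 : 0 ≤ NT T φ ψ := InX.h1Norm_nonneg.trans (hX.h1Norm_le_NT h0)
  have hl1 : ∀ τ ∈ Icc 0 T, (∫ x, φ x τ ^ 2) + ∫ x, ψ x τ ^ 2 ≤ 1 := fun τ hτ =>
    (hX.l2Sq_le_NT hτ).trans (pow_le_one₀ hN0 hN)
  obtain ⟨ν, hν⟩ : ∃ ν, ν = |vp - vm| + NT T φ ψ := ⟨_, rfl⟩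
  rw [← hν]
  have hν0 : 0 ≤ ν := by rw [hν]; positivity
  have hbd : ∀ τ ∈ Icc 0 T, ∀ x, |φ x τ| ≤ ν ∧ |ψ x τ| ≤ ν := fun τ hτ x => by
    have h := hX.abs_le_NT hτ x
    have := abs_nonneg (vp - vm)
    constructor <;> linarith [h.1, h.2]
  -- the terms of the energy inequality are integrable in time
  have hsub : uIcc 0 t ⊆ Icc 0 T := by rw [uIcc_of_le ht.1]; exact Icc_subset_Icc_right ht.2
  have hii : ∀ {f : ℝ → ℝ}, IntegrableOn f (Icc 0 T) → IntervalIntegrable f volume 0 t :=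
    fun hf => (hf.mono_set hsub).intervalIntegrable
  obtain ⟨k1, k2⟩ := integrableOn_terms hσ hμ hs hT hX hv
  have i1 := hii k1
  have i2 := hii k2
  have i3 := hii (integrable_slab_energyRate hσ hμ hs hw hT hX hv Λ).integral_prod_left
  have i4 : IntervalIntegrable (fun τ => (∫ x, dx φ x τ ^ 2) + ∫ x, dx ψ x τ ^ 2) volume 0 t :=
    hii (hX.phi_x_L2.add hX.psi_x_L2)
  have i5 : IntervalIntegrable (fun τ => 1 / qrt τ ^ 5) volume 0 t := by
    refine ContinuousOn.intervalIntegrable ?_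
    rw [uIcc_of_le ht.1]
    exact continuousOn_const.div (continuous_qrt.pow 5).continuousOn
      fun τ hτ => pow_ne_zero 5 (qrt_pos hτ.1).ne'
  have hineq := intervalIntegral.integral_mono_ae_restrict ht.1 ((i1.const_mul c₀).add i3)
    (((i4.add i5).add (i2.const_mul ν)).const_mul C) (by
      have hle : volume.restrict (Icc 0 t) ≤ volume.restrict (Icc 0 T) :=
        Measure.restrict_mono (Icc_subset_Icc_right ht.2) le_rfl
      filter_upwards [ae_mono hle (ae_restrict_mem measurableSet_Icc),
        ae_mono hle hX.psi_x_H1] with τ hτ hτ'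
      exact H vm vp ν τ (fun x => φ x τ) (fun x => ψ x τ) hs hw hτ.1 (hX.phi_H1 τ hτ)
        (hX.psi_H1 τ hτ) hτ' (fun x => hv x τ hτ) (hl1 τ hτ) (fun x => (hbd τ hτ x).1)
        (fun x => (hbd τ hτ x).2) (by rw [hν]; linarith [le_abs_self (vp - vm)]))
  rw [intervalIntegral.integral_add (i1.const_mul c₀) i3, intervalIntegral.integral_const_mul,
    intervalIntegral.integral_const_mul, intervalIntegral.integral_add (i4.add i5) (i2.const_mul ν),
    intervalIntegral.integral_add i4 i5, intervalIntegral.integral_const_mul,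
    ← energy_identity hσ hμ hs hw hT hX hv Λ hsol ht] at hineq
  -- the energy is bounded
  have hEb : ∀ τ ∈ Icc 0 T, |∫ x, energy Λ σ a b μ vm vp x τ (φ x τ) (ψ x τ)| ≤ A := by
    intro τ hτ
    have j1 := (hX.phi_H1 τ hτ).integrable_sq
    have j2 := (hX.psi_H1 τ hτ).integrable_sq
    calc _ ≤ ∫ x, |energy Λ σ a b μ vm vp x τ (φ x τ) (ψ x τ)| := abs_integral_le_integral_abs
      _ ≤ ∫ x, A * (φ x τ ^ 2 + ψ x τ ^ 2) :=
          integral_mono (integrable_energy hσ hμ hs hτ.1 Λ (hX.phi_H1 τ hτ) (hX.psi_H1 τ hτ)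
            fun x => hv x τ hτ).abs ((j1.add j2).const_mul A)
            fun x => hE vm vp x τ _ _ hs hτ.1 (hv x τ hτ)
      _ ≤ A := by
          rw [integral_const_mul, integral_add j1 j2]
          exact mul_le_of_le_one_right hA (hl1 τ hτ)
  have e1 := abs_le.1 (hEb t ht)
  have e2 := abs_le.1 (hEb 0 h0)
  have hq := mul_le_mul_of_nonneg_left (integral_qrt_le ht.1) hC
  obtain ⟨D, hD⟩ : ∃ D, D = ∫ τ in (0 : ℝ)..t, l2Sq (fun x => dx φ x τ) (fun x => dx ψ x τ) :=
    ⟨_, rfl⟩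
  obtain ⟨J, hJ⟩ : ∃ J, J = ∫ τ in (0 : ℝ)..t, ∫ x, heatWeight b μ x τ *
      nlRel σ b (vhat σ a b μ vm vp x τ + φ x τ) (vhat σ a b μ vm vp x τ) := ⟨_, rfl⟩
  have hD0 : 0 ≤ D := by
    rw [hD]
    exact intervalIntegral.integral_nonneg ht.1 fun τ _ => InX.l2Sq_nonneg
  have hJ0 : 0 ≤ J := by
    rw [hJ]
    refine intervalIntegral.integral_nonneg ht.1 fun τ hτ => integral_nonneg fun x => ?_
    have hτ' : τ ∈ Icc 0 T := ⟨hτ.1, hτ.2.trans ht.2⟩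
    exact mul_nonneg heatWeight_nonneg (hσ.nlRel_nonneg (hv x τ hτ') (hs.vhat_mem hσ hμ hτ.1))
  change _ ≤ C * ((∫ τ in (0 : ℝ)..t, l2Sq (fun x => dx φ x τ) (fun x => dx ψ x τ)) + _ + _) at hineq
  rw [← hD, ← hJ] at hineq ⊢
  rw [div_mul_eq_mul_div, le_div_iff₀ hc₀, mul_comm]
  have hνJ : 0 ≤ ν * J := mul_nonneg hν0 hJ0
  have p1 : 0 ≤ C * D := mul_nonneg hC hD0
  have p2 : 0 ≤ C * (ν * J) := mul_nonneg hC hνJ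
  have p3 : 0 ≤ A * D := mul_nonneg hA hD0
  have p4 : 0 ≤ A * (ν * J) := mul_nonneg hA hνJ
  linarith

end

end Viscoelastic

end

theorem lemma4p2 (a b μ : ℝ) (σ : ℝ → ℝ) (hσ : Viscoelastic.IsStress a b σ) (hμ : 0 < μ) :
    ∃ ε₀ > 0, ∃ C > 0, ∀ (vm vp um up T : ℝ) (v u φ ψ : ℝ → ℝ → ℝ),
      Viscoelastic.IsContactRarefaction σ a b vm vp um up →
      Viscoelastic.IsSolution σ μ T v u →
      φ = (fun x t => v x t - Viscoelastic.vhat σ a b μ vm vp x t) →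
      ψ = (fun x t => u x t - Viscoelastic.uhat σ a b μ vm vp um up x t) →
      Viscoelastic.InX T φ ψ →
      |vp - vm| + Viscoelastic.h1Norm (fun x => φ x 0) (fun x => ψ x 0) ≤ ε₀ →
      Viscoelastic.NT T φ ψ ≤ ε₀ →
      ∀ t ∈ Set.Icc 0 T,
        (∫ τ in (0 : ℝ)..t, ∫ x,
            Viscoelastic.heatWeight b μ x τ ^ 2 * (φ x τ ^ 2 + ψ x τ ^ 2))
          ≤ C * (∫ τ in (0 : ℝ)..t,
                Viscoelastic.l2Sq (fun x => Viscoelastic.dx φ x τ)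
                  (fun x => Viscoelastic.dx ψ x τ))
            + C * (Viscoelastic.l2Sq (fun x => φ x t) (fun x => ψ x t) + 1)
            + C * Viscoelastic.G a v (Viscoelastic.vhat σ a b μ vm vp)
                (Viscoelastic.uhat1 σ a b μ vm vp up) t
            + C * (|vp - vm| + Viscoelastic.NT T φ ψ) *
                (∫ τ in (0 : ℝ)..t, ∫ x, Viscoelastic.heatWeight b μ x τ *
                  (σ (v x τ) - σ (Viscoelastic.vhat σ a b μ vm vp x τ)
                    - deriv σ (Viscoelastic.vhat σ a b μ vm vp x τ) * φ x τ)) := by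
  obtain ⟨κ, K, hσ'⟩ := hσ.exists_bounds
  obtain ⟨ε₀, hε₀, hε₁, hsmall⟩ := Viscoelastic.exists_smallness hσ' hμ
  obtain ⟨C, hC, H⟩ := Viscoelastic.exists_heat_kernel_estimate hσ' hμ
  refine ⟨ε₀, hε₀, C, hC, fun vm vp um up T v u φ ψ hcr hsol hφ hψ hX h0 hN t ht => ?_⟩
  have hδ : |vp - vm| ≤ ε₀ :=
    (le_add_of_nonneg_right Viscoelastic.InX.h1Norm_nonneg).trans h0
  obtain ⟨hs, hmem⟩ := hsmall vm vp um up _ hcr hδ hN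
  have hv : v = fun x t => Viscoelastic.vhat σ a b μ vm vp x t + φ x t := by
    rw [hφ]; funext x t; ring
  have hu : u = fun x t => Viscoelastic.uhat σ a b μ vm vp um up x t + ψ x t := by
    rw [hψ]; funext x t; ring
  have h := H vm vp um up T φ ψ hs hX (hN.trans hε₁)
    (fun x τ hτ => hmem x τ _ hτ.1 (hX.abs_le_NT hτ x).1) (hv ▸ hu ▸ hsol) t ht
  have hG := mul_nonneg hC.le (Viscoelastic.G_nonneg (up := up) hσ' hμ hs v ht.1)
  have hl := mul_nonneg hC.le
    (Viscoelastic.InX.l2Sq_nonneg (f := fun x => φ x t) (g := fun x => ψ x t))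
  have e : ∀ x τ, σ (v x τ) - σ (Viscoelastic.vhat σ a b μ vm vp x τ) -
      deriv σ (Viscoelastic.vhat σ a b μ vm vp x τ) * φ x τ =
      Viscoelastic.nlRel σ b (Viscoelastic.vhat σ a b μ vm vp x τ + φ x τ)
        (Viscoelastic.vhat σ a b μ vm vp x τ) := fun x τ => by
    rw [Viscoelastic.StressBounds.nlRel_eq, add_sub_cancel_left, hv]
  simp only [e]
  linarith
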